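/- Write $T^*S^2=\{(q,p)\in\mathbb R^3\times\mathbb R^3 : |q|=1,\ q\perp p\}$ with $SO(3)$ acting by $g\cdot(q,p)=(gq,gp)$ and $\lambda_{\mathrm{can}}=p\cdot dq$. For $k\in\mathbb Z$ and $\varepsilon>0$ let $f(r)=\pi k(1+\rho_\varepsilon(r))$, where $\rho_\varepsilon$ is $0$ for $r\le\varepsilon/2$, $1$ for $r\ge\varepsilon$, and $\rho_\varepsilon(r)=N(\varepsilon)\int_{\varepsilon/2}^r\exp\frac{\varepsilon^2}{4(x-\varepsilon/2)(x-\varepsilon)}dx$ in between, with $N(\varepsilon)$ the normalizing constant. The $k$-fold generalized Dehn twist is $$\tau_k(q,p)=\Big(q\cos f(|p|)+\tfrac{p}{|p|}\sin f(|p|),\ p\cos f(|p|)-|p|\,q\sin f(|p|)\Big),$$ and $X_k=\mathbb R\times T^*S^2/\!\sim$ with $(t;q,p)\sim(t+1;\tau_k(q,p))$ is its mapping torus, an $SO(3)$-manifold. Let $V^*E_{\mathrm{triv}}$ and $V^*E_{\mathrm{twist}}$ be the dual vertical bundles of the trivial and the twisted $S^2$-bundle over $S^1$, i.e. the quotients of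 $\mathbb R\times T^*S^2$ by $(t;q,p)\sim(t+1;q,p)$ and $(t;q,p)\sim(t+1;-q,-p)$. **Invariants.** Let $(M,\alpha)$ be a closed $5$-dimensional contact $SO(3)$-manifold with trivial principal stabilizer, with moment map $\langle\mu(x),X\rangle=\alpha_x(X_M)$ and cross-section $R=\mu^{-1}(\mathbb R^+Z^*)$. Here $Z\in\mathfrak{so}(3)$ generates the rotations around the $z$-axis, and the circle of these rotations acts on $\overline R$. Orient $R$ by $\alpha\wedge d\alpha$. Let $\sigma$ be a section of the circle action over $\overline R$ minus the exceptional orbits that is standard near the exceptional orbits (normalized Seifert invariants). For each connected component $K$ of the set of singular orbits, $T_K=\overline R\cap K$ is a boundary torus of $\overline R$. Let $\gamma_K\subset T_K$ be a curve of marked points, i.e. a component of the set of points with a fixed stabilizer in $SO(3)$; it meets each circle orbit once or twice. Orient $\gamma_K$ so that $\dot\gamma_K$ followed by $Z_M$ is positive in $T_K$, and $\sigma$ so that its tangent plane followed by $Z_M$ is positive in $\overline R$. Boundaries are oriented by putting the outward normal last (with these conventions the standard contact sphere $S^5\subset\mathbb C^3$ has Dehn–Euler number $+1$). The contribution of $K$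 is $2\,\iota(\gamma_K,\partial\sigma)$ if $\gamma_K$ meets each circle orbit once and $\iota(\gamma_K,\partial\sigma)$ if it meets each twice, where $\iota$ is the intersection number in $T_K$. The Dehn–Euler number $n(R)$, computed with $\sigma$, is the sum of the contributions of all components. **Gluing.** A *standard collar* of $K$ of size $\delta$ adapted to $\sigma$ is an $SO(3)$-contactomorphism $\psi$, preserving coorientations, from $\{0<|p|<\delta\}\subset S^1\times T^*S^2$ with the form $dt+\lambda_{\mathrm{can}}$ onto a punctured neighbourhood of $K$, such that $p\to0$ corresponds to approaching $K$ and $\sigma$ is given in it by $(t;(1,0,0),(0,r,0))$, $0<r<\delta$. For $\varepsilon<\delta$, *gluing in the mapping torus of $\tau_k$ in place of $K$* means removing $K$ and $\psi(\{|p|\le\varepsilon\})$ from $M$ and gluing in the part $\{|p|<\delta\}$ of $X_k$, identifying the class of $(t;q,p)$ with $\psi(t;q,p)$ for $\varepsilon<|p|<\delta$ (where $\tau_k=\mathrm{id}$). **Statement.** For every $k\in\mathbb Z$: 1. For every $\varepsilon>0$, $X_k$ is $SO(3)$-equivariantly diffeomorphic to $V^*E_{\mathrm{triv}}$ if $k$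 is even and to $V^*E_{\mathrm{twist}}$ if $k$ is odd. There is $\varepsilon_0=\varepsilon_0(k)>0$ such that, moreover, for all $0<\varepsilon<\varepsilon_0$: 2. The form $dt+\lambda_{\mathrm{can}}-t\,|p|\,df$ on $\mathbb R\times T^*S^2$ descends to an $SO(3)$-invariant contact form on $X_k$ (which is Hausdorff and second countable). 3. Let $(M,\alpha)$, a component $K$ of its singular orbits, a section $\sigma$ and a standard collar of $K$ of size $\delta>\varepsilon$ adapted to $\sigma$ be as above. Then gluing in the mapping torus of $\tau_k$ in place of $K$ gives a closed contact $SO(3)$-manifold whose contact form is a positive multiple of $\alpha$ on the part coming from $M$ and of the form in (2) on the part coming from $X_k$. For every $(M',\alpha')$ obtained in this way, the components of its singular orbits are the image $K'$ of the zero-section of $X_k$ and the images of the components $L\ne K$ of the singular orbits of $M$, and these are distinct. The restriction of $\sigma$ to the part coming from $M$ extends to a standard section over $M'$. For every such extension $\sigma'$, the contribution of $K'$ is exactly $k$, and the contributions of all other components are unchanged. Consequently, if $n(R)$ is the Dehn–Euler number of $M$ computed with $\sigma$ and $c$ is the contribution of $K$ to it, then the Dehn–Euler number of $M'$ computed with $\sigma'$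 is $n(R')=n(R)-c+k$. -/

import Mathlib

open scoped Manifold ContDiff InnerProductSpace Matrix
noncomputable section
namespace DehnTwist
abbrev E3 : Type := EuclideanSpace ℝ (Fin 3)
abbrev E5 : Type := EuclideanSpace ℝ (Fin 5)
abbrev E2 : Type := EuclideanSpace ℝ (Fin 2)

/-- The cotangent bundle `T^*S²` as the set of `(q, p)` in `ℝ³ × ℝ³` with `|q| = 1` and `q ⊥ p`. -/
def CotS2 : Type := {x : E3 × E3 // ‖x.1‖ = 1 ∧ ⟪x.1, x.2⟫_ℝ = 0}

namespace CotS2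
def q (x : CotS2) : E3 := x.1.1
def p (x : CotS2) : E3 := x.1.2
instance : TopologicalSpace CotS2 := inferInstanceAs (TopologicalSpace {x : E3 × E3 // ‖x.1‖ = 1 ∧ ⟪x.1, x.2⟫_ℝ = 0})
theorem norm_q (x : CotS2) : ‖x.q‖ = 1 := x.2.1
theorem inner_q_p (x : CotS2) : ⟪x.q, x.p⟫_ℝ = 0 := x.2.2
@[ext] theorem ext {x y : CotS2} (h : x.q = y.q) (h' : x.p = y.p) : x = y :=
  Subtype.ext (Prod.ext h h')
end CotS2

/-- The 5-manifold `ℝ × T^*S²`, with points `(t; q, p)`.  Its smooth structure, built below, is that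
of a submanifold of `ℝ × ℝ³ × ℝ³`. -/
abbrev Cyl : Type := ℝ × CotS2

namespace Cyl

/-- The inclusion into `ℝ × ℝ³ × ℝ³`. -/
def emb (y : Cyl) : ℝ × E3 × E3 := (y.1, y.2.q, y.2.p)

theorem isInducing_emb : Topology.IsInducing emb :=
  (Topology.IsInducing.id (X := ℝ)).prodMap Topology.IsInducing.subtypeVal

theorem emb_injective : Function.Injective emb := by
  intro y z h
  simp only [emb, Prod.mk.injEq] at h
  exact Prod.ext h.1 (CotS2.ext h.2.1 h.2.2)

def modelEquiv : (ℝ × E2 × E2) ≃L[ℝ] E5 :=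
  ContinuousLinearEquiv.ofFinrankEq (by simp)

instance : Fact (Module.finrank ℝ E3 = 2 + 1) := ⟨by simp⟩

/-- Linear isometric coordinates on the orthogonal complement of `v`. -/
def perpCoord (v : E3) (hv : v ≠ 0) : (ℝ ∙ v)ᗮ ≃ₗᵢ[ℝ] E2 :=
  (OrthonormalBasis.fromOrthogonalSpanSingleton 2 hv).repr

theorem q_ne_zero (x : CotS2) : x.q ≠ 0 := by
  intro h; have := x.norm_q; simp [h] at this

/-- The chart around the points over `x₀`: `t` together with the coordinates of the orthogonal
projections of `q` and `p` to the plane orthogonal to `q(x₀)`. -/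
def chartFun (x₀ : CotS2) : (ℝ × E3 × E3) →L[ℝ] E5 :=
  let P : E3 →L[ℝ] E2 := (perpCoord x₀.q (q_ne_zero x₀)).toContinuousLinearEquiv.toContinuousLinearMap.comp
    (ℝ ∙ x₀.q)ᗮ.orthogonalProjectionOnto
  modelEquiv.toContinuousLinearMap.comp
    ((ContinuousLinearMap.id ℝ ℝ).prodMap (P.prodMap P))

def liftPerp (x₀ : CotS2) (a : E2) : E3 := ((perpCoord x₀.q (q_ne_zero x₀)).symm a : E3)

/-- The inverse of the chart: the component of `q` along `q(x₀)` is recovered from `|q| = 1`, that of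
`p` from `q ⊥ p`. -/
def chartInv (x₀ : CotS2) (z : E5) : ℝ × E3 × E3 :=
  let w := modelEquiv.symm z
  (w.1, liftPerp x₀ w.2.1 + √(1 - ‖w.2.1‖ ^ 2) • x₀.q,
    liftPerp x₀ w.2.2 - (⟪w.2.1, w.2.2⟫_ℝ / √(1 - ‖w.2.1‖ ^ 2)) • x₀.q)

theorem inner_liftPerp_q (x₀ : CotS2) (a : E2) : ⟪liftPerp x₀ a, x₀.q⟫_ℝ = 0 :=
  (Submodule.mem_orthogonal_singleton_iff_inner_left).1 ((perpCoord x₀.q (q_ne_zero x₀)).symm a).2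

theorem inner_liftPerp (x₀ : CotS2) (a b : E2) : ⟪liftPerp x₀ a, liftPerp x₀ b⟫_ℝ = ⟪a, b⟫_ℝ := by
  rw [← (perpCoord x₀.q (q_ne_zero x₀)).symm.inner_map_map a b]
  rfl

theorem chartInv_mem (x₀ : CotS2) (z : E5) (hz : ‖(modelEquiv.symm z).2.1‖ < 1) :
    ‖(chartInv x₀ z).2.1‖ = 1 ∧ ⟪(chartInv x₀ z).2.1, (chartInv x₀ z).2.2⟫_ℝ = 0 := by
  set w := modelEquiv.symm z with hw
  have hs : 0 < 1 - ‖w.2.1‖ ^ 2 := by nlinarith [norm_nonneg w.2.1]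
  have hs' : 0 < √(1 - ‖w.2.1‖ ^ 2) := Real.sqrt_pos.2 hs
  have hq : ⟪x₀.q, x₀.q⟫_ℝ = 1 := by rw [real_inner_self_eq_norm_sq, x₀.norm_q]; norm_num
  have h1 := inner_liftPerp_q x₀ w.2.1
  have h2 := inner_liftPerp_q x₀ w.2.2
  have h1' : ⟪x₀.q, liftPerp x₀ w.2.1⟫_ℝ = 0 := by rw [real_inner_comm]; exact h1
  have h2' : ⟪x₀.q, liftPerp x₀ w.2.2⟫_ℝ = 0 := by rw [real_inner_comm]; exact h2
  constructor
  · have : ‖(chartInv x₀ z).2.1‖ ^ 2 = 1 := by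
      rw [← real_inner_self_eq_norm_sq]
      simp only [chartInv, ← hw, inner_add_left, inner_add_right, inner_smul_left, inner_smul_right,
        h1, h1', hq, inner_liftPerp]
      simp
      rw [← pow_two, Real.sq_sqrt hs.le]; ring
    nlinarith [norm_nonneg (chartInv x₀ z).2.1]
  · simp only [chartInv, ← hw, inner_add_left, inner_sub_right, inner_smul_left, inner_smul_right,
        h1, h2', hq, inner_liftPerp]
    simp
    field_simp
    simp

theorem chartFun_chartInv (x₀ : CotS2) (z : E5) : chartFun x₀ (chartInv x₀ z) = z := by
  set w := modelEquiv.symm z with hw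
  have hP : ∀ (a : E2) (c : ℝ), (perpCoord x₀.q (q_ne_zero x₀))
      ((ℝ ∙ x₀.q)ᗮ.orthogonalProjectionOnto (liftPerp x₀ a + c • x₀.q)) = a := by
    intro a c
    have h1 : (ℝ ∙ x₀.q)ᗮ.orthogonalProjectionOnto x₀.q = 0 := by
      apply Submodule.orthogonalProjectionOnto_orthogonalComplement_singleton_eq_zero
    rw [map_add, map_smul, h1, smul_zero, add_zero, liftPerp,
      Submodule.orthogonalProjectionOnto_mem_subspace_eq_self]
    simp
  have hP2 : ∀ (a : E2) (c : ℝ), (perpCoord x₀.q (q_ne_zero x₀))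
      ((ℝ ∙ x₀.q)ᗮ.orthogonalProjectionOnto (liftPerp x₀ a - c • x₀.q)) = a := by
    intro a c
    rw [sub_eq_add_neg, ← neg_smul]; exact hP a (-c)
  have : chartFun x₀ (chartInv x₀ z) = modelEquiv (w.1, w.2.1, w.2.2) := by
    have e1 := hP w.2.1 (√(1 - ‖w.2.1‖ ^ 2))
    have e2 := hP2 w.2.2 (⟪w.2.1, w.2.2⟫_ℝ / √(1 - ‖w.2.1‖ ^ 2))
    exact congrArg modelEquiv (Prod.ext rfl (Prod.ext e1 e2))
  rw [this]
  simp [hw]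

theorem contDiffOn_chartInv (x₀ : CotS2) :
    ContDiffOn ℝ ∞ (chartInv x₀) {z | ‖(modelEquiv.symm z).2.1‖ < 1} := by
  have hw : ContDiff ℝ ∞ (fun z : E5 => modelEquiv.symm z) := modelEquiv.symm.contDiff
  have hl : ContDiff ℝ ∞ (liftPerp x₀) :=
    ((ℝ ∙ x₀.q)ᗮ.subtypeL.contDiff).comp (perpCoord x₀.q (q_ne_zero x₀)).symm.contDiff
  have hn : ContDiff ℝ ∞ (fun z : E5 => 1 - ‖(modelEquiv.symm z).2.1‖ ^ 2) :=
    contDiff_const.sub ((hw.snd.fst).norm_sq ℝ)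
  have hs : ContDiffOn ℝ ∞ (fun z : E5 => √(1 - ‖(modelEquiv.symm z).2.1‖ ^ 2))
      {z | ‖(modelEquiv.symm z).2.1‖ < 1} := by
    apply hn.contDiffOn.sqrt
    intro z hz
    have hz' : ‖(modelEquiv.symm z).2.1‖ < 1 := hz
    nlinarith [norm_nonneg (modelEquiv.symm z).2.1]
  refine hw.fst.contDiffOn.prodMk (ContDiffOn.prodMk ?_ ?_)
  · exact (hl.comp hw.snd.fst).contDiffOn.add (hs.smul contDiffOn_const)
  · refine (hl.comp hw.snd.snd).contDiffOn.sub
      (ContDiffOn.smul (f := fun z : E5 => ⟪(modelEquiv.symm z).2.1, (modelEquiv.symm z).2.2⟫_ℝ /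
        √(1 - ‖(modelEquiv.symm z).2.1‖ ^ 2)) (g := fun _ => x₀.q) ?_ contDiffOn_const)
    refine ((hw.snd.fst).inner ℝ hw.snd.snd).contDiffOn.div hs ?_
    intro z hz
    have hz' : ‖(modelEquiv.symm z).2.1‖ < 1 := hz
    apply (Real.sqrt_pos.2 _).ne'
    nlinarith [norm_nonneg (modelEquiv.symm z).2.1]

theorem decomp (x₀ : CotS2) (v : E3) :
    v = ((ℝ ∙ x₀.q)ᗮ.orthogonalProjectionOnto v : E3) + ⟪x₀.q, v⟫_ℝ • x₀.q := by
  have h := Submodule.starProjection_add_starProjection_orthogonal (K := ℝ ∙ x₀.q) v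
  have h2 : (ℝ ∙ x₀.q).starProjection v = ⟪x₀.q, v⟫_ℝ • x₀.q :=
    Submodule.starProjection_unit_singleton ℝ x₀.norm_q v
  rw [h2, add_comm] at h
  exact h.symm

theorem mem_target (x₀ : CotS2) (y : Cyl) (hy : 0 < ⟪x₀.q, y.2.q⟫_ℝ) :
    ‖(modelEquiv.symm (chartFun x₀ (emb y))).2.1‖ < 1 ∧ chartInv x₀ (chartFun x₀ (emb y)) = emb y := by
  obtain ⟨t, x⟩ := y
  set u := (ℝ ∙ x₀.q)ᗮ.orthogonalProjectionOnto x.q with hu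
  set v := (ℝ ∙ x₀.q)ᗮ.orthogonalProjectionOnto x.p with hv
  have hw : modelEquiv.symm (chartFun x₀ (emb (t, x))) =
      (t, perpCoord x₀.q (q_ne_zero x₀) u, perpCoord x₀.q (q_ne_zero x₀) v) := by
    simp [chartFun, emb, hu, hv]
  have du := decomp x₀ x.q
  have dv := decomp x₀ x.p
  rw [← hu] at du
  rw [← hv] at dv
  set s := ⟪x₀.q, x.q⟫_ℝ with hs
  set r := ⟪x₀.q, x.p⟫_ℝ with hr
  have hs0 : 0 < s := hy
  have hq : ⟪x₀.q, x₀.q⟫_ℝ = 1 := by rw [real_inner_self_eq_norm_sq, x₀.norm_q]; norm_num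
  have hup : ⟪(u : E3), x₀.q⟫_ℝ = 0 := (Submodule.mem_orthogonal_singleton_iff_inner_left).1 u.2
  have hvp : ⟪(v : E3), x₀.q⟫_ℝ = 0 := (Submodule.mem_orthogonal_singleton_iff_inner_left).1 v.2
  have hup' : ⟪x₀.q, (u : E3)⟫_ℝ = 0 := by rw [real_inner_comm]; exact hup
  have hvp' : ⟪x₀.q, (v : E3)⟫_ℝ = 0 := by rw [real_inner_comm]; exact hvp
  have hn : ‖(u : E3)‖ ^ 2 + s ^ 2 = 1 := by
    have h1 : ⟪x.q, x.q⟫_ℝ = 1 := by rw [real_inner_self_eq_norm_sq, x.norm_q]; norm_num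
    rw [du] at h1
    simp only [inner_add_left, inner_add_right, inner_smul_left, inner_smul_right,
        hup, hup', hq, real_inner_self_eq_norm_sq] at h1
    simp at h1
    nlinarith
  have hi : ⟪(u : E3), (v : E3)⟫_ℝ + s * r = 0 := by
    have h1 := x.inner_q_p
    rw [du, dv] at h1
    simp only [inner_add_left, inner_add_right, inner_smul_left, inner_smul_right,
        hup, hvp', hq] at h1
    simp at h1
    linarith
  have hnu : ‖perpCoord x₀.q (q_ne_zero x₀) u‖ = ‖(u : E3)‖ := by simp
  have hsq : √(1 - ‖(u : E3)‖ ^ 2) = s := by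
    rw [← hn, add_sub_cancel_left, Real.sqrt_sq hs0.le]
  constructor
  · rw [hw]; simp only; rw [hnu]; nlinarith [norm_nonneg (u : E3)]
  · have hl : ∀ a : (ℝ ∙ x₀.q)ᗮ, liftPerp x₀ (perpCoord x₀.q (q_ne_zero x₀) a) = a := by
      intro a; simp [liftPerp]
    have hinn : ⟪perpCoord x₀.q (q_ne_zero x₀) u, perpCoord x₀.q (q_ne_zero x₀) v⟫_ℝ =
        ⟪(u : E3), (v : E3)⟫_ℝ := by
      rw [(perpCoord x₀.q (q_ne_zero x₀)).inner_map_map]; rfl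
    simp only [chartInv]
    rw [hw]
    simp only [hl, hnu, hsq, hinn, emb]
    refine Prod.ext rfl (Prod.ext du.symm ?_)
    simp only
    have : ⟪(u : E3), (v : E3)⟫_ℝ / s = - r := by
      field_simp; linarith
    rw [this, neg_smul, sub_neg_eq_add]
    exact dv.symm

open Classical in
def chart (x₀ : CotS2) : OpenPartialHomeomorph Cyl E5 where
  toFun y := chartFun x₀ (emb y)
  invFun z := if hz : ‖(modelEquiv.symm z).2.1‖ < 1 then
    ((chartInv x₀ z).1, ⟨(chartInv x₀ z).2, chartInv_mem x₀ z hz⟩) else (0, x₀)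
  source := {y | 0 < ⟪x₀.q, y.2.q⟫_ℝ}
  target := {z | ‖(modelEquiv.symm z).2.1‖ < 1}
  map_source' y hy := (mem_target x₀ y hy).1
  map_target' z hz := by
    have hz' : ‖(modelEquiv.symm z).2.1‖ < 1 := hz
    simp only [hz', dif_pos, Set.mem_ofPred_eq]
    change 0 < ⟪x₀.q, (chartInv x₀ z).2.1⟫_ℝ
    have hq : ⟪x₀.q, x₀.q⟫_ℝ = 1 := by rw [real_inner_self_eq_norm_sq, x₀.norm_q]; norm_num
    simp only [chartInv, inner_add_right, inner_smul_right, hq, mul_one]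
    rw [real_inner_comm, inner_liftPerp_q, zero_add]
    apply Real.sqrt_pos.2
    nlinarith [norm_nonneg (modelEquiv.symm z).2.1]
  left_inv' y hy := by
    obtain ⟨h1, h2⟩ := mem_target x₀ y hy
    simp only [h1, dif_pos]
    apply emb_injective
    exact h2
  right_inv' z hz := by
    have hz' : ‖(modelEquiv.symm z).2.1‖ < 1 := hz
    simp only [hz', dif_pos]
    exact chartFun_chartInv x₀ z
  open_source := by
    apply isOpen_lt continuous_const
    exact continuous_const.inner (continuous_snd.fst.comp isInducing_emb.continuous)
  open_target := by
    apply isOpen_lt _ continuous_const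
    exact (modelEquiv.symm.continuous.snd.fst).norm
  continuousOn_toFun := ((chartFun x₀).continuous.comp isInducing_emb.continuous).continuousOn
  continuousOn_invFun := by
    rw [isInducing_emb.continuousOn_iff]
    refine (contDiffOn_chartInv x₀).continuousOn.congr ?_
    intro z hz
    have hz' : ‖(modelEquiv.symm z).2.1‖ < 1 := hz
    simp only [Function.comp, hz', dif_pos]
    rfl

theorem emb_chart_symm (x₀ : CotS2) {z : E5} (hz : z ∈ (chart x₀).target) :
    emb ((chart x₀).symm z) = chartInv x₀ z := by
  have hz' : ‖(modelEquiv.symm z).2.1‖ < 1 := hz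
  simp only [chart, OpenPartialHomeomorph.coe_mk_symm, PartialEquiv.coe_symm_mk, hz', dif_pos]
  rfl

instance : ChartedSpace E5 Cyl where
  atlas := {e | ∃ x₀, e = chart x₀}
  chartAt y := chart y.2
  mem_chart_source y := by
    change 0 < ⟪y.2.q, y.2.q⟫_ℝ
    rw [real_inner_self_eq_norm_sq, y.2.norm_q]; norm_num
  chart_mem_atlas y := ⟨y.2, rfl⟩

instance : IsManifold (𝓡 5) ∞ Cyl := by
  apply isManifold_of_contDiffOn
  rintro _ _ ⟨x, rfl⟩ ⟨x', rfl⟩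
  simp only [modelWithCornersSelf_coe, modelWithCornersSelf_coe_symm, Function.id_comp,
    Function.comp_id, Set.preimage_id, Set.range_id, Set.inter_univ]
  refine ((chartFun x').contDiff.comp_contDiffOn ((contDiffOn_chartInv x).mono ?_)).congr ?_
  · intro z hz
    exact hz.1
  · intro z hz
    change chartFun x' (emb ((chart x).symm z)) = _
    rw [emb_chart_symm x hz.1]; rfl

theorem contMDiff_emb : ContMDiff (𝓡 5) 𝓘(ℝ, ℝ × E3 × E3) ∞ emb := by
  intro y
  rw [contMDiffAt_iff]
  refine ⟨isInducing_emb.continuous.continuousAt, ?_⟩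
  simp only [mfld_simps]
  have ht := (chart y.2).map_source (mem_chart_source E5 y)
  have : ContDiffOn ℝ ∞ (emb ∘ (chart y.2).symm) (chart y.2).target :=
    (contDiffOn_chartInv y.2).congr (fun z hz => emb_chart_symm y.2 hz)
  exact ((this.contDiffAt ((chart y.2).open_target.mem_nhds ht))).contDiffWithinAt

theorem contMDiff_of_emb {f : Cyl → Cyl}
    (h : ContMDiff (𝓡 5) 𝓘(ℝ, ℝ × E3 × E3) ∞ (emb ∘ f)) : ContMDiff (𝓡 5) (𝓡 5) ∞ f := by
  have hc : Continuous f := isInducing_emb.continuous_iff.2 h.continuous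
  intro y
  rw [contMDiffAt_iff_target]
  refine ⟨hc.continuousAt, ?_⟩
  exact ((chartFun (f y).2).contDiff.contMDiff.contMDiffAt).comp y (h y)

end Cyl

/-- The rotation group `SO(3)`. -/
abbrev SO3 : Type := Matrix.specialOrthogonalGroup (Fin 3) ℝ

/-- The standard action of `SO(3)` on `ℝ³`. -/
def rotVec (g : SO3) (v : E3) : E3 := WithLp.toLp 2 (g.1 *ᵥ v.ofLp)

theorem inner_rotVec (g : SO3) (v w : E3) : ⟪rotVec g v, rotVec g w⟫_ℝ = ⟪v, w⟫_ℝ := by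
  have hg : g.1ᵀ * g.1 = 1 := by
    have := (Matrix.mem_orthogonalGroup_iff' (Fin 3) ℝ).1 (Matrix.mem_specialOrthogonalGroup_iff.1 g.2).1
    exact this
  simp only [rotVec, EuclideanSpace.inner_eq_star_dotProduct, star_trivial]
  rw [Matrix.dotProduct_mulVec, Matrix.vecMul_mulVec, hg, Matrix.vecMul_one]

theorem norm_rotVec (g : SO3) (v : E3) : ‖rotVec g v‖ = ‖v‖ := by
  rw [norm_eq_sqrt_real_inner, inner_rotVec, ← norm_eq_sqrt_real_inner]

theorem rotVec_one (v : E3) : rotVec 1 v = v := by simp [rotVec]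

theorem rotVec_mul (g h : SO3) (v : E3) : rotVec (g * h) v = rotVec g (rotVec h v) := by
  simp [rotVec, Matrix.mulVec_mulVec]

theorem rotVec_add (g : SO3) (v w : E3) : rotVec g (v + w) = rotVec g v + rotVec g w := by
  simp [rotVec, Matrix.mulVec_add]

theorem rotVec_smul (g : SO3) (c : ℝ) (v : E3) : rotVec g (c • v) = c • rotVec g v := by
  simp [rotVec, Matrix.mulVec_smul]

/-- The rotation of `ℝ³` by the angle `s` around the coordinate axis `i`, that is `exp (sX)`,
`exp (sY)`, `exp (sZ)` for the standard basis `X, Y, Z` of `so(3)`. -/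
def rot (i : Fin 3) (s : ℝ) : SO3 :=
  match i with
  | 0 => ⟨!![1, 0, 0; 0, Real.cos s, -Real.sin s; 0, Real.sin s, Real.cos s], by
      rw [Matrix.mem_specialOrthogonalGroup_iff, Matrix.mem_orthogonalGroup_iff]
      refine ⟨?_, ?_⟩
      · ext i j
        fin_cases i <;> fin_cases j <;> simp [Matrix.mul_apply, Fin.sum_univ_three] <;>
          nlinarith [Real.sin_sq_add_cos_sq s]
      · simp [Matrix.det_fin_three]; nlinarith [Real.sin_sq_add_cos_sq s]⟩
  | 1 => ⟨!![Real.cos s, 0, Real.sin s; 0, 1, 0; -Real.sin s, 0, Real.cos s], by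
      rw [Matrix.mem_specialOrthogonalGroup_iff, Matrix.mem_orthogonalGroup_iff]
      refine ⟨?_, ?_⟩
      · ext i j
        fin_cases i <;> fin_cases j <;> simp [Matrix.mul_apply, Fin.sum_univ_three] <;>
          nlinarith [Real.sin_sq_add_cos_sq s]
      · simp [Matrix.det_fin_three]; nlinarith [Real.sin_sq_add_cos_sq s]⟩
  | 2 => ⟨!![Real.cos s, -Real.sin s, 0; Real.sin s, Real.cos s, 0; 0, 0, 1], by
      rw [Matrix.mem_specialOrthogonalGroup_iff, Matrix.mem_orthogonalGroup_iff]
      refine ⟨?_, ?_⟩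
      · ext i j
        fin_cases i <;> fin_cases j <;> simp [Matrix.mul_apply, Fin.sum_univ_three] <;>
          nlinarith [Real.sin_sq_add_cos_sq s]
      · simp [Matrix.det_fin_three]; nlinarith [Real.sin_sq_add_cos_sq s]⟩

/-- `SO(3)` acts on `T^*S²` by `g · (q, p) = (gq, gp)`. -/
instance : MulAction SO3 CotS2 where
  smul g x := ⟨(rotVec g x.q, rotVec g x.p), by
    rw [norm_rotVec, inner_rotVec]; exact x.2⟩
  one_smul x := CotS2.ext (rotVec_one _) (rotVec_one _)
  mul_smul g h x := CotS2.ext (rotVec_mul g h _) (rotVec_mul g h _)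

theorem CotS2.smul_q (g : SO3) (x : CotS2) : (g • x).q = rotVec g x.q := rfl
theorem CotS2.smul_p (g : SO3) (x : CotS2) : (g • x).p = rotVec g x.p := rfl

/-- `SO(3)` acts trivially on the factor `ℝ` of `ℝ × T^*S²`. -/
instance : MulAction SO3 Cyl where
  smul g y := (y.1, g • y.2)
  one_smul y := Prod.ext rfl (one_smul SO3 y.2)
  mul_smul g h y := Prod.ext rfl (mul_smul g h y.2)

def rhoIntegrand (ε x : ℝ) : ℝ := Real.exp (ε ^ 2 / (4 * (x - ε / 2) * (x - ε)))

/-- The smooth step function `ρ_ε`: it is `0` for `r ≤ ε/2` and `1` for `r ≥ ε`. -/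
def rho (ε r : ℝ) : ℝ :=
  if r ≤ ε / 2 then 0
  else if r < ε then
    (∫ x in (ε / 2)..ε, rhoIntegrand ε x)⁻¹ * ∫ x in (ε / 2)..r, rhoIntegrand ε x
  else 1

/-- The function `f(r) = π k (1 + ρ_ε(r))`. -/
def twistAngle (k : ℤ) (ε r : ℝ) : ℝ := Real.pi * k * (1 + rho ε r)

/-- The integrand of `ρ_ε`, extended smoothly by zero (only used to prove smoothness). -/
def rhoSmooth (ε x : ℝ) : ℝ :=
  expNegInvGlue (2 * (x - ε / 2) / ε) * expNegInvGlue (2 * (ε - x) / ε)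

theorem rhoIntegrand_eq {ε x : ℝ} (h1 : ε / 2 < x) (h2 : x < ε) :
    rhoIntegrand ε x = rhoSmooth ε x := by
  have hε : 0 < ε := by linarith
  have a1 : 0 < x - ε / 2 := by linarith
  have a2 : 0 < ε - x := by linarith
  have b1 : 0 < 2 * (x - ε / 2) / ε := by positivity
  have b2 : 0 < 2 * (ε - x) / ε := by positivity
  rw [rhoIntegrand, rhoSmooth, expNegInvGlue, expNegInvGlue, if_neg b1.not_ge, if_neg b2.not_ge,
    ← Real.exp_add]
  congr 1
  have a3 : x - ε ≠ 0 := by linarith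
  have a4 : x * 2 - ε ≠ 0 := by linarith
  field_simp
  ring

theorem contDiff_rhoSmooth (ε : ℝ) : ContDiff ℝ ∞ (rhoSmooth ε) :=
  (expNegInvGlue.contDiff.comp (by fun_prop)).mul (expNegInvGlue.contDiff.comp (by fun_prop))

theorem integral_rho {ε r : ℝ} (h1 : ε / 2 ≤ r) (h2 : r ≤ ε) :
    ∫ x in (ε / 2)..r, rhoIntegrand ε x = ∫ x in (ε / 2)..r, rhoSmooth ε x := by
  rw [intervalIntegral.integral_of_le h1, intervalIntegral.integral_of_le h1,
    MeasureTheory.integral_Ioc_eq_integral_Ioo, MeasureTheory.integral_Ioc_eq_integral_Ioo]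
  apply MeasureTheory.setIntegral_congr_fun measurableSet_Ioo
  intro x hx
  exact rhoIntegrand_eq hx.1 (hx.2.trans_le h2)

theorem integral_rhoSmooth_pos {ε : ℝ} (hε : 0 < ε) : 0 < ∫ x in (ε / 2)..ε, rhoSmooth ε x := by
  apply intervalIntegral.intervalIntegral_pos_of_pos_on
  · exact (contDiff_rhoSmooth ε).continuous.intervalIntegrable _ _
  · intro x hx
    rw [← rhoIntegrand_eq hx.1 hx.2]
    exact Real.exp_pos _
  · linarith

theorem rho_eq {ε : ℝ} (hε : 0 < ε) (r : ℝ) :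
    rho ε r = (∫ x in (ε / 2)..ε, rhoSmooth ε x)⁻¹ * ∫ x in (ε / 2)..r, rhoSmooth ε x := by
  have hi : ∀ a b, IntervalIntegrable (rhoSmooth ε) MeasureTheory.volume a b :=
    fun a b => (contDiff_rhoSmooth ε).continuous.intervalIntegrable _ _
  unfold rho
  split_ifs with h1 h2
  · have : ∫ x in (ε / 2)..r, rhoSmooth ε x = 0 := by
      apply intervalIntegral.integral_zero_ae
      filter_upwards with x hx
      rw [Set.uIoc_of_ge h1] at hx
      rw [rhoSmooth, expNegInvGlue.zero_of_nonpos, zero_mul]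
      have : x - ε / 2 ≤ 0 := by linarith [hx.2]
      exact div_nonpos_of_nonpos_of_nonneg (by linarith) hε.le
    rw [this, mul_zero]
  · rw [integral_rho (by linarith) le_rfl, integral_rho (not_le.1 h1).le h2.le]
  · have h0 : ∫ x in ε..r, rhoSmooth ε x = 0 := by
      apply intervalIntegral.integral_zero_ae
      filter_upwards with x hx
      rw [Set.uIoc_of_le (not_lt.1 h2)] at hx
      rw [rhoSmooth, expNegInvGlue.zero_of_nonpos (x := 2 * (ε - x) / ε), mul_zero]
      have : ε - x ≤ 0 := by linarith [hx.1]
      exact div_nonpos_of_nonpos_of_nonneg (by linarith) hε.le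
    rw [← intervalIntegral.integral_add_adjacent_intervals (hi (ε / 2) ε) (hi ε r), h0, add_zero,
      inv_mul_cancel₀ (integral_rhoSmooth_pos hε).ne']

theorem contDiff_rho {ε : ℝ} (hε : 0 < ε) : ContDiff ℝ ∞ (rho ε) := by
  have h : ContDiff ℝ ∞ (fun r => ∫ x in (ε / 2)..r, rhoSmooth ε x) := by
    have hd : ∀ r, HasDerivAt (fun r => ∫ x in (ε / 2)..r, rhoSmooth ε x) (rhoSmooth ε r) r :=
      fun r => ((contDiff_rhoSmooth ε).continuous).integral_hasStrictDerivAt _ _ |>.hasDerivAt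
    rw [contDiff_infty_iff_deriv]
    refine ⟨fun r => (hd r).differentiableAt, ?_⟩
    have : deriv (fun r => ∫ x in (ε / 2)..r, rhoSmooth ε x) = rhoSmooth ε := by
      ext r; exact (hd r).deriv
    rw [this]; exact contDiff_rhoSmooth ε
  have : rho ε = fun r => (∫ x in (ε / 2)..ε, rhoSmooth ε x)⁻¹ *
      ∫ x in (ε / 2)..r, rhoSmooth ε x := funext (rho_eq hε)
  rw [this]
  exact contDiff_const.mul h

theorem twistAngle_of_le {k : ℤ} {ε r : ℝ} (h : r ≤ ε / 2) : twistAngle k ε r = Real.pi * k := by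
  simp [twistAngle, rho, h]

theorem sin_twistAngle_of_le {k : ℤ} {ε r : ℝ} (h : r ≤ ε / 2) : Real.sin (twistAngle k ε r) = 0 := by
  rw [twistAngle_of_le h, mul_comm]; exact Real.sin_int_mul_pi k

/-- The map `(q, p) ↦ (q cos θ + (p/|p|) sin θ, p cos θ - |p| q sin θ)`. -/
def geod (θ : ℝ) (x : E3 × E3) : E3 × E3 :=
  (Real.cos θ • x.1 + (Real.sin θ / ‖x.2‖) • x.2, Real.cos θ • x.2 - (‖x.2‖ * Real.sin θ) • x.1)

theorem geod_mem {θ : ℝ} {x : E3 × E3} (h : ‖x.1‖ = 1 ∧ ⟪x.1, x.2⟫_ℝ = 0)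
    (h0 : x.2 = 0 → Real.sin θ = 0) :
    (‖(geod θ x).1‖ = 1 ∧ ⟪(geod θ x).1, (geod θ x).2⟫_ℝ = 0) ∧ ‖(geod θ x).2‖ = ‖x.2‖ := by
  obtain ⟨q, p⟩ := x
  obtain ⟨h1, h2⟩ := h
  simp only at h1 h2 h0
  have h2' : ⟪p, q⟫_ℝ = 0 := by rw [real_inner_comm]; exact h2
  have sc := Real.sin_sq_add_cos_sq θ
  by_cases hp : p = 0
  · have hs := h0 hp
    have hc : Real.cos θ ^ 2 = 1 := by rw [hs] at sc; linarith
    have hc' : |Real.cos θ| = 1 := by rw [← sq_abs] at hc; nlinarith [abs_nonneg (Real.cos θ)]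
    subst hp
    simp [geod, hs, norm_smul, h1, hc']
  · have hn : ‖p‖ ≠ 0 := norm_ne_zero_iff.2 hp
    have e1 : ‖(geod θ (q, p)).1‖ ^ 2 = 1 := by
      rw [← real_inner_self_eq_norm_sq]
      simp only [geod, inner_add_left, inner_add_right, inner_smul_left, inner_smul_right, h2, h2',
        real_inner_self_eq_norm_sq, h1]
      simp
      field_simp
      linarith
    have e2 : ‖(geod θ (q, p)).2‖ ^ 2 = ‖p‖ ^ 2 := by
      rw [← real_inner_self_eq_norm_sq]
      simp only [geod, inner_sub_left, inner_sub_right, inner_smul_left, inner_smul_right, h2, h2',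
        real_inner_self_eq_norm_sq, h1]
      simp
      linear_combination ‖p‖ ^ 2 * sc
    refine ⟨⟨?_, ?_⟩, ?_⟩
    · nlinarith [norm_nonneg (geod θ (q, p)).1]
    · simp only [geod, inner_add_left, inner_sub_right, inner_smul_left, inner_smul_right, h2, h2',
        real_inner_self_eq_norm_sq, h1]
      simp
      field_simp
      ring
    · exact (sq_eq_sq₀ (norm_nonneg _) (norm_nonneg _)).1 e2

theorem geod_geod_neg {θ : ℝ} {x : E3 × E3} (h : ‖x.1‖ = 1 ∧ ⟪x.1, x.2⟫_ℝ = 0)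
    (h0 : x.2 = 0 → Real.sin θ = 0) : geod (-θ) (geod θ x) = x := by
  have hn := (geod_mem h h0).2
  obtain ⟨q, p⟩ := x
  have sc := Real.sin_sq_add_cos_sq θ
  simp only at h0 hn
  rw [geod, hn]
  by_cases hp : p = 0
  · subst hp
    simp only [geod, h0 rfl, Real.sin_neg, Real.cos_neg]
    have hc : Real.cos θ * Real.cos θ = 1 := by rw [h0 rfl] at sc; linarith
    simp [smul_smul, hc]
  · have hp' : ‖p‖ ≠ 0 := norm_ne_zero_iff.2 hp
    simp only [geod, Real.sin_neg, Real.cos_neg]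
    refine Prod.ext ?_ ?_
    · simp only
      match_scalars <;> field_simp <;> linarith
    · simp only
      match_scalars <;> field_simp <;> linarith

theorem geod_rotVec (θ : ℝ) (g : SO3) (x : E3 × E3) :
    geod θ (rotVec g x.1, rotVec g x.2) = (rotVec g (geod θ x).1, rotVec g (geod θ x).2) := by
  simp only [geod, norm_rotVec, sub_eq_add_neg, ← neg_smul, rotVec_add, rotVec_smul]

/-- The formula of the `k`-fold Dehn twist: the previous map with `θ = f(|p|)`. -/
def twistFun (k : ℤ) (ε : ℝ) (x : E3 × E3) : E3 × E3 := geod (twistAngle k ε ‖x.2‖) x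

theorem twist_h0 (k : ℤ) {ε : ℝ} (hε : 0 < ε) (x : E3 × E3) :
    x.2 = 0 → Real.sin (twistAngle k ε ‖x.2‖) = 0 := by
  intro h
  apply sin_twistAngle_of_le
  rw [h, norm_zero]; linarith

theorem twistFun_neg {k : ℤ} {ε : ℝ} (hε : 0 < ε) {x : E3 × E3}
    (h : ‖x.1‖ = 1 ∧ ⟪x.1, x.2⟫_ℝ = 0) : twistFun (-k) ε (twistFun k ε x) = x := by
  have hn := (geod_mem h (twist_h0 k hε x)).2
  rw [twistFun, twistFun, hn]
  have : twistAngle (-k) ε ‖x.2‖ = - twistAngle k ε ‖x.2‖ := by simp [twistAngle]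
  rw [this]
  exact geod_geod_neg h (twist_h0 k hε x)

theorem contDiff_twistFun (k : ℤ) {ε : ℝ} (hε : 0 < ε) : ContDiff ℝ ∞ (twistFun k ε) := by
  have hf : ContDiff ℝ ∞ (twistAngle k ε) :=
    contDiff_const.mul (contDiff_const.add (contDiff_rho hε))
  rw [contDiff_iff_contDiffAt]
  rintro ⟨q, p⟩
  by_cases hp : p = 0
  · have hev : twistFun k ε =ᶠ[nhds (q, p)] fun x =>
        (Real.cos (Real.pi * k) • x.1, Real.cos (Real.pi * k) • x.2) := by
      have : ∀ᶠ x : E3 × E3 in nhds (q, p), ‖x.2‖ < ε / 2 := by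
        apply (continuous_snd.norm.continuousAt).eventually_lt continuousAt_const
        simp [hp, hε]
      filter_upwards [this] with x hx
      rw [twistFun, geod, sin_twistAngle_of_le hx.le, twistAngle_of_le hx.le]
      simp
    refine ContDiffAt.congr_of_eventuallyEq ?_ hev
    fun_prop
  · have hn : ContDiffAt ℝ ∞ (fun x : E3 × E3 => ‖x.2‖) (q, p) := contDiffAt_snd.norm ℝ hp
    have hθ : ContDiffAt ℝ ∞ (fun x : E3 × E3 => twistAngle k ε ‖x.2‖) (q, p) :=
      hf.contDiffAt.comp _ hn
    have hp' : ‖p‖ ≠ 0 := norm_ne_zero_iff.2 hp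
    exact ((hθ.cos.smul contDiffAt_fst).add ((hθ.sin.div hn hp').smul contDiffAt_snd)).prodMk
      ((hθ.cos.smul contDiffAt_snd).sub ((hn.mul hθ.sin).smul contDiffAt_fst))

/-- An `SO(3)`-equivariant diffeomorphism `τ` of `T^*S²`; smoothness of `τ` is expressed by smoothness
of `id × τ` on `ℝ × T^*S²`. -/
structure EquivDiffeo where
  toEquiv : CotS2 ≃ CotS2
  smooth : ContMDiff (𝓡 5) (𝓡 5) ∞ fun y : Cyl => ((y.1, toEquiv y.2) : Cyl)
  smooth_symm : ContMDiff (𝓡 5) (𝓡 5) ∞ fun y : Cyl => ((y.1, toEquiv.symm y.2) : Cyl)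
  equivariant : ∀ (g : SO3) (x : CotS2), toEquiv (g • x) = g • toEquiv x

theorem contMDiff_of_ambient {F : CotS2 → CotS2} {A : E3 × E3 → E3 × E3} (hA : ContDiff ℝ ∞ A)
    (h : ∀ x, (F x).1 = A x.1) : ContMDiff (𝓡 5) (𝓡 5) ∞ fun y : Cyl => ((y.1, F y.2) : Cyl) := by
  apply Cyl.contMDiff_of_emb
  have : Cyl.emb ∘ (fun y : Cyl => ((y.1, F y.2) : Cyl)) =
      (fun z : ℝ × E3 × E3 => (z.1, A z.2)) ∘ Cyl.emb := by
    ext1 y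
    exact Prod.ext rfl (h y.2)
  rw [this]
  exact (contDiff_fst.prodMk (hA.comp contDiff_snd)).contMDiff.comp Cyl.contMDiff_emb

def dehnTwistEquiv (k : ℤ) (ε : ℝ) (hε : 0 < ε) : CotS2 ≃ CotS2 where
  toFun x := ⟨twistFun k ε x.1, (geod_mem x.2 (twist_h0 k hε x.1)).1⟩
  invFun x := ⟨twistFun (-k) ε x.1, (geod_mem x.2 (twist_h0 (-k) hε x.1)).1⟩
  left_inv x := Subtype.ext (twistFun_neg hε x.2)
  right_inv x := Subtype.ext (by
    have := twistFun_neg (k := -k) hε x.2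
    rwa [neg_neg] at this)

/-- The `k`-fold generalized Dehn twist `τ_k` on `T^*S²`. -/
def dehnTwist (k : ℤ) (ε : ℝ) (hε : 0 < ε) : EquivDiffeo where
  toEquiv := dehnTwistEquiv k ε hε
  smooth := contMDiff_of_ambient (contDiff_twistFun k hε) (fun _ => rfl)
  smooth_symm := contMDiff_of_ambient (contDiff_twistFun (-k) hε) (fun _ => rfl)
  equivariant g x := by
    apply Subtype.ext
    change twistFun k ε (rotVec g x.q, rotVec g x.p) = _
    rw [twistFun, norm_rotVec]
    exact geod_rotVec _ g x.1

def idDiffeo : EquivDiffeo where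
  toEquiv := Equiv.refl _
  smooth := contMDiff_id
  smooth_symm := contMDiff_id
  equivariant _ _ := rfl

/-- The map of `T^*S²` induced by the antipodal map of `S²`. -/
def antipodal : CotS2 ≃ CotS2 where
  toFun x := ⟨(-x.q, -x.p), by
    rw [norm_neg, inner_neg_neg]; exact x.2⟩
  invFun x := ⟨(-x.q, -x.p), by
    rw [norm_neg, inner_neg_neg]; exact x.2⟩
  left_inv x := CotS2.ext (neg_neg x.q) (neg_neg x.p)
  right_inv x := CotS2.ext (neg_neg x.q) (neg_neg x.p)

def antipodalDiffeo : EquivDiffeo where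
  toEquiv := antipodal
  smooth := contMDiff_of_ambient (A := fun x => -x) contDiff_neg (fun _ => rfl)
  smooth_symm := contMDiff_of_ambient (A := fun x => -x) contDiff_neg (fun _ => rfl)
  equivariant g x := by
    have : ∀ v : E3, rotVec g (-v) = - rotVec g v := by
      intro v; rw [← neg_one_smul ℝ v, rotVec_smul, neg_one_smul]
    exact CotS2.ext (this x.q).symm (this x.p).symm

namespace EquivDiffeo

/-- `(t, x) ↦ (t + n, τⁿ x)`. -/
def shift (τ : EquivDiffeo) (n : ℤ) (y : Cyl) : Cyl := (y.1 + n, (τ.toEquiv ^ n : Equiv.Perm CotS2) y.2)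

theorem shift_zero (τ : EquivDiffeo) (y : Cyl) : τ.shift 0 y = y := by simp [shift]

theorem shift_add (τ : EquivDiffeo) (m n : ℤ) (y : Cyl) :
    τ.shift (m + n) y = τ.shift m (τ.shift n y) := by
  refine Prod.ext ?_ ?_
  · simp only [shift]; push_cast; ring
  · simp only [shift, zpow_add, Equiv.Perm.mul_apply]

/-- The equivalence relation generated by `(t; x) ∼ (t + 1; τ x)`. -/
def rel (τ : EquivDiffeo) : Setoid Cyl where
  r y z := ∃ n : ℤ, z = τ.shift n y
  iseqv := {
    refl := fun y => ⟨0, (τ.shift_zero y).symm⟩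
    symm := by
      rintro y z ⟨n, rfl⟩
      exact ⟨-n, by rw [← shift_add, neg_add_cancel, shift_zero]⟩
    trans := by
      rintro x y z ⟨n, rfl⟩ ⟨m, rfl⟩
      exact ⟨m + n, by rw [shift_add]⟩ }

theorem contMDiff_translate (c : ℝ) :
    ContMDiff (𝓡 5) (𝓡 5) ∞ fun y : Cyl => ((y.1 + c, y.2) : Cyl) := by
  apply Cyl.contMDiff_of_emb
  exact (((contDiff_fst.add contDiff_const).prodMk contDiff_snd).contMDiff
    (f := fun z : ℝ × E3 × E3 => (z.1 + c, z.2))).comp Cyl.contMDiff_emb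

theorem contMDiff_shift (τ : EquivDiffeo) (n : ℤ) : ContMDiff (𝓡 5) (𝓡 5) ∞ (τ.shift n) := by
  have hp : ∀ n : ℕ, ContMDiff (𝓡 5) (𝓡 5) ∞ (τ.shift n) := by
    intro n
    induction n with
    | zero => exact contMDiff_id.congr (fun y => τ.shift_zero y)
    | succ n ih =>
      have h1 : ContMDiff (𝓡 5) (𝓡 5) ∞ (τ.shift 1) :=
        (contMDiff_translate 1).comp τ.smooth |>.congr (fun y => by simp [shift])
      refine (h1.comp ih).congr (fun y => ?_)
      rw [Function.comp, ← shift_add, add_comm]; rfl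
  have hn : ∀ n : ℕ, ContMDiff (𝓡 5) (𝓡 5) ∞ (τ.shift (-n)) := by
    intro n
    induction n with
    | zero => exact contMDiff_id.congr (fun y => by simpa using τ.shift_zero y)
    | succ n ih =>
      have h1 : ContMDiff (𝓡 5) (𝓡 5) ∞ (τ.shift (-1)) :=
        (contMDiff_translate (-1)).comp τ.smooth_symm |>.congr (fun y => by
          simp [shift])
      refine (h1.comp ih).congr (fun y => ?_)
      rw [Function.comp, ← shift_add]; congr 1; push_cast; ring
  obtain ⟨m, rfl | rfl⟩ := n.eq_nat_or_neg
  · exact hp m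
  · exact hn m

theorem shift_smul (τ : EquivDiffeo) (n : ℤ) (g : SO3) (y : Cyl) :
    τ.shift n (g • y) = g • τ.shift n y := by
  have h1 : ∀ z : Cyl, τ.shift 1 (g • z) = g • τ.shift 1 z := by
    intro z
    refine Prod.ext rfl ?_
    have : ∀ w : Cyl, (τ.shift 1 w).2 = τ.toEquiv w.2 := fun w => by simp [shift]
    rw [this]
    exact (τ.equivariant g z.2).trans (congrArg (g • ·) (this z).symm)
  induction n using Int.induction_on generalizing y with
  | zero => rw [shift_zero, shift_zero]
  | succ i ih => rw [shift_add, h1, ih, ← shift_add]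
  | pred i ih =>
    have h2 : ∀ z : Cyl, τ.shift (-1) (g • z) = g • τ.shift (-1) z := by
      intro z
      have := h1 (τ.shift (-1) z)
      rw [← shift_add τ 1 (-1) z, add_neg_cancel, shift_zero] at this
      rw [← this, ← shift_add, neg_add_cancel, shift_zero]
    rw [sub_eq_add_neg, shift_add, h2, ih, ← shift_add]

end EquivDiffeo

/-- The mapping torus `ℝ × T^*S² / ∼` with `(t; x) ∼ (t + 1; τ x)`, with the quotient topology and
the smooth structure for which the projection is a local diffeomorphism. -/
def MappingTorus (τ : EquivDiffeo) : Type := Quotient τ.rel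

namespace MappingTorus
variable (τ : EquivDiffeo)

instance : TopologicalSpace (MappingTorus τ) := inferInstanceAs (TopologicalSpace (Quotient τ.rel))

/-- The projection `ℝ × T^*S² → ℝ × T^*S² / ∼`. -/
def mk (y : Cyl) : MappingTorus τ := Quotient.mk τ.rel y

theorem mk_eq_iff {y z : Cyl} : mk τ y = mk τ z ↔ ∃ n : ℤ, z = τ.shift n y :=
  Quotient.eq (r := τ.rel)

theorem mk_surjective : Function.Surjective (mk τ) := Quotient.mk_surjective

theorem continuous_mk : Continuous (mk τ) := continuous_quotient_mk'

theorem mk_shift (n : ℤ) (y : Cyl) : mk τ (τ.shift n y) = mk τ y :=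
  ((mk_eq_iff τ).2 ⟨n, rfl⟩).symm

theorem isOpenMap_mk : IsOpenMap (mk τ) := by
  intro U hU
  have hq : Topology.IsQuotientMap (mk τ) := isQuotientMap_quotient_mk'
  rw [← hq.isOpen_preimage]
  have : mk τ ⁻¹' (mk τ '' U) = ⋃ n : ℤ, τ.shift n ⁻¹' U := by
    ext y
    simp only [Set.mem_preimage, Set.mem_image, Set.mem_iUnion]
    constructor
    · rintro ⟨u, hu, h⟩
      obtain ⟨n, rfl⟩ := (mk_eq_iff τ).1 h.symm
      exact ⟨n, hu⟩
    · rintro ⟨n, hn⟩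
      exact ⟨_, hn, mk_shift τ n y⟩
  rw [this]
  exact isOpen_iUnion fun n => hU.preimage (τ.contMDiff_shift n).continuous

theorem isLocalHomeomorph_mk : IsLocalHomeomorph (mk τ) := by
  rw [isLocalHomeomorph_iff_isOpenEmbedding_restrict]
  intro y
  have hU : IsOpen {z : Cyl | |z.1 - y.1| < 1 / 2} :=
    isOpen_lt ((continuous_fst.sub continuous_const).abs) continuous_const
  refine ⟨_, hU.mem_nhds (by simp), ?_⟩
  refine Topology.IsOpenEmbedding.of_continuous_injective_isOpenMap
    ((continuous_mk τ).comp continuous_subtype_val) ?_ ((isOpenMap_mk τ).domRestrict hU)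
  rintro ⟨a, ha⟩ ⟨b, hb⟩ h
  obtain ⟨n, hn⟩ := (mk_eq_iff τ).1 h
  have ha' : |a.1 - y.1| < 1 / 2 := ha
  have hb' : |b.1 - y.1| < 1 / 2 := hb
  have h1 : b.1 = a.1 + n := congrArg Prod.fst hn
  rw [abs_lt] at ha' hb'
  have h2 : (n : ℝ) < 1 := by linarith
  have h3 : (-1 : ℝ) < n := by linarith
  have h4 : n < 1 := by exact_mod_cast h2
  have h5 : -1 < n := by exact_mod_cast h3
  have : n = 0 := by omega
  subst this
  rw [EquivDiffeo.shift_zero] at hn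
  exact Subtype.ext hn.symm

instance : ChartedSpace E5 (MappingTorus τ) :=
  (isLocalHomeomorph_mk τ).chartedSpace (mk_surjective τ)

theorem localInverse_eventuallyEq {l : OpenPartialHomeomorph (MappingTorus τ) Cyl}
    (hl : ⇑l.symm = mk τ) {y : Cyl} (hy : mk τ y ∈ l.source) :
    ∃ n : ℤ, (fun z => l (mk τ z)) =ᶠ[nhds y] τ.shift n := by
  have h1 : mk τ y = mk τ (l (mk τ y)) := by
    rw [← hl]; exact (l.left_inv (hl ▸ hy)).symm
  obtain ⟨n, hn⟩ := (mk_eq_iff τ).1 h1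
  refine ⟨n, ?_⟩
  have hc := (τ.contMDiff_shift n).continuous
  have ht : τ.shift n y ∈ l.target := hn ▸ l.map_source hy
  filter_upwards [hc.continuousAt.preimage_mem_nhds (l.open_target.mem_nhds ht)] with z hz
  rw [← mk_shift τ n z, ← hl]
  exact l.right_inv hz

instance : IsManifold (𝓡 5) ∞ (MappingTorus τ) := by
  apply isManifold_of_contDiffOn
  rintro _ _ ⟨a, rfl⟩ ⟨b, rfl⟩
  set g := (mk_surjective τ).hasRightInverse.choose
  set l := (isLocalHomeomorph_mk τ).localInverseAt (g a)
  set l' := (isLocalHomeomorph_mk τ).localInverseAt (g b)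
  have hl : ⇑l.symm = mk τ := (isLocalHomeomorph_mk τ).localInverseAt_symm _
  have hl' : ⇑l'.symm = mk τ := (isLocalHomeomorph_mk τ).localInverseAt_symm _
  set c := chartAt E5 (g a)
  set c' := chartAt E5 (g b)
  simp only [modelWithCornersSelf_coe, modelWithCornersSelf_coe_symm, Function.id_comp,
    Function.comp_id, Set.preimage_id, Set.range_id, Set.inter_univ]
  rintro z ⟨⟨hz1, hz2⟩, hz3, hz4⟩
  have e1 : ⇑(l.trans c).symm = fun z => mk τ (c.symm z) := by
    rw [← hl]; rfl
  simp only [Set.mem_preimage] at hz3 hz4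
  have hz3' : mk τ (c.symm z) ∈ l'.source := by rw [← hl]; exact hz3
  have hz4' : l' (mk τ (c.symm z)) ∈ c'.source := by rw [← hl]; exact hz4
  obtain ⟨n, hn⟩ := localInverse_eventuallyEq τ hl' hz3'
  have hcz : ContinuousAt c.symm z := c.continuousAt_symm hz1
  have hev : (l.trans c).symm.trans (l'.trans c') =ᶠ[nhds z] c' ∘ τ.shift n ∘ c.symm := by
    filter_upwards [hcz.eventually hn] with w hw
    change c' (l' (l.symm (c.symm w))) = c' (τ.shift n (c.symm w))
    rw [hl, hw]
  refine (ContDiffAt.congr_of_eventuallyEq ?_ hev).contDiffWithinAt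
  have s1 : ContMDiffAt (𝓡 5) (𝓡 5) ∞ c.symm z :=
    (contMDiffOn_chart_symm).contMDiffAt (c.open_target.mem_nhds hz1)
  have s2 : ContMDiffAt (𝓡 5) (𝓡 5) ∞ c' (τ.shift n (c.symm z)) := by
    rw [← hn.self_of_nhds]
    exact (contMDiffOn_chart).contMDiffAt (c'.open_source.mem_nhds hz4')
  exact (s2.comp z (((τ.contMDiff_shift n) _).comp z s1)).contDiffAt

/-- The action of `SO(3)` on the mapping torus induced from the one on `ℝ × T^*S²`. -/
instance : MulAction SO3 (MappingTorus τ) where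
  smul g := Quotient.map (fun y : Cyl => g • y) (by
    rintro y z ⟨n, rfl⟩
    exact ⟨n, (τ.shift_smul n g y).symm⟩)
  one_smul x := by
    obtain ⟨y, rfl⟩ := mk_surjective τ x
    exact congrArg (mk τ) (one_smul SO3 y)
  mul_smul g h x := by
    obtain ⟨y, rfl⟩ := mk_surjective τ x
    exact congrArg (mk τ) (mul_smul g h y)

end MappingTorus

section Forms

variable {M : Type*} [TopologicalSpace M] [ChartedSpace E5 M]
variable {N : Type*} [TopologicalSpace N] [ChartedSpace E5 N]

/-- A (not necessarily smooth) 1-form on a 5-manifold. -/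
abbrev OneForm (M : Type*) [TopologicalSpace M] [ChartedSpace E5 M] : Type _ :=
  ∀ x : M, TangentSpace (𝓡 5) x →L[ℝ] ℝ

/-- The pull-back `F^* α`. -/
def pullback (F : M → N) (α : OneForm N) : OneForm M :=
  fun x => (α (F x)).comp (mfderiv (𝓡 5) (𝓡 5) F x)

/-- The coordinate expression of a 1-form in the preferred chart at `x₀`. -/
def inChart (α : OneForm M) (x₀ : M) : E5 → (E5 →L[ℝ] ℝ) :=
  fun z => (α ((chartAt E5 x₀).symm z)).comp (mfderiv (𝓡 5) (𝓡 5) (chartAt E5 x₀).symm z)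

def IsSmoothForm (α : OneForm M) : Prop :=
  ∀ x₀ : M, ContDiffOn ℝ ∞ (inChart α x₀) (chartAt E5 x₀).target

/-- The exterior derivative `dα(u, v)` at `x`, computed in the preferred chart at `x` (the chart
by which Mathlib identifies the tangent space at `x` with the model space). -/
def extD (α : OneForm M) (x : M) (u v : TangentSpace (𝓡 5) x) : ℝ :=
  fderiv ℝ (inChart α x) (chartAt E5 x x) u v - fderiv ℝ (inChart α x) (chartAt E5 x x) v u

/-- The 3-form `α ∧ dα`. -/
def wedgeD (α : OneForm M) (x : M) (u v w : TangentSpace (𝓡 5) x) : ℝ :=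
  α x u * extD α x v w + α x v * extD α x w u + α x w * extD α x u v

/-- The contact condition: `α` does not vanish and `dα` is nondegenerate on `ker α`. -/
def IsContactForm (α : OneForm M) : Prop :=
  ∀ x : M, α x ≠ 0 ∧ ∀ u : TangentSpace (𝓡 5) x, α x u = 0 →
    (∀ v : TangentSpace (𝓡 5) x, α x v = 0 → extD α x u v = 0) → u = 0

variable [MulAction SO3 M] [MulAction SO3 N]

/-- The action map `SO(3) × M → M` is smooth: it is smooth along every smooth family of rotations
(a smooth map from some `ℝⁿ` to `SO(3)`, in particular along local parametrizations of `SO(3)`). -/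
def IsSmoothAction (M : Type*) [TopologicalSpace M] [ChartedSpace E5 M] [MulAction SO3 M] : Prop :=
  ∀ (n : ℕ) (g : EuclideanSpace ℝ (Fin n) → SO3), (∀ i j, ContDiff ℝ ∞ fun a => (g a).1 i j) →
    ContMDiff ((𝓡 n).prod (𝓡 5)) (𝓡 5) ∞
      (fun z : EuclideanSpace ℝ (Fin n) × M => g z.1 • z.2)

/-- `(M, α)` is a contact `SO(3)`-manifold: the action is smooth and `α` is an invariant contact form. -/
structure IsContactSO3 (α : OneForm M) : Prop where
  smooth_action : IsSmoothAction M
  smooth_form : IsSmoothForm α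
  invariant : ∀ g : SO3, pullback (fun x : M => g • x) α = α
  contact : IsContactForm α

/-- The infinitesimal generators `X_M`, `Y_M`, `Z_M` for `i = 0, 1, 2`: the velocity of
`s ↦ exp (sX) · x` at `s = 0`. -/
def gen (i : Fin 3) (x : M) : TangentSpace (𝓡 5) x :=
  (mfderiv 𝓘(ℝ, ℝ) (𝓡 5) (fun s : ℝ => rot i s • x) 0 : ℝ →L[ℝ] E5) 1

/-- The moment map `⟨μ(x), X⟩ = α_x(X_M)`, in the basis of `so(3)^*` dual to `X, Y, Z`. -/
def momentMap (α : OneForm M) (x : M) : Fin 3 → ℝ := fun i => α x (gen i x)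

/-- The cross-section `R = μ⁻¹(ℝ⁺ Z^*)`. -/
def crossSection (α : OneForm M) : Set M :=
  {x | momentMap α x 0 = 0 ∧ momentMap α x 1 = 0 ∧ 0 < momentMap α x 2}

/-- The points on singular orbits, i.e. on orbits of dimension less than three. -/
def singularSet (M : Type*) [TopologicalSpace M] [ChartedSpace E5 M] [MulAction SO3 M] : Set M :=
  {x | ¬ LinearIndependent ℝ fun i : Fin 3 => (gen i x : E5)}

/-- The connected components of the set of singular orbits. -/
def singularComponents (M : Type*) [TopologicalSpace M] [ChartedSpace E5 M] [MulAction SO3 M] :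
    Set (Set M) :=
  {K | ∃ x ∈ singularSet M, K = connectedComponentIn (singularSet M) x}

/-- The orbit of `x` under the circle of rotations around the `z`-axis, which acts on the
cross-section. -/
def zOrbit (x : M) : Set M := {z | ∃ s : ℝ, z = rot 2 s • x}

/-- The closure of the cross-section without the exceptional circle orbits: the points of the closure
with trivial stabilizer in the circle. -/
def freePart (α : OneForm M) : Set M :=
  {x | x ∈ closure (crossSection α) ∧ ∀ s : ℝ, rot 2 s • x = x → rot 2 s = 1}

/-- `d` is a slice disc in the cross-section at the exceptional point `x`, whose stabilizer in the circle
is cyclic of order `m`; the generator `e^{2πi/m}` acts on the disc by `z ↦ e^{2πiν/m} z`.  The disc is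
oriented so that its tangent plane followed by `Z_M` is positive for `α ∧ dα`. -/
structure IsOrbitSlice (α : OneForm M) (m : ℕ) (x : M) (d : ℂ → M) : Prop where
  center : d 0 = x
  smooth : ContMDiffOn 𝓘(ℝ, ℂ) (𝓡 5) ∞ d (Metric.ball 0 1)
  injOn : Set.InjOn d (Metric.ball 0 1)
  mem : ∀ z ∈ Metric.ball (0 : ℂ) 1, d z ∈ crossSection α
  equivariant : ∃ ν : ℤ, ∀ z ∈ Metric.ball (0 : ℂ) 1,
    rot 2 (2 * Real.pi / m) • d z = d (Complex.exp (2 * Real.pi * Complex.I * ν / m) * z)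
  slice : ∀ z ∈ Metric.ball (0 : ℂ) 1, ∀ z' ∈ Metric.ball (0 : ℂ) 1, ∀ s : ℝ,
    rot 2 s • d z = d z' → ∃ j : ℤ, rot 2 s = rot 2 (2 * Real.pi * j / m)
  oriented : 0 < wedgeD α (d 0) (mfderiv 𝓘(ℝ, ℂ) (𝓡 5) d 0 (1 : ℂ))
    (mfderiv 𝓘(ℝ, ℂ) (𝓡 5) d 0 Complex.I) (gen 2 (d 0))

/-- `σ` is a section of the circle action over the closure of the cross-section, outside the exceptional
orbits (written as the map sending a point to the point of the section on its circle orbit), which is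
standard near the exceptional orbits: with respect to `σ` the boundary of a slice disc winds `β` times
around the circle direction with `0 < β < m` (then `β ν ≡ 1` modulo `m`, so that `(m, β)` is the
normalized Seifert invariant). -/
structure IsStandardSection (α : OneForm M) (σ : M → M) : Prop where
  continuousOn : ContinuousOn σ (freePart α)
  mem_orbit : ∀ x ∈ freePart α, σ x ∈ zOrbit x
  invariant : ∀ x ∈ freePart α, ∀ s : ℝ, σ (rot 2 s • x) = σ x
  standard : ∀ x ∈ crossSection α, (∃ s : ℝ, rot 2 s • x = x ∧ rot 2 s ≠ 1) →
    ∃ (m : ℕ) (d : ℂ → M) (β : ℤ), 2 ≤ m ∧ IsOrbitSlice α m x d ∧ 0 < β ∧ β < m ∧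
      ∀ r : ℝ, 0 < r → r < 1 → ∃ h : ℝ → ℝ, Continuous h ∧ (∀ u, h (u + 1) = h u + β) ∧
        ∀ u : ℝ, d (r * Complex.exp (2 * Real.pi * Complex.I * u)) =
          rot 2 (2 * Real.pi * h u) • σ (d (r * Complex.exp (2 * Real.pi * Complex.I * u)))

/-- `Φ : ℝ² → T` is the universal covering of the boundary torus `T` by oriented coordinates `(x, y)` such
that `y` runs along the circle orbits.  The orientation of `T` is the boundary orientation, where the
closure of the cross-section is oriented by `α ∧ dα`.  On `T` one has `α(Z_M) = 0`, the form
`dα(v, Z_M)` vanishes for tangent `v`, and `dα(Z_M, ν) > 0` for outward `ν`; so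
`(α ∧ dα)(v, Z_M, ν) > 0` means `α(v) > 0`: a tangent `v` followed by `Z_M` is a positive basis of
`T` exactly if `α(v) > 0`. -/
structure IsTorusCover (α : OneForm M) (T : Set M) (Φ : ℝ × ℝ → M) : Prop where
  smooth : ContMDiff 𝓘(ℝ, ℝ × ℝ) (𝓡 5) ∞ Φ
  equivariant : ∀ x y s : ℝ, Φ (x, y + s) = rot 2 (2 * Real.pi * s) • Φ (x, y)
  fibers : ∀ a b : ℝ × ℝ, Φ a = Φ b ↔ ∃ m n : ℤ, b = a + ((m : ℝ), (n : ℝ))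
  range_eq : Set.range Φ = T
  oriented : ∀ a : ℝ × ℝ, 0 < α (Φ a) (mfderiv 𝓘(ℝ, ℝ × ℝ) (𝓡 5) Φ a ((1, 0) : ℝ × ℝ))

/-- The curve `u ↦ Φ (c u)` with `u` in `ℝ/ℤ` is a simple closed curve with image `S`, and its homology
class in the torus is `a`, in the basis given by the coordinates. -/
structure IsSimpleLoop (Φ : ℝ × ℝ → M) (S : Set M) (c : ℝ → ℝ × ℝ) (a : ℤ × ℤ) : Prop where
  continuous : Continuous c
  periodic : ∀ u : ℝ, c (u + 1) = c u + ((a.1 : ℝ), (a.2 : ℝ))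
  simple : ∀ u v : ℝ, Φ (c u) = Φ (c v) → ∃ n : ℤ, v = u + n
  range_eq : Set.range (fun u => Φ (c u)) = S

/-- The algebraic intersection number of two homology classes of an oriented torus. -/
def torusIntersection (a b : ℤ × ℤ) : ℤ := a.1 * b.2 - a.2 * b.1

/-- The curve of marked points through `x₀`: the component of `x₀` in the set of points of `T` with
the same stabilizer in `SO(3)` as `x₀`. -/
def markedCurve (T : Set M) (x₀ : M) : Set M :=
  connectedComponentIn
    {x | x ∈ T ∧ MulAction.stabilizer SO3 x = MulAction.stabilizer SO3 x₀} x₀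

/-- The component `K` of the singular orbits contributes the summand `n` to the Dehn-Euler number computed
with the section `σ`: this is `2 ι(γ, ∂σ)` if the marked curve `γ` in the boundary torus `T` meets each
circle orbit once and `ι(γ, ∂σ)` if it meets each circle orbit twice.  The curve `γ` is oriented so that
`γ` followed by `Z_M` is positive in `T`, hence `0 < a.1`.  The section is oriented so that its tangent
plane followed by `Z_M` is positive in the closure of the cross-section, and `∂σ` is its boundary; as for
`T`, the outward normal is put last in a positive basis, which means `b.1 < 0`. -/
def HasContribution (α : OneForm M) (σ : M → M) (K : Set M) (n : ℤ) : Prop :=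
  ∃ (T : Set M) (Φ : ℝ × ℝ → M) (x₀ : M) (γ β : ℝ → ℝ × ℝ) (a b : ℤ × ℤ),
    T = closure (crossSection α) ∩ K ∧ IsTorusCover α T Φ ∧ x₀ ∈ T ∧
    IsSimpleLoop Φ (markedCurve T x₀) γ a ∧ 0 < a.1 ∧
    IsSimpleLoop Φ (σ '' T) β b ∧ b.1 < 0 ∧
    (((∀ x ∈ T, (markedCurve T x₀ ∩ zOrbit x).ncard = 1) ∧ n = 2 * torusIntersection a b) ∨
     ((∀ x ∈ T, (markedCurve T x₀ ∩ zOrbit x).ncard = 2) ∧ n = torusIntersection a b))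

/-- `n` is the Dehn-Euler number of `(M, α)`, computed with the section `σ`. -/
def IsDehnEulerNumber (α : OneForm M) (σ : M → M) (n : ℤ) : Prop :=
  ∃ (F : Finset (Set M)) (c : Set M → ℤ), (F : Set (Set M)) = singularComponents M ∧
    (∀ K ∈ F, HasContribution α σ K (c K)) ∧ n = ∑ K ∈ F, c K

end Forms

/-- The differential at `y` of a map from `ℝ × T^*S²` to a normed space. -/
def dMap {F : Type*} [NormedAddCommGroup F] [NormedSpace ℝ F] (f : Cyl → F) (y : Cyl) :
    TangentSpace (𝓡 5) y →L[ℝ] F := mfderiv (𝓡 5) 𝓘(ℝ, F) f y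

/-- The form `dt + λ_can` on `ℝ × T^*S²`, where `λ_can = p · dq`. -/
def canForm : OneForm Cyl := fun y =>
  dMap (fun z => z.1) y + (innerSL ℝ y.2.p).comp (dMap (fun z => z.2.q) y)

/-- The form `dt + λ_can - t |p| df` on `ℝ × T^*S²`, where `f` is the function of the Dehn twist. -/
def dehnForm (k : ℤ) (ε : ℝ) : OneForm Cyl := fun y =>
  canForm y - (y.1 * ‖y.2.p‖) • dMap (fun z => twistAngle k ε ‖z.2.p‖) y

/-- The point `q = (1, 0, 0)`, `p = (0, r, 0)`; the standard section over the collar consists of the points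
`(t; q, p)` of this form. -/
def stdPoint (r : ℝ) : CotS2 :=
  ⟨(!₂[1, 0, 0], !₂[0, r, 0]), by
    simp [EuclideanSpace.norm_eq, Fin.sum_univ_three, PiLp.inner_apply]⟩

/-- `V^*E_triv`, the dual of the vertical bundle of the trivial `S²`-bundle `ℝ × S² / (t, q) ∼ (t+1, q)`:
the quotient of `ℝ × T^*S²` by `(t; q, p) ∼ (t + 1; q, p)`. -/
abbrev VdualTriv : Type := MappingTorus idDiffeo
/-- `V^*E_twist`, the dual of the vertical bundle of the twisted `S²`-bundle
`ℝ × S² / (t, q) ∼ (t+1, -q)`: the quotient of `ℝ × T^*S²` by `(t; q, p) ∼ (t + 1; -q, -p)`. -/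
abbrev VdualTwist : Type := MappingTorus antipodalDiffeo

/-- What is cut out of `M`: the component `K` and the part `|p| ≤ a` of its collar. -/
def core {M : Type*} (K : Set M) (ψ : Cyl → M) (a : ℝ) : Set M :=
  K ∪ ψ '' {y : Cyl | 0 < ‖y.2.p‖ ∧ ‖y.2.p‖ ≤ a}

/-- `ψ` is a standard collar of size `δ` of the component `K` of the singular orbits: an equivariant
contactomorphism, preserving coorientations, from the part `0 < |p| < δ` of `ℝ × T^*S²` modulo
`t ∼ t + 1`, with the form `dt + λ_can`, onto a punctured neighbourhood of `K`, such that `p → 0`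
corresponds to approaching `K`. -/
structure IsCollar {M : Type*} [TopologicalSpace M] [ChartedSpace E5 M] [MulAction SO3 M]
    (α : OneForm M) (K : Set M) (δ : ℝ) (ψ : Cyl → M) : Prop where
  localDiffeo : IsLocalDiffeomorphOn (𝓡 5) (𝓡 5) ∞ ψ {y : Cyl | 0 < ‖y.2.p‖ ∧ ‖y.2.p‖ < δ}
  equivariant : ∀ (g : SO3) (y : Cyl), 0 < ‖y.2.p‖ → ‖y.2.p‖ < δ → ψ (g • y) = g • ψ y
  fibers : ∀ y z : Cyl, 0 < ‖y.2.p‖ → ‖y.2.p‖ < δ → 0 < ‖z.2.p‖ → ‖z.2.p‖ < δ →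
    (ψ y = ψ z ↔ ∃ n : ℤ, z = (y.1 + n, y.2))
  disjoint : ∀ y : Cyl, 0 < ‖y.2.p‖ → ‖y.2.p‖ < δ → ψ y ∉ K
  form : ∀ y : Cyl, 0 < ‖y.2.p‖ → ‖y.2.p‖ < δ → ∃ c : ℝ, 0 < c ∧ pullback ψ α y = c • canForm y
  isOpen : ∀ a : ℝ, 0 < a → a < δ → IsOpen (K ∪ ψ '' {y : Cyl | 0 < ‖y.2.p‖ ∧ ‖y.2.p‖ < a})
  isClosed : ∀ a : ℝ, 0 < a → a < δ → IsClosed (core K ψ a)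

/-- `(M', α')` is obtained from `(M, α)` by cutting out `K` along the collar `ψ` and gluing in the part
`|p| < δ` of the mapping torus of `τ_k`, with the form `dt + λ_can - t |p| df`: it is covered by the
images of the equivariant open contact embeddings `j₁` of `M` minus the core and `j₂` of that part of the
mapping torus, which overlap exactly along `ε < |p| < δ`, where the point `ψ (t; q, p)` is identified
with the class of `(t; q, p)`. -/
structure IsGluing {M : Type*} [TopologicalSpace M] [ChartedSpace E5 M] [MulAction SO3 M]
    (α : OneForm M) (K : Set M) (δ : ℝ) (ψ : Cyl → M) (k : ℤ) (ε : ℝ) (hε : 0 < ε)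
    {M' : Type*} [TopologicalSpace M'] [ChartedSpace E5 M'] [MulAction SO3 M']
    (α' : OneForm M') (j₁ : M → M') (j₂ : MappingTorus (dehnTwist k ε hε) → M') : Prop where
  contact : IsContactSO3 α'
  localDiffeo₁ : IsLocalDiffeomorphOn (𝓡 5) (𝓡 5) ∞ j₁ (core K ψ ε)ᶜ
  injOn₁ : Set.InjOn j₁ (core K ψ ε)ᶜ
  equivariant₁ : ∀ (g : SO3), ∀ x ∈ (core K ψ ε)ᶜ, j₁ (g • x) = g • j₁ x
  form₁ : ∀ x ∈ (core K ψ ε)ᶜ, ∃ c : ℝ, 0 < c ∧ pullback j₁ α' x = c • α x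
  localDiffeo₂ : IsLocalDiffeomorphOn (𝓡 5) (𝓡 5) ∞ j₂
    (MappingTorus.mk (dehnTwist k ε hε) '' {y : Cyl | ‖y.2.p‖ < δ})
  injOn₂ : Set.InjOn j₂ (MappingTorus.mk (dehnTwist k ε hε) '' {y : Cyl | ‖y.2.p‖ < δ})
  equivariant₂ : ∀ (g : SO3) (y : Cyl), ‖y.2.p‖ < δ →
    j₂ (g • MappingTorus.mk (dehnTwist k ε hε) y) = g • j₂ (MappingTorus.mk (dehnTwist k ε hε) y)
  form₂ : ∀ y : Cyl, ‖y.2.p‖ < δ → ∃ c : ℝ, 0 < c ∧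
    pullback (fun z => j₂ (MappingTorus.mk (dehnTwist k ε hε) z)) α' y = c • dehnForm k ε y
  glue : ∀ x ∈ (core K ψ ε)ᶜ, ∀ y : Cyl, ‖y.2.p‖ < δ →
    (j₁ x = j₂ (MappingTorus.mk (dehnTwist k ε hε) y) ↔ ε < ‖y.2.p‖ ∧ x = ψ y)
  cover : j₁ '' (core K ψ ε)ᶜ ∪
    (fun y => j₂ (MappingTorus.mk (dehnTwist k ε hε) y)) '' {y : Cyl | ‖y.2.p‖ < δ} = Set.univ

/-- The component of the singular orbits that was glued in: the image of the zero-section. -/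
def gluedComponent {M' : Type*} {k : ℤ} {ε : ℝ} {hε : 0 < ε}
    (j₂ : MappingTorus (dehnTwist k ε hε) → M') : Set M' :=
  (fun y => j₂ (MappingTorus.mk (dehnTwist k ε hε) y)) '' {y : Cyl | y.2.p = 0}

end DehnTwist

end

universe u

open DehnTwist

/-!
The Dehn twist `τ_k` is, on the sphere bundle `|p| = r`, the time-`f(r)` map of the normalized
geodesic flow `geod`, and `ℝ × T^*S²` is embedded in `ℝ × ℝ³ × ℝ³`. All computations on the mapping
torus `X_k` are made upstairs in this ambient vector space and descend.

*The diffeomorphism type.* Since `f = πk(1 + ρ)`, flowing the point over `t` for the time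
`-tπkρ(|p|)` straightens the identification by `τ_k` into the identification by the time-`πk` map,
which is the identity for even `k` and the antipodal map for odd `k` (`bend_shift`,
`exists_diffeomorph_of_geod`).

*The contact form.* On `T^*S²` one has `τ_k^*λ = λ + |p| df`, so the form `dt + λ - t |p| df` is
invariant under `(t; x) ↦ (t + 1; τ_k x)` (`cov_pullback_shift_one`). It is a contact form where
`r² f'(r) ≠ 1` (`contactAt_dehnForm`). As `f'` is of the size `k/ε` and supported in `r ≤ ε`, this
holds everywhere for small `ε`, and `epsBound` is an explicit bound.

*The gluing.* Two manifolds glued along open sets form a manifold with the union of the charts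
(`GluingData`); it is Hausdorff here because the overlap is an annulus with an end in each part. On
the collar the forms are positive multiples of each other, and a cut-off function in `|p|`
interpolates between them (`exists_isGluing`). Every glued manifold is covered by the images of two
equivariant contact embeddings, and a `ContactEmb` carries singular orbits, cross-sections, slices,
sections and contributions along. This gives the components of the singular orbits, the extension of
the section and the invariance of the contributions of the old components.

*Uniqueness of contributions.* The contribution of a component is defined through a covering of its
boundary torus by `ℝ²` and through parametrized loops. At singular points of the cross-section
closure `α(Z_M) = 0` (`momentMap_two_eq_zero`), so that the sign of `α` on the first coordinate
direction fixes the orientation of the covering, and two coverings differ by a shear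
`(x, y) ↦ (x, y + e x)` up to a periodic map (`IsTorusCover.exists_transition`). A simple loop
determines its class up to sign, and two curves of marked points are rotations of each other. Hence
the intersection number depends only on the section (`HasContribution.unique`).

*The contribution of the new component.* The closure of the cross-section of `X_k` consists of the
classes of the points `crossPoint t θ r` with `q = (cos θ, sin θ, 0)` and `p` of length `r` at a
right angle to `q`, on which `τ_k` acts as `θ ↦ θ + f(r)`. In the coordinates `torusPoint`, where
`θ = x f(r) + 2πy`, each torus `r = const` is the quotient of the `(x, y)`-plane by `ℤ²`, with the
circle acting along `y`. A section of the circle action is a curve `y = g(x, r)` whose winding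
number `g(x + 1, r) - g(x, r)` is an integer and hence independent of `r`. For `r > ε` the section
is prescribed as `θ = 0` with `f = 2πk`, that is, `y = -kx`. Thus every extension winds `-k` times
at `r = 0` as well (`exists_boundary_section`). There `f = πk`, and the marked curve
`q = ±(1, 0, 0)` is the line `y = -kx/2`: its class is `(1, -k/2)`, meeting each orbit once, for
even `k` and `(2, -k)`, meeting each orbit twice, for odd `k`. With the boundary of the section
oriented as `(-1, k)` the contribution is `k` in both cases. The last assertion follows by comparing
the two sums (`isDehnEulerNumber_iff`).
-/

open scoped Manifold ContDiff InnerProductSpace Matrix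
noncomputable section
set_option linter.unusedSectionVars false
namespace DehnTwist

/-! ### Exterior derivatives of 1-forms on normed spaces -/

section Flat

variable {V W : Type*} [NormedAddCommGroup V] [NormedSpace ℝ V]
  [NormedAddCommGroup W] [NormedSpace ℝ W]

/-- The exterior derivative `dA(u, v)` at `z` of a 1-form `A` on a normed space. -/
def flatD (A : V → V →L[ℝ] ℝ) (z u v : V) : ℝ := fderiv ℝ A z u v - fderiv ℝ A z v u

theorem flatD_congr {A B : V → V →L[ℝ] ℝ} {z : V} (h : A =ᶠ[nhds z] B) (u v : V) :
    flatD A z u v = flatD B z u v := by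
  simp only [flatD, h.fderiv_eq]

/-- The exterior derivative commutes with pull-backs: the second derivative of `F` is symmetric and
drops out of the antisymmetrization. -/
theorem flatD_pullback {F : V → W} {B : W → W →L[ℝ] ℝ} {z : V} (hF : ContDiffAt ℝ ∞ F z)
    (hB : DifferentiableAt ℝ B (F z)) (u v : V) :
    flatD (fun x => (B (F x)).comp (fderiv ℝ F x)) z u v =
      flatD B (F z) (fderiv ℝ F z u) (fderiv ℝ F z v) := by
  have hF1 : DifferentiableAt ℝ F z := hF.differentiableAt (by simp)
  have hF2 : DifferentiableAt ℝ (fderiv ℝ F) z :=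
    (hF.fderiv_right (m := ∞) (by simp)).differentiableAt (by simp)
  have hs : IsSymmSndFDerivAt ℝ F z :=
    (hF.of_le (m := 2) (WithTop.coe_le_coe.2 (le_top (a := (2 : ℕ∞))))).isSymmSndFDerivAt (by simp)
  have h1 : HasFDerivAt (fun x => B (F x)) ((fderiv ℝ B (F z)).comp (fderiv ℝ F z)) z :=
    hB.hasFDerivAt.comp z hF1.hasFDerivAt
  have h2 := h1.clm_comp hF2.hasFDerivAt
  have e : fderiv ℝ (fderiv ℝ F) z u v = fderiv ℝ (fderiv ℝ F) z v u := hs u v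
  simp only [flatD, h2.fderiv]
  simp [e]

/-- The exterior derivative of a multiple `c • B`, up to multiples of `B`. -/
theorem flatD_smul {A B : V → V →L[ℝ] ℝ} {c : V → ℝ} {z : V}
    (hA : DifferentiableAt ℝ A z) (hB : DifferentiableAt ℝ B z)
    (h : ∀ᶠ x in nhds z, A x = c x • B x) (h0 : B z ≠ 0) :
    ∃ l : V →L[ℝ] ℝ, ∀ u v, flatD A z u v = c z * flatD B z u v + l u * B z v - l v * B z u := by
  obtain ⟨w, hw⟩ : ∃ w, B z w ≠ 0 := by
    by_contra! hh
    exact h0 (ContinuousLinearMap.ext hh)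
  have hBw : DifferentiableAt ℝ (fun x => B x w) z := hB.clm_apply (differentiableAt_const w)
  have hAw : DifferentiableAt ℝ (fun x => A x w) z := hA.clm_apply (differentiableAt_const w)
  have hq : DifferentiableAt ℝ (fun x => A x w * (B x w)⁻¹) z := hAw.fun_mul (hBw.inv hw)
  have hev : c =ᶠ[nhds z] fun x => A x w * (B x w)⁻¹ := by
    filter_upwards [h, hBw.continuousAt.eventually_ne hw] with x hx hx'
    rw [hx]
    simp [hx']
  have hc : DifferentiableAt ℝ c z := hev.differentiableAt_iff.2 hq
  have hA' : fderiv ℝ A z = fderiv ℝ (fun x => c x • B x) z := Filter.EventuallyEq.fderiv_eq h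
  refine ⟨fderiv ℝ c z, fun u v => ?_⟩
  simp only [flatD, hA', fderiv_fun_smul hc hB]
  simp
  ring

end Flat

/-! ### Pull-backs of 1-forms on manifolds -/

section Mder

variable {E E' E'' : Type*} [NormedAddCommGroup E] [NormedSpace ℝ E]
  [NormedAddCommGroup E'] [NormedSpace ℝ E'] [NormedAddCommGroup E''] [NormedSpace ℝ E'']
  {H H' H'' : Type*} [TopologicalSpace H] [TopologicalSpace H'] [TopologicalSpace H'']
  (I : ModelWithCorners ℝ E H) (I' : ModelWithCorners ℝ E' H') (I'' : ModelWithCorners ℝ E'' H'')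
  {M : Type*} [TopologicalSpace M] [ChartedSpace H M]
  {N : Type*} [TopologicalSpace N] [ChartedSpace H' N]
  {P : Type*} [TopologicalSpace P] [ChartedSpace H'' P]

/-- The manifold derivative, as a map between the model spaces. -/
def mder (F : M → N) (x : M) : E →L[ℝ] E' := mfderiv I I' F x

variable {I I' I''}

theorem mder_comp {F : M → N} {G : N → P} {x : M} (hG : MDifferentiableAt I' I'' G (F x))
    (hF : MDifferentiableAt I I' F x) :
    mder I I'' (fun y => G (F y)) x = (mder I' I'' G (F x)).comp (mder I I' F x) :=
  mfderiv_comp x hG hF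

theorem mder_congr {F G : M → N} {x : M} (h : F =ᶠ[nhds x] G) : mder I I' F x = mder I I' G x :=
  h.mfderiv_eq

theorem mder_congr_point {F : M → N} {x y : M} (h : x = y) : mder I I' F x = mder I I' F y := by
  rw [h]

theorem mder_id (x : M) : mder I I (fun y => y) x = ContinuousLinearMap.id ℝ E := mfderiv_id

/-- On a normed space the manifold derivative is the Fréchet derivative. -/
theorem mder_eq_fderiv {F : E → E'} {x : E} : mder 𝓘(ℝ, E) 𝓘(ℝ, E') F x = fderiv ℝ F x :=
  mfderiv_eq_fderiv

end Mder

section Pullback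

variable {M : Type*} [TopologicalSpace M] [ChartedSpace E5 M]
variable {N : Type*} [TopologicalSpace N] [ChartedSpace E5 N]
variable {P : Type*} [TopologicalSpace P] [ChartedSpace E5 P]

/-- The value of a 1-form at a point, as a functional on the model space. -/
def cov (α : OneForm M) (x : M) : E5 →L[ℝ] ℝ := α x

theorem cov_pullback (F : M → N) (α : OneForm N) (x : M) :
    cov (pullback F α) x = (cov α (F x)).comp (mder (𝓡 5) (𝓡 5) F x) := rfl

theorem pullback_comp {F : M → N} {G : N → P} {x : M} (α : OneForm P)
    (hG : MDifferentiableAt (𝓡 5) (𝓡 5) G (F x)) (hF : MDifferentiableAt (𝓡 5) (𝓡 5) F x) :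
    cov (pullback (fun y => G (F y)) α) x = cov (pullback F (pullback G α)) x := by
  simp only [cov_pullback, mder_comp hG hF]
  rfl

theorem pullback_congr {F G : M → N} {x : M} (α : OneForm N) (h : F =ᶠ[nhds x] G) :
    cov (pullback F α) x = cov (pullback G α) x := by
  simp only [cov_pullback, mder_congr h, h.self_of_nhds]

theorem pullback_id (α : OneForm M) (x : M) : cov (pullback (fun y => y) α) x = cov α x := by
  simp only [cov_pullback, mder_id]
  rfl

theorem inChart_eq (α : OneForm M) (x₀ : M) (z : E5) :
    inChart α x₀ z = cov (pullback (chartAt E5 x₀).symm α) z := rfl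

variable [IsManifold (𝓡 5) ∞ M] [IsManifold (𝓡 5) ∞ N]

theorem contMDiffAt_chart_symm {x₀ : M} {z : E5} (hz : z ∈ (chartAt E5 x₀).target) :
    ContMDiffAt (𝓡 5) (𝓡 5) ∞ (chartAt E5 x₀).symm z :=
  (contMDiffOn_chart_symm (n := ∞)).contMDiffAt ((chartAt E5 x₀).open_target.mem_nhds hz)

theorem contMDiffAt_chart {x₀ x : M} (hx : x ∈ (chartAt E5 x₀).source) :
    ContMDiffAt (𝓡 5) (𝓡 5) ∞ (chartAt E5 x₀) x :=
  (contMDiffOn_chart (n := ∞)).contMDiffAt ((chartAt E5 x₀).open_source.mem_nhds hx)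

/-- Tangent vectors are read in the preferred chart at the base point, so the derivative of its
inverse at this point is the identity. -/
theorem mder_chart_symm_self (x : M) :
    mder (𝓡 5) (𝓡 5) (chartAt E5 x).symm (chartAt E5 x x) = ContinuousLinearMap.id ℝ E5 := by
  have hx := mem_chart_source E5 x
  have hmd : MDifferentiableAt (𝓡 5) (𝓡 5) (chartAt E5 x).symm (chartAt E5 x x) :=
    (contMDiffAt_chart_symm ((chartAt E5 x).map_source hx)).mdifferentiableAt (by simp)
  have e : (chartAt E5 x).symm (chartAt E5 x x) = x := (chartAt E5 x).left_inv hx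
  have : writtenInExtChartAt (𝓡 5) (𝓡 5) (chartAt E5 x x) (chartAt E5 x).symm
      =ᶠ[nhds (chartAt E5 x x)] id := by
    filter_upwards [(chartAt E5 x).open_target.mem_nhds ((chartAt E5 x).map_source hx)] with z hz
    simp only [writtenInExtChartAt, mfld_simps, e]
    exact (chartAt E5 x).right_inv hz
  refine hmd.mfderiv.trans ?_
  change fderivWithin ℝ (writtenInExtChartAt (𝓡 5) (𝓡 5) (chartAt E5 x x) (chartAt E5 x).symm)
    (Set.range (𝓡 5)) ((extChartAt (𝓡 5) (chartAt E5 x x)) (chartAt E5 x x)) = _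
  have r : Set.range (𝓡 5) = Set.univ := by simp
  rw [r, fderivWithin_univ]
  exact this.fderiv_eq.trans fderiv_id

/-- At the base point of its chart, the coordinate expression of a 1-form has the coefficients of
the form itself. -/
theorem inChart_self (α : OneForm M) (x : M) : inChart α x (chartAt E5 x x) = cov α x := by
  have e : (chartAt E5 x).symm (chartAt E5 x x) = x :=
    (chartAt E5 x).left_inv (mem_chart_source E5 x)
  rw [inChart_eq, cov_pullback, mder_chart_symm_self, e]
  rfl

/-- Smoothness of a 1-form near a point. -/
def FormSmoothAt (α : OneForm M) (x : M) : Prop := ContDiffAt ℝ ∞ (inChart α x) (chartAt E5 x x)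

theorem extD_eq (α : OneForm M) (x : M) (u v : E5) :
    extD α x u v = flatD (inChart α x) (chartAt E5 x x) u v := rfl

theorem eventually_mdifferentiableAt {F : M → N} {x : M} (hF : ContMDiffAt (𝓡 5) (𝓡 5) ∞ F x) :
    ∀ᶠ y in nhds x, MDifferentiableAt (𝓡 5) (𝓡 5) F y := by
  have h1 : ContMDiffAt (𝓡 5) (𝓡 5) 1 F x := hF.of_le (by exact_mod_cast le_top)
  have : IsManifold (𝓡 5) 1 M := IsManifold.of_le (n := ∞) (by exact_mod_cast le_top)
  have : IsManifold (𝓡 5) 1 N := IsManifold.of_le (n := ∞) (by exact_mod_cast le_top)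
  filter_upwards [(contMDiffAt_iff_contMDiffAt_nhds (by simp)).1 h1] with y hy
  exact hy.mdifferentiableAt (by simp)

/-- The expression of a pull-back to the model space in terms of the coordinate expression of the
form. -/
theorem pullback_eq_inChart {F : E5 → M} {z : E5} (α : OneForm M)
    (hF : ContMDiffAt (𝓡 5) (𝓡 5) ∞ F z) :
    (cov (pullback F α)) =ᶠ[nhds z] fun w =>
      (inChart α (F z) (chartAt E5 (F z) (F w))).comp
        (fderiv ℝ (fun w => chartAt E5 (F z) (F w)) w) := by
  set c := chartAt E5 (F z) with hc
  have hsrc : ∀ᶠ w in nhds z, F w ∈ c.source :=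
    hF.continuousAt.preimage_mem_nhds (c.open_source.mem_nhds (mem_chart_source E5 (F z)))
  filter_upwards [hsrc.eventually_nhds, eventually_mdifferentiableAt hF] with w hw hFw
  have hw0 : F w ∈ c.source := hw.self_of_nhds
  have e : F =ᶠ[nhds w] fun y => c.symm (c (F y)) := by
    filter_upwards [hw] with y hy using (c.left_inv hy).symm
  have hcd : MDifferentiableAt (𝓡 5) (𝓡 5) c (F w) :=
    (contMDiffAt_chart hw0).mdifferentiableAt (by simp)
  have hd : MDifferentiableAt (𝓡 5) (𝓡 5) (fun y => c (F y)) w := hcd.comp w hFw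
  have hcs : MDifferentiableAt (𝓡 5) (𝓡 5) c.symm (c (F w)) :=
    (contMDiffAt_chart_symm (c.map_source hw0)).mdifferentiableAt (by simp)
  rw [pullback_congr α e, pullback_comp (F := fun y => c (F y)) α hcs hd, cov_pullback]
  congr 1
  exact mder_eq_fderiv

theorem contDiffAt_chart_comp {F : E5 → M} {z : E5} (hF : ContMDiffAt (𝓡 5) (𝓡 5) ∞ F z) :
    ContDiffAt ℝ ∞ (fun w => chartAt E5 (F z) (F w)) z :=
  ((contMDiffAt_chart (mem_chart_source E5 (F z))).comp z hF).contDiffAt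

theorem contDiffAt_pullback {F : E5 → M} {z : E5} {α : OneForm M}
    (hF : ContMDiffAt (𝓡 5) (𝓡 5) ∞ F z) (hα : FormSmoothAt α (F z)) :
    ContDiffAt ℝ ∞ (cov (pullback F α)) z := by
  refine ContDiffAt.congr_of_eventuallyEq ?_ (pullback_eq_inChart α hF)
  have h1 := contDiffAt_chart_comp hF
  exact (ContDiffAt.comp (f := fun w => chartAt E5 (F z) (F w)) (g := inChart α (F z)) z hα
    h1).clm_comp (h1.fderiv_right (by simp))

theorem IsSmoothForm.formSmoothAt {α : OneForm M} (h : IsSmoothForm α) (x : M) :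
    FormSmoothAt α x :=
  (h x).contDiffAt ((chartAt E5 x).open_target.mem_nhds
    ((chartAt E5 x).map_source (mem_chart_source E5 x)))

theorem isSmoothForm_of_formSmoothAt {α : OneForm M} (h : ∀ x, FormSmoothAt α x) :
    IsSmoothForm α := fun _ _ hz =>
  (contDiffAt_pullback (contMDiffAt_chart_symm hz) (h _)).contDiffWithinAt

/-- The coordinate expression of a pull-back is the pull-back along the map read in the chart of its
source. -/
theorem inChart_pullback {F : N → M} {y : N} (α : OneForm M)
    (hF : ContMDiffAt (𝓡 5) (𝓡 5) ∞ F y) :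
    inChart (pullback F α) y =ᶠ[nhds (chartAt E5 y y)]
      cov (pullback (fun z => F ((chartAt E5 y).symm z)) α) := by
  set c := chartAt E5 y with hc
  have ht := c.map_source (mem_chart_source E5 y)
  have e : c.symm (c y) = y := c.left_inv (mem_chart_source E5 y)
  have hcont : ContinuousAt c.symm (c y) := c.continuousAt_symm ht
  have hev := eventually_mdifferentiableAt hF
  rw [← e] at hev
  filter_upwards [hcont.eventually hev, c.open_target.mem_nhds ht] with z hz hzt
  rw [inChart_eq]
  exact (pullback_comp α hz ((contMDiffAt_chart_symm hzt).mdifferentiableAt (by simp))).symm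

theorem contMDiffAt_comp_chart_symm {F : N → M} {y : N}
    (hF : ContMDiffAt (𝓡 5) (𝓡 5) ∞ F y) :
    ContMDiffAt (𝓡 5) (𝓡 5) ∞ (fun z => F ((chartAt E5 y).symm z)) (chartAt E5 y y) := by
  have e : (chartAt E5 y).symm (chartAt E5 y y) = y :=
    (chartAt E5 y).left_inv (mem_chart_source E5 y)
  refine ContMDiffAt.comp (chartAt E5 y y) (g := F) ?_
    (contMDiffAt_chart_symm ((chartAt E5 y).map_source (mem_chart_source E5 y)))
  rw [e]
  exact hF

theorem FormSmoothAt.pullback {F : N → M} {y : N} {α : OneForm M}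
    (hα : FormSmoothAt α (F y)) (hF : ContMDiffAt (𝓡 5) (𝓡 5) ∞ F y) :
    FormSmoothAt (pullback F α) y := by
  refine ContDiffAt.congr_of_eventuallyEq ?_ (inChart_pullback α hF)
  refine contDiffAt_pullback (contMDiffAt_comp_chart_symm hF) ?_
  rwa [(chartAt E5 y).left_inv (mem_chart_source E5 y)]

theorem inChart_congr {α β : OneForm M} {x : M} (h : ∀ᶠ y in nhds x, cov α y = cov β y) :
    inChart α x =ᶠ[nhds (chartAt E5 x x)] inChart β x := by
  have e : (chartAt E5 x).symm (chartAt E5 x x) = x :=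
    (chartAt E5 x).left_inv (mem_chart_source E5 x)
  have hc := (chartAt E5 x).continuousAt_symm ((chartAt E5 x).map_source (mem_chart_source E5 x))
  rw [← e] at h
  filter_upwards [hc.eventually h] with z hz
  rw [inChart_eq, inChart_eq, cov_pullback, cov_pullback, hz]

theorem FormSmoothAt.congr {α β : OneForm M} {x : M} (hβ : FormSmoothAt β x)
    (h : ∀ᶠ y in nhds x, cov α y = cov β y) : FormSmoothAt α x :=
  ContDiffAt.congr_of_eventuallyEq hβ (inChart_congr h)

theorem extD_congr {α β : OneForm M} {x : M} (h : ∀ᶠ y in nhds x, cov α y = cov β y) (u v : E5) :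
    extD α x u v = extD β x u v := flatD_congr (inChart_congr h) u v

/-- The exterior derivative commutes with pull-backs along parametrizations `E5 → M`. -/
theorem flatD_pullback_manifold {F : E5 → M} {z : E5} {α : OneForm M}
    (hF : ContMDiffAt (𝓡 5) (𝓡 5) ∞ F z) (hα : FormSmoothAt α (F z)) (u v : E5) :
    flatD (cov (pullback F α)) z u v =
      extD α (F z) (mder (𝓡 5) (𝓡 5) F z u) (mder (𝓡 5) (𝓡 5) F z v) := by
  set c := chartAt E5 (F z) with hc
  rw [flatD_congr (pullback_eq_inChart α hF), extD_eq]
  have h1 := contDiffAt_chart_comp hF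
  have key : fderiv ℝ (fun w => c (F w)) z = mder (𝓡 5) (𝓡 5) F z := by
    have e : F =ᶠ[nhds z] fun y => c.symm (c (F y)) := by
      filter_upwards [hF.continuousAt.preimage_mem_nhds
        (c.open_source.mem_nhds (mem_chart_source E5 (F z)))] with y hy using (c.left_inv hy).symm
    have hcs : MDifferentiableAt (𝓡 5) (𝓡 5) c.symm (c (F z)) :=
      (contMDiffAt_chart_symm (c.map_source (mem_chart_source E5 (F z)))).mdifferentiableAt
        (by simp)
    have hd : MDifferentiableAt (𝓡 5) (𝓡 5) (fun y => c (F y)) z :=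
      h1.contMDiffAt.mdifferentiableAt (by simp)
    rw [mder_congr e, mder_comp (F := fun y => c (F y)) hcs hd, mder_chart_symm_self]
    exact mder_eq_fderiv.symm
  rw [flatD_pullback (B := inChart α (F z)) h1 (ContDiffAt.differentiableAt hα (by simp)), key]

/-- The exterior derivative commutes with pull-backs. -/
theorem extD_pullback {F : N → M} {y : N} {α : OneForm M} (hα : FormSmoothAt α (F y))
    (hF : ContMDiffAt (𝓡 5) (𝓡 5) ∞ F y) (u v : E5) :
    extD (pullback F α) y u v =
      extD α (F y) (mder (𝓡 5) (𝓡 5) F y u) (mder (𝓡 5) (𝓡 5) F y v) := by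
  have e : (chartAt E5 y).symm (chartAt E5 y y) = y :=
    (chartAt E5 y).left_inv (mem_chart_source E5 y)
  have hd : MDifferentiableAt (𝓡 5) (𝓡 5) F ((chartAt E5 y).symm (chartAt E5 y y)) := by
    rw [e]; exact hF.mdifferentiableAt (by simp)
  have hcs : MDifferentiableAt (𝓡 5) (𝓡 5) (chartAt E5 y).symm (chartAt E5 y y) :=
    (contMDiffAt_chart_symm ((chartAt E5 y).map_source (mem_chart_source E5 y))).mdifferentiableAt
      (by simp)
  rw [extD_eq, flatD_congr (inChart_pullback α hF),
    flatD_pullback_manifold (contMDiffAt_comp_chart_symm hF) (by rwa [e]),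
    mder_comp hd hcs, mder_chart_symm_self, e]
  rfl

theorem wedgeD_pullback {F : N → M} {y : N} {α : OneForm M} (hα : FormSmoothAt α (F y))
    (hF : ContMDiffAt (𝓡 5) (𝓡 5) ∞ F y) (u v w : E5) :
    wedgeD (pullback F α) y u v w = wedgeD α (F y) (mder (𝓡 5) (𝓡 5) F y u)
      (mder (𝓡 5) (𝓡 5) F y v) (mder (𝓡 5) (𝓡 5) F y w) := by
  unfold wedgeD
  erw [extD_pullback hα hF, extD_pullback hα hF, extD_pullback hα hF]
  rfl

/-- The contact condition at a point. -/
def ContactAt (α : OneForm M) (x : M) : Prop :=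
  cov α x ≠ 0 ∧ ∀ u : E5, cov α x u = 0 → (∀ v : E5, cov α x v = 0 → extD α x u v = 0) → u = 0

/-- The exterior derivative of a multiple `c • β` on a manifold, up to multiples of `β`. The
function `c` is not assumed to be smooth: this follows from the smoothness of `α` and `β` where `β`
does not vanish. -/
theorem extD_smul {α β : OneForm M} {x : M} {c : M → ℝ} (hα : FormSmoothAt α x)
    (hβ : FormSmoothAt β x) (h : ∀ᶠ y in nhds x, cov α y = c y • cov β y) (h0 : cov β x ≠ 0) :
    ∃ l : E5 →L[ℝ] ℝ, ∀ u v : E5,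
      extD α x u v = c x * extD β x u v + l u * cov β x v - l v * cov β x u := by
  have e : (chartAt E5 x).symm (chartAt E5 x x) = x :=
    (chartAt E5 x).left_inv (mem_chart_source E5 x)
  have hc := (chartAt E5 x).continuousAt_symm ((chartAt E5 x).map_source (mem_chart_source E5 x))
  rw [← e] at h
  have h' : ∀ᶠ z in nhds (chartAt E5 x x),
      inChart α x z = c ((chartAt E5 x).symm z) • inChart β x z := by
    filter_upwards [hc.eventually h] with z hz
    rw [inChart_eq, inChart_eq, cov_pullback, cov_pullback, hz]
    rfl
  have := flatD_smul (hα.differentiableAt (by simp)) (hβ.differentiableAt (by simp)) h'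
    (by rwa [inChart_self])
  simpa only [inChart_self, e, ← extD_eq] using this

/-- The contact condition does not change under multiplication with a nonvanishing function. -/
theorem ContactAt.smul {α β : OneForm M} {x : M} {c : M → ℝ} (hα : FormSmoothAt α x)
    (hβ : FormSmoothAt β x) (h : ∀ᶠ y in nhds x, cov α y = c y • cov β y) (hc : c x ≠ 0)
    (hb : ContactAt β x) : ContactAt α x := by
  obtain ⟨l, hl⟩ := extD_smul hα hβ h hb.1
  have hx := h.self_of_nhds
  have h0 : ∀ u : E5, cov α x u = 0 ↔ cov β x u = 0 := by
    intro u
    rw [hx]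
    simp [hc]
  refine ⟨?_, fun u hu huv => hb.2 u ((h0 u).1 hu) fun v hv => ?_⟩
  · rw [hx]
    exact smul_ne_zero hc hb.1
  · have := huv v ((h0 v).2 hv)
    rw [hl, hv, (h0 u).1 hu] at this
    simpa [hc] using this

/-- `α ∧ dα` is multiplied by `c²` when `α` is multiplied by `c`; the terms containing `dc` cancel.
-/
theorem wedgeD_smul {α β : OneForm M} {x : M} {c : M → ℝ} (hα : FormSmoothAt α x)
    (hβ : FormSmoothAt β x) (h : ∀ᶠ y in nhds x, cov α y = c y • cov β y) (h0 : cov β x ≠ 0)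
    (u v w : E5) : wedgeD α x u v w = c x ^ 2 * wedgeD β x u v w := by
  obtain ⟨l, hl⟩ := extD_smul hα hβ h h0
  have hx := h.self_of_nhds
  have h1 : ∀ u : E5, α x u = c x * cov β x u := fun u => by
    change cov α x u = _
    rw [hx]; rfl
  have h2 : ∀ u : E5, β x u = cov β x u := fun u => rfl
  unfold wedgeD
  simp only [h1, h2]
  erw [hl, hl, hl]
  ring

theorem ContactAt.congr {α β : OneForm M} {x : M} (h : ∀ᶠ y in nhds x, cov α y = cov β y)
    (hb : ContactAt β x) : ContactAt α x := by
  refine ⟨by rw [h.self_of_nhds]; exact hb.1, fun u hu huv => ?_⟩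
  rw [h.self_of_nhds] at hu huv
  exact hb.2 u hu fun v hv => by rw [← extD_congr h]; exact huv v hv

/-- The contact condition can be checked after pull-back along a submersion. -/
theorem ContactAt.of_pullback {F : N → M} {y : N} {α : OneForm M} (hα : FormSmoothAt α (F y))
    (hF : ContMDiffAt (𝓡 5) (𝓡 5) ∞ F y)
    (hs : Function.Surjective (mder (𝓡 5) (𝓡 5) F y)) (h : ContactAt (pullback F α) y) :
    ContactAt α (F y) := by
  refine ⟨fun h0 => h.1 (by rw [cov_pullback, h0]; rfl), fun u hu huv => ?_⟩
  obtain ⟨u, rfl⟩ := hs u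
  rw [h.2 u hu fun v hv => ?_, map_zero]
  rw [extD_pullback hα hF]
  exact huv _ hv

end Pullback

/-! ### Local diffeomorphisms -/

section LocalDiffeo

variable {M : Type*} [TopologicalSpace M] [ChartedSpace E5 M]
variable {N : Type*} [TopologicalSpace N] [ChartedSpace E5 N]

/-- A local inverse of a local diffeomorphism. -/
theorem exists_local_inverse {F : M → N} {x : M} (h : IsLocalDiffeomorphAt (𝓡 5) (𝓡 5) ∞ F x) :
    ∃ G : N → M, G (F x) = x ∧ ContMDiffAt (𝓡 5) (𝓡 5) ∞ G (F x) ∧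
      (∀ᶠ y in nhds (F x), F (G y) = y) ∧ ∀ᶠ z in nhds x, G (F z) = z := by
  refine ⟨h.localInverse, ?_, h.localInverse_contMDiffAt, h.localInverse_eventuallyEq_right,
    h.localInverse_eventuallyEq_left⟩
  exact h.localInverse_eventuallyEq_left.self_of_nhds

theorem mder_comp_local_inverse {F : M → N} {G : N → M} {x : M} (h1 : G (F x) = x)
    (hF : ContMDiffAt (𝓡 5) (𝓡 5) ∞ F x) (hG : ContMDiffAt (𝓡 5) (𝓡 5) ∞ G (F x))
    (h2 : ∀ᶠ y in nhds (F x), F (G y) = y) :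
    (mder (𝓡 5) (𝓡 5) F x).comp (mder (𝓡 5) (𝓡 5) G (F x)) = ContinuousLinearMap.id ℝ E5 := by
  have hF' : MDifferentiableAt (𝓡 5) (𝓡 5) F (G (F x)) := by
    rw [h1]; exact hF.mdifferentiableAt (by simp)
  have := mder_comp hF' (hG.mdifferentiableAt (by simp))
  rw [h1] at this
  rw [← this, mder_congr (G := fun y => y) h2, mder_id]

theorem mder_local_inverse_comp {F : M → N} {G : N → M} {x : M}
    (hF : ContMDiffAt (𝓡 5) (𝓡 5) ∞ F x) (hG : ContMDiffAt (𝓡 5) (𝓡 5) ∞ G (F x))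
    (h2 : ∀ᶠ z in nhds x, G (F z) = z) :
    (mder (𝓡 5) (𝓡 5) G (F x)).comp (mder (𝓡 5) (𝓡 5) F x) = ContinuousLinearMap.id ℝ E5 := by
  rw [← mder_comp (hG.mdifferentiableAt (by simp)) (hF.mdifferentiableAt (by simp)),
    mder_congr (G := fun y => y) h2, mder_id]

/-- The derivative of a local diffeomorphism is bijective. -/
theorem mder_bijective {F : M → N} {x : M} (h : IsLocalDiffeomorphAt (𝓡 5) (𝓡 5) ∞ F x) :
    Function.Bijective (mder (𝓡 5) (𝓡 5) F x) := by
  obtain ⟨G, h1, h2, h3, h4⟩ := exists_local_inverse h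
  have e1 := mder_comp_local_inverse h1 h.contMDiffAt h2 h3
  have e2 := mder_local_inverse_comp h.contMDiffAt h2 h4
  exact ⟨Function.LeftInverse.injective (fun v => DFunLike.congr_fun e2 v),
    Function.RightInverse.surjective (fun v => DFunLike.congr_fun e1 v)⟩

variable [IsManifold (𝓡 5) ∞ M] [IsManifold (𝓡 5) ∞ N]

/-- Smoothness of a form can be checked after pull-back along a local diffeomorphism. -/
theorem FormSmoothAt.of_pullback {F : M → N} {x : M} {α : OneForm N}
    (h : IsLocalDiffeomorphAt (𝓡 5) (𝓡 5) ∞ F x) (hs : FormSmoothAt (DehnTwist.pullback F α) x) :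
    FormSmoothAt α (F x) := by
  obtain ⟨G, h1, h2, h3, h4⟩ := exists_local_inverse h
  have h5 : FormSmoothAt (DehnTwist.pullback G (DehnTwist.pullback F α)) (F x) :=
    FormSmoothAt.pullback (by rwa [h1]) h2
  refine h5.congr ?_
  have hF : ∀ᶠ y in nhds (F x), MDifferentiableAt (𝓡 5) (𝓡 5) F (G y) := by
    apply h2.continuousAt.eventually
    rw [h1]
    exact eventually_mdifferentiableAt h.contMDiffAt
  filter_upwards [hF, eventually_mdifferentiableAt h2, h3.eventually_nhds] with y e1 e2 e3
  rw [← pullback_comp α e1 e2, pullback_congr (G := fun y => y) α e3, pullback_id]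

end LocalDiffeo

/-! ### The embedding of `ℝ × T^*S²` in `ℝ × ℝ³ × ℝ³` -/

/-- The ambient space of `ℝ × T^*S²`. -/
abbrev Amb : Type := ℝ × E3 × E3

namespace Cyl

/-- Smoothness of a map to `ℝ × T^*S²` can be checked in the ambient space, because the charts are
restrictions of linear maps of the ambient space. -/
theorem contMDiffAt_of_emb {E H : Type*} [NormedAddCommGroup E] [NormedSpace ℝ E]
    [TopologicalSpace H] {I : ModelWithCorners ℝ E H} {N : Type*} [TopologicalSpace N]
    [ChartedSpace H N] {f : N → Cyl} {x : N}
    (h : ContMDiffAt I 𝓘(ℝ, Amb) ∞ (fun z => emb (f z)) x) : ContMDiffAt I (𝓡 5) ∞ f x := by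
  have hc : ContinuousAt f x := isInducing_emb.continuousAt_iff.2 h.continuousAt
  rw [contMDiffAt_iff_target]
  exact ⟨hc, ((chartFun (f x).2).contDiff.contMDiff.contMDiffAt).comp x h⟩

theorem continuous_q : Continuous CotS2.q := continuous_subtype_val.fst
theorem continuous_p : Continuous CotS2.p := continuous_subtype_val.snd

theorem continuous_iff_emb {X : Type*} [TopologicalSpace X] {f : X → Cyl} :
    Continuous f ↔ Continuous fun x => emb (f x) := isInducing_emb.continuous_iff

/-- The differential of the embedding. -/
def demb (y : Cyl) : E5 →L[ℝ] Amb := mder (𝓡 5) 𝓘(ℝ, Amb) emb y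

theorem mdifferentiableAt_emb (y : Cyl) : MDifferentiableAt (𝓡 5) 𝓘(ℝ, Amb) emb y :=
  (contMDiff_emb y).mdifferentiableAt (by simp)

theorem emb_chartAt_symm (y : Cyl) :
    (fun z => emb ((chartAt E5 y).symm z)) =ᶠ[nhds (chartAt E5 y y)] chartInv y.2 := by
  filter_upwards [(chartAt E5 y).open_target.mem_nhds
    ((chartAt E5 y).map_source (mem_chart_source E5 y))] with z hz using emb_chart_symm y.2 hz

theorem contDiffAt_chartInv (y : Cyl) : ContDiffAt ℝ ∞ (chartInv y.2) (chartAt E5 y y) :=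
  (contDiffOn_chartInv y.2).contDiffAt ((chartAt E5 y).open_target.mem_nhds
    ((chartAt E5 y).map_source (mem_chart_source E5 y)))

/-- In the preferred chart at `y` the embedding is the parametrization `chartInv`. -/
theorem demb_eq (y : Cyl) : demb y = fderiv ℝ (chartInv y.2) (chartAt E5 y y) := by
  have e : (chartAt E5 y).symm (chartAt E5 y y) = y :=
    (chartAt E5 y).left_inv (mem_chart_source E5 y)
  have hs : MDifferentiableAt (𝓡 5) (𝓡 5) (chartAt E5 y).symm (chartAt E5 y y) :=
    (contMDiffAt_chart_symm ((chartAt E5 y).map_source (mem_chart_source E5 y))).mdifferentiableAt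
      (by simp)
  have h1 := mder_comp (I'' := 𝓘(ℝ, Amb)) (G := emb) (mdifferentiableAt_emb _) hs
  rw [mder_chart_symm_self, e, mder_congr (emb_chartAt_symm y)] at h1
  exact h1.symm.trans mder_eq_fderiv

/-- The linear map `chartFun` is a left inverse of the parametrization `chartInv`. -/
theorem demb_injective (y : Cyl) : Function.Injective (demb y) := by
  have h : HasFDerivAt (fun z => chartFun y.2 (chartInv y.2 z))
      ((chartFun y.2).comp (demb y)) (chartAt E5 y y) := by
    rw [demb_eq]
    exact (chartFun y.2).hasFDerivAt.comp _
      ((contDiffAt_chartInv y).differentiableAt (by simp)).hasFDerivAt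
  have h2 : HasFDerivAt (fun z => chartFun y.2 (chartInv y.2 z))
      (ContinuousLinearMap.id ℝ E5) (chartAt E5 y y) := by
    simp only [chartFun_chartInv]
    exact hasFDerivAt_id _
  exact Function.LeftInverse.injective (g := chartFun y.2)
    fun v => DFunLike.congr_fun (h.unique h2) v

/-- The chain rule for functions given in ambient coordinates. -/
theorem mder_comp_emb {F : Type*} [NormedAddCommGroup F] [NormedSpace ℝ F] {f : Amb → F} {y : Cyl}
    (hf : DifferentiableAt ℝ f (emb y)) :
    mder (𝓡 5) 𝓘(ℝ, F) (fun z => f (emb z)) y = (fderiv ℝ f (emb y)).comp (demb y) := by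
  rw [mder_comp (F := emb) (I' := 𝓘(ℝ, Amb)) hf.mdifferentiableAt (mdifferentiableAt_emb y),
    mder_eq_fderiv]
  rfl

/-- The derivative of a self-map of `ℝ × T^*S²` given in ambient coordinates by `A`. -/
theorem demb_mder {F : Cyl → Cyl} {A : Amb → Amb} {y : Cyl}
    (hF : MDifferentiableAt (𝓡 5) (𝓡 5) F y) (hA : DifferentiableAt ℝ A (emb y))
    (h : ∀ᶠ z in nhds y, emb (F z) = A (emb z)) (u : E5) :
    demb (F y) (mder (𝓡 5) (𝓡 5) F y u) = fderiv ℝ A (emb y) (demb y u) := by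
  have h1 := mder_comp (I'' := 𝓘(ℝ, Amb)) (F := F) (G := emb) (mdifferentiableAt_emb _) hF
  rw [mder_congr h, mder_comp_emb hA] at h1
  exact (DFunLike.congr_fun h1 u).symm

/-- The tangent space of `ℝ × T^*S²` inside the ambient space. -/
def tangent (y : Cyl) : Submodule ℝ Amb where
  carrier := {w | ⟪y.2.q, w.2.1⟫_ℝ = 0 ∧ ⟪y.2.p, w.2.1⟫_ℝ + ⟪y.2.q, w.2.2⟫_ℝ = 0}
  add_mem' := by
    rintro a b ⟨h1, h2⟩ ⟨h3, h4⟩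
    refine ⟨?_, ?_⟩
    · simp only [Prod.snd_add, Prod.fst_add, inner_add_right, h1, h3, add_zero]
    · simp only [Prod.snd_add, Prod.fst_add, inner_add_right]
      linarith
  zero_mem' := by simp
  smul_mem' := by
    rintro c a ⟨h1, h2⟩
    refine ⟨?_, ?_⟩
    · simp only [Prod.smul_snd, Prod.smul_fst, inner_smul_right, h1, mul_zero]
    · simp only [Prod.smul_snd, Prod.smul_fst, inner_smul_right, ← mul_add, h2, mul_zero]

theorem mem_tangent {y : Cyl} {w : Amb} : w ∈ tangent y ↔
    ⟪y.2.q, w.2.1⟫_ℝ = 0 ∧ ⟪y.2.p, w.2.1⟫_ℝ + ⟪y.2.q, w.2.2⟫_ℝ = 0 := Iff.rfl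

/-- Differentiating the equations `⟪q, q⟫ = 1` and `⟪q, p⟫ = 0` shows that the image of `demb` lies
in the tangent space. -/
theorem demb_mem_tangent (y : Cyl) (u : E5) : demb y u ∈ tangent y := by
  have hq : HasFDerivAt (fun w : Amb => w.2.1)
      ((ContinuousLinearMap.fst ℝ E3 E3).comp (ContinuousLinearMap.snd ℝ ℝ (E3 × E3))) (emb y) :=
    ContinuousLinearMap.hasFDerivAt
      ((ContinuousLinearMap.fst ℝ E3 E3).comp (ContinuousLinearMap.snd ℝ ℝ (E3 × E3)))
  have hp : HasFDerivAt (fun w : Amb => w.2.2)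
      ((ContinuousLinearMap.snd ℝ E3 E3).comp (ContinuousLinearMap.snd ℝ ℝ (E3 × E3))) (emb y) :=
    ContinuousLinearMap.hasFDerivAt
      ((ContinuousLinearMap.snd ℝ E3 E3).comp (ContinuousLinearMap.snd ℝ ℝ (E3 × E3)))
  have key : ∀ (f : Amb → ℝ) (c : ℝ), DifferentiableAt ℝ f (emb y) → (∀ z, f (emb z) = c) →
      fderiv ℝ f (emb y) (demb y u) = 0 := by
    intro f c hf hc
    have := mder_comp_emb hf
    rw [funext hc] at this
    have h0 : mder (𝓡 5) 𝓘(ℝ, ℝ) (fun _ : Cyl => c) y = 0 := mfderiv_const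
    rw [h0] at this
    exact (DFunLike.congr_fun this u).symm
  have h1 := key (fun w => ⟪w.2.1, w.2.1⟫_ℝ) 1 (hq.inner ℝ hq).differentiableAt (fun z => by
    simp only [emb, real_inner_self_eq_norm_sq, z.2.norm_q]; norm_num)
  have h2 := key (fun w => ⟪w.2.1, w.2.2⟫_ℝ) 0 (hq.inner ℝ hp).differentiableAt (fun z =>
    z.2.inner_q_p)
  rw [(hq.inner ℝ hq).fderiv] at h1
  rw [(hq.inner ℝ hp).fderiv] at h2
  simp [fderivInnerCLM_apply, emb] at h1 h2
  refine ⟨?_, ?_⟩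
  · rw [real_inner_comm] at h1 ⊢
    linarith [real_inner_comm y.2.q (demb y u).2.1]
  · rw [real_inner_comm]; linarith [real_inner_comm y.2.p (demb y u).2.1]

/-- The tangent space is the image of `demb`: both are five-dimensional. -/
theorem exists_demb_eq {y : Cyl} {w : Amb} (hw : w ∈ tangent y) : ∃ u, demb y u = w := by
  let L : Amb →ₗ[ℝ] ℝ × ℝ :=
    { toFun := fun w => (⟪y.2.q, w.2.1⟫_ℝ, ⟪y.2.p, w.2.1⟫_ℝ + ⟪y.2.q, w.2.2⟫_ℝ)
      map_add' := fun a b => by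
        simp only [Prod.snd_add, Prod.fst_add, inner_add_right, Prod.mk_add_mk]
        congr 1; ring
      map_smul' := fun c a => by
        simp only [Prod.smul_snd, Prod.smul_fst, inner_smul_right, RingHom.id_apply,
          Prod.smul_mk, smul_eq_mul]
        congr 1; ring }
  have hq : ⟪y.2.q, y.2.q⟫_ℝ = 1 := by rw [real_inner_self_eq_norm_sq, y.2.norm_q]; norm_num
  have hpq : ⟪y.2.p, y.2.q⟫_ℝ = 0 := by rw [real_inner_comm]; exact y.2.inner_q_p
  have hL : Function.Surjective L := by
    rintro ⟨a, b⟩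
    refine ⟨(0, a • y.2.q, b • y.2.q), ?_⟩
    simp [L, inner_smul_right, hpq, y.2.norm_q]
  -- the tangent space is the kernel of the two differentials `L`, hence of dimension `7 - 2`
  have hk : LinearMap.ker L = tangent y := by
    ext w
    simp [L, mem_tangent]
  have h1 := LinearMap.finrank_range_add_finrank_ker L
  rw [LinearMap.range_eq_top.2 hL, hk, finrank_top] at h1
  simp at h1
  have h2 : LinearMap.range (demb y : E5 →ₗ[ℝ] Amb) = tangent y := by
    apply Submodule.eq_of_le_of_finrank_eq
    · rintro _ ⟨u, rfl⟩
      exact demb_mem_tangent y u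
    · rw [LinearMap.finrank_range_of_inj (demb_injective y)]
      simp
      omega
  rw [← h2] at hw
  exact hw

/-! ### 1-forms induced from the ambient space -/

/-- The restriction to `ℝ × T^*S²` of a 1-form on the ambient space. -/
def ambForm (B : Amb → Amb →L[ℝ] ℝ) : OneForm Cyl := fun y => (B (emb y)).comp (demb y)

theorem cov_ambForm (B : Amb → Amb →L[ℝ] ℝ) (y : Cyl) :
    cov (ambForm B) y = (B (emb y)).comp (demb y) := rfl

theorem inChart_ambForm (B : Amb → Amb →L[ℝ] ℝ) (y : Cyl) :
    inChart (ambForm B) y =ᶠ[nhds (chartAt E5 y y)]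
      fun z => (B (chartInv y.2 z)).comp (fderiv ℝ (chartInv y.2) z) := by
  filter_upwards [(emb_chartAt_symm y).eventually_nhds, (chartAt E5 y).open_target.mem_nhds
    ((chartAt E5 y).map_source (mem_chart_source E5 y))] with z hz hzt
  rw [inChart_eq, cov_pullback, cov_ambForm, ← hz.self_of_nhds, ContinuousLinearMap.comp_assoc]
  congr 1
  have h1 := mder_comp (I'' := 𝓘(ℝ, Amb)) (G := emb) (F := (chartAt E5 y).symm) (x := z)
    (mdifferentiableAt_emb _) ((contMDiffAt_chart_symm hzt).mdifferentiableAt (by simp))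
  rw [mder_congr hz] at h1
  exact h1.symm.trans mder_eq_fderiv

theorem chartInv_chartAt (y : Cyl) : chartInv y.2 (chartAt E5 y y) = emb y := by
  rw [← (emb_chartAt_symm y).self_of_nhds]
  exact congrArg emb ((chartAt E5 y).left_inv (mem_chart_source E5 y))

/-- The restriction of a smooth ambient form is smooth. -/
theorem formSmoothAt_ambForm {B : Amb → Amb →L[ℝ] ℝ} {y : Cyl} (hB : ContDiffAt ℝ ∞ B (emb y)) :
    FormSmoothAt (ambForm B) y := by
  refine ContDiffAt.congr_of_eventuallyEq ?_ (inChart_ambForm B y)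
  have h := contDiffAt_chartInv y
  refine (ContDiffAt.comp (g := B) (f := chartInv y.2) _ ?_ h).clm_comp
    (h.fderiv_right (by simp))
  rwa [chartInv_chartAt]

/-- The exterior derivative of the restriction of an ambient form. -/
theorem extD_ambForm {B : Amb → Amb →L[ℝ] ℝ} {y : Cyl} (hB : DifferentiableAt ℝ B (emb y))
    (u v : E5) : extD (ambForm B) y u v = flatD B (emb y) (demb y u) (demb y v) := by
  rw [extD_eq, flatD_congr (inChart_ambForm B y), flatD_pullback (contDiffAt_chartInv y) (by
    rwa [chartInv_chartAt]), chartInv_chartAt, demb_eq]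

/-! ### The action of `SO(3)` on `ℝ × T^*S²` -/

end Cyl

/-- A rotation of `ℝ³` as a continuous linear map. -/
def rotL (g : SO3) : E3 →L[ℝ] E3 :=
  LinearMap.toContinuousLinearMap
    { toFun := rotVec g, map_add' := rotVec_add g, map_smul' := fun c v => rotVec_smul g c v }

theorem rotVec_apply (g : SO3) (v : E3) (i : Fin 3) : rotVec g v i = ∑ j, g.1 i j * v j := rfl

theorem contDiff_rotVec {F : Type*} [NormedAddCommGroup F] [NormedSpace ℝ F] {g : F → SO3}
    {v : F → E3} (hg : ∀ i j, ContDiff ℝ ∞ fun a => (g a).1 i j) (hv : ContDiff ℝ ∞ v) :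
    ContDiff ℝ ∞ fun a => rotVec (g a) (v a) := by
  rw [contDiff_euclidean]
  intro i
  simp only [rotVec_apply]
  exact ContDiff.sum fun j _ => (hg i j).mul ((contDiff_euclidean.1 hv) j)

theorem contDiff_rot_entry (i : Fin 3) (j l : Fin 3) : ContDiff ℝ ∞ fun s => (rot i s).1 j l := by
  fin_cases i <;> fin_cases j <;> fin_cases l <;> simp [rot] <;> fun_prop

/-- The action of `SO(3)` on `ℝ × T^*S²` is smooth. -/
theorem isSmoothAction_cyl : IsSmoothAction Cyl := by
  intro n g hg z
  apply Cyl.contMDiffAt_of_emb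
  have h1 : ContMDiff ((𝓡 n).prod (𝓡 5)) 𝓘(ℝ, EuclideanSpace ℝ (Fin n) × Amb) ∞
      (fun z : EuclideanSpace ℝ (Fin n) × Cyl => (z.1, Cyl.emb z.2)) :=
    contMDiff_fst.prodMk_space (Cyl.contMDiff_emb.comp contMDiff_snd)
  have h2 : ContDiff ℝ ∞ (fun w : EuclideanSpace ℝ (Fin n) × Amb =>
      ((w.2.1, rotVec (g w.1) w.2.2.1, rotVec (g w.1) w.2.2.2) : Amb)) := by
    have hg' : ∀ i j, ContDiff ℝ ∞
        fun a : EuclideanSpace ℝ (Fin n) × Amb => (g a.1).1 i j :=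
      fun i j => (hg i j).comp contDiff_fst
    exact contDiff_snd.fst.prodMk ((contDiff_rotVec hg' contDiff_snd.snd.fst).prodMk
      (contDiff_rotVec hg' contDiff_snd.snd.snd))
  exact (h2.contMDiff.comp h1) z

/-- The cross product of a standard basis vector with `v`. -/
def crs (i : Fin 3) (v : E3) : E3 :=
  match i with
  | 0 => !₂[0, -v 2, v 1]
  | 1 => !₂[v 2, 0, -v 0]
  | 2 => !₂[-v 1, v 0, 0]

/-- The rotations around the `i`-th axis are generated by the cross product with `eᵢ`. -/
theorem hasDerivAt_rotVec (i : Fin 3) (v : E3) :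
    HasDerivAt (fun s => rotVec (rot i s) v) (crs i v) 0 := by
  have hs : HasDerivAt Real.sin 1 0 := by simpa using Real.hasDerivAt_sin 0
  have hc : HasDerivAt Real.cos 0 0 := by simpa using Real.hasDerivAt_cos 0
  have key : ∀ j, HasDerivAt (fun s => rotVec (rot i s) v j) (crs i v j) 0 := by
    intro j
    simp only [rotVec_apply, Fin.sum_univ_three]
    fin_cases i <;> fin_cases j <;> simp [rot, crs]
    all_goals first
      | exact hasDerivAt_const _ _
      | exact HasDerivAt.congr_deriv (DifferentiableAt.hasDerivAt (by fun_prop)) (by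
          simp [deriv_fun_add])
  have h := (hasDerivAt_pi.2 key)
  exact (PiLp.continuousLinearEquiv 2 ℝ (fun _ : Fin 3 => ℝ)).symm.hasFDerivAt.comp_hasDerivAt 0 h

theorem rot_zero (i : Fin 3) : rot i 0 = 1 := by
  apply Subtype.ext
  ext j l
  fin_cases i <;> fin_cases j <;> fin_cases l <;> simp [rot]

/-! ### Smooth actions and infinitesimal generators -/

section Action

variable {M : Type*} [TopologicalSpace M] [ChartedSpace E5 M] [MulAction SO3 M]
variable {N : Type*} [TopologicalSpace N] [ChartedSpace E5 N] [MulAction SO3 N]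

/-- The infinitesimal generators, as vectors of the model space. -/
def genv (i : Fin 3) (x : M) : E5 := gen i x

theorem mem_singularSet {x : M} :
    x ∈ singularSet M ↔ ¬ LinearIndependent ℝ fun i : Fin 3 => genv i x := Iff.rfl

theorem gen_eq (i : Fin 3) (x : M) :
    gen i x = mder 𝓘(ℝ, ℝ) (𝓡 5) (fun s : ℝ => rot i s • x) 0 1 := rfl

theorem IsSmoothAction.contMDiff_smul (h : IsSmoothAction M) (g : SO3) :
    ContMDiff (𝓡 5) (𝓡 5) ∞ fun x : M => g • x :=
  (h 0 (fun _ => g) fun _ _ => contDiff_const).comp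
    ((contMDiff_const (c := (0 : EuclideanSpace ℝ (Fin 0)))).prodMk contMDiff_id)

theorem IsSmoothAction.contMDiff_family (h : IsSmoothAction M) {n : ℕ}
    {g : EuclideanSpace ℝ (Fin n) → SO3} (hg : ∀ i j, ContDiff ℝ ∞ fun a => (g a).1 i j) (x : M) :
    ContMDiff (𝓡 n) (𝓡 5) ∞ fun a => g a • x :=
  (h n g hg).comp (contMDiff_id.prodMk contMDiff_const)

theorem IsSmoothAction.contMDiff_curve₂ (h : IsSmoothAction M) {g : ℝ → SO3}
    (hg : ∀ i j, ContDiff ℝ ∞ fun a => (g a).1 i j) :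
    ContMDiff (𝓘(ℝ, ℝ).prod (𝓡 5)) (𝓡 5) ∞ fun z : ℝ × M => g z.1 • z.2 := by
  have h1 := h 1 (fun a => g (a 0)) fun i j => (hg i j).comp (by fun_prop)
  have h2 : ContDiff ℝ ∞ fun s : ℝ => (!₂[s] : EuclideanSpace ℝ (Fin 1)) := by
    rw [contDiff_euclidean]
    intro i
    fin_cases i
    exact contDiff_id
  exact h1.comp ((h2.contMDiff.comp contMDiff_fst).prodMk contMDiff_snd)

theorem IsSmoothAction.contMDiff_curve (h : IsSmoothAction M) {g : ℝ → SO3}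
    (hg : ∀ i j, ContDiff ℝ ∞ fun a => (g a).1 i j) (x : M) :
    ContMDiff 𝓘(ℝ, ℝ) (𝓡 5) ∞ fun s : ℝ => g s • x :=
  (h.contMDiff_curve₂ hg).comp (contMDiff_id.prodMk contMDiff_const)

theorem IsSmoothAction.contMDiff_rot (h : IsSmoothAction M) (i : Fin 3) (x : M) :
    ContMDiff 𝓘(ℝ, ℝ) (𝓡 5) ∞ fun s : ℝ => rot i s • x :=
  h.contMDiff_curve (contDiff_rot_entry i) x

theorem IsSmoothAction.mdifferentiableAt_rot (h : IsSmoothAction M) (i : Fin 3) (x : M) :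
    MDifferentiableAt 𝓘(ℝ, ℝ) (𝓡 5) (fun s : ℝ => rot i s • x) 0 :=
  (h.contMDiff_rot i x 0).mdifferentiableAt (by simp)

/-- Equivariant maps respect the infinitesimal generators. -/
theorem gen_map (h : IsSmoothAction M) {F : M → N} {x : M}
    (hF : MDifferentiableAt (𝓡 5) (𝓡 5) F x) (he : ∀ g : SO3, F (g • x) = g • F x) (i : Fin 3) :
    gen i (F x) = mder (𝓡 5) (𝓡 5) F x (gen i x) := by
  have h0 : rot i 0 • x = x := by rw [rot_zero, one_smul]
  have hF' : MDifferentiableAt (𝓡 5) (𝓡 5) F (rot i 0 • x) := by rwa [h0]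
  have h1 := mder_comp (F := fun s : ℝ => rot i s • x) hF' (h.mdifferentiableAt_rot i x)
  simp only [he, h0] at h1
  rw [gen_eq, gen_eq, h1]
  rfl

/-- The moment map of a form that pulls back to a multiple of `α`. -/
theorem momentMap_map (h : IsSmoothAction M) {F : M → N} {x : M} {α : OneForm M} {β : OneForm N}
    {c : ℝ} (hF : MDifferentiableAt (𝓡 5) (𝓡 5) F x) (he : ∀ g : SO3, F (g • x) = g • F x)
    (hc : cov (pullback F β) x = c • cov α x) (i : Fin 3) :
    momentMap β (F x) i = c * momentMap α x i := by
  change cov β (F x) (gen i (F x)) = c * cov α x (gen i x)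
  rw [gen_map h hF he]
  exact DFunLike.congr_fun hc (gen i x)

/-- The cross-section is preserved by equivariant maps pulling back the form to a positive multiple.
-/
theorem crossSection_map (h : IsSmoothAction M) {F : M → N} {x : M} {α : OneForm M} {β : OneForm N}
    {c : ℝ} (hF : MDifferentiableAt (𝓡 5) (𝓡 5) F x) (he : ∀ g : SO3, F (g • x) = g • F x)
    (hc0 : 0 < c) (hc : cov (pullback F β) x = c • cov α x) :
    F x ∈ crossSection β ↔ x ∈ crossSection α := by
  simp only [crossSection, Set.mem_ofPred_eq, momentMap_map h hF he hc, mul_eq_zero, hc0.ne',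
    false_or, mul_pos_iff_of_pos_left hc0]

/-- An equivariant immersion respects singular orbits. -/
theorem singularSet_map (h : IsSmoothAction M) {F : M → N} {x : M}
    (hF : MDifferentiableAt (𝓡 5) (𝓡 5) F x) (he : ∀ g : SO3, F (g • x) = g • F x)
    (hi : Function.Injective (mder (𝓡 5) (𝓡 5) F x)) :
    F x ∈ singularSet N ↔ x ∈ singularSet M := by
  have : (fun i : Fin 3 => genv i (F x)) =
      (mder (𝓡 5) (𝓡 5) F x : E5 →ₗ[ℝ] E5) ∘ fun i : Fin 3 => genv i x :=
    funext fun i => gen_map h hF he i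
  rw [mem_singularSet, mem_singularSet, this, LinearMap.linearIndependent_iff_of_injOn]
  exact hi.injOn

end Action

/-! ### Generators, moment map and singular orbits of `ℝ × T^*S²` -/

namespace Cyl

theorem smul_p (g : SO3) (y : Cyl) : (g • y).2.p = rotVec g y.2.p := rfl
theorem norm_smul_p (g : SO3) (y : Cyl) : ‖(g • y).2.p‖ = ‖y.2.p‖ := norm_rotVec g _

/-- The infinitesimal generators of the action on `ℝ × T^*S²` in ambient coordinates. -/
theorem demb_gen (i : Fin 3) (y : Cyl) : demb y (gen i y) = (0, crs i y.2.q, crs i y.2.p) := by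
  have h0 : rot i 0 • y = y := by rw [rot_zero, one_smul]
  have h1 := mder_comp (F := fun s : ℝ => rot i s • y) (G := emb) (I'' := 𝓘(ℝ, Amb))
    (mdifferentiableAt_emb _) (isSmoothAction_cyl.mdifferentiableAt_rot i y)
  rw [mder_eq_fderiv] at h1
  have h2 : HasDerivAt (fun s : ℝ => emb (rot i s • y)) (0, crs i y.2.q, crs i y.2.p) 0 :=
    (hasDerivAt_const _ _).prodMk ((hasDerivAt_rotVec i y.2.q).prodMk (hasDerivAt_rotVec i y.2.p))
  have h3 := DFunLike.congr_fun h1 1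
  rw [h2.hasFDerivAt.fderiv] at h3
  simp only [h0] at h3
  simp only [ContinuousLinearMap.toSpanSingleton_apply, one_smul] at h3
  exact h3.symm

theorem sum_smul_crs (c : Fin 3 → ℝ) (v : E3) : ∑ i, c i • crs i v =
    !₂[c 1 * v 2 - c 2 * v 1, c 2 * v 0 - c 0 * v 2, c 0 * v 1 - c 1 * v 0] := by
  ext j
  fin_cases j <;> simp [Fin.sum_univ_three, crs] <;> ring

theorem norm_sq_E3 (v : E3) : ‖v‖ ^ 2 = v 0 ^ 2 + v 1 ^ 2 + v 2 ^ 2 := by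
  simp [EuclideanSpace.norm_sq_eq, Fin.sum_univ_three]

theorem inner_E3 (v w : E3) : ⟪v, w⟫_ℝ = v 0 * w 0 + v 1 * w 1 + v 2 * w 2 := by
  simp [PiLp.inner_apply, Fin.sum_univ_three, mul_comm]

/-- The orbits of `ℝ × T^*S²` are singular exactly on the zero-section. -/
theorem mem_singularSet_iff (y : Cyl) : y ∈ singularSet Cyl ↔ y.2.p = 0 := by
  have hq : y.2.q 0 ^ 2 + y.2.q 1 ^ 2 + y.2.q 2 ^ 2 = 1 := by
    rw [← norm_sq_E3, y.2.norm_q]; norm_num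
  have hli : LinearIndependent ℝ (fun i : Fin 3 => genv i y) ↔
      LinearIndependent ℝ fun i : Fin 3 => ((0, crs i y.2.q, crs i y.2.p) : Amb) := by
    have : (fun i : Fin 3 => ((0, crs i y.2.q, crs i y.2.p) : Amb)) =
        (demb y : E5 →ₗ[ℝ] Amb) ∘ fun i : Fin 3 => genv i y :=
      funext fun i => (demb_gen i y).symm
    rw [this, LinearMap.linearIndependent_iff_of_injOn]
    exact (demb_injective y).injOn
  have hsum : ∀ c : Fin 3 → ℝ, ∑ i, c i • ((0, crs i y.2.q, crs i y.2.p) : Amb) =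
      (0, ∑ i, c i • crs i y.2.q, ∑ i, c i • crs i y.2.p) := by
    intro c
    simp [Fin.sum_univ_three]
  rw [mem_singularSet, hli, Fintype.linearIndependent_iff]
  constructor
  · intro h
    by_contra hp
    refine h fun c hc => ?_
    rw [hsum, Prod.mk_eq_zero, Prod.mk_eq_zero, sum_smul_crs, sum_smul_crs] at hc
    obtain ⟨-, h1, h2⟩ := hc
    have a0 := congrArg (fun v : E3 => v 0) h1
    have a1 := congrArg (fun v : E3 => v 1) h1
    have a2 := congrArg (fun v : E3 => v 2) h1
    have b0 := congrArg (fun v : E3 => v 0) h2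
    have b1 := congrArg (fun v : E3 => v 1) h2
    have b2 := congrArg (fun v : E3 => v 2) h2
    simp at a0 a1 a2 b0 b1 b2
    have hpq := y.2.inner_q_p
    rw [inner_E3] at hpq
    set q := y.2.q
    set p := y.2.p
    -- `c` is a multiple of `q`, so that `c × p = 0` forces `c = 0`
    obtain ⟨m, hc0, hc1, hc2⟩ : ∃ m, c 0 = m * q 0 ∧ c 1 = m * q 1 ∧ c 2 = m * q 2 := by
      refine ⟨c 0 * q 0 + c 1 * q 1 + c 2 * q 2, ?_, ?_, ?_⟩
      · linear_combination (-c 0) * hq + q 1 * a2 - q 2 * a1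
      · linear_combination (-c 1) * hq - q 0 * a2 + q 2 * a0
      · linear_combination (-c 2) * hq + q 0 * a1 - q 1 * a0
    have hp2 : p 0 ^ 2 + p 1 ^ 2 + p 2 ^ 2 ≠ 0 := by
      rw [← norm_sq_E3]
      exact pow_ne_zero 2 (norm_ne_zero_iff.2 hp)
    have hm0 : m = 0 := by
      have : m ^ 2 * (p 0 ^ 2 + p 1 ^ 2 + p 2 ^ 2) = 0 := by
        rw [hc1, hc2] at b0
        rw [hc0, hc2] at b1
        rw [hc0, hc1] at b2
        linear_combination m * (q 1 * p 2 - q 2 * p 1) * b0 + m * (q 2 * p 0 - q 0 * p 2) * b1 +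
          m * (q 0 * p 1 - q 1 * p 0) * b2 - m ^ 2 * (p 0 ^ 2 + p 1 ^ 2 + p 2 ^ 2) * hq +
          m ^ 2 * (q 0 * p 0 + q 1 * p 1 + q 2 * p 2) * hpq
      simpa [hp2] using this
    intro i
    fin_cases i <;> simp [hc0, hc1, hc2, hm0]
  · intro hp h
    -- over the zero-section the rotations around the axis `q` fix `(q, 0)`
    have := h (fun i => y.2.q i) (by
      rw [hsum, sum_smul_crs, sum_smul_crs, hp]
      refine Prod.ext rfl (Prod.ext ?_ ?_) <;> ext j <;> fin_cases j <;> simp <;> ring)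
    rw [this 0, this 1, this 2] at hq
    norm_num at hq

end Cyl

/-! ### Transfer along local diffeomorphisms -/

section Transfer

variable {M : Type*} [TopologicalSpace M] [ChartedSpace E5 M]
variable {N : Type*} [TopologicalSpace N] [ChartedSpace E5 N]

theorem isLocalDiffeomorphAt_of_openPartialHomeomorph {F : M → N} (e : OpenPartialHomeomorph M N)
    (h1 : ContMDiffOn (𝓡 5) (𝓡 5) ∞ e e.source) (h2 : ContMDiffOn (𝓡 5) (𝓡 5) ∞ e.symm e.target)
    {x : M} (hx : x ∈ e.source) (h : Set.EqOn F e e.source) :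
    IsLocalDiffeomorphAt (𝓡 5) (𝓡 5) ∞ F x :=
  ⟨{ toPartialEquiv := e.toPartialEquiv
     open_source := e.open_source
     open_target := e.open_target
     contMDiffOn_toFun := h1
     contMDiffOn_invFun := h2 }, hx, h⟩

/-- Smoothness can be checked after composition with a local diffeomorphism. -/
theorem contMDiffAt_of_comp {E H : Type*} [NormedAddCommGroup E] [NormedSpace ℝ E]
    [TopologicalSpace H] {I : ModelWithCorners ℝ E H} {P : Type*} [TopologicalSpace P]
    [ChartedSpace H P] {F : M → N} {D : N → P} {x : M}
    (h : IsLocalDiffeomorphAt (𝓡 5) (𝓡 5) ∞ F x)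
    (hD : ContMDiffAt (𝓡 5) I ∞ (fun z => D (F z)) x) : ContMDiffAt (𝓡 5) I ∞ D (F x) := by
  obtain ⟨G, h1, h2, h3, -⟩ := exists_local_inverse h
  have h4 : ContMDiffAt (𝓡 5) I ∞ (fun y => D (F (G y))) (F x) := by
    refine ContMDiffAt.comp (g := fun z => D (F z)) (F x) ?_ h2
    rwa [h1]
  refine h4.congr_of_eventuallyEq ?_
  filter_upwards [h3] with y hy
  rw [hy]

variable [MulAction SO3 M] [MulAction SO3 N]

/-- Smoothness of the action is transferred along an equivariant local diffeomorphism `F` at `x`.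
Equivariance is needed near `x` only, but for all group elements. -/
theorem smoothAction_at (hM : IsSmoothAction M) {F : M → N} {x : M}
    (hx : IsLocalDiffeomorphAt (𝓡 5) (𝓡 5) ∞ F x)
    (he' : ∀ᶠ z in nhds x, ∀ g : SO3, F (g • z) = g • F z)
    {n : ℕ} {g : EuclideanSpace ℝ (Fin n) → SO3} (hg : ∀ i j, ContDiff ℝ ∞ fun a => (g a).1 i j)
    (a : EuclideanSpace ℝ (Fin n)) (hgx : ContMDiffAt (𝓡 5) (𝓡 5) ∞ F (g a • x)) :
    ContMDiffAt ((𝓡 n).prod (𝓡 5)) (𝓡 5) ∞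
      (fun z : EuclideanSpace ℝ (Fin n) × N => g z.1 • z.2) (a, F x) := by
  obtain ⟨G, h1, h2, h3, -⟩ := exists_local_inverse hx
  have hG : ContMDiffAt ((𝓡 n).prod (𝓡 5)) ((𝓡 n).prod (𝓡 5)) ∞
      (fun z : EuclideanSpace ℝ (Fin n) × N => (z.1, G z.2)) (a, F x) :=
    contMDiffAt_fst.prodMk (ContMDiffAt.comp (a, F x) (g := G) h2 contMDiffAt_snd)
  have h4 : ContMDiffAt ((𝓡 n).prod (𝓡 5)) (𝓡 5) ∞
      (fun z : EuclideanSpace ℝ (Fin n) × N => F (g z.1 • G z.2)) (a, F x) := by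
    refine ContMDiffAt.comp (a, F x) (g := F)
      (f := fun z : EuclideanSpace ℝ (Fin n) × N => g z.1 • G z.2) (by simpa [h1] using hgx) ?_
    exact ((hM n g hg) _).comp (a, F x) hG
  refine h4.congr_of_eventuallyEq ?_
  have hc : Filter.Tendsto (fun z : EuclideanSpace ℝ (Fin n) × N => G z.2) (nhds (a, F x))
      (nhds x) := by
    have := h2.continuousAt.comp (x := (a, F x)) (f := Prod.snd) continuousAt_snd
    simpa [ContinuousAt, Function.comp_def, h1] using this
  have hc2 : Filter.Tendsto (fun z : EuclideanSpace ℝ (Fin n) × N => z.2) (nhds (a, F x))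
      (nhds (F x)) := continuousAt_snd
  filter_upwards [hc.eventually he', hc2.eventually h3] with z hz1 hz2
  rw [hz1, hz2]

/-- Invariance of a form at a point follows from invariance of its pull-back. -/
theorem invariant_at (hM : IsSmoothAction M) (hN : IsSmoothAction N) {F : M → N} {x : M} {g : SO3}
    {α : OneForm N} {β : OneForm M} (hx : IsLocalDiffeomorphAt (𝓡 5) (𝓡 5) ∞ F x)
    (hgx : ContMDiffAt (𝓡 5) (𝓡 5) ∞ F (g • x)) (he : ∀ᶠ z in nhds x, F (g • z) = g • F z)
    (h1 : cov (pullback F α) x = cov β x) (h2 : cov (pullback F α) (g • x) = cov β (g • x))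
    (hβ : cov (pullback (fun z : M => g • z) β) x = cov β x) :
    cov (pullback (fun z : N => g • z) α) (F x) = cov α (F x) := by
  have e0 : F (g • x) = g • F x := he.self_of_nhds
  have hs := (mder_bijective hx).2
  have hFx : MDifferentiableAt (𝓡 5) (𝓡 5) F x := hx.contMDiffAt.mdifferentiableAt (by simp)
  have hgM := (hM.contMDiff_smul g x).mdifferentiableAt (by simp)
  have hgN := (hN.contMDiff_smul g (F x)).mdifferentiableAt (by simp)
  have hgx' : MDifferentiableAt (𝓡 5) (𝓡 5) F (g • x) := hgx.mdifferentiableAt (by simp)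
  have e1 : (cov (pullback (fun z : N => g • z) α) (F x)).comp (mder (𝓡 5) (𝓡 5) F x) =
      (cov α (F x)).comp (mder (𝓡 5) (𝓡 5) F x) := by
    rw [← cov_pullback, ← cov_pullback, ← pullback_comp α hgN hFx,
      ← pullback_congr α he, pullback_comp (G := F) (F := fun z => g • z) α hgx' hgM,
      h1, ← hβ, cov_pullback, h2, cov_pullback]
  ext v
  obtain ⟨u, rfl⟩ := hs v
  exact DFunLike.congr_fun e1 u

end Transfer

/-! ### The mapping torus -/

namespace MappingTorus

variable (τ : EquivDiffeo)

/-- The projection to the mapping torus is a local diffeomorphism. -/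
theorem isLocalDiffeomorph_mk : IsLocalDiffeomorph (𝓡 5) (𝓡 5) ∞ (mk τ) := by
  intro y
  obtain ⟨n, hn⟩ := (mk_eq_iff τ).1
    (((mk_surjective τ).hasRightInverse.choose_spec (mk τ y)).symm)
  set y₀ := (mk_surjective τ).hasRightInverse.choose (mk τ y) with hy₀
  -- the chart of the mapping torus at the class of `y` is defined through the chosen representative
  -- `y₀`, where the projection reads as the identity; from there it is carried to `y` by a shift
  have key : IsLocalDiffeomorphAt (𝓡 5) (𝓡 5) ∞ (mk τ) y₀ := by
    set l := (isLocalHomeomorph_mk τ).localInverseAt y₀ with hl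
    have hls : ⇑l.symm = mk τ := (isLocalHomeomorph_mk τ).localInverseAt_symm _
    set c := chartAt E5 y₀ with hc
    set e := chartAt E5 (mk τ y) with he
    have hee : e = l.trans c := rfl
    refine isLocalDiffeomorphAt_of_openPartialHomeomorph (c.trans e.symm) ?_ ?_ ?_ ?_
    · intro z hz
      exact ((contMDiffAt_chart_symm (M := MappingTorus τ) (x₀ := mk τ y) (z := c z) hz.2).comp z
        (contMDiffAt_chart hz.1)).contMDiffWithinAt
    · intro z hz
      exact ((contMDiffAt_chart_symm (M := Cyl) (x₀ := y₀) (z := e z) hz.2).comp z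
        (contMDiffAt_chart (M := MappingTorus τ) hz.1)).contMDiffWithinAt
    · refine ⟨mem_chart_source E5 y₀, ?_⟩
      have h1 : mk τ y ∈ e.source := mem_chart_source E5 (mk τ y)
      have h2 : e (mk τ y) = c y₀ := by
        have h3 : l (mk τ y₀) = y₀ := (isLocalHomeomorph_mk τ).localInverseAt_apply_self
        have h4 : mk τ y₀ = mk τ y := (mk_surjective τ).hasRightInverse.choose_spec (mk τ y)
        rw [hee]
        change c (l (mk τ y)) = _
        rw [← h4, h3]
      change c y₀ ∈ e.target
      rw [← h2]
      exact e.map_source h1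
    · intro z hz
      change mk τ z = l.symm (c.symm (c z))
      rw [c.left_inv hz.1, hls]
  have hsh : IsLocalDiffeomorphAt (𝓡 5) (𝓡 5) ∞ (τ.shift n) y :=
    (Diffeomorph.isLocalDiffeomorph
      { toFun := τ.shift n
        invFun := τ.shift (-n)
        left_inv := fun z => by rw [← τ.shift_add, neg_add_cancel, τ.shift_zero]
        right_inv := fun z => by rw [← τ.shift_add, add_neg_cancel, τ.shift_zero]
        contMDiff_toFun := τ.contMDiff_shift n
        contMDiff_invFun := τ.contMDiff_shift (-n) }) y
  rw [hn] at key
  have h := hsh.comp (𝓡 5) _ key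
  have e : mk τ ∘ τ.shift n = mk τ := funext fun z => mk_shift τ n z
  rwa [e] at h

variable {τ}

/-- Invariance under the generator of the `ℤ`-action implies invariance under the action. -/
theorem eq_of_shift_one {X : Type*} {f : Cyl → X} (h : ∀ y, f (τ.shift 1 y) = f y) (n : ℤ)
    (y : Cyl) : f (τ.shift n y) = f y := by
  induction n using Int.induction_on with
  | zero => rw [τ.shift_zero]
  | succ i ih => rw [add_comm, τ.shift_add, h, ih]
  | pred i ih => rw [← ih, ← h, ← τ.shift_add]; congr 2; ring

variable (τ) in
/-- The map on the mapping torus induced by a map that is invariant under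
`(t; x) ↦ (t + 1; τ x)`. -/
def lift {X : Type*} (f : Cyl → X) (h : ∀ y, f (τ.shift 1 y) = f y) : MappingTorus τ → X :=
  Quotient.lift f (by
    rintro y z ⟨n, rfl⟩
    exact (eq_of_shift_one h n y).symm)

theorem lift_mk {X : Type*} {f : Cyl → X} (h : ∀ y, f (τ.shift 1 y) = f y) (y : Cyl) :
    lift τ f h (mk τ y) = f y := rfl

theorem continuous_lift {X : Type*} [TopologicalSpace X] {f : Cyl → X}
    (h : ∀ y, f (τ.shift 1 y) = f y) (hf : Continuous f) : Continuous (lift τ f h) :=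
  hf.quotient_lift _

theorem smul_mk (g : SO3) (y : Cyl) : g • mk τ y = mk τ (g • y) := rfl

theorem shift_one (y : Cyl) : τ.shift 1 y = (y.1 + 1, τ.toEquiv y.2) := by
  simp [EquivDiffeo.shift]

theorem isSmoothAction : IsSmoothAction (MappingTorus τ) := by
  rintro n g hg ⟨a, x⟩
  obtain ⟨y, rfl⟩ := mk_surjective τ x
  exact smoothAction_at isSmoothAction_cyl (isLocalDiffeomorph_mk τ y)
    (Filter.Eventually.of_forall fun z g => rfl) hg a
    ((isLocalDiffeomorph_mk τ).contMDiff _)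

instance : SecondCountableTopology CotS2 :=
  inferInstanceAs (SecondCountableTopology {x : E3 × E3 // ‖x.1‖ = 1 ∧ ⟪x.1, x.2⟫_ℝ = 0})

instance : T2Space CotS2 :=
  inferInstanceAs (T2Space {x : E3 × E3 // ‖x.1‖ = 1 ∧ ⟪x.1, x.2⟫_ℝ = 0})

instance : SecondCountableTopology (MappingTorus τ) :=
  Topology.IsQuotientMap.secondCountableTopology (π := mk τ) isQuotientMap_quotient_mk'
    (isOpenMap_mk τ)

/-- The mapping torus is Hausdorff: the graphs of the maps `(t; x) ↦ (t + n; τⁿ x)` form a locally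
finite family of closed sets. -/
instance : T2Space (MappingTorus τ) := by
  rw [t2Space_iff_of_isOpenQuotientMap (π := mk τ)
    ⟨mk_surjective τ, continuous_mk τ, isOpenMap_mk τ⟩]
  have e : {q : Cyl × Cyl | mk τ q.1 = mk τ q.2} =
      ⋃ n : ℤ, {q : Cyl × Cyl | q.2 = τ.shift n q.1} := by
    ext q
    simp only [Set.mem_iUnion]
    exact mk_eq_iff τ
  rw [e]
  refine LocallyFinite.isClosed_iUnion ?_ fun n => isClosed_eq continuous_snd
    ((τ.contMDiff_shift n).continuous.comp continuous_fst)
  intro q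
  have hc : Continuous fun q : Cyl × Cyl => q.2.1 - q.1.1 :=
    (continuous_fst.comp continuous_snd).sub (continuous_fst.comp continuous_fst)
  refine ⟨{q' | |(q'.2.1 - q'.1.1) - (q.2.1 - q.1.1)| < 1}, 
    (isOpen_lt (hc.sub continuous_const).abs continuous_const).mem_nhds (by simp), ?_⟩
  refine (Set.finite_Icc (⌊q.2.1 - q.1.1⌋ - 1) (⌈q.2.1 - q.1.1⌉ + 1)).subset ?_
  rintro n ⟨q', h1, h2⟩
  -- only those `n` matter for which the difference of the times is close to `n`
  have h3 : q'.2.1 - q'.1.1 = n := by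
    have := congrArg Prod.fst h1
    simp only [EquivDiffeo.shift] at this
    linarith
  have h4 : |(q'.2.1 - q'.1.1) - (q.2.1 - q.1.1)| < 1 := h2
  rw [h3, abs_lt] at h4
  constructor
  · have := Int.floor_le (q.2.1 - q.1.1)
    have h5 : ((⌊q.2.1 - q.1.1⌋ - 1 : ℤ) : ℝ) < n := by push_cast; linarith
    exact_mod_cast h5.le
  · have := Int.le_ceil (q.2.1 - q.1.1)
    have h5 : (n : ℝ) < ((⌈q.2.1 - q.1.1⌉ + 1 : ℤ) : ℝ) := by push_cast; linarith
    exact_mod_cast h5.le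

/-- Equivariant maps of `ℝ × T^*S²`, inverse to each other and compatible with the identifications,
induce a diffeomorphism of the mapping tori. -/
theorem exists_diffeomorph {τ' : EquivDiffeo} (F G : Cyl → Cyl)
    (hF : ContMDiff (𝓡 5) (𝓡 5) ∞ F) (hG : ContMDiff (𝓡 5) (𝓡 5) ∞ G)
    (h1 : ∀ y, G (F y) = y) (h2 : ∀ y, F (G y) = y)
    (he : ∀ (g : SO3) y, F (g • y) = g • F y) (hs : ∀ y, F (τ.shift 1 y) = τ'.shift 1 (F y)) :
    ∃ D : MappingTorus τ ≃ₘ^∞⟮𝓡 5, 𝓡 5⟯ MappingTorus τ', ∀ (g : SO3) x, D (g • x) = g • D x := by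
  have a1 : ∀ y, mk τ' (F (τ.shift 1 y)) = mk τ' (F y) := fun y => by rw [hs, mk_shift]
  have a2 : ∀ y, mk τ (G (τ'.shift 1 y)) = mk τ (G y) := fun y => by
    have : G (τ'.shift 1 y) = τ.shift 1 (G y) := by
      rw [← h1 (τ.shift 1 (G y)), hs, h2]
    rw [this, mk_shift]
  refine ⟨{ toFun := lift τ (fun y => mk τ' (F y)) a1
            invFun := lift τ' (fun y => mk τ (G y)) a2
            left_inv := ?_
            right_inv := ?_
            contMDiff_toFun := ?_
            contMDiff_invFun := ?_ }, ?_⟩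
  · intro x
    obtain ⟨y, rfl⟩ := mk_surjective τ x
    rw [lift_mk, lift_mk, h1]
  · intro x
    obtain ⟨y, rfl⟩ := mk_surjective τ' x
    rw [lift_mk, lift_mk, h2]
  · intro x
    obtain ⟨y, rfl⟩ := mk_surjective τ x
    exact contMDiffAt_of_comp (isLocalDiffeomorph_mk τ y)
      (((isLocalDiffeomorph_mk τ').contMDiff.comp hF) y)
  · intro x
    obtain ⟨y, rfl⟩ := mk_surjective τ' x
    exact contMDiffAt_of_comp (isLocalDiffeomorph_mk τ' y)
      (((isLocalDiffeomorph_mk τ).contMDiff.comp hG) y)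
  · intro g x
    obtain ⟨y, rfl⟩ := mk_surjective τ x
    change mk τ' (F (g • y)) = g • mk τ' (F y)
    rw [he, smul_mk]

end MappingTorus

/-! ### The mapping torus of the Dehn twist as a dual vertical bundle -/

theorem geod_zero_right (θ : ℝ) (q : E3) : geod θ (q, 0) = (Real.cos θ • q, 0) := by
  simp [geod]

/-- The normalized geodesic flow is a flow. On the zero-section, where the direction of motion is
undefined, this needs the inner angle to be a multiple of `π`. -/
theorem geod_add {a b : ℝ} {x : E3 × E3} (h : ‖x.1‖ = 1 ∧ ⟪x.1, x.2⟫_ℝ = 0)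
    (h0 : x.2 = 0 → Real.sin b = 0) : geod a (geod b x) = geod (a + b) x := by
  have hn := (geod_mem h h0).2
  obtain ⟨q, p⟩ := x
  by_cases hp : p = 0
  · subst hp
    have hb := h0 rfl
    simp [geod_zero_right, Real.cos_add, hb, smul_smul]
  · have hp' : ‖p‖ ≠ 0 := norm_ne_zero_iff.2 hp
    rw [geod, hn]
    simp only [geod, Real.cos_add, Real.sin_add]
    refine Prod.ext ?_ ?_ <;> simp only <;> match_scalars <;> field_simp <;> ring

/-- The variable part of the angle of the Dehn twist, `π k ρ_ε`. -/
def bendAngle (k : ℤ) (ε r : ℝ) : ℝ := Real.pi * k * rho ε r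

theorem twistAngle_eq (k : ℤ) (ε r : ℝ) :
    twistAngle k ε r = Real.pi * k + bendAngle k ε r := by
  simp only [twistAngle, bendAngle]; ring

theorem bendAngle_of_le {k : ℤ} {ε r : ℝ} (h : r ≤ ε / 2) : bendAngle k ε r = 0 := by
  simp [bendAngle, rho, h]

theorem contDiff_bendAngle (k : ℤ) {ε : ℝ} (hε : 0 < ε) : ContDiff ℝ ∞ (bendAngle k ε) :=
  contDiff_const.mul (contDiff_rho hε)

/-- The map `(t; x) ↦ (t; geod (c t π k ρ_ε(|p|)) x)`.  For `c = -1` it conjugates the Dehn twist to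
the map `geod (π k)`, which is the identity or the antipodal map. -/
def bend (k : ℤ) (ε : ℝ) (hε : 0 < ε) (c : ℝ) (y : Cyl) : Cyl :=
  (y.1, ⟨geod (c * y.1 * bendAngle k ε ‖y.2.p‖) y.2.1, (geod_mem y.2.2 fun h => by
    change y.2.p = 0 at h
    rw [h, norm_zero, bendAngle_of_le (by linarith)]; simp).1⟩)

section Bend

variable {k : ℤ} {ε : ℝ} {hε : 0 < ε}

theorem sin_bend_eq_zero (hε : 0 < ε) (a : ℝ) {x : E3 × E3} (h : x.2 = 0) :
    Real.sin (a * bendAngle k ε ‖x.2‖) = 0 := by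
  rw [h, norm_zero, bendAngle_of_le (by linarith)]; simp

theorem norm_bend_p (c : ℝ) (y : Cyl) : ‖(bend k ε hε c y).2.p‖ = ‖y.2.p‖ :=
  (geod_mem y.2.2 (sin_bend_eq_zero hε _)).2

theorem bend_bend_neg (c : ℝ) (y : Cyl) : bend k ε hε (-c) (bend k ε hε c y) = y := by
  refine Prod.ext rfl (Subtype.ext ?_)
  change geod (-c * y.1 * bendAngle k ε ‖(bend k ε hε c y).2.p‖)
    (geod (c * y.1 * bendAngle k ε ‖y.2.p‖) y.2.1) = y.2.1
  rw [norm_bend_p, neg_mul, neg_mul]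
  exact geod_geod_neg y.2.2 (sin_bend_eq_zero hε _)

theorem bend_smul (c : ℝ) (g : SO3) (y : Cyl) :
    bend k ε hε c (g • y) = g • bend k ε hε c y := by
  refine Prod.ext rfl (Subtype.ext ?_)
  change geod (c * y.1 * bendAngle k ε ‖(g • y).2.p‖) (rotVec g y.2.1.1, rotVec g y.2.1.2) = _
  rw [Cyl.norm_smul_p, geod_rotVec]
  rfl

/-- Near the zero-section `bend` is the identity, elsewhere `|p|` is smooth. -/
theorem contMDiff_bend (c : ℝ) : ContMDiff (𝓡 5) (𝓡 5) ∞ (bend k ε hε c) := by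
  intro y
  apply Cyl.contMDiffAt_of_emb
  have key : ContDiff ℝ ∞ (fun w : Amb =>
      ((w.1, geod (c * w.1 * bendAngle k ε ‖w.2.2‖) w.2) : Amb)) := by
    refine contDiff_fst.prodMk ?_
    rw [contDiff_iff_contDiffAt]
    rintro ⟨t, q, p⟩
    by_cases hp : p = 0
    · have hev : (fun w : Amb => geod (c * w.1 * bendAngle k ε ‖w.2.2‖) w.2) =ᶠ[nhds (t, q, p)]
          fun w => w.2 := by
        have : ∀ᶠ x : Amb in nhds (t, q, p), ‖x.2.2‖ < ε / 2 := by
          apply (continuous_snd.snd.norm.continuousAt).eventually_lt continuousAt_const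
          simp [hp, hε]
        filter_upwards [this] with x hx
        rw [bendAngle_of_le hx.le]
        simp [geod]
      exact contDiffAt_snd.congr_of_eventuallyEq hev
    · have hn : ContDiffAt ℝ ∞ (fun x : Amb => ‖x.2.2‖) (t, q, p) := contDiffAt_snd.snd.norm ℝ hp
      have hθ : ContDiffAt ℝ ∞ (fun x : Amb => c * x.1 * bendAngle k ε ‖x.2.2‖) (t, q, p) :=
        (contDiffAt_const.mul contDiffAt_fst).mul ((contDiff_bendAngle k hε).contDiffAt.comp _ hn)
      have hp' : ‖p‖ ≠ 0 := norm_ne_zero_iff.2 hp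
      exact ((hθ.cos.smul contDiffAt_snd.fst).add ((hθ.sin.div hn hp').smul
        contDiffAt_snd.snd)).prodMk ((hθ.cos.smul contDiffAt_snd.snd).sub
        ((hn.mul hθ.sin).smul contDiffAt_snd.fst))
  exact (key.contMDiff.comp Cyl.contMDiff_emb) y

/-- `bend` with `c = -1` conjugates `(t; x) ↦ (t + 1; τ_k x)` to `(t; x) ↦ (t + 1; geod (π k) x)`:
the angles `πk(1 + ρ) - (t + 1)πkρ` and `πk - tπkρ` agree. -/
theorem bend_shift {τ' : EquivDiffeo}
    (h : ∀ x : CotS2, (τ'.toEquiv x).1 = geod (Real.pi * k) x.1) (y : Cyl) :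
    bend k ε hε (-1) ((dehnTwist k ε hε).shift 1 y) = τ'.shift 1 (bend k ε hε (-1) y) := by
  rw [MappingTorus.shift_one, MappingTorus.shift_one]
  refine Prod.ext rfl (Subtype.ext ?_)
  have hn : ‖(twistFun k ε y.2.1).2‖ = ‖y.2.p‖ := (geod_mem y.2.2 (twist_h0 k hε y.2.1)).2
  rw [h]
  change geod (-1 * (y.1 + 1) * bendAngle k ε ‖(twistFun k ε y.2.1).2‖) (twistFun k ε y.2.1) =
    geod (Real.pi * k) (geod (-1 * y.1 * bendAngle k ε ‖y.2.p‖) y.2.1)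
  have e1 := geod_add (a := Real.pi * k) (b := -1 * y.1 * bendAngle k ε ‖y.2.p‖) y.2.2
    (sin_bend_eq_zero hε _)
  have e2 := geod_add (a := -1 * (y.1 + 1) * bendAngle k ε ‖y.2.p‖)
    (b := twistAngle k ε ‖y.2.p‖) y.2.2 (twist_h0 k hε y.2.1)
  rw [hn]
  refine e2.trans (Eq.trans ?_ e1.symm)
  rw [twistAngle_eq]
  congr 1
  ring

/-- `geod` of an even multiple of `π` is the identity. -/
theorem geod_pi_mul_even (hk : Even k) (x : E3 × E3) : geod (Real.pi * k) x = x := by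
  have h1 : Real.sin (Real.pi * k) = 0 := by rw [mul_comm]; exact Real.sin_int_mul_pi k
  have h2 : Real.cos (Real.pi * k) = 1 := by
    obtain ⟨m, rfl⟩ := hk
    rw [show Real.pi * ((m + m : ℤ) : ℝ) = m * (2 * Real.pi) by push_cast; ring]
    exact Real.cos_int_mul_two_pi m
  simp [geod, h1, h2]

/-- `geod` of an odd multiple of `π` is the antipodal map. -/
theorem geod_pi_mul_odd (hk : Odd k) (x : E3 × E3) : geod (Real.pi * k) x = -x := by
  have h1 : Real.sin (Real.pi * k) = 0 := by rw [mul_comm]; exact Real.sin_int_mul_pi k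
  have h2 : Real.cos (Real.pi * k) = -1 := by
    obtain ⟨m, rfl⟩ := hk
    rw [show Real.pi * ((2 * m + 1 : ℤ) : ℝ) = m * (2 * Real.pi) + Real.pi by push_cast; ring]
    exact Real.cos_int_mul_two_pi_add_pi m
  simp only [geod, h1, h2]
  simp
  rfl

/-- The mapping torus of the Dehn twist is the mapping torus of `geod (π k)`. -/
theorem exists_diffeomorph_of_geod {τ' : EquivDiffeo}
    (h : ∀ x : CotS2, (τ'.toEquiv x).1 = geod (Real.pi * k) x.1) :
    ∃ D : MappingTorus (dehnTwist k ε hε) ≃ₘ^∞⟮𝓡 5, 𝓡 5⟯ MappingTorus τ',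
      ∀ (g : SO3) x, D (g • x) = g • D x := by
  refine MappingTorus.exists_diffeomorph (bend k ε hε (-1)) (bend k ε hε 1) (contMDiff_bend _)
    (contMDiff_bend _) (fun y => ?_) (fun y => bend_bend_neg 1 y) (fun g y => bend_smul _ g y)
    (bend_shift h)
  have := bend_bend_neg (k := k) (hε := hε) (-1) y
  rwa [neg_neg] at this

variable (hε)

theorem exists_diffeomorph_triv (hk : Even k) :
    ∃ D : MappingTorus (dehnTwist k ε hε) ≃ₘ^∞⟮𝓡 5, 𝓡 5⟯ VdualTriv,
      ∀ (g : SO3) x, D (g • x) = g • D x :=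
  exists_diffeomorph_of_geod fun x => (geod_pi_mul_even hk x.1).symm

theorem exists_diffeomorph_twist (hk : Odd k) :
    ∃ D : MappingTorus (dehnTwist k ε hε) ≃ₘ^∞⟮𝓡 5, 𝓡 5⟯ VdualTwist,
      ∀ (g : SO3) x, D (g • x) = g • D x :=
  exists_diffeomorph_of_geod fun x => (geod_pi_mul_odd hk x.1).symm

end Bend

/-! ### The contact form on `ℝ × T^*S²` -/

namespace Amb

/-- The projection to the coordinate `t`. -/
def dt : Amb →L[ℝ] ℝ := ContinuousLinearMap.fst ℝ ℝ (E3 × E3)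
/-- The projection to the coordinate `q`. -/
def dq : Amb →L[ℝ] E3 :=
  (ContinuousLinearMap.fst ℝ E3 E3).comp (ContinuousLinearMap.snd ℝ ℝ (E3 × E3))
/-- The projection to the coordinate `p`. -/
def dp : Amb →L[ℝ] E3 :=
  (ContinuousLinearMap.snd ℝ E3 E3).comp (ContinuousLinearMap.snd ℝ ℝ (E3 × E3))

@[simp] theorem dt_apply (w : Amb) : dt w = w.1 := rfl
@[simp] theorem dq_apply (w : Amb) : dq w = w.2.1 := rfl
@[simp] theorem dp_apply (w : Amb) : dp w = w.2.2 := rfl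

/-- The ambient form `dt + p · dq`. -/
def canB (w : Amb) : Amb →L[ℝ] ℝ := dt + (innerSL ℝ w.2.2).comp dq

/-- The function `f(|p|)`. -/
def angle (k : ℤ) (ε : ℝ) (w : Amb) : ℝ := twistAngle k ε ‖w.2.2‖

/-- The ambient form `dt + p · dq - t |p| df`. -/
def dehnB (k : ℤ) (ε : ℝ) (w : Amb) : Amb →L[ℝ] ℝ :=
  canB w - (w.1 * ‖w.2.2‖) • fderiv ℝ (angle k ε) w

theorem canB_apply (w v : Amb) : canB w v = v.1 + ⟪w.2.2, v.2.1⟫_ℝ := rfl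

theorem hasFDerivAt_canB (w : Amb) :
    HasFDerivAt canB (((ContinuousLinearMap.compL ℝ Amb E3 ℝ).flip dq).comp
      ((innerSL ℝ (E := E3)).comp dp)) w := by
  have h := ((((ContinuousLinearMap.compL ℝ Amb E3 ℝ).flip dq).comp
      ((innerSL ℝ (E := E3)).comp dp)).hasFDerivAt (x := w)).const_add dt
  exact h

theorem contDiff_canB : ContDiff ℝ ∞ canB :=
  contDiff_const.add ((((ContinuousLinearMap.compL ℝ Amb E3 ℝ).flip dq).comp
      ((innerSL ℝ (E := E3)).comp dp)).contDiff)

/-- The exterior derivative of `dt + p · dq` is `dp ∧ dq`. -/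
theorem flatD_canB (w v v' : Amb) : flatD canB w v v' = ⟪v.2.2, v'.2.1⟫_ℝ - ⟪v'.2.2, v.2.1⟫_ℝ := by
  simp only [flatD, (hasFDerivAt_canB w).fderiv]
  rfl

variable {k : ℤ} {ε : ℝ}

theorem contDiff_twistAngle (k : ℤ) (hε : 0 < ε) : ContDiff ℝ ∞ (twistAngle k ε) :=
  contDiff_const.mul (contDiff_const.add (contDiff_rho hε))

theorem eventually_norm_lt {w : Amb} (hw : w.2.2 = 0) (hε : 0 < ε) :
    ∀ᶠ v : Amb in nhds w, ‖v.2.2‖ < ε := by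
  apply (continuous_snd.snd.norm.continuousAt).eventually_lt continuousAt_const
  simp [hw, hε]

theorem eventually_angle_eq (k : ℤ) {w : Amb} (hw : w.2.2 = 0) (hε : 0 < ε) :
    angle k ε =ᶠ[nhds w] fun _ => Real.pi * k := by
  filter_upwards [eventually_norm_lt hw (half_pos hε)] with v hv using twistAngle_of_le hv.le

theorem contDiff_angle (k : ℤ) (hε : 0 < ε) : ContDiff ℝ ∞ (angle k ε) := by
  rw [contDiff_iff_contDiffAt]
  intro w
  by_cases hp : w.2.2 = 0
  · exact contDiffAt_const.congr_of_eventuallyEq (eventually_angle_eq k hp hε)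
  · exact (contDiff_twistAngle k hε).contDiffAt.comp w (contDiffAt_snd.snd.norm ℝ hp)

/-- Near the zero-section the angle is constant, so that both forms agree. -/
theorem eventually_dehnB_eq (k : ℤ) {w : Amb} (hw : w.2.2 = 0) (hε : 0 < ε) :
    dehnB k ε =ᶠ[nhds w] canB := by
  filter_upwards [(eventually_angle_eq k hw hε).eventually_nhds] with v hv
  rw [dehnB, Filter.EventuallyEq.fderiv_eq hv]
  simp

/-- The norm `|p|` is not smooth on the zero-section, but the form agrees with `dt + p · dq` nearby.
-/
theorem contDiff_dehnB (k : ℤ) (hε : 0 < ε) : ContDiff ℝ ∞ (dehnB k ε) := by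
  rw [contDiff_iff_contDiffAt]
  intro w
  by_cases hp : w.2.2 = 0
  · exact contDiff_canB.contDiffAt.congr_of_eventuallyEq (eventually_dehnB_eq k hp hε)
  · exact contDiff_canB.contDiffAt.sub ((contDiffAt_fst.mul (contDiffAt_snd.snd.norm ℝ hp)).smul
      ((contDiff_angle k hε).contDiffAt.fderiv_right (by simp)))

/-- The differential of `|p|`. -/
theorem exists_hasFDerivAt_norm {w : Amb} (hw : w.2.2 ≠ 0) :
    ∃ l : Amb →L[ℝ] ℝ, HasFDerivAt (fun v : Amb => ‖v.2.2‖) l w ∧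
      ∀ v, ‖w.2.2‖ * l v = ⟪w.2.2, v.2.2⟫_ℝ := by
  have hn : DifferentiableAt ℝ (fun v : Amb => ‖v.2.2‖) w :=
    (contDiffAt_snd.snd.norm ℝ hw (n := 1)).differentiableAt (by simp)
  refine ⟨_, hn.hasFDerivAt, fun v => ?_⟩
  have hp : HasFDerivAt (fun v : Amb => v.2.2) dp w := dp.hasFDerivAt
  have h1 := hp.inner ℝ hp
  have h2 := hn.hasFDerivAt.mul hn.hasFDerivAt
  have e : (fun v : Amb => ⟪v.2.2, v.2.2⟫_ℝ) =
      (fun v : Amb => ‖v.2.2‖) * fun v : Amb => ‖v.2.2‖ := by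
    ext v
    rw [real_inner_self_eq_norm_mul_norm]; rfl
  rw [e] at h1
  have h3 := DFunLike.congr_fun (h1.unique h2) v
  simp [fderivInnerCLM_apply] at h3
  have := real_inner_comm w.2.2 v.2.2
  linarith

theorem deriv_twistAngle_zero (k : ℤ) (hε : 0 < ε) : deriv (twistAngle k ε) 0 = 0 := by
  have : twistAngle k ε =ᶠ[nhds 0] fun _ => Real.pi * k := by
    filter_upwards [eventually_lt_nhds (half_pos hε)] with r hr using twistAngle_of_le hr.le
  rw [this.deriv_eq, deriv_const]

theorem hasFDerivAt_angle (k : ℤ) (hε : 0 < ε) {w : Amb} {l : Amb →L[ℝ] ℝ}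
    (hl : HasFDerivAt (fun v : Amb => ‖v.2.2‖) l w) :
    HasFDerivAt (angle k ε) (deriv (twistAngle k ε) ‖w.2.2‖ • l) w :=
  (((contDiff_twistAngle k hε).differentiable (by simp)) _).hasDerivAt.comp_hasFDerivAt w hl

/-- `|p| df = f'(|p|) p · dp`, which holds on the zero-section as well, both sides being zero there.
-/
theorem norm_mul_fderiv_angle (k : ℤ) (hε : 0 < ε) (w v : Amb) :
    ‖w.2.2‖ * fderiv ℝ (angle k ε) w v = deriv (twistAngle k ε) ‖w.2.2‖ * ⟪w.2.2, v.2.2⟫_ℝ := by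
  by_cases hp : w.2.2 = 0
  · simp [hp]
  · obtain ⟨l, hl, hlv⟩ := exists_hasFDerivAt_norm hp
    rw [(hasFDerivAt_angle k hε hl).fderiv, ← hlv]
    simp
    ring

theorem dehnB_apply (k : ℤ) (hε : 0 < ε) (w v : Amb) : dehnB k ε w v =
    v.1 + ⟪w.2.2, v.2.1⟫_ℝ - w.1 * deriv (twistAngle k ε) ‖w.2.2‖ * ⟪w.2.2, v.2.2⟫_ℝ := by
  have := norm_mul_fderiv_angle k hε w v
  simp only [dehnB, sub_apply, smul_apply, canB_apply,
    smul_eq_mul]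
  linear_combination (-w.1) * this

/-- `d(dt + p · dq - t |p| df) = dp ∧ dq - |p| dt ∧ df`, where `|p| df = f'(|p|) p · dp`. -/
theorem flatD_dehnB (k : ℤ) (hε : 0 < ε) (w v v' : Amb) : flatD (dehnB k ε) w v v' =
    ⟪v.2.2, v'.2.1⟫_ℝ - ⟪v'.2.2, v.2.1⟫_ℝ - deriv (twistAngle k ε) ‖w.2.2‖ *
      (v.1 * ⟪w.2.2, v'.2.2⟫_ℝ - v'.1 * ⟪w.2.2, v.2.2⟫_ℝ) := by
  by_cases hp : w.2.2 = 0
  · rw [flatD_congr (eventually_dehnB_eq k hp hε), flatD_canB, hp, norm_zero,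
      deriv_twistAngle_zero k hε]
    ring
  · obtain ⟨l, hl, hlv⟩ := exists_hasFDerivAt_norm hp
    have hA := (contDiff_angle k hε)
    have hd : HasFDerivAt (fderiv ℝ (angle k ε)) (fderiv ℝ (fderiv ℝ (angle k ε)) w) w :=
      ((hA.contDiffAt.fderiv_right (m := ∞) (by simp)).differentiableAt (by simp)).hasFDerivAt
    -- the second derivative of `f(|p|)` is symmetric and does not contribute
    have hs : IsSymmSndFDerivAt ℝ (angle k ε) w :=
      (hA.contDiffAt.of_le (m := 2)
        (WithTop.coe_le_coe.2 (le_top (a := (2 : ℕ∞))))).isSymmSndFDerivAt (by simp)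
    have ht : HasFDerivAt (fun w : Amb => w.1) dt w := dt.hasFDerivAt
    have h := (hasFDerivAt_canB w).sub ((ht.mul hl).smul hd)
    have h' : HasFDerivAt (dehnB k ε) _ w := h
    have hc := flatD_canB w v v'
    simp only [flatD, (hasFDerivAt_canB w).fderiv] at hc
    have e := hs v v'
    have hg := (hasFDerivAt_angle k hε hl).fderiv
    simp only [flatD, h'.fderiv]
    simp [hg, e] at hc ⊢
    have l1 := hlv v
    have l2 := hlv v'
    rw [← l1, ← l2]
    ring

end Amb

open Amb

theorem canForm_eq : canForm = Cyl.ambForm canB := by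
  funext y
  have h1 := Cyl.mder_comp_emb (y := y) (f := fun w : Amb => w.1) (dt.hasFDerivAt).differentiableAt
  have h2 := Cyl.mder_comp_emb (y := y) (f := fun w : Amb => w.2.1)
    (dq.hasFDerivAt).differentiableAt
  have e1 : fderiv ℝ (fun w : Amb => w.1) (Cyl.emb y) = dt := dt.hasFDerivAt.fderiv
  have e2 : fderiv ℝ (fun w : Amb => w.2.1) (Cyl.emb y) = dq := dq.hasFDerivAt.fderiv
  rw [e1] at h1
  rw [e2] at h2
  have h3 : (mder (𝓡 5) 𝓘(ℝ, ℝ) (fun z : Cyl => z.1) y : E5 →L[ℝ] ℝ) +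
      (innerSL ℝ y.2.p).comp (mder (𝓡 5) 𝓘(ℝ, E3) (fun z : Cyl => z.2.q) y) =
      (canB (Cyl.emb y)).comp (Cyl.demb y) := by
    rw [canB, ContinuousLinearMap.add_comp, ContinuousLinearMap.comp_assoc, ← h1, ← h2]
    rfl
  exact h3

/-- The form `dt + λ_can - t |p| df` on `ℝ × T^*S²` is the restriction of the ambient form. -/
theorem dehnForm_eq (k : ℤ) {ε : ℝ} (hε : 0 < ε) : dehnForm k ε = Cyl.ambForm (dehnB k ε) := by
  funext y
  have h1 := Cyl.mder_comp_emb (y := y) (f := angle k ε)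
    (((contDiff_angle k hε).differentiable (by simp)) _)
  have h2 : cov canForm y - (y.1 * ‖y.2.p‖) •
      (mder (𝓡 5) 𝓘(ℝ, ℝ) (fun z : Cyl => angle k ε (Cyl.emb z)) y : E5 →L[ℝ] ℝ) =
      (dehnB k ε (Cyl.emb y)).comp (Cyl.demb y) := by
    rw [h1, canForm_eq, Cyl.cov_ambForm, dehnB, ContinuousLinearMap.sub_comp,
      ContinuousLinearMap.smul_comp]
    rfl
  exact h2

theorem cov_canForm_apply (y : Cyl) (u : E5) :
    cov canForm y u = (Cyl.demb y u).1 + ⟪y.2.p, (Cyl.demb y u).2.1⟫_ℝ := by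
  rw [canForm_eq]; rfl

theorem cov_dehnForm_apply (k : ℤ) {ε : ℝ} (hε : 0 < ε) (y : Cyl) (u : E5) :
    cov (dehnForm k ε) y u = (Cyl.demb y u).1 + ⟪y.2.p, (Cyl.demb y u).2.1⟫_ℝ -
      y.1 * deriv (twistAngle k ε) ‖y.2.p‖ * ⟪y.2.p, (Cyl.demb y u).2.2⟫_ℝ := by
  rw [dehnForm_eq k hε]
  exact dehnB_apply k hε _ _

/-- The exterior derivative of `dt + λ_can - t |p| df` in ambient coordinates. -/
theorem extD_dehnForm (k : ℤ) {ε : ℝ} (hε : 0 < ε) (y : Cyl) (u v : E5) :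
    extD (dehnForm k ε) y u v =
      ⟪(Cyl.demb y u).2.2, (Cyl.demb y v).2.1⟫_ℝ - ⟪(Cyl.demb y v).2.2, (Cyl.demb y u).2.1⟫_ℝ -
      deriv (twistAngle k ε) ‖y.2.p‖ * ((Cyl.demb y u).1 * ⟪y.2.p, (Cyl.demb y v).2.2⟫_ℝ -
        (Cyl.demb y v).1 * ⟪y.2.p, (Cyl.demb y u).2.2⟫_ℝ) := by
  rw [dehnForm_eq k hε, Cyl.extD_ambForm (((contDiff_dehnB k hε).differentiable (by simp)) _),
    flatD_dehnB k hε]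
  rfl

theorem formSmoothAt_canForm (y : Cyl) : FormSmoothAt canForm y := by
  rw [canForm_eq]
  exact Cyl.formSmoothAt_ambForm contDiff_canB.contDiffAt

theorem formSmoothAt_dehnForm (k : ℤ) {ε : ℝ} (hε : 0 < ε) (y : Cyl) :
    FormSmoothAt (dehnForm k ε) y := by
  rw [dehnForm_eq k hε]
  exact Cyl.formSmoothAt_ambForm (contDiff_dehnB k hε).contDiffAt

/-- The contact condition for `dt + λ_can - t |p| df` amounts to `|p|² f'(|p|) ≠ 1`. -/
theorem contactAt_dehnForm (k : ℤ) {ε : ℝ} (hε : 0 < ε) {y : Cyl}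
    (h : ‖y.2.p‖ ^ 2 * deriv (twistAngle k ε) ‖y.2.p‖ ≠ 1) : ContactAt (dehnForm k ε) y := by
  set f' := deriv (twistAngle k ε) ‖y.2.p‖ with hf'
  have hqp := y.2.inner_q_p
  have hpq : ⟪y.2.p, y.2.q⟫_ℝ = 0 := by rw [real_inner_comm]; exact hqp
  have hqq : ⟪y.2.q, y.2.q⟫_ℝ = 1 := by rw [real_inner_self_eq_norm_sq, y.2.norm_q]; norm_num
  have hpp : ⟪y.2.p, y.2.p⟫_ℝ = ‖y.2.p‖ ^ 2 := real_inner_self_eq_norm_sq _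
  refine ⟨fun h0 => ?_, fun u hu huv => ?_⟩
  · obtain ⟨u, hu⟩ := Cyl.exists_demb_eq (y := y) (w := (1, 0, 0)) (by simp [Cyl.mem_tangent])
    have := cov_dehnForm_apply k hε y u
    rw [h0, hu] at this
    simp at this
  · have ht := Cyl.demb_mem_tangent y u
    obtain ⟨t1, t2⟩ := Cyl.mem_tangent.1 ht
    rw [cov_dehnForm_apply k hε, ← hf'] at hu
    -- a vector `u` in the kernel of the form and of its exterior derivative is tested against
    -- explicit tangent vectors `w` in the kernel of the form
    have test : ∀ w : Amb, w ∈ Cyl.tangent y →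
        w.1 + ⟪y.2.p, w.2.1⟫_ℝ - y.1 * f' * ⟪y.2.p, w.2.2⟫_ℝ = 0 →
        ⟪(Cyl.demb y u).2.2, w.2.1⟫_ℝ - ⟪w.2.2, (Cyl.demb y u).2.1⟫_ℝ -
          f' * ((Cyl.demb y u).1 * ⟪y.2.p, w.2.2⟫_ℝ -
          w.1 * ⟪y.2.p, (Cyl.demb y u).2.2⟫_ℝ) = 0 := by
      intro w hw hw0
      obtain ⟨v, rfl⟩ := Cyl.exists_demb_eq hw
      have := huv v (by rw [cov_dehnForm_apply k hε]; exact hw0)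
      rwa [extD_dehnForm k hε] at this
    apply Cyl.demb_injective y
    rw [map_zero]
    clear ht huv
    generalize Cyl.demb y u = w at t1 t2 hu test ⊢
    obtain ⟨τ, a, b⟩ := w
    simp only at t1 t2 hu test
    have c1 := real_inner_comm y.2.p a
    have c2 := real_inner_comm y.2.p b
    have c3 := real_inner_comm y.2.q a
    have c4 := real_inner_comm y.2.q b
    by_cases hp : y.2.p = 0
    · simp only [hp, inner_zero_left, zero_add, add_zero, mul_zero, sub_zero] at t2 hu test
      -- on the zero-section the kernel of the form is `dt = 0`
      have e1 := test (0, b, 0) (by simp [Cyl.mem_tangent, hp, t2]) (by simp)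
      have e2 := test (0, 0, a) (by simp [Cyl.mem_tangent, hp, t1]) (by simp)
      simp at e1 e2
      simp [e1, e2, hu]
    · have hp2 : ‖y.2.p‖ ^ 2 ≠ 0 := pow_ne_zero 2 (norm_ne_zero_iff.2 hp)
      -- the components of the tangent vector orthogonal to `q` and `p` vanish
      have e1 := test (0, b + ⟪y.2.p, a⟫_ℝ • y.2.q - (⟪y.2.p, b⟫_ℝ / ‖y.2.p‖ ^ 2) • y.2.p, 0) (by
          simp only [Cyl.mem_tangent, inner_sub_right, inner_add_right, inner_smul_right, hqp, hpq,
            hqq, hpp, inner_zero_right]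
          refine ⟨?_, ?_⟩
          · linear_combination t2
          · field_simp; ring) (by
          simp only [inner_sub_right, inner_add_right, inner_smul_right, hpq, hpp,
            inner_zero_right]
          field_simp; ring)
      have e2 := test (0, 0, a - (⟪y.2.p, a⟫_ℝ / ‖y.2.p‖ ^ 2) • y.2.p) (by
          simp only [Cyl.mem_tangent, inner_sub_right, inner_smul_right, hqp, inner_zero_right]
          exact ⟨trivial, by linear_combination t1⟩) (by
          simp only [inner_sub_right, inner_smul_right, hpp, inner_zero_right]
          field_simp; ring)
      -- the remaining two test vectors lie in the plane spanned by the geodesic and the radial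
      -- direction, where the condition on `f'` enters
      have e3 := test (-‖y.2.p‖ ^ 2, y.2.p, (-‖y.2.p‖ ^ 2) • y.2.q) (by
          simp only [Cyl.mem_tangent, inner_smul_right, hqp, hpp, hqq]
          exact ⟨trivial, by ring⟩) (by
          simp only [inner_smul_right, hpp, hpq]; ring)
      have e4 := test (y.1 * f' * ‖y.2.p‖ ^ 2, 0, y.2.p) (by
          simp [Cyl.mem_tangent, hqp]) (by
          simp only [hpp, inner_zero_right]; ring)
      simp only [inner_smul_right, inner_smul_left, inner_zero_right, inner_sub_left,
        inner_sub_right, inner_add_right, hpp, hpq, inner_zero_left,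
        conj_trivial, t1] at e1 e2 e3 e4
      have hb : ⟪y.2.p, b⟫_ℝ = 0 := by
        have : ⟪y.2.p, b⟫_ℝ * (1 - ‖y.2.p‖ ^ 2 * f') = 0 := by linear_combination e3 - c2
        exact (mul_eq_zero.1 this).resolve_right (sub_ne_zero.2 h.symm)
      have ha : ⟪y.2.p, a⟫_ℝ = 0 := by
        have : ⟪y.2.p, a⟫_ℝ * (1 - ‖y.2.p‖ ^ 2 * f') = 0 := by
          rw [hb] at e4 hu
          linear_combination (-1) * e4 - f' * ‖y.2.p‖ ^ 2 * hu
        exact (mul_eq_zero.1 this).resolve_right (sub_ne_zero.2 h.symm)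
      have hτ : τ = 0 := by rw [ha, hb] at hu; linarith
      have hb0 : b = 0 := by
        rw [ha, hb] at e1
        simpa using e1
      have ha0 : a = 0 := by
        rw [ha, hb] at e2
        simpa using e2
      simp [hτ, ha0, hb0]

/-- For `k = 0` the angle vanishes, so that results on `dehnForm` cover `canForm`. -/
theorem canForm_eq_dehnForm : canForm = dehnForm 0 1 := by
  have : (fun z : Cyl => twistAngle 0 1 ‖z.2.p‖) = fun _ => 0 := by
    ext z; simp [twistAngle]
  funext y
  have h0 : dMap (fun _ : Cyl => (0 : ℝ)) y = 0 := mfderiv_const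
  rw [dehnForm, this, h0, smul_zero, sub_zero]

theorem contactAt_canForm (y : Cyl) : ContactAt canForm y := by
  have h1 : twistAngle 0 1 = fun _ => 0 := by ext r; simp [twistAngle]
  rw [canForm_eq_dehnForm]
  exact contactAt_dehnForm 0 one_pos (by simp [h1])

/-! ### Invariance of the contact form -/

/-- Rotations preserve the form, because they preserve inner products. -/
theorem cov_pullback_smul_dehnForm (k : ℤ) {ε : ℝ} (hε : 0 < ε) (g : SO3) (y : Cyl) :
    cov (pullback (fun z : Cyl => g • z) (dehnForm k ε)) y = cov (dehnForm k ε) y := by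
  have hA : HasFDerivAt (fun w : Amb => ((w.1, rotVec g w.2.1, rotVec g w.2.2) : Amb))
      ((ContinuousLinearMap.id ℝ ℝ).prodMap ((rotL g).prodMap (rotL g))) (Cyl.emb y) :=
    ContinuousLinearMap.hasFDerivAt
      ((ContinuousLinearMap.id ℝ ℝ).prodMap ((rotL g).prodMap (rotL g)))
  ext u
  rw [cov_pullback, ContinuousLinearMap.comp_apply, cov_dehnForm_apply k hε,
    cov_dehnForm_apply k hε, Cyl.demb_mder (F := fun z : Cyl => g • z)
    ((isSmoothAction_cyl.contMDiff_smul g y).mdifferentiableAt (by simp)) hA.differentiableAt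
    (Filter.Eventually.of_forall fun z => rfl), hA.fderiv]
  simp only [Cyl.smul_p]
  change (Cyl.demb y u).1 + ⟪rotVec g y.2.p, rotVec g (Cyl.demb y u).2.1⟫_ℝ -
    y.1 * _ * ⟪rotVec g y.2.p, rotVec g (Cyl.demb y u).2.2⟫_ℝ = _
  rw [inner_rotVec, inner_rotVec, norm_rotVec]

theorem cov_pullback_smul_canForm (g : SO3) (y : Cyl) :
    cov (pullback (fun z : Cyl => g • z) canForm) y = cov canForm y := by
  rw [canForm_eq_dehnForm]
  exact cov_pullback_smul_dehnForm 0 one_pos g y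

/-- For `|p| > ε` the angle is constant. -/
theorem dehnForm_eq_canForm {k : ℤ} {ε : ℝ} (hε : 0 < ε) {y : Cyl} (h : ε < ‖y.2.p‖) :
    cov (dehnForm k ε) y = cov canForm y := by
  have : deriv (twistAngle k ε) ‖y.2.p‖ = 0 := by
    have : twistAngle k ε =ᶠ[nhds ‖y.2.p‖] fun _ => Real.pi * k * 2 := by
      filter_upwards [lt_mem_nhds h] with r hr
      have h1 : ¬ r ≤ ε / 2 := by linarith
      have h2 : ¬ r < ε := by linarith
      simp only [twistAngle, rho, h1, h2, if_false]
      ring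
    rw [this.deriv_eq, deriv_const]
  ext u
  rw [cov_dehnForm_apply k hε, cov_canForm_apply, this]
  ring

/-- The Dehn twist changes the canonical form by `|p| df`: the infinitesimal version of
`τ_k^* λ_can = λ_can + |p| df`, for tangent vectors of `ℝ × T^*S²`. -/
theorem inner_fderiv_twistFun (k : ℤ) {ε : ℝ} (hε : 0 < ε) (y : Cyl) {w : Amb}
    (hw : w ∈ Cyl.tangent y) :
    ⟪(twistFun k ε y.2.1).2, (fderiv ℝ (twistFun k ε) y.2.1 w.2).1⟫_ℝ =
      ⟪y.2.p, w.2.1⟫_ℝ + ‖y.2.p‖ * fderiv ℝ (angle k ε) (Cyl.emb y) w := by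
  obtain ⟨t1, t2⟩ := Cyl.mem_tangent.1 hw
  have hd : HasFDerivAt (fun v : Amb => (twistFun k ε v.2).1)
      ((ContinuousLinearMap.fst ℝ E3 E3).comp ((fderiv ℝ (twistFun k ε) y.2.1).comp
        (ContinuousLinearMap.snd ℝ ℝ (E3 × E3)))) (Cyl.emb y) := by
    have h1 : HasFDerivAt (twistFun k ε) (fderiv ℝ (twistFun k ε) y.2.1) (Cyl.emb y).2 :=
      (((contDiff_twistFun k hε).differentiable (by simp)) _).hasFDerivAt
    exact (h1.comp (Cyl.emb y) (ContinuousLinearMap.snd ℝ ℝ (E3 × E3)).hasFDerivAt).fst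
  have hq : HasFDerivAt (fun v : Amb => v.2.1) dq (Cyl.emb y) := dq.hasFDerivAt
  have hp : HasFDerivAt (fun v : Amb => v.2.2) dp (Cyl.emb y) := dp.hasFDerivAt
  by_cases hp0 : y.2.p = 0
  · have : (twistFun k ε y.2.1).2 = 0 := by
      have := (geod_mem y.2.2 (twist_h0 k hε y.2.1)).2
      change ‖(twistFun k ε y.2.1).2‖ = ‖y.2.p‖ at this
      rw [hp0, norm_zero] at this
      exact norm_eq_zero.1 this
    rw [this, hp0]
    simp
  · have hr : ‖y.2.p‖ ≠ 0 := norm_ne_zero_iff.2 hp0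
    obtain ⟨l, hl, hlv⟩ := exists_hasFDerivAt_norm (w := Cyl.emb y) hp0
    have hG := hasFDerivAt_angle k hε hl
    have hGd : HasFDerivAt (angle k ε) (fderiv ℝ (angle k ε) (Cyl.emb y)) (Cyl.emb y) := by
      rw [hG.fderiv]; exact hG
    set dG := fderiv ℝ (angle k ε) (Cyl.emb y)
    set θ := angle k ε (Cyl.emb y) with hθ
    set c : Amb → ℝ := fun v => Real.sin (angle k ε v) * ‖v.2.2‖⁻¹ with hc
    have hcd : DifferentiableAt ℝ c (Cyl.emb y) :=
      hGd.sin.differentiableAt.mul (hl.differentiableAt.inv hr)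
    have hcv : c (Cyl.emb y) = Real.sin θ / ‖y.2.p‖ := rfl
    -- the derivative of `sin f / |p|`, from the product rule
    have hcl : fderiv ℝ c (Cyl.emb y) w * ‖y.2.p‖ + c (Cyl.emb y) * l w = Real.cos θ * dG w := by
      have h1 : (c * fun v : Amb => ‖v.2.2‖) =ᶠ[nhds (Cyl.emb y)]
          fun v => Real.sin (angle k ε v) := by
        filter_upwards [hl.continuousAt.eventually_ne hr] with v hv
        simp [hc, hv]
      have h2 := (hcd.hasFDerivAt.mul hl).congr_of_eventuallyEq h1.symm
      have h3 := DFunLike.congr_fun (h2.unique hGd.sin) w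
      simp at h3
      change c (Cyl.emb y) * l w + ‖y.2.p‖ * _ = _ at h3
      linarith
    have hd' : HasFDerivAt (fun v : Amb => (twistFun k ε v.2).1) _ (Cyl.emb y) :=
      (hGd.cos.smul hq).add (hcd.hasFDerivAt.smul hp)
    have e := DFunLike.congr_fun (hd.unique hd') w
    have e1 : (fderiv ℝ (twistFun k ε) y.2.1 w.2).1 = Real.cos θ • w.2.1 -
        (Real.sin θ * dG w) • y.2.q + (c (Cyl.emb y) • w.2.2 +
          fderiv ℝ c (Cyl.emb y) w • y.2.p) := by
      refine e.trans ?_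
      simp [hθ, Cyl.emb, sub_eq_add_neg]
    have e2 : (twistFun k ε y.2.1).2 = Real.cos θ • y.2.p - (‖y.2.p‖ * Real.sin θ) • y.2.q := rfl
    have hqp := y.2.inner_q_p
    have hpq : ⟪y.2.p, y.2.q⟫_ℝ = 0 := by rw [real_inner_comm]; exact hqp
    have hqq : ⟪y.2.q, y.2.q⟫_ℝ = 1 := by rw [real_inner_self_eq_norm_sq, y.2.norm_q]; norm_num
    have hpp : ⟪y.2.p, y.2.p⟫_ℝ = ‖y.2.p‖ ^ 2 := real_inner_self_eq_norm_sq _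
    have hlw : ‖y.2.p‖ * l w = ⟪y.2.p, w.2.2⟫_ℝ := hlv w
    have sc := Real.sin_sq_add_cos_sq θ
    rw [e1, e2]
    simp only [inner_sub_left, inner_sub_right, inner_add_right, inner_smul_left, inner_smul_right,
      hqp, hpq, hqq, hpp, conj_trivial, t1, ← hlw]
    have hs : ‖y.2.p‖ * c (Cyl.emb y) = Real.sin θ := by rw [hcv]; field_simp
    have t3 : ⟪y.2.q, w.2.2⟫_ℝ = -⟪y.2.p, w.2.1⟫_ℝ := by linarith
    rw [t3]
    linear_combination (⟪y.2.p, w.2.1⟫_ℝ + ‖y.2.p‖ * dG w) * sc +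
      (Real.cos θ * ‖y.2.p‖) * hcl + Real.sin θ * ⟪y.2.p, w.2.1⟫_ℝ * hs

/-- The form is invariant under `(t; x) ↦ (t + 1; τ_k x)`: the term `|p| df` in `τ_k^* λ_can` is
compensated by the change of `t`. -/
theorem cov_pullback_shift_one (k : ℤ) {ε : ℝ} (hε : 0 < ε) (y : Cyl) :
    cov (pullback ((dehnTwist k ε hε).shift 1) (dehnForm k ε)) y = cov (dehnForm k ε) y := by
  set F := (dehnTwist k ε hε).shift 1 with hF
  have hS : HasFDerivAt (fun v : Amb => ((v.1 + 1, twistFun k ε v.2) : Amb))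
      (dt.prod ((fderiv ℝ (twistFun k ε) y.2.1).comp (ContinuousLinearMap.snd ℝ ℝ (E3 × E3))))
      (Cyl.emb y) := by
    have h1 : HasFDerivAt (twistFun k ε) (fderiv ℝ (twistFun k ε) y.2.1) (Cyl.emb y).2 :=
      (((contDiff_twistFun k hε).differentiable (by simp)) _).hasFDerivAt
    exact (dt.hasFDerivAt.add_const 1).prodMk
      (h1.comp (Cyl.emb y) (ContinuousLinearMap.snd ℝ ℝ (E3 × E3)).hasFDerivAt)
  have hFe : ∀ z : Cyl, Cyl.emb (F z) = (z.1 + 1, twistFun k ε z.2.1) := fun z => by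
    rw [hF, MappingTorus.shift_one]; rfl
  have hFd : MDifferentiableAt (𝓡 5) (𝓡 5) F y :=
    ((dehnTwist k ε hε).contMDiff_shift 1 y).mdifferentiableAt (by simp)
  ext u
  have h1 : Cyl.demb (F y) (mder (𝓡 5) (𝓡 5) F y u) = ((Cyl.demb y u).1,
      fderiv ℝ (twistFun k ε) y.2.1 (Cyl.demb y u).2) := by
    rw [Cyl.demb_mder hFd hS.differentiableAt (Filter.Eventually.of_forall hFe), hS.fderiv]
    rfl
  have hAd : ∀ w, DifferentiableAt ℝ (angle k ε) w :=
    fun w => (contDiff_angle k hε).differentiable (by simp) w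
  have hn : ∀ z : Cyl, ‖(twistFun k ε z.2.1).2‖ = ‖z.2.p‖ :=
    fun z => (geod_mem z.2.2 (twist_h0 k hε z.2.1)).2
  -- the Dehn twist preserves `|p|`, hence `df`
  have h2 : fderiv ℝ (angle k ε) (Cyl.emb (F y)) (Cyl.demb (F y) (mder (𝓡 5) (𝓡 5) F y u)) =
      fderiv ℝ (angle k ε) (Cyl.emb y) (Cyl.demb y u) := by
    have e1 := Cyl.mder_comp_emb (y := F y) (hAd _)
    have e2 := Cyl.mder_comp_emb (y := y) (hAd _)
    have e3 : (fun z : Cyl => angle k ε (Cyl.emb z)) =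
        fun z => angle k ε (Cyl.emb (F z)) := by
      ext z
      rw [hFe]
      simp only [angle, hn]
      rfl
    rw [e3] at e2
    have e4 := mder_comp (I'' := 𝓘(ℝ, ℝ)) (G := fun z : Cyl => angle k ε (Cyl.emb z)) (F := F)
      (x := y) ((hAd _).mdifferentiableAt.comp (F y) (Cyl.mdifferentiableAt_emb (F y))) hFd
    rw [e2, e1] at e4
    exact (DFunLike.congr_fun e4 u).symm
  have h3 := inner_fderiv_twistFun k hε y (Cyl.demb_mem_tangent y u)
  rw [cov_pullback, ContinuousLinearMap.comp_apply, dehnForm_eq k hε, Cyl.cov_ambForm,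
    Cyl.cov_ambForm, ContinuousLinearMap.comp_apply, ContinuousLinearMap.comp_apply, dehnB, dehnB,
    sub_apply, sub_apply, smul_apply, smul_apply, h2, canB_apply, canB_apply, h1, hFe]
  simp only [hn]
  rw [h3]
  simp only [smul_eq_mul, Cyl.emb]
  ring

/-! ### Smallness of `ε` -/

theorem rhoSmooth_nonneg (ε x : ℝ) : 0 ≤ rhoSmooth ε x :=
  mul_nonneg (expNegInvGlue.nonneg _) (expNegInvGlue.nonneg _)

theorem expNegInvGlue_le_one (x : ℝ) : expNegInvGlue x ≤ 1 := by
  unfold expNegInvGlue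
  split_ifs with h
  · exact zero_le_one
  · rw [Real.exp_le_one_iff]
    have := inv_pos.2 (not_le.1 h)
    linarith

theorem rhoSmooth_le_one (ε x : ℝ) : rhoSmooth ε x ≤ 1 :=
  mul_le_one₀ (expNegInvGlue_le_one _) (expNegInvGlue.nonneg _) (expNegInvGlue_le_one _)

/-- Scaling the bump of width `ε / 2` to the one of width `1 / 2`. -/
theorem integral_rhoSmooth {ε : ℝ} (hε : 0 < ε) :
    ∫ x in (ε / 2)..ε, rhoSmooth ε x = ε * ∫ x in (1 / 2 : ℝ)..1, rhoSmooth 1 x := by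
  have h := intervalIntegral.mul_integral_comp_mul_left (f := rhoSmooth ε) (a := 1 / 2) (b := 1) ε
  have e : ∀ x, rhoSmooth ε (ε * x) = rhoSmooth 1 x := by
    intro x
    unfold rhoSmooth
    congr 2 <;> field_simp
  simp only [e, mul_one, mul_one_div] at h
  rw [h]

/-- The derivative of the angle: it is of order `1 / ε`, supported in `r ≤ ε`. -/
theorem deriv_twistAngle (k : ℤ) {ε : ℝ} (hε : 0 < ε) (r : ℝ) :
    deriv (twistAngle k ε) r =
      Real.pi * k * ((ε * ∫ x in (1 / 2 : ℝ)..1, rhoSmooth 1 x)⁻¹ * rhoSmooth ε r) := by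
  have hd : HasDerivAt (fun r => ∫ x in (ε / 2)..r, rhoSmooth ε x) (rhoSmooth ε r) r :=
    ((contDiff_rhoSmooth ε).continuous).integral_hasStrictDerivAt _ _ |>.hasDerivAt
  have h1 := ((hd.const_mul (∫ x in (ε / 2)..ε, rhoSmooth ε x)⁻¹).const_add 1).const_mul
    (Real.pi * k)
  have e : twistAngle k ε = fun r => Real.pi * k * (1 + (∫ x in (ε / 2)..ε, rhoSmooth ε x)⁻¹ *
      ∫ x in (ε / 2)..r, rhoSmooth ε x) := by
    ext r
    rw [twistAngle, rho_eq hε]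
  rw [e, h1.deriv, integral_rhoSmooth hε]

/-- The bound for `ε` below which the form on the mapping torus is a contact form. -/
def epsBound (k : ℤ) : ℝ := (∫ x in (1 / 2 : ℝ)..1, rhoSmooth 1 x) / (Real.pi * (|(k : ℝ)| + 1))

theorem epsBound_pos (k : ℤ) : 0 < epsBound k := by
  have := integral_rhoSmooth_pos one_pos
  have := Real.pi_pos
  unfold epsBound
  positivity

/-- For small `ε` the derivative of the angle, which is of order `1 / ε` and supported in `r ≤ ε`,
is too small for `r² f'(r) = 1`. -/
theorem sq_mul_deriv_twistAngle_ne_one (k : ℤ) {ε : ℝ} (hε : 0 < ε) (h : ε < epsBound k) {r : ℝ}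
    (hr : 0 ≤ r) : r ^ 2 * deriv (twistAngle k ε) r ≠ 1 := by
  have hI : 0 < ∫ x in (1 / 2 : ℝ)..1, rhoSmooth 1 x := integral_rhoSmooth_pos one_pos
  rw [deriv_twistAngle k hε]
  unfold epsBound at h
  set I := ∫ x in (1 / 2 : ℝ)..1, rhoSmooth 1 x
  rcases lt_or_ge ε r with h1 | h1
  · have : rhoSmooth ε r = 0 := by
      rw [rhoSmooth, expNegInvGlue.zero_of_nonpos (x := 2 * (ε - r) / ε), mul_zero]
      exact div_nonpos_of_nonpos_of_nonneg (by linarith) hε.le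
    rw [this]
    simp
  · have hk : (0 : ℝ) < |(k : ℝ)| + 1 := by positivity
    have hpi := Real.pi_pos
    rw [lt_div_iff₀ (by positivity)] at h
    intro he
    have e1 : r ^ 2 * (Real.pi * k * rhoSmooth ε r) = ε * I := by
      field_simp at he
      linarith
    have a0 := rhoSmooth_nonneg ε r
    have a1 := rhoSmooth_le_one ε r
    have a2 : r ^ 2 ≤ ε ^ 2 := by gcongr
    have a3 : r ^ 2 * rhoSmooth ε r ≤ ε ^ 2 * 1 := by gcongr
    have a4 : (k : ℝ) ≤ |(k : ℝ)| + 1 := by linarith [le_abs_self (k : ℝ)]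
    have a5 : r ^ 2 * (Real.pi * k * rhoSmooth ε r) ≤ ε ^ 2 * (Real.pi * (|(k : ℝ)| + 1)) := by
      calc r ^ 2 * (Real.pi * k * rhoSmooth ε r)
          = (r ^ 2 * rhoSmooth ε r) * (Real.pi * k) := by ring
        _ ≤ (r ^ 2 * rhoSmooth ε r) * (Real.pi * (|(k : ℝ)| + 1)) := by gcongr
        _ ≤ ε ^ 2 * 1 * (Real.pi * (|(k : ℝ)| + 1)) := by gcongr
        _ = _ := by ring
    nlinarith

/-! ### The contact form on the mapping torus -/

section TorusForm

variable (k : ℤ) {ε : ℝ} (hε : 0 < ε)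

/-- The form is invariant under all powers of `(t; x) ↦ (t + 1; τ_k x)`. -/
theorem cov_pullback_shift (n : ℤ) (y : Cyl) :
    cov (pullback ((dehnTwist k ε hε).shift n) (dehnForm k ε)) y = cov (dehnForm k ε) y := by
  set τ := dehnTwist k ε hε
  have hd : ∀ n z, MDifferentiableAt (𝓡 5) (𝓡 5) (τ.shift n) z :=
    fun n z => (τ.contMDiff_shift n z).mdifferentiableAt (by simp)
  have hadd : ∀ m n z, cov (pullback (τ.shift (m + n)) (dehnForm k ε)) z =
      (cov (pullback (τ.shift m) (dehnForm k ε)) (τ.shift n z)).comp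
        (mder (𝓡 5) (𝓡 5) (τ.shift n) z) := by
    intro m n z
    have e : τ.shift (m + n) = fun z => τ.shift m (τ.shift n z) := funext (τ.shift_add m n)
    rw [e, pullback_comp _ (hd _ _) (hd _ _), cov_pullback]
  have h0 : ∀ z, cov (pullback (τ.shift 0) (dehnForm k ε)) z = cov (dehnForm k ε) z := by
    intro z
    rw [pullback_congr (G := fun z => z) _ (Filter.Eventually.of_forall τ.shift_zero), pullback_id]
  have hm1 : ∀ z, cov (pullback (τ.shift (-1)) (dehnForm k ε)) z = cov (dehnForm k ε) z := by
    intro z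
    have h := hadd 1 (-1) z
    rw [cov_pullback_shift_one, add_neg_cancel, h0] at h
    rw [h, cov_pullback]
  induction n using Int.induction_on generalizing y with
  | zero => exact h0 y
  | succ i ih => rw [add_comm, hadd, cov_pullback_shift_one, ← cov_pullback, ih]
  | pred i ih => rw [sub_eq_add_neg, add_comm, hadd, hm1, ← cov_pullback, ih]

/-- The value at a point of the form induced on the mapping torus by `dt + λ_can - t |p| df`,
computed at a chosen preimage. -/
def torusCov (x : MappingTorus (dehnTwist k ε hε)) : E5 →L[ℝ] ℝ :=
  (cov (dehnForm k ε) (MappingTorus.mk_surjective _ x).choose).comp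
    (Ring.inverse (mder (𝓡 5) (𝓡 5) (MappingTorus.mk (dehnTwist k ε hε))
      (MappingTorus.mk_surjective _ x).choose))

/-- The form induced on the mapping torus by `dt + λ_can - t |p| df`. -/
def torusForm : OneForm (MappingTorus (dehnTwist k ε hε)) := torusCov k hε

/-- The form on the mapping torus pulls back to the form on `ℝ × T^*S²`, independently of the chosen
preimages. -/
theorem cov_pullback_torusForm (y : Cyl) :
    cov (pullback (MappingTorus.mk (dehnTwist k ε hε)) (torusForm k hε)) y =
      cov (dehnForm k ε) y := by
  set τ := dehnTwist k ε hε
  set y₀ := (MappingTorus.mk_surjective _ (MappingTorus.mk τ y)).choose with hy₀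
  have h0 : MappingTorus.mk τ y₀ = MappingTorus.mk τ y :=
    (MappingTorus.mk_surjective _ (MappingTorus.mk τ y)).choose_spec
  obtain ⟨n, hn⟩ := (MappingTorus.mk_eq_iff τ).1 h0.symm
  have hb := mder_bijective (MappingTorus.isLocalDiffeomorph_mk τ y₀)
  -- the derivative of the projection is invertible, so that `Ring.inverse` is its actual inverse
  have hu : IsUnit (mder (𝓡 5) (𝓡 5) (MappingTorus.mk τ) y₀) := by
    let e := ContinuousLinearEquiv.ofBijective (mder (𝓡 5) (𝓡 5) (MappingTorus.mk τ) y₀)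
      (LinearMap.ker_eq_bot.2 hb.1) (LinearMap.range_eq_top.2 hb.2)
    exact ⟨ContinuousLinearEquiv.toUnit e, by ext v; rfl⟩
  have e1 : cov (torusForm k hε) (MappingTorus.mk τ y) = (cov (dehnForm k ε) y₀).comp
      (Ring.inverse (mder (𝓡 5) (𝓡 5) (MappingTorus.mk τ) y₀)) := rfl
  -- `y` and the chosen representative `y₀` differ by a shift, which preserves the form
  have e2 : mder (𝓡 5) (𝓡 5) (MappingTorus.mk τ) y =
      (mder (𝓡 5) (𝓡 5) (MappingTorus.mk τ) y₀).comp (mder (𝓡 5) (𝓡 5) (τ.shift n) y) := by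
    have h := mder_comp (I'' := 𝓡 5) (G := MappingTorus.mk τ) (F := τ.shift n) (x := y)
      ((MappingTorus.isLocalDiffeomorph_mk τ).contMDiff.mdifferentiable (by simp) _)
      ((τ.contMDiff_shift n y).mdifferentiableAt (by simp))
    rw [hn, ← h]
    exact mder_congr (Filter.Eventually.of_forall fun z => (MappingTorus.mk_shift τ n z).symm)
  have e3 := Ring.inverse_mul_cancel _ hu
  rw [cov_pullback, e1, e2, ContinuousLinearMap.comp_assoc, ← ContinuousLinearMap.comp_assoc _ _
    (mder (𝓡 5) (𝓡 5) (τ.shift n) y)]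
  change (cov (dehnForm k ε) y₀).comp ((Ring.inverse (mder (𝓡 5) (𝓡 5) (MappingTorus.mk τ) y₀) *
    mder (𝓡 5) (𝓡 5) (MappingTorus.mk τ) y₀).comp _) = _
  rw [e3]
  refine Eq.trans ?_ (cov_pullback_shift k hε n y)
  rw [cov_pullback, ← hn]
  rfl

theorem pullback_torusForm :
    pullback (MappingTorus.mk (dehnTwist k ε hε)) (torusForm k hε) = dehnForm k ε :=
  funext fun y => cov_pullback_torusForm k hε y

theorem formSmoothAt_torusForm (x : MappingTorus (dehnTwist k ε hε)) :
    FormSmoothAt (torusForm k hε) x := by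
  obtain ⟨y, rfl⟩ := MappingTorus.mk_surjective _ x
  refine FormSmoothAt.of_pullback (MappingTorus.isLocalDiffeomorph_mk _ y) ?_
  rw [pullback_torusForm]
  exact formSmoothAt_dehnForm k hε y

theorem cov_pullback_smul_torusForm (g : SO3) (x : MappingTorus (dehnTwist k ε hε)) :
    cov (pullback (fun z => g • z) (torusForm k hε)) x = cov (torusForm k hε) x := by
  obtain ⟨y, rfl⟩ := MappingTorus.mk_surjective _ x
  exact invariant_at isSmoothAction_cyl MappingTorus.isSmoothAction
    (MappingTorus.isLocalDiffeomorph_mk _ y) ((MappingTorus.isLocalDiffeomorph_mk _).contMDiff _)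
    (Filter.Eventually.of_forall fun z => rfl) (cov_pullback_torusForm k hε y)
    (cov_pullback_torusForm k hε _) (cov_pullback_smul_dehnForm k hε g y)

theorem contactAt_torusForm (h : ε < epsBound k) (x : MappingTorus (dehnTwist k ε hε)) :
    ContactAt (torusForm k hε) x := by
  obtain ⟨y, rfl⟩ := MappingTorus.mk_surjective _ x
  refine ContactAt.of_pullback (formSmoothAt_torusForm k hε _)
    ((MappingTorus.isLocalDiffeomorph_mk _).contMDiff _)
    (mder_bijective (MappingTorus.isLocalDiffeomorph_mk _ y)).2 ?_
  rw [pullback_torusForm]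
  exact contactAt_dehnForm k hε (sq_mul_deriv_twistAngle_ne_one k hε h (norm_nonneg _))

theorem isContactSO3_torusForm (h : ε < epsBound k) : IsContactSO3 (torusForm k hε) where
  smooth_action := MappingTorus.isSmoothAction
  smooth_form := isSmoothForm_of_formSmoothAt (formSmoothAt_torusForm k hε)
  invariant g := funext fun x => cov_pullback_smul_torusForm k hε g x
  contact := contactAt_torusForm k hε h

end TorusForm

/-! ### Gluing two manifolds along open sets -/

/-- Data for gluing the open part `U₂` of `N` to the open part `U₁` of `M`: the points `y` of
`V ⊆ U₂` are to be identified with `θ y`.  The condition `separated` makes the result Hausdorff. -/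
structure GluingData (M N : Type*) [TopologicalSpace M] [ChartedSpace E5 M] [MulAction SO3 M]
    [TopologicalSpace N] [ChartedSpace E5 N] [MulAction SO3 N] where
  U₁ : Set M
  U₂ : Set N
  V : Set N
  θ : N → M
  isOpen₁ : IsOpen U₁
  isOpen₂ : IsOpen U₂
  isOpenV : IsOpen V
  subset : V ⊆ U₂
  nonempty : V.Nonempty
  mapsTo : ∀ y ∈ V, θ y ∈ U₁
  injOn : Set.InjOn θ V
  localDiffeo : IsLocalDiffeomorphOn (𝓡 5) (𝓡 5) ∞ θ V
  separated : ∀ x ∈ U₁, ∀ y ∈ U₂, (y ∈ V → x ≠ θ y) → ∃ (A : Set M) (B : Set N),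
    IsOpen A ∧ IsOpen B ∧ x ∈ A ∧ y ∈ B ∧ ∀ z ∈ B, z ∈ V → θ z ∉ A
  smul₁ : ∀ (g : SO3), ∀ x ∈ U₁, g • x ∈ U₁
  smul₂ : ∀ (g : SO3), ∀ y ∈ U₂, g • y ∈ U₂
  smulV : ∀ (g : SO3), ∀ y ∈ V, g • y ∈ V
  equivariant : ∀ (g : SO3), ∀ y ∈ V, θ (g • y) = g • θ y

/-- Local diffeomorphisms are open maps. -/
theorem isOpen_image_of_isLocalDiffeomorphOn {M N : Type*} [TopologicalSpace M] [ChartedSpace E5 M]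
    [TopologicalSpace N] [ChartedSpace E5 N] {F : M → N} {V B : Set M}
    (h : IsLocalDiffeomorphOn (𝓡 5) (𝓡 5) ∞ F V) (hB : IsOpen B) (hBV : B ⊆ V) :
    IsOpen (F '' B) := by
  rw [isOpen_iff_mem_nhds]
  rintro _ ⟨x, hx, rfl⟩
  obtain ⟨G, h1, h2, h3, -⟩ := exists_local_inverse (h ⟨x, hBV hx⟩)
  have h4 : G (F x) ∈ B := by rw [h1]; exact hx
  filter_upwards [h3, h2.continuousAt.preimage_mem_nhds (hB.mem_nhds h4)] with y hy hy'
  exact ⟨G y, hy', hy⟩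

namespace GluingData

variable {M N : Type*} [TopologicalSpace M] [ChartedSpace E5 M] [MulAction SO3 M]
  [TopologicalSpace N] [ChartedSpace E5 N] [MulAction SO3 N] (D : GluingData M N)

/-- The glued space, as a set: the points of `U₁` and the points of `U₂` that are not identified
with points of `U₁`. -/
def Space : Type _ := {x // x ∈ D.U₁} ⊕ {y // y ∈ D.U₂ \ D.V}

/-- The inclusion of `U₁`. -/
def i₁ (x : {x // x ∈ D.U₁}) : D.Space := Sum.inl x

/-- The inclusion of the part of `U₂` that is not identified with a part of `U₁`. -/
def i₃ (y : {y // y ∈ D.U₂ \ D.V}) : D.Space := Sum.inr y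

open Classical in
/-- The map from `U₂` to the glued space: `θ` on `V` and the inclusion on the rest. -/
def i₂ (y : {y // y ∈ D.U₂}) : D.Space :=
  if h : y.1 ∈ D.V then D.i₁ ⟨D.θ y.1, D.mapsTo _ h⟩ else D.i₃ ⟨y.1, y.2, h⟩

theorem i₁_injective : Function.Injective D.i₁ := Sum.inl_injective

theorem i₂_of_mem {y : {y // y ∈ D.U₂}} (h : y.1 ∈ D.V) :
    D.i₂ y = D.i₁ ⟨D.θ y.1, D.mapsTo _ h⟩ := by
  unfold i₂; rw [dif_pos h]

theorem i₂_of_notMem {y : {y // y ∈ D.U₂}} (h : y.1 ∉ D.V) : D.i₂ y = D.i₃ ⟨y.1, y.2, h⟩ := by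
  unfold i₂; rw [dif_neg h]

theorem i₃_injective : Function.Injective D.i₃ := Sum.inr_injective

theorem i₁_ne_i₃ (x : {x // x ∈ D.U₁}) (y : {y // y ∈ D.U₂ \ D.V}) : D.i₁ x ≠ D.i₃ y :=
  Sum.inl_ne_inr

/-- Points of `U₁` and `U₂` become equal exactly if they are identified by `θ`. -/
theorem i₁_eq_i₂ {x : {x // x ∈ D.U₁}} {y : {y // y ∈ D.U₂}} :
    D.i₁ x = D.i₂ y ↔ y.1 ∈ D.V ∧ x.1 = D.θ y.1 := by
  by_cases h : y.1 ∈ D.V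
  · rw [D.i₂_of_mem h, D.i₁_injective.eq_iff, Subtype.ext_iff]
    simp [h]
  · rw [D.i₂_of_notMem h]
    simp [h, D.i₁_ne_i₃]

theorem i₂_injective : Function.Injective D.i₂ := by
  intro y y' h
  by_cases hy : y.1 ∈ D.V
  · rw [D.i₂_of_mem hy, i₁_eq_i₂] at h
    exact Subtype.ext (D.injOn hy h.1 h.2)
  · by_cases hy' : y'.1 ∈ D.V
    · rw [D.i₂_of_mem hy', eq_comm, i₁_eq_i₂] at h
      exact absurd h.1 hy
    · rw [D.i₂_of_notMem hy, D.i₂_of_notMem hy'] at h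
      have := D.i₃_injective h
      exact Subtype.ext (Subtype.mk.inj this)

/-- Every point of the glued space comes from `U₁` or from the rest of `U₂`. -/
theorem exists_rep (z : D.Space) : (∃ x, z = D.i₁ x) ∨ ∃ y, z = D.i₂ y ∧ y.1 ∉ D.V := by
  rcases z with x | y
  · exact Or.inl ⟨x, rfl⟩
  · exact Or.inr ⟨⟨y.1, y.2.1⟩, (D.i₂_of_notMem (y := ⟨y.1, y.2.1⟩) y.2.2).symm, y.2.2⟩

/-- A set is open if its preimages in `U₁` and `U₂` are. -/
instance : TopologicalSpace D.Space :=
  TopologicalSpace.coinduced D.i₁ inferInstance ⊔ TopologicalSpace.coinduced D.i₂ inferInstance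

theorem isOpen_iff {S : Set D.Space} : IsOpen S ↔ IsOpen (D.i₁ ⁻¹' S) ∧ IsOpen (D.i₂ ⁻¹' S) :=
  Iff.rfl

theorem continuous_i₁ : Continuous D.i₁ := continuous_def.2 fun _ h => (D.isOpen_iff.1 h).1
theorem continuous_i₂ : Continuous D.i₂ := continuous_def.2 fun _ h => (D.isOpen_iff.1 h).2

theorem continuousOn_θ : ContinuousOn D.θ D.V := fun y hy =>
  (D.localDiffeo ⟨y, hy⟩).contMDiffAt.continuousAt.continuousWithinAt

theorem isOpenEmbedding_i₁ : Topology.IsOpenEmbedding D.i₁ := by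
  refine .of_continuous_injective_isOpenMap D.continuous_i₁ D.i₁_injective fun A hA => ?_
  rw [isOpen_iff, Set.preimage_image_eq _ D.i₁_injective]
  refine ⟨hA, ?_⟩
  obtain ⟨A', hA', rfl⟩ := isOpen_induced_iff.1 hA
  have : D.i₂ ⁻¹' (D.i₁ '' (Subtype.val ⁻¹' A')) = Subtype.val ⁻¹' (D.V ∩ D.θ ⁻¹' A') := by
    ext y
    simp only [Set.mem_preimage, Set.mem_image, i₁_eq_i₂, Set.mem_inter_iff]
    constructor
    · rintro ⟨x, hx, h1, h2⟩
      exact ⟨h1, h2 ▸ hx⟩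
    · rintro ⟨h1, h2⟩
      exact ⟨⟨_, D.mapsTo _ h1⟩, h2, h1, rfl⟩
  rw [this]
  exact (D.continuousOn_θ.isOpen_inter_preimage D.isOpenV hA').preimage continuous_subtype_val

/-- The map `i₂` is open because `θ` is an open map on `V`. -/
theorem isOpenEmbedding_i₂ : Topology.IsOpenEmbedding D.i₂ := by
  refine .of_continuous_injective_isOpenMap D.continuous_i₂ D.i₂_injective fun B hB => ?_
  rw [isOpen_iff, Set.preimage_image_eq _ D.i₂_injective]
  refine ⟨?_, hB⟩
  obtain ⟨B', hB', rfl⟩ := isOpen_induced_iff.1 hB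
  have : D.i₁ ⁻¹' (D.i₂ '' (Subtype.val ⁻¹' B')) = Subtype.val ⁻¹' (D.θ '' (B' ∩ D.V)) := by
    ext x
    simp only [Set.mem_preimage, Set.mem_image]
    constructor
    · rintro ⟨y, hy, h⟩
      obtain ⟨h1, h2⟩ := D.i₁_eq_i₂.1 h.symm
      exact ⟨y.1, ⟨hy, h1⟩, h2.symm⟩
    · rintro ⟨y, ⟨h1, h2⟩, h3⟩
      exact ⟨⟨y, D.subset h2⟩, h1, (D.i₁_eq_i₂.2 ⟨h2, h3.symm⟩).symm⟩
  rw [this]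
  exact (isOpen_image_of_isLocalDiffeomorphOn D.localDiffeo (hB'.inter D.isOpenV)
    Set.inter_subset_right).preimage continuous_subtype_val

instance : Nonempty {y // y ∈ D.U₂} := ⟨⟨_, D.subset D.nonempty.some_mem⟩⟩
instance : Nonempty {x // x ∈ D.U₁} := ⟨⟨_, D.mapsTo _ D.nonempty.some_mem⟩⟩

/-- The inclusion of `U₁` in the glued space. -/
def E₁ : OpenPartialHomeomorph M D.Space :=
  (D.isOpen₁.isOpenEmbedding_subtypeVal.toOpenPartialHomeomorph _).symm.trans
    (D.isOpenEmbedding_i₁.toOpenPartialHomeomorph _)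

/-- The inclusion of `U₂` in the glued space. -/
def E₂ : OpenPartialHomeomorph N D.Space :=
  (D.isOpen₂.isOpenEmbedding_subtypeVal.toOpenPartialHomeomorph _).symm.trans
    (D.isOpenEmbedding_i₂.toOpenPartialHomeomorph _)

theorem E₁_source : D.E₁.source = D.U₁ := by
  simp [E₁]

theorem E₂_source : D.E₂.source = D.U₂ := by
  simp [E₂]

theorem E₁_apply {x : M} (hx : x ∈ D.U₁) : D.E₁ x = D.i₁ ⟨x, hx⟩ := by
  change D.i₁ ((D.isOpen₁.isOpenEmbedding_subtypeVal.toOpenPartialHomeomorph _).symm x) = _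
  congr 1
  exact (D.isOpen₁.isOpenEmbedding_subtypeVal.toOpenPartialHomeomorph _).left_inv
    (x := ⟨x, hx⟩) (by simp)

theorem E₂_apply {y : N} (hy : y ∈ D.U₂) : D.E₂ y = D.i₂ ⟨y, hy⟩ := by
  change D.i₂ ((D.isOpen₂.isOpenEmbedding_subtypeVal.toOpenPartialHomeomorph _).symm y) = _
  congr 1
  exact (D.isOpen₂.isOpenEmbedding_subtypeVal.toOpenPartialHomeomorph _).left_inv
    (x := ⟨y, hy⟩) (by simp)

theorem E₁_eq_E₂ {x : M} (hx : x ∈ D.U₁) {y : N} (hy : y ∈ D.U₂) :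
    D.E₁ x = D.E₂ y ↔ y ∈ D.V ∧ x = D.θ y := by
  rw [D.E₁_apply hx, D.E₂_apply hy, i₁_eq_i₂]

theorem exists_eq (z : D.Space) : (∃ x ∈ D.U₁, z = D.E₁ x) ∨ ∃ y ∈ D.U₂, y ∉ D.V ∧ z = D.E₂ y := by
  rcases D.exists_rep z with ⟨x, rfl⟩ | ⟨y, rfl, hy⟩
  · exact Or.inl ⟨x.1, x.2, (D.E₁_apply x.2).symm⟩
  · exact Or.inr ⟨y.1, y.2, hy, (D.E₂_apply y.2).symm⟩

theorem mem_target (z : D.Space) : z ∈ D.E₁.target ∨ z ∈ D.E₂.target := by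
  rcases D.exists_eq z with ⟨x, hx, rfl⟩ | ⟨y, hy, -, rfl⟩
  · exact Or.inl (D.E₁.map_source (D.E₁_source ▸ hx))
  · exact Or.inr (D.E₂.map_source (D.E₂_source ▸ hy))

/-- On the overlap the change from `N` to `M` is `θ`. -/
theorem E₁_symm_E₂ {y : N} (hy : y ∈ D.U₂) (h : D.E₂ y ∈ D.E₁.target) :
    y ∈ D.V ∧ D.E₁.symm (D.E₂ y) = D.θ y := by
  have h1 := D.E₁.map_target h
  rw [E₁_source] at h1
  exact (D.E₁_eq_E₂ h1 hy).1 (D.E₁.right_inv h)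

theorem E₁_symm_E₂' {y : N} (hy : y ∈ D.V) : D.E₁.symm (D.E₂ y) = D.θ y := by
  have h := (D.E₁_eq_E₂ (D.mapsTo y hy) (D.subset hy)).2 ⟨hy, rfl⟩
  rw [← h]
  exact D.E₁.left_inv (D.E₁_source ▸ D.mapsTo y hy)

theorem E₂_symm_E₁ {x : M} (hx : x ∈ D.U₁) (h : D.E₁ x ∈ D.E₂.target) :
    D.E₂.symm (D.E₁ x) ∈ D.V ∧ D.θ (D.E₂.symm (D.E₁ x)) = x := by
  have h1 := D.E₂.map_target h
  rw [E₂_source] at h1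
  have := (D.E₁_eq_E₂ hx h1).1 (D.E₂.right_inv h).symm
  exact ⟨this.1, this.2.symm⟩

/-- The glued space is Hausdorff. -/
instance [T2Space M] [T2Space N] : T2Space D.Space := by
  have e1 : ∀ x ∈ D.U₁, ∀ A : Set M, IsOpen A → x ∈ A → ∃ A' : Set D.Space,
      IsOpen A' ∧ D.E₁ x ∈ A' ∧ ∀ z ∈ A', ∃ x' ∈ A, x' ∈ D.U₁ ∧ z = D.E₁ x' := by
    intro x hx A hA hxA
    refine ⟨D.E₁ '' (D.E₁.source ∩ A), D.E₁.isOpen_image_source_inter hA,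
      ⟨x, ⟨D.E₁_source ▸ hx, hxA⟩, rfl⟩, ?_⟩
    rintro _ ⟨x', ⟨h1, h2⟩, rfl⟩
    exact ⟨x', h2, D.E₁_source ▸ h1, rfl⟩
  have e2 : ∀ y ∈ D.U₂, ∀ B : Set N, IsOpen B → y ∈ B → ∃ B' : Set D.Space,
      IsOpen B' ∧ D.E₂ y ∈ B' ∧ ∀ z ∈ B', ∃ y' ∈ B, y' ∈ D.U₂ ∧ z = D.E₂ y' := by
    intro y hy B hB hyB
    refine ⟨D.E₂ '' (D.E₂.source ∩ B), D.E₂.isOpen_image_source_inter hB,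
      ⟨y, ⟨D.E₂_source ▸ hy, hyB⟩, rfl⟩, ?_⟩
    rintro _ ⟨y', ⟨h1, h2⟩, rfl⟩
    exact ⟨y', h2, D.E₂_source ▸ h1, rfl⟩
  -- points coming from different sides are separated by the condition in the gluing data
  have e3 : ∀ x ∈ D.U₁, ∀ y ∈ D.U₂, D.E₁ x ≠ D.E₂ y → ∃ A B : Set D.Space,
      IsOpen A ∧ IsOpen B ∧ D.E₁ x ∈ A ∧ D.E₂ y ∈ B ∧ Disjoint A B := by
    intro x hx y hy h
    obtain ⟨A, B, hA, hB, hxA, hyB, hd⟩ := D.separated x hx y hy fun h1 h2 =>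
      h ((D.E₁_eq_E₂ hx hy).2 ⟨h1, h2⟩)
    obtain ⟨A', hA', hx', h1⟩ := e1 x hx A hA hxA
    obtain ⟨B', hB', hy', h2⟩ := e2 y hy B hB hyB
    refine ⟨A', B', hA', hB', hx', hy', Set.disjoint_left.2 fun z hz hz' => ?_⟩
    obtain ⟨x', hx'A, hx'U, rfl⟩ := h1 z hz
    obtain ⟨y', hy'B, hy'U, h3⟩ := h2 _ hz'
    obtain ⟨h4, rfl⟩ := (D.E₁_eq_E₂ hx'U hy'U).1 h3
    exact hd y' hy'B h4 hx'A
  refine ⟨fun z w hzw => ?_⟩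
  rcases D.exists_eq z with ⟨x, hx, rfl⟩ | ⟨y, hy, -, rfl⟩ <;>
    rcases D.exists_eq w with ⟨x', hx', rfl⟩ | ⟨y', hy', -, rfl⟩
  · obtain ⟨A, B, hA, hB, h1, h2, hd⟩ := t2_separation (fun h => hzw (congrArg D.E₁ h))
    obtain ⟨A', hA', hx1, h3⟩ := e1 x hx A hA h1
    obtain ⟨B', hB', hx2, h4⟩ := e1 x' hx' B hB h2
    refine ⟨A', B', hA', hB', hx1, hx2, Set.disjoint_left.2 fun z hz hz' => ?_⟩
    obtain ⟨a, ha, haU, rfl⟩ := h3 z hz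
    obtain ⟨b, hb, hbU, h5⟩ := h4 _ hz'
    have := D.E₁.injOn (D.E₁_source ▸ haU) (D.E₁_source ▸ hbU) h5
    exact Set.disjoint_left.1 hd ha (this ▸ hb)
  · exact e3 x hx y' hy' hzw
  · obtain ⟨A, B, hA, hB, h1, h2, hd⟩ := e3 x' hx' y hy hzw.symm
    exact ⟨B, A, hB, hA, h2, h1, hd.symm⟩
  · obtain ⟨A, B, hA, hB, h1, h2, hd⟩ := t2_separation (fun h => hzw (congrArg D.E₂ h))
    obtain ⟨A', hA', hx1, h3⟩ := e2 y hy A hA h1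
    obtain ⟨B', hB', hx2, h4⟩ := e2 y' hy' B hB h2
    refine ⟨A', B', hA', hB', hx1, hx2, Set.disjoint_left.2 fun z hz hz' => ?_⟩
    obtain ⟨a, ha, haU, rfl⟩ := h3 z hz
    obtain ⟨b, hb, hbU, h5⟩ := h4 _ hz'
    have := D.E₂.injOn (D.E₂_source ▸ haU) (D.E₂_source ▸ hbU) h5
    exact Set.disjoint_left.1 hd ha (this ▸ hb)

open Classical in
/-- The charts of the glued space are those of `M` and of `N`, restricted to `U₁` and `U₂`. -/
instance : ChartedSpace E5 D.Space where
  atlas := {e | (∃ c ∈ atlas E5 M, e = D.E₁.symm.trans c) ∨ ∃ c ∈ atlas E5 N, e = D.E₂.symm.trans c}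
  chartAt z := if z ∈ D.E₁.target then D.E₁.symm.trans (chartAt E5 (D.E₁.symm z))
    else D.E₂.symm.trans (chartAt E5 (D.E₂.symm z))
  mem_chart_source z := by
    split_ifs with h
    · simp [h]
    · simp [(D.mem_target z).resolve_left h]
  chart_mem_atlas z := by
    split_ifs with h
    · exact Or.inl ⟨_, chart_mem_atlas _ _, rfl⟩
    · exact Or.inr ⟨_, chart_mem_atlas _ _, rfl⟩

variable [IsManifold (𝓡 5) ∞ M] [IsManifold (𝓡 5) ∞ N]

/-- The change of coordinates between charts coming from two embeddings `e` and `e'` is smooth, if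
`e'⁻¹ ∘ e` is smooth. -/
theorem contDiffOn_transition {P Q X : Type*} [TopologicalSpace P] [ChartedSpace E5 P]
    [IsManifold (𝓡 5) ∞ P] [TopologicalSpace Q] [ChartedSpace E5 Q] [IsManifold (𝓡 5) ∞ Q]
    [TopologicalSpace X] (e : OpenPartialHomeomorph P X) (e' : OpenPartialHomeomorph Q X)
    (h : ∀ x ∈ e.source, e x ∈ e'.target → ContMDiffAt (𝓡 5) (𝓡 5) ∞ (fun y => e'.symm (e y)) x)
    {c : OpenPartialHomeomorph P E5} (hc : c ∈ atlas E5 P) {c' : OpenPartialHomeomorph Q E5}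
    (hc' : c' ∈ atlas E5 Q) :
    ContDiffOn ℝ ∞ ((e.symm.trans c).symm.trans (e'.symm.trans c'))
      ((e.symm.trans c).symm.trans (e'.symm.trans c')).source := by
  intro z hz
  simp only [OpenPartialHomeomorph.trans_source, OpenPartialHomeomorph.symm_source,
    Set.mem_inter_iff, Set.mem_preimage, OpenPartialHomeomorph.trans_symm_eq_symm_trans_symm,
    OpenPartialHomeomorph.symm_symm, OpenPartialHomeomorph.coe_trans, Function.comp] at hz
  obtain ⟨⟨h1, h2⟩, h3, h4⟩ := hz
  have s1 : ContMDiffAt (𝓡 5) (𝓡 5) ∞ c.symm z :=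
    (contMDiffOn_symm_of_mem_maximalAtlas (IsManifold.subset_maximalAtlas hc)).contMDiffAt
      (c.open_target.mem_nhds h1)
  have s2 : ContMDiffAt (𝓡 5) (𝓡 5) ∞ c' (e'.symm (e (c.symm z))) :=
    (contMDiffOn_of_mem_maximalAtlas (IsManifold.subset_maximalAtlas hc')).contMDiffAt
      (c'.open_source.mem_nhds h4)
  exact (s2.comp z ((h _ h2 h3).comp z s1)).contDiffAt.contDiffWithinAt

theorem contMDiffAt_symm_comp_self {P X : Type*} [TopologicalSpace P] [ChartedSpace E5 P]
    [TopologicalSpace X] (e : OpenPartialHomeomorph P X) {x : P} (hx : x ∈ e.source) :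
    ContMDiffAt (𝓡 5) (𝓡 5) ∞ (fun y => e.symm (e y)) x := by
  refine (contMDiffAt_id (I := 𝓡 5)).congr_of_eventuallyEq ?_
  filter_upwards [e.open_source.mem_nhds hx] with y hy using e.left_inv hy

theorem contMDiffAt_E₁_symm_E₂ {y : N} (hy : y ∈ D.E₂.source) (h : D.E₂ y ∈ D.E₁.target) :
    ContMDiffAt (𝓡 5) (𝓡 5) ∞ (fun y => D.E₁.symm (D.E₂ y)) y := by
  have hV := (D.E₁_symm_E₂ (D.E₂_source ▸ hy) h).1
  refine (D.localDiffeo ⟨y, hV⟩).contMDiffAt.congr_of_eventuallyEq ?_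
  filter_upwards [D.isOpenV.mem_nhds hV] with z hz using D.E₁_symm_E₂' hz

theorem contMDiffAt_E₂_symm_E₁ {x : M} (hx : x ∈ D.E₁.source) (h : D.E₁ x ∈ D.E₂.target) :
    ContMDiffAt (𝓡 5) (𝓡 5) ∞ (fun y => D.E₂.symm (D.E₁ y)) x := by
  obtain ⟨h1, h2⟩ := D.E₂_symm_E₁ (D.E₁_source ▸ hx) h
  obtain ⟨G, g1, g2, g3, -⟩ := exists_local_inverse (D.localDiffeo ⟨_, h1⟩)
  simp only at g1 g2 g3
  rw [h2] at g1 g2 g3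
  refine g2.congr_of_eventuallyEq ?_
  have hV : G x ∈ D.V := g1 ▸ h1
  filter_upwards [g3, g2.continuousAt.preimage_mem_nhds (D.isOpenV.mem_nhds hV)] with y hy hy'
  have h3 := (D.E₁_eq_E₂ (D.mapsTo _ hy') (D.subset hy')).2 ⟨hy', rfl⟩
  rw [hy] at h3
  rw [h3]
  exact D.E₂.left_inv (D.E₂_source ▸ D.subset hy')

instance : IsManifold (𝓡 5) ∞ D.Space := by
  apply isManifold_of_contDiffOn
  simp only [modelWithCornersSelf_coe, modelWithCornersSelf_coe_symm, Function.id_comp,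
    Function.comp_id, Set.preimage_id, Set.range_id, Set.inter_univ]
  rintro _ _ (⟨c, hc, rfl⟩ | ⟨c, hc, rfl⟩) (⟨c', hc', rfl⟩ | ⟨c', hc', rfl⟩)
  · exact contDiffOn_transition _ _ (fun x hx _ => contMDiffAt_symm_comp_self _ hx) hc hc'
  · exact contDiffOn_transition _ _ (fun x hx h => D.contMDiffAt_E₂_symm_E₁ hx h) hc hc'
  · exact contDiffOn_transition _ _ (fun x hx h => D.contMDiffAt_E₁_symm_E₂ hx h) hc hc'
  · exact contDiffOn_transition _ _ (fun x hx _ => contMDiffAt_symm_comp_self _ hx) hc hc'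

/-- An embedding `e` is a diffeomorphism onto its image, if the charts of its source are charts of
its target. -/
theorem contMDiffOn_of_chart {P X : Type*} [TopologicalSpace P] [ChartedSpace E5 P]
    [IsManifold (𝓡 5) ∞ P] [TopologicalSpace X] [ChartedSpace E5 X] [IsManifold (𝓡 5) ∞ X]
    (e : OpenPartialHomeomorph P X) (h : ∀ c ∈ atlas E5 P, e.symm.trans c ∈ atlas E5 X) :
    ContMDiffOn (𝓡 5) (𝓡 5) ∞ e e.source ∧ ContMDiffOn (𝓡 5) (𝓡 5) ∞ e.symm e.target := by
  constructor
  · intro x hx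
    set c := chartAt E5 x
    have hm := h c (chart_mem_atlas E5 x)
    have s1 : ContMDiffAt (𝓡 5) (𝓡 5) ∞ c x := contMDiffAt_chart (mem_chart_source E5 x)
    have ht : c x ∈ (e.symm.trans c).target := by
      simp only [OpenPartialHomeomorph.trans_target, OpenPartialHomeomorph.symm_target,
        Set.mem_inter_iff, Set.mem_preimage]
      exact ⟨c.map_source (mem_chart_source E5 x), by rwa [c.left_inv (mem_chart_source E5 x)]⟩
    have s2 : ContMDiffAt (𝓡 5) (𝓡 5) ∞ (e.symm.trans c).symm (c x) :=
      (contMDiffOn_symm_of_mem_maximalAtlas (IsManifold.subset_maximalAtlas hm)).contMDiffAt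
        ((e.symm.trans c).open_target.mem_nhds ht)
    refine ContMDiffAt.contMDiffWithinAt ((s2.comp x s1).congr_of_eventuallyEq ?_)
    filter_upwards [c.open_source.mem_nhds (mem_chart_source E5 x)] with y hy
    change e y = e (c.symm (c y))
    rw [c.left_inv hy]
  · intro z hz
    set x := e.symm z
    set c := chartAt E5 x
    have hm := h c (chart_mem_atlas E5 x)
    have s1 : ContMDiffAt (𝓡 5) (𝓡 5) ∞ c.symm (c x) :=
      contMDiffAt_chart_symm (c.map_source (mem_chart_source E5 x))
    have hs : z ∈ (e.symm.trans c).source := by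
      simp only [OpenPartialHomeomorph.trans_source, OpenPartialHomeomorph.symm_source,
        Set.mem_inter_iff, Set.mem_preimage]
      exact ⟨hz, mem_chart_source E5 x⟩
    have s2 : ContMDiffAt (𝓡 5) (𝓡 5) ∞ (e.symm.trans c) z :=
      (contMDiffOn_of_mem_maximalAtlas (IsManifold.subset_maximalAtlas hm)).contMDiffAt
        ((e.symm.trans c).open_source.mem_nhds hs)
    refine ContMDiffAt.contMDiffWithinAt ((s1.comp z s2).congr_of_eventuallyEq ?_)
    filter_upwards [(e.symm.trans c).open_source.mem_nhds hs] with y hy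
    change e.symm y = c.symm (c (e.symm y))
    simp only [OpenPartialHomeomorph.trans_source, OpenPartialHomeomorph.symm_source,
        Set.mem_inter_iff, Set.mem_preimage] at hy
    rw [c.left_inv hy.2]

theorem contMDiffOn_E₁ : ContMDiffOn (𝓡 5) (𝓡 5) ∞ D.E₁ D.E₁.source ∧
    ContMDiffOn (𝓡 5) (𝓡 5) ∞ D.E₁.symm D.E₁.target :=
  contMDiffOn_of_chart _ fun c hc => Or.inl ⟨c, hc, rfl⟩

theorem contMDiffOn_E₂ : ContMDiffOn (𝓡 5) (𝓡 5) ∞ D.E₂ D.E₂.source ∧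
    ContMDiffOn (𝓡 5) (𝓡 5) ∞ D.E₂.symm D.E₂.target :=
  contMDiffOn_of_chart _ fun c hc => Or.inr ⟨c, hc, rfl⟩

theorem isLocalDiffeomorphAt_E₁ {x : M} (hx : x ∈ D.U₁) :
    IsLocalDiffeomorphAt (𝓡 5) (𝓡 5) ∞ D.E₁ x :=
  isLocalDiffeomorphAt_of_openPartialHomeomorph D.E₁ D.contMDiffOn_E₁.1 D.contMDiffOn_E₁.2
    (D.E₁_source ▸ hx) fun _ _ => rfl

theorem isLocalDiffeomorphAt_E₂ {y : N} (hy : y ∈ D.U₂) :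
    IsLocalDiffeomorphAt (𝓡 5) (𝓡 5) ∞ D.E₂ y :=
  isLocalDiffeomorphAt_of_openPartialHomeomorph D.E₂ D.contMDiffOn_E₂.1 D.contMDiffOn_E₂.2
    (D.E₂_source ▸ hy) fun _ _ => rfl

/-! ### The action on the glued space -/

instance : MulAction SO3 D.Space where
  smul g z := match z with
    | Sum.inl x => Sum.inl ⟨g • x.1, D.smul₁ g _ x.2⟩
    | Sum.inr y => Sum.inr ⟨g • y.1, D.smul₂ g _ y.2.1, fun h => y.2.2 (by
        have := D.smulV g⁻¹ _ h
        rwa [inv_smul_smul] at this)⟩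
  one_smul z := by
    rcases z with x | y
    · exact congrArg Sum.inl (Subtype.ext (one_smul SO3 x.1))
    · exact congrArg Sum.inr (Subtype.ext (one_smul SO3 y.1))
  mul_smul g h z := by
    rcases z with x | y
    · exact congrArg Sum.inl (Subtype.ext (mul_smul g h x.1))
    · exact congrArg Sum.inr (Subtype.ext (mul_smul g h y.1))

theorem E₁_smul (g : SO3) {x : M} (hx : x ∈ D.U₁) : D.E₁ (g • x) = g • D.E₁ x := by
  rw [D.E₁_apply hx, D.E₁_apply (D.smul₁ g x hx)]
  rfl

theorem E₂_smul (g : SO3) {y : N} (hy : y ∈ D.U₂) : D.E₂ (g • y) = g • D.E₂ y := by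
  by_cases hV : y ∈ D.V
  · rw [← (D.E₁_eq_E₂ (D.mapsTo _ hV) hy).2 ⟨hV, rfl⟩, ← D.E₁_smul g (D.mapsTo _ hV),
      ← D.equivariant g y hV]
    exact ((D.E₁_eq_E₂ (D.mapsTo _ (D.smulV g y hV)) (D.smul₂ g y hy)).2
      ⟨D.smulV g y hV, rfl⟩).symm
  · have hV' : g • y ∉ D.V := fun h => hV (by
      have := D.smulV g⁻¹ _ h
      rwa [inv_smul_smul] at this)
    rw [D.E₂_apply hy, D.E₂_apply (D.smul₂ g y hy), D.i₂_of_notMem (y := ⟨y, hy⟩) hV,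
      D.i₂_of_notMem (y := ⟨g • y, D.smul₂ g y hy⟩) hV']
    rfl

theorem isSmoothAction (hM : IsSmoothAction M) (hN : IsSmoothAction N) :
    IsSmoothAction D.Space := by
  rintro n g hg ⟨a, z⟩
  rcases D.exists_eq z with ⟨x, hx, rfl⟩ | ⟨y, hy, -, rfl⟩
  · refine smoothAction_at hM (D.isLocalDiffeomorphAt_E₁ hx) ?_ hg a
      (D.isLocalDiffeomorphAt_E₁ (D.smul₁ _ _ hx)).contMDiffAt
    filter_upwards [D.isOpen₁.mem_nhds hx] with z hz g using D.E₁_smul g hz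
  · refine smoothAction_at hN (D.isLocalDiffeomorphAt_E₂ hy) ?_ hg a
      (D.isLocalDiffeomorphAt_E₂ (D.smul₂ _ _ hy)).contMDiffAt
    filter_upwards [D.isOpen₂.mem_nhds hy] with z hz g using D.E₂_smul g hz

/-! ### Forms on the glued space -/

open Classical in
/-- The form on the glued space that is `α₁` on `U₁` and `α₂` on the rest. -/
def form (α₁ : OneForm M) (α₂ : OneForm N) : OneForm D.Space := fun z =>
  if z ∈ D.E₁.target then pullback D.E₁.symm α₁ z else pullback D.E₂.symm α₂ z

theorem cov_pullback_symm_pullback {P X : Type*} [TopologicalSpace P] [ChartedSpace E5 P]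
    [TopologicalSpace X] [ChartedSpace E5 X]
    {e : OpenPartialHomeomorph P X} (h1 : ContMDiffOn (𝓡 5) (𝓡 5) ∞ e e.source)
    (h2 : ContMDiffOn (𝓡 5) (𝓡 5) ∞ e.symm e.target) {x : P} (hx : x ∈ e.source) (β : OneForm P) :
    cov (pullback e (pullback e.symm β)) x = cov β x := by
  rw [← pullback_comp (G := e.symm) (F := e) β ((h2.contMDiffAt (e.open_target.mem_nhds
    (e.map_source hx))).mdifferentiableAt (by simp)) ((h1.contMDiffAt (e.open_source.mem_nhds
    hx)).mdifferentiableAt (by simp)), pullback_congr (G := fun y => y), pullback_id]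
  filter_upwards [e.open_source.mem_nhds hx] with y hy using e.left_inv hy

theorem cov_pullback_E₁_form (α₁ : OneForm M) (α₂ : OneForm N) {x : M} (hx : x ∈ D.U₁) :
    cov (pullback D.E₁ (D.form α₁ α₂)) x = cov α₁ x := by
  rw [← cov_pullback_symm_pullback D.contMDiffOn_E₁.1 D.contMDiffOn_E₁.2 (D.E₁_source ▸ hx) α₁,
    cov_pullback, cov_pullback]
  congr 1
  unfold cov form
  rw [if_pos (D.E₁.map_source (D.E₁_source ▸ hx))]

/-- The glued form restricts to `α₂` where the two forms agree on the overlap. -/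
theorem cov_pullback_E₂_form {α₁ : OneForm M} {α₂ : OneForm N} {y : N} (hy : y ∈ D.U₂)
    (h : y ∈ D.V → cov (pullback D.θ α₁) y = cov α₂ y) :
    cov (pullback D.E₂ (D.form α₁ α₂)) y = cov α₂ y := by
  by_cases hV : y ∈ D.V
  · rw [← h hV]
    have e1 := D.E₁_symm_E₂' hV
    have h1 : ContMDiffAt (𝓡 5) (𝓡 5) ∞ D.E₂ y := (D.isLocalDiffeomorphAt_E₂ hy).contMDiffAt
    have h2 : D.E₂ y = D.E₁ (D.θ y) :=
      ((D.E₁_eq_E₂ (D.mapsTo _ hV) hy).2 ⟨hV, rfl⟩).symm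
    have h3 := D.localDiffeo ⟨y, hV⟩
    rw [pullback_congr (G := fun y => D.E₁ (D.θ y)), pullback_comp, cov_pullback,
      D.cov_pullback_E₁_form _ _ (D.mapsTo _ hV), cov_pullback]
    · exact (D.isLocalDiffeomorphAt_E₁ (D.mapsTo _ hV)).contMDiffAt.mdifferentiableAt (by simp)
    · exact h3.contMDiffAt.mdifferentiableAt (by simp)
    · filter_upwards [D.isOpenV.mem_nhds hV] with z hz
      exact ((D.E₁_eq_E₂ (D.mapsTo _ hz) (D.subset hz)).2 ⟨hz, rfl⟩).symm
  · rw [← cov_pullback_symm_pullback D.contMDiffOn_E₂.1 D.contMDiffOn_E₂.2 (D.E₂_source ▸ hy) α₂,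
      cov_pullback, cov_pullback]
    congr 1
    unfold cov form
    rw [if_neg fun h' => hV (D.E₁_symm_E₂ hy h').1]

/-- The glued form is a contact form, if `α₁` and `α₂` agree on the part `V ∩ W` of the overlap,
where `W` is a neighbourhood of `U₂ \ V`. -/
theorem isContactSO3_form (hM : IsSmoothAction M) (hN : IsSmoothAction N) {α₁ : OneForm M}
    {α₂ : OneForm N} {W : Set N} (hW : IsOpen W) (hWV : ∀ y ∈ D.U₂, y ∉ D.V → y ∈ W)
    (hWs : ∀ (g : SO3), ∀ y ∈ W, g • y ∈ W)
    (s1 : ∀ x ∈ D.U₁, FormSmoothAt α₁ x) (c1 : ∀ x ∈ D.U₁, ContactAt α₁ x)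
    (n1 : ∀ g : SO3, ∀ x ∈ D.U₁, cov (pullback (fun z : M => g • z) α₁) x = cov α₁ x)
    (s2 : ∀ y, FormSmoothAt α₂ y) (c2 : ∀ y, ContactAt α₂ y)
    (n2 : ∀ (g : SO3) y, cov (pullback (fun z : N => g • z) α₂) y = cov α₂ y)
    (h : ∀ y ∈ D.V, y ∈ W → cov (pullback D.θ α₁) y = cov α₂ y) :
    IsContactSO3 (D.form α₁ α₂) := by
  -- all properties are local: near a point of `U₁` the form is `α₁`, near the other points it is
  -- `α₂`
  have p1 : ∀ x ∈ D.U₁, ∀ᶠ z in nhds x, cov (pullback D.E₁ (D.form α₁ α₂)) z = cov α₁ z := by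
    intro x hx
    filter_upwards [D.isOpen₁.mem_nhds hx] with z hz using D.cov_pullback_E₁_form _ _ hz
  have p2 : ∀ y ∈ D.U₂, y ∈ W → ∀ᶠ z in nhds y,
      cov (pullback D.E₂ (D.form α₁ α₂)) z = cov α₂ z := by
    intro y hy hyW
    filter_upwards [D.isOpen₂.mem_nhds hy, hW.mem_nhds hyW] with z hz hzW
    exact D.cov_pullback_E₂_form hz fun hV => h z hV hzW
  have sm : ∀ z, FormSmoothAt (D.form α₁ α₂) z := by
    intro z
    rcases D.exists_eq z with ⟨x, hx, rfl⟩ | ⟨y, hy, hyV, rfl⟩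
    · exact FormSmoothAt.of_pullback (D.isLocalDiffeomorphAt_E₁ hx) ((s1 x hx).congr (p1 x hx))
    · exact FormSmoothAt.of_pullback (D.isLocalDiffeomorphAt_E₂ hy)
        ((s2 y).congr (p2 y hy (hWV y hy hyV)))
  refine ⟨D.isSmoothAction hM hN, isSmoothForm_of_formSmoothAt sm, fun g => funext fun z => ?_,
    fun z => ?_⟩
  · rcases D.exists_eq z with ⟨x, hx, rfl⟩ | ⟨y, hy, hyV, rfl⟩
    · refine invariant_at hM (D.isSmoothAction hM hN) (D.isLocalDiffeomorphAt_E₁ hx)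
        (D.isLocalDiffeomorphAt_E₁ (D.smul₁ g x hx)).contMDiffAt ?_ (p1 x hx).self_of_nhds
        (p1 _ (D.smul₁ g x hx)).self_of_nhds (n1 g x hx)
      filter_upwards [D.isOpen₁.mem_nhds hx] with z hz using D.E₁_smul g hz
    · have hyW := hWV y hy hyV
      refine invariant_at hN (D.isSmoothAction hM hN) (D.isLocalDiffeomorphAt_E₂ hy)
        (D.isLocalDiffeomorphAt_E₂ (D.smul₂ g y hy)).contMDiffAt ?_ (p2 y hy hyW).self_of_nhds
        (p2 _ (D.smul₂ g y hy) (hWs g y hyW)).self_of_nhds (n2 g y)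
      filter_upwards [D.isOpen₂.mem_nhds hy] with z hz using D.E₂_smul g hz
  · rcases D.exists_eq z with ⟨x, hx, rfl⟩ | ⟨y, hy, hyV, rfl⟩
    · exact ContactAt.of_pullback (sm _) (D.isLocalDiffeomorphAt_E₁ hx).contMDiffAt
        (mder_bijective (D.isLocalDiffeomorphAt_E₁ hx)).2 ((c1 x hx).congr (p1 x hx))
    · exact ContactAt.of_pullback (sm _) (D.isLocalDiffeomorphAt_E₂ hy).contMDiffAt
        (mder_bijective (D.isLocalDiffeomorphAt_E₂ hy)).2
        ((c2 y).congr (p2 y hy (hWV y hy hyV)))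

end GluingData

/-! ### Generation of `SO(3)` by rotations around coordinate axes -/

/-- Polar coordinates. -/
theorem exists_polar (x y : ℝ) : ∃ θ : ℝ, x = √(x ^ 2 + y ^ 2) * Real.cos θ ∧
    y = √(x ^ 2 + y ^ 2) * Real.sin θ := by
  refine ⟨Complex.arg ⟨x, y⟩, ?_, ?_⟩
  · have h := Complex.norm_mul_cos_arg ⟨x, y⟩
    rw [Complex.norm_eq_sqrt_sq_add_sq] at h
    exact h.symm
  · have h := Complex.norm_mul_sin_arg ⟨x, y⟩
    rw [Complex.norm_eq_sqrt_sq_add_sq] at h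
    exact h.symm

/-- Orthonormality of the columns and of the rows, and the determinant of a rotation. -/
theorem SO3.relations (g : SO3) :
    (∀ i j, g.1 i 0 * g.1 j 0 + g.1 i 1 * g.1 j 1 + g.1 i 2 * g.1 j 2 = if i = j then 1 else 0) ∧
    (∀ i j, g.1 0 i * g.1 0 j + g.1 1 i * g.1 1 j + g.1 2 i * g.1 2 j = if i = j then 1 else 0) ∧
    g.1.det = 1 := by
  have h := Matrix.mem_specialOrthogonalGroup_iff.1 g.2
  refine ⟨fun i j => ?_, fun i j => ?_, h.2⟩
  · have := congrFun (congrFun ((Matrix.mem_orthogonalGroup_iff _ _).1 h.1) i) j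
    simpa [Matrix.mul_apply, Fin.sum_univ_three, Matrix.one_apply] using this
  · have := congrFun (congrFun ((Matrix.mem_orthogonalGroup_iff' _ _).1 h.1) i) j
    simpa [Matrix.mul_apply, Fin.sum_univ_three, Matrix.one_apply] using this

/-- A rotation fixing the `z`-axis pointwise is a rotation around the `z`-axis. -/
theorem exists_eq_rot_two {g : SO3} (h : g.1 2 2 = 1) : ∃ c, g = rot 2 c := by
  obtain ⟨hr, hc, hd⟩ := g.relations
  have r22 := hr 2 2
  have c22 := hc 2 2
  simp only [if_true, h] at r22 c22
  have z20 : g.1 2 0 = 0 := by nlinarith [sq_nonneg (g.1 2 0), sq_nonneg (g.1 2 1)]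
  have z21 : g.1 2 1 = 0 := by nlinarith [sq_nonneg (g.1 2 0), sq_nonneg (g.1 2 1)]
  have z02 : g.1 0 2 = 0 := by nlinarith [sq_nonneg (g.1 0 2), sq_nonneg (g.1 1 2)]
  have z12 : g.1 1 2 = 0 := by nlinarith [sq_nonneg (g.1 0 2), sq_nonneg (g.1 1 2)]
  have c00 := hc 0 0
  have c11 := hc 1 1
  rw [Matrix.det_fin_three] at hd
  simp only [if_true, z20, z21, z02, z12, h] at c00 c11 hd
  have e1 : g.1 1 1 = g.1 0 0 := by
    nlinarith [sq_nonneg (g.1 1 1 - g.1 0 0), sq_nonneg (g.1 0 1 + g.1 1 0)]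
  have e2 : g.1 0 1 = - g.1 1 0 := by
    nlinarith [sq_nonneg (g.1 1 1 - g.1 0 0), sq_nonneg (g.1 0 1 + g.1 1 0)]
  obtain ⟨c, h1, h2⟩ := exists_polar (g.1 0 0) (g.1 1 0)
  have hs : √(g.1 0 0 ^ 2 + g.1 1 0 ^ 2) = 1 := by
    rw [Real.sqrt_eq_one]; linarith
  rw [hs, one_mul] at h1 h2
  refine ⟨c, Subtype.ext ?_⟩
  ext i j
  fin_cases i <;> fin_cases j <;> simp [rot, z20, z21, z02, z12, h, e1, e2, h1, h2]

/-- Euler angles. -/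
theorem exists_euler (g : SO3) : ∃ a b c, g = rot 2 a * rot 0 b * rot 2 c := by
  obtain ⟨hr, hc, hd⟩ := g.relations
  have c22 := hc 2 2
  simp only [if_true] at c22
  obtain ⟨a, h1, h2⟩ := exists_polar (-g.1 1 2) (g.1 0 2)
  set s := √((-g.1 1 2) ^ 2 + g.1 0 2 ^ 2) with hs
  have hs2 : s ^ 2 = g.1 1 2 ^ 2 + g.1 0 2 ^ 2 := by
    rw [hs, Real.sq_sqrt (by positivity)]; ring
  obtain ⟨b, h3, h4⟩ := exists_polar (g.1 2 2) s
  have h5 : √(g.1 2 2 ^ 2 + s ^ 2) = 1 := by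
    rw [Real.sqrt_eq_one]; linarith
  rw [h5, one_mul] at h3 h4
  obtain ⟨c, hc'⟩ := exists_eq_rot_two (g := (rot 2 a * rot 0 b)⁻¹ * g) (by
    have e : ((rot 2 a * rot 0 b)⁻¹ * g : SO3).1 = ((rot 2 a).1 * (rot 0 b).1)ᵀ * g.1 := rfl
    rw [e]
    simp only [Matrix.mul_apply, Fin.sum_univ_three, Matrix.transpose_apply]
    simp [rot]
    have e1 : g.1 1 2 = -(s * Real.cos a) := by linarith
    rw [e1, h2, h3, h4]
    have sa := Real.sin_sq_add_cos_sq a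
    have sb := Real.sin_sq_add_cos_sq b
    linear_combination sb + Real.sin b ^ 2 * sa)
  exact ⟨a, b, c, by rw [← hc', mul_inv_cancel_left]⟩

/-- A set is invariant under `SO(3)` if it is invariant under the rotations around the coordinate
axes. -/
theorem rot_smul_of_forall {M : Type*} [MulAction SO3 M] {K : Set M}
    (h : ∀ i s, ∀ x ∈ K, rot i s • x ∈ K) (g : SO3) {x : M} (hx : x ∈ K) : g • x ∈ K := by
  obtain ⟨a, b, c, rfl⟩ := exists_euler g
  rw [mul_smul, mul_smul]
  exact h _ _ _ (h _ _ _ (h _ _ _ hx))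

theorem rot_add (i : Fin 3) (s t : ℝ) : rot i (s + t) = rot i s * rot i t := by
  apply Subtype.ext
  change _ = (rot i s).1 * (rot i t).1
  ext j l
  fin_cases i <;> fin_cases j <;> fin_cases l <;>
    simp [rot, Matrix.mul_apply, Fin.sum_univ_three, Real.cos_add, Real.sin_add] <;> ring

/-! ### Collars -/

/-- For `|p| > ε` the Dehn twist is the identity: its angle is `2πk`. -/
theorem shift_eq_of_lt (k : ℤ) {ε : ℝ} (hε : 0 < ε) {y : Cyl} (h : ε < ‖y.2.p‖) (n : ℤ) :
    (dehnTwist k ε hε).shift n y = (y.1 + n, y.2) := by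
  refine Prod.ext rfl ?_
  change ((dehnTwist k ε hε).toEquiv ^ n) y.2 = y.2
  apply Equiv.Perm.zpow_apply_eq_self_of_apply_eq_self
  apply Subtype.ext
  change geod (twistAngle k ε ‖y.2.p‖) y.2.1 = y.2.1
  have h1 : ¬ ‖y.2.p‖ ≤ ε / 2 := by linarith
  have h2 : ¬ ‖y.2.p‖ < ε := by linarith
  have h3 : twistAngle k ε ‖y.2.p‖ = Real.pi * ((2 * k : ℤ) : ℝ) := by
    rw [twistAngle, rho, if_neg h1, if_neg h2]; push_cast; ring
  rw [h3]
  exact geod_pi_mul_even (even_two_mul k) _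

theorem shift_zero_twist (n : ℤ) (y : Cyl) :
    (dehnTwist 0 1 one_pos).shift n y = (y.1 + n, y.2) := by
  refine Prod.ext rfl ?_
  change ((dehnTwist 0 1 one_pos).toEquiv ^ n) y.2 = y.2
  apply Equiv.Perm.zpow_apply_eq_self_of_apply_eq_self
  apply Subtype.ext
  change geod (twistAngle 0 1 ‖y.2.p‖) y.2.1 = y.2.1
  simp [twistAngle, geod]

/-- The translation by an integer in the direction `t`. -/
def translate (n : ℤ) (y : Cyl) : Cyl := (y.1 + n, y.2)

theorem contMDiff_translate (n : ℤ) : ContMDiff (𝓡 5) (𝓡 5) ∞ (translate n) :=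
  EquivDiffeo.contMDiff_translate n

theorem cov_pullback_translate (n : ℤ) (y : Cyl) :
    cov (pullback (translate n) canForm) y = cov canForm y := by
  rw [canForm_eq_dehnForm, ← cov_pullback_shift 0 one_pos n y]
  exact congrArg (fun F => cov (pullback F (dehnForm 0 1)) y)
    (funext fun z => (shift_zero_twist n z).symm)

theorem surjective_mder_translate (n : ℤ) (y : Cyl) :
    Function.Surjective (mder (𝓡 5) (𝓡 5) (translate n) y) := by
  have h1 : ∀ z, translate (-n) (translate n z) = z := fun z => by simp [translate]
  have h2 : ∀ z, translate n (translate (-n) z) = z := fun z => by simp [translate]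
  have hd : ∀ n z, MDifferentiableAt (𝓡 5) (𝓡 5) (translate n) z :=
    fun n z => (contMDiff_translate n z).mdifferentiableAt (by simp)
  have e := mder_comp (x := translate n y) (hd n (translate (-n) (translate n y)))
    (hd (-n) (translate n y))
  simp only [h2, mder_id, h1] at e
  exact Function.RightInverse.surjective fun v => (DFunLike.congr_fun e v).symm

theorem surjective_mder_smul {M : Type*} [TopologicalSpace M] [ChartedSpace E5 M] [MulAction SO3 M]
    (h : IsSmoothAction M) (g : SO3) (x : M) :
    Function.Surjective (mder (𝓡 5) (𝓡 5) (fun z : M => g • z) x) := by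
  have hd : ∀ (g : SO3) (z : M), MDifferentiableAt (𝓡 5) (𝓡 5) (fun z : M => g • z) z :=
    fun g z => (h.contMDiff_smul g z).mdifferentiableAt (by simp)
  have e := mder_comp (x := g • x) (hd g (g⁻¹ • g • x)) (hd g⁻¹ (g • x))
  simp only [smul_inv_smul, mder_id, inv_smul_smul] at e
  exact Function.RightInverse.surjective fun v => (DFunLike.congr_fun e v).symm

section Collar

variable {M : Type*} [TopologicalSpace M] [ChartedSpace E5 M] [MulAction SO3 M]
  {α : OneForm M} {K : Set M} {δ : ℝ} {ψ : Cyl → M}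

/-- The region `0 < |p| < δ`. -/
def annulus (δ : ℝ) : Set Cyl := {y : Cyl | 0 < ‖y.2.p‖ ∧ ‖y.2.p‖ < δ}

theorem continuous_norm_p : Continuous fun y : Cyl => ‖y.2.p‖ :=
  (Cyl.continuous_p.comp continuous_snd).norm

theorem isOpen_annulus (δ : ℝ) : IsOpen (annulus δ) :=
  (isOpen_lt continuous_const continuous_norm_p).inter
    (isOpen_lt continuous_norm_p continuous_const)

theorem smul_mem_annulus (g : SO3) {y : Cyl} (hy : y ∈ annulus δ) : g • y ∈ annulus δ := by
  unfold annulus; rw [Set.mem_ofPred_eq, Cyl.norm_smul_p]; exact hy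

namespace IsCollar

theorem norm_eq (h : IsCollar α K δ ψ) {y z : Cyl} (hy : y ∈ annulus δ) (hz : z ∈ annulus δ)
    (e : ψ y = ψ z) : ‖y.2.p‖ = ‖z.2.p‖ := by
  obtain ⟨n, rfl⟩ := (h.fibers y z hy.1 hy.2 hz.1 hz.2).1 e
  rfl

/-- The core of size `a` contains the points of the collar with `|p| ≤ a`. -/
theorem mem_core_iff (h : IsCollar α K δ ψ) {y : Cyl} (hy : y ∈ annulus δ) {a : ℝ} (ha : a < δ) :
    ψ y ∈ core K ψ a ↔ ‖y.2.p‖ ≤ a := by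
  constructor
  · rintro (h1 | ⟨z, ⟨hz1, hz2⟩, hz⟩)
    · exact absurd h1 (h.disjoint y hy.1 hy.2)
    · rwa [h.norm_eq hy ⟨hz1, hz2.trans_lt ha⟩ hz.symm]
  · exact fun h1 => Or.inr ⟨y, ⟨hy.1, h1⟩, rfl⟩

/-- `K` is the intersection of the closed cores. -/
theorem isClosed_K (h : IsCollar α K δ ψ) (hδ : 0 < δ) : IsClosed K := by
  have : K = ⋂ a : Set.Ioo 0 δ, core K ψ a.1 := by
    refine Set.Subset.antisymm (Set.subset_iInter fun a => Set.subset_union_left) fun x hx => ?_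
    simp only [Set.mem_iInter] at hx
    rcases hx ⟨δ / 2, by constructor <;> linarith⟩ with h1 | ⟨y, ⟨h1, h2⟩, rfl⟩
    · exact h1
    · have hy : y ∈ annulus δ := ⟨h1, h2.trans_lt (by simp only; linarith)⟩
      have := (h.mem_core_iff hy (a := ‖y.2.p‖ / 2) (by linarith [hy.2])).1
        (hx ⟨‖y.2.p‖ / 2, by constructor <;> linarith [hy.2]⟩)
      linarith
  rw [this]
  exact isClosed_iInter fun a => h.isClosed a.1 a.2.1 a.2.2

/-- A component of the singular orbits is invariant: an orbit of a one-parameter group meets it in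
an open and closed set of parameters. -/
theorem smul_mem_K (h : IsCollar α K δ ψ) (hM : IsSmoothAction M) (hδ : 0 < δ) (g : SO3) {x : M}
    (hx : x ∈ K) : g • x ∈ K := by
  refine rot_smul_of_forall (fun i s x hx => ?_) g hx
  have hc : Continuous fun s : ℝ => rot i s • x := (hM.contMDiff_rot i x).continuous
  have hcl : IsClopen {s : ℝ | rot i s • x ∈ K} := by
    refine ⟨(h.isClosed_K hδ).preimage hc, ?_⟩
    rw [isOpen_iff_mem_nhds]
    intro s hs
    have ho := (h.isOpen (δ / 2) (by linarith) (by linarith)).preimage hc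
    filter_upwards [ho.mem_nhds (Or.inl hs)] with s' hs'
    rcases hs' with h1 | ⟨y, ⟨h1, h2⟩, h3⟩
    · exact h1
    -- the collar does not meet `K`, so an orbit of a point of the collar does not enter `K`
    · exfalso
      have hy : y ∈ annulus δ := ⟨h1, by linarith⟩
      have h4 : rot i (s - s') • ψ y = rot i s • x := by
        rw [h3, ← mul_smul, ← rot_add]; simp
      rw [← h.equivariant _ y hy.1 hy.2] at h4
      have hy' := smul_mem_annulus (rot i (s - s')) hy
      refine h.disjoint _ hy'.1 hy'.2 ?_
      rw [h4]
      exact hs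
  have h0 : (0 : ℝ) ∈ {s : ℝ | rot i s • x ∈ K} := by
    rw [Set.mem_ofPred_eq, rot_zero, one_smul]
    exact hx
  rcases isClopen_iff.1 hcl with h1 | h1
  · rw [h1] at h0; exact absurd h0 (Set.notMem_empty _)
  · have : s ∈ {s : ℝ | rot i s • x ∈ K} := h1 ▸ Set.mem_univ s
    exact this

theorem smul_mem_core (h : IsCollar α K δ ψ) (hM : IsSmoothAction M) {a : ℝ} (ha0 : 0 < a)
    (ha : a < δ) (g : SO3) {x : M} (hx : x ∈ core K ψ a) : g • x ∈ core K ψ a := by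
  rcases hx with h1 | ⟨y, ⟨h1, h2⟩, rfl⟩
  · exact Or.inl (h.smul_mem_K hM (ha0.trans ha) g h1)
  · refine Or.inr ⟨g • y, ⟨?_, ?_⟩, h.equivariant g y h1 (h2.trans_lt ha)⟩ <;>
      rw [Cyl.norm_smul_p] <;> assumption

theorem smul_mem_compl_core (h : IsCollar α K δ ψ) (hM : IsSmoothAction M) {a : ℝ} (ha0 : 0 < a)
    (ha : a < δ) (g : SO3) {x : M} (hx : x ∈ (core K ψ a)ᶜ) : g • x ∈ (core K ψ a)ᶜ := by
  intro h1
  have := h.smul_mem_core hM ha0 ha g⁻¹ h1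
  rw [inv_smul_smul] at this
  exact hx this

theorem contMDiffAt (h : IsCollar α K δ ψ) {y : Cyl} (hy : y ∈ annulus δ) :
    ContMDiffAt (𝓡 5) (𝓡 5) ∞ ψ y := (h.localDiffeo ⟨y, hy⟩).contMDiffAt

theorem mdifferentiableAt (h : IsCollar α K δ ψ) {y : Cyl} (hy : y ∈ annulus δ) :
    MDifferentiableAt (𝓡 5) (𝓡 5) ψ y := (h.contMDiffAt hy).mdifferentiableAt (by simp)

theorem cov_canForm_ne_zero (y : Cyl) : cov canForm y ≠ 0 := (contactAt_canForm y).1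

/-- The conformal factor of a collar is preserved by the symmetries of the collar. -/
theorem factor_of_symmetry (h : IsCollar α K δ ψ) {F : Cyl → Cyl} {G : M → M} {y : Cyl}
    (hy : y ∈ annulus δ) (hFy : F y ∈ annulus δ) (hF : MDifferentiableAt (𝓡 5) (𝓡 5) F y)
    (hG : MDifferentiableAt (𝓡 5) (𝓡 5) G (ψ y))
    (hs : Function.Surjective (mder (𝓡 5) (𝓡 5) F y))
    (he : ∀ z ∈ annulus δ, ψ (F z) = G (ψ z)) (h1 : cov (pullback F canForm) y = cov canForm y)
    (h2 : cov (pullback G α) (ψ y) = cov α (ψ y)) {c : ℝ}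
    (hc : cov (pullback ψ α) y = c • cov canForm y) :
    cov (pullback ψ α) (F y) = c • cov canForm (F y) := by
  have hα : MDifferentiableAt (𝓡 5) (𝓡 5) ψ (F y) := h.mdifferentiableAt hFy
  have e1 : cov (pullback F (pullback ψ α)) y = c • cov (pullback F canForm) y := by
    rw [← pullback_comp α hα hF, pullback_congr (G := fun z => G (ψ z)),
      pullback_comp α hG (h.mdifferentiableAt hy), cov_pullback, h2, ← cov_pullback, hc, h1]
    filter_upwards [(isOpen_annulus δ).mem_nhds hy] with z hz using he z hz
  ext v
  obtain ⟨u, rfl⟩ := hs v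
  exact DFunLike.congr_fun e1 u

/-- `(y, c)` consists of collar coordinates of `x` and the conformal factor of the collar at `y`. -/
def IsCoord (α : OneForm M) (δ : ℝ) (ψ : Cyl → M) (x : M) (z : Cyl × ℝ) : Prop :=
  z.1 ∈ annulus δ ∧ ψ z.1 = x ∧ 0 < z.2 ∧ cov (pullback ψ α) z.1 = z.2 • cov canForm z.1

theorem exists_isCoord (h : IsCollar α K δ ψ) {y : Cyl} (hy : y ∈ annulus δ) :
    ∃ c, IsCoord α δ ψ (ψ y) (y, c) := by
  obtain ⟨c, hc, e⟩ := h.form y hy.1 hy.2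
  exact ⟨c, hy, rfl, hc, e⟩

/-- The norm of `p` and the conformal factor depend only on the point of `M`, since collar
coordinates are unique up to translation by integers in the direction `t`. -/
theorem isCoord_unique (h : IsCollar α K δ ψ) {x : M} {z z' : Cyl × ℝ} (hz : IsCoord α δ ψ x z)
    (hz' : IsCoord α δ ψ x z') : ‖z.1.2.p‖ = ‖z'.1.2.p‖ ∧ z.2 = z'.2 := by
  obtain ⟨y, c⟩ := z
  obtain ⟨y', c'⟩ := z'
  obtain ⟨h1, h2, h3, h4⟩ := hz
  obtain ⟨h1', h2', h3', h4'⟩ := hz'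
  simp only at h1 h2 h3 h4 h1' h2' h3' h4' ⊢
  refine ⟨h.norm_eq h1 h1' (h2.trans h2'.symm), ?_⟩
  obtain ⟨n, e⟩ := (h.fibers y y' h1.1 h1.2 h1'.1 h1'.2).1 (h2.trans h2'.symm)
  have e' : y' = translate n y := e
  have := h.factor_of_symmetry (F := translate n) (G := fun x => x) (y := y) h1 (e' ▸ h1')
    ((contMDiff_translate n y).mdifferentiableAt (by simp)) mdifferentiableAt_id
    (surjective_mder_translate n y)
    (fun z hz => ((h.fibers z (translate n z) hz.1 hz.2 hz.1 hz.2).2 ⟨n, rfl⟩).symm)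
    (cov_pullback_translate n y) (pullback_id α _) h4
  rw [← e', h4'] at this
  exact (smul_left_injective ℝ (cov_canForm_ne_zero y') this).symm

/-- The conformal factor of a collar is invariant. -/
theorem isCoord_smul (h : IsCollar α K δ ψ) (hα : IsContactSO3 α) (g : SO3) {x : M} {z : Cyl × ℝ}
    (hz : IsCoord α δ ψ x z) : IsCoord α δ ψ (g • x) (g • z.1, z.2) := by
  obtain ⟨h1, h2, h3, h4⟩ := hz
  refine ⟨smul_mem_annulus g h1, by rw [h.equivariant g _ h1.1 h1.2, h2], h3, ?_⟩
  exact h.factor_of_symmetry (F := fun y => g • y) (G := fun x => g • x) h1 (smul_mem_annulus g h1)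
    ((isSmoothAction_cyl.contMDiff_smul g _).mdifferentiableAt (by simp))
    ((hα.smooth_action.contMDiff_smul g _).mdifferentiableAt (by simp))
    (surjective_mder_smul isSmoothAction_cyl g _) (fun y hy => h.equivariant g y hy.1 hy.2)
    (cov_pullback_smul_canForm g _) (congrArg (fun β => cov β _) (hα.invariant g)) h4

open Classical in
/-- The function by which `α` is multiplied to make it equal to `dt + λ_can` in the part of the
collar where the cut-off function `χ(|p|)` is `1`. -/
def scale (α : OneForm M) (δ : ℝ) (ψ : Cyl → M) (χ : ℝ → ℝ) (x : M) : ℝ :=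
  if h : ∃ z, IsCoord α δ ψ x z then
    χ ‖h.choose.1.2.p‖ * h.choose.2⁻¹ + (1 - χ ‖h.choose.1.2.p‖) else 1

theorem scale_eq (h : IsCollar α K δ ψ) (χ : ℝ → ℝ) {x : M} {z : Cyl × ℝ}
    (hz : IsCoord α δ ψ x z) : scale α δ ψ χ x = χ ‖z.1.2.p‖ * z.2⁻¹ + (1 - χ ‖z.1.2.p‖) := by
  have hex : ∃ z, IsCoord α δ ψ x z := ⟨z, hz⟩
  rw [scale, dif_pos hex]
  obtain ⟨h1, h2⟩ := h.isCoord_unique hex.choose_spec hz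
  rw [h1, h2]

theorem scale_pos {χ : ℝ → ℝ} (hχ0 : ∀ r, 0 ≤ χ r) (hχ1 : ∀ r, χ r ≤ 1) (x : M) :
    0 < scale α δ ψ χ x := by
  unfold scale
  split_ifs with hex
  · have hc := inv_pos.2 hex.choose_spec.2.2.1
    have h0 := hχ0 ‖hex.choose.1.2.p‖
    rcases (hχ1 ‖hex.choose.1.2.p‖).lt_or_eq with h1 | h1
    · have := mul_nonneg h0 hc.le
      linarith
    · rw [h1]; linarith
  · exact one_pos

/-- The rescaling function is invariant. -/
theorem scale_smul (h : IsCollar α K δ ψ) (hα : IsContactSO3 α) (χ : ℝ → ℝ) (g : SO3) (x : M) :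
    scale α δ ψ χ (g • x) = scale α δ ψ χ x := by
  by_cases hex : ∃ z, IsCoord α δ ψ x z
  · obtain ⟨z, hz⟩ := hex
    rw [h.scale_eq χ hz, h.scale_eq χ (h.isCoord_smul hα g hz), Cyl.norm_smul_p]
  · have hex' : ¬ ∃ z, IsCoord α δ ψ (g • x) z := by
      rintro ⟨z, hz⟩
      have := h.isCoord_smul hα g⁻¹ hz
      rw [inv_smul_smul] at this
      exact hex ⟨_, this⟩
    rw [scale, scale, dif_neg hex, dif_neg hex']

/-- The rescaled form. -/
def scaledForm (α : OneForm M) (δ : ℝ) (ψ : Cyl → M) (χ : ℝ → ℝ) : OneForm M :=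
  fun x => scale α δ ψ χ x • α x

theorem cov_scaledForm (χ : ℝ → ℝ) (x : M) :
    cov (scaledForm α δ ψ χ) x = scale α δ ψ χ x • cov α x := rfl

/-- In the collar the rescaled form interpolates between `dt + λ_can` and `α`. -/
theorem cov_pullback_scaledForm (h : IsCollar α K δ ψ) (χ : ℝ → ℝ) {y : Cyl}
    (hy : y ∈ annulus δ) : cov (pullback ψ (scaledForm α δ ψ χ)) y =
      χ ‖y.2.p‖ • cov canForm y + (1 - χ ‖y.2.p‖) • cov (pullback ψ α) y := by
  obtain ⟨c, hc⟩ := h.exists_isCoord hy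
  have e : cov (pullback ψ (scaledForm α δ ψ χ)) y =
      scale α δ ψ χ (ψ y) • cov (pullback ψ α) y := by
    rw [cov_pullback, cov_scaledForm, ContinuousLinearMap.smul_comp, ← cov_pullback]
  have hc0 : c ≠ 0 := hc.2.2.1.ne'
  have hcf : cov (pullback ψ α) y = c • cov canForm y := hc.2.2.2
  rw [e, h.scale_eq χ hc, hcf, smul_smul, smul_smul, ← add_smul]
  congr 1
  field_simp

theorem cov_pullback_smul_scaledForm (h : IsCollar α K δ ψ) (hα : IsContactSO3 α) (χ : ℝ → ℝ)
    (g : SO3) (x : M) : cov (pullback (fun z : M => g • z) (scaledForm α δ ψ χ)) x =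
      cov (scaledForm α δ ψ χ) x := by
  rw [cov_pullback, cov_scaledForm, ContinuousLinearMap.smul_comp, ← cov_pullback,
    h.scale_smul hα, hα.invariant, cov_scaledForm]

end IsCollar

variable [IsManifold (𝓡 5) ∞ M]

/-- Linear combinations of smooth forms with smooth coefficients are smooth. -/
theorem FormSmoothAt.smul_add_smul {N : Type*} [TopologicalSpace N] [ChartedSpace E5 N]
    [IsManifold (𝓡 5) ∞ N] {β β₁ β₂ : OneForm N} {f g : N → ℝ} {x : N}
    (hf : ContMDiffAt (𝓡 5) 𝓘(ℝ, ℝ) ∞ f x) (hg : ContMDiffAt (𝓡 5) 𝓘(ℝ, ℝ) ∞ g x)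
    (h1 : FormSmoothAt β₁ x) (h2 : FormSmoothAt β₂ x)
    (h : ∀ y, cov β y = f y • cov β₁ y + g y • cov β₂ y) : FormSmoothAt β x := by
  have e : inChart β x = fun z => f ((chartAt E5 x).symm z) • inChart β₁ x z +
      g ((chartAt E5 x).symm z) • inChart β₂ x z := by
    funext z
    rw [inChart_eq, inChart_eq, inChart_eq, cov_pullback, cov_pullback, cov_pullback, h,
      ContinuousLinearMap.add_comp, ContinuousLinearMap.smul_comp, ContinuousLinearMap.smul_comp]
  have ht := (chartAt E5 x).map_source (mem_chart_source E5 x)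
  have hs := contMDiffAt_chart_symm ht
  have hl : (chartAt E5 x).symm (chartAt E5 x x) = x :=
    (chartAt E5 x).left_inv (mem_chart_source E5 x)
  have hf' : ContDiffAt ℝ ∞ (fun z => f ((chartAt E5 x).symm z)) (chartAt E5 x x) := by
    rw [← contMDiffAt_iff_contDiffAt]
    exact ContMDiffAt.comp (g := f) _ (by rwa [hl]) hs
  have hg' : ContDiffAt ℝ ∞ (fun z => g ((chartAt E5 x).symm z)) (chartAt E5 x x) := by
    rw [← contMDiffAt_iff_contDiffAt]
    exact ContMDiffAt.comp (g := g) _ (by rwa [hl]) hs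
  unfold FormSmoothAt at h1 h2 ⊢
  rw [e]
  exact (hf'.smul h1).add (hg'.smul h2)

theorem contMDiffAt_norm_p {χ : ℝ → ℝ} (hχ : ContDiff ℝ ∞ χ) {y : Cyl} (hy : y.2.p ≠ 0) :
    ContMDiffAt (𝓡 5) 𝓘(ℝ, ℝ) ∞ (fun z : Cyl => χ ‖z.2.p‖) y := by
  have h1 : ContDiffAt ℝ ∞ (fun w : Amb => χ ‖w.2.2‖) (Cyl.emb y) :=
    hχ.contDiffAt.comp _ (contDiffAt_snd.snd.norm ℝ hy)
  exact h1.contMDiffAt.comp y (Cyl.contMDiff_emb y)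

namespace IsCollar

/-- The rescaled form is smooth: in the collar it is a combination of `dt + λ_can` and `α` with
smooth coefficients, elsewhere it is `α`. -/
theorem formSmoothAt_scaledForm (h : IsCollar α K δ ψ) (hα : IsContactSO3 α) {χ : ℝ → ℝ}
    (hχ : ContDiff ℝ ∞ χ) {a : ℝ} (ha0 : 0 < a) (ha : a < δ) (hχa : ∀ r, a < r → χ r = 0) {x : M}
    (hx : x ∉ K) : FormSmoothAt (scaledForm α δ ψ χ) x := by
  by_cases hxc : x ∈ core K ψ a
  · obtain ⟨y, ⟨h1, h2⟩, rfl⟩ := hxc.resolve_left hx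
    have hy : y ∈ annulus δ := ⟨h1, h2.trans_lt ha⟩
    refine FormSmoothAt.of_pullback (h.localDiffeo ⟨y, hy⟩) ?_
    have hp : y.2.p ≠ 0 := norm_pos_iff.1 h1
    refine FormSmoothAt.congr (β := fun z => χ ‖z.2.p‖ • canForm z +
      (1 - χ ‖z.2.p‖) • pullback ψ α z) ?_ ?_
    · exact FormSmoothAt.smul_add_smul (contMDiffAt_norm_p hχ hp)
        (contMDiffAt_norm_p (contDiff_const.sub hχ) hp) (formSmoothAt_canForm y)
        ((hα.smooth_form.formSmoothAt _).pullback (h.contMDiffAt hy)) fun z => rfl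
    · filter_upwards [(isOpen_annulus δ).mem_nhds hy] with z hz
      exact h.cov_pullback_scaledForm χ hz
  · refine (hα.smooth_form.formSmoothAt x).congr ?_
    filter_upwards [(h.isClosed a ha0 ha).isOpen_compl.mem_nhds hxc] with z hz
    have : scale α δ ψ χ z = 1 := by
      by_cases hex : ∃ w, IsCoord α δ ψ z w
      · obtain ⟨w, hw⟩ := hex
        rw [h.scale_eq χ hw, hχa, zero_mul, sub_zero, zero_add]
        by_contra! hle
        exact hz (hw.2.1 ▸ (h.mem_core_iff hw.1 ha).2 hle)
      · rw [scale, dif_neg hex]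
    rw [cov_scaledForm, this, one_smul]

/-- The rescaled form is a positive multiple of `α`. -/
theorem contactAt_scaledForm (h : IsCollar α K δ ψ) (hα : IsContactSO3 α) {χ : ℝ → ℝ}
    (hχ : ContDiff ℝ ∞ χ) (hχ0 : ∀ r, 0 ≤ χ r) (hχ1 : ∀ r, χ r ≤ 1) {a : ℝ} (ha0 : 0 < a)
    (ha : a < δ) (hχa : ∀ r, a < r → χ r = 0) {x : M} (hx : x ∉ K) :
    ContactAt (scaledForm α δ ψ χ) x :=
  ContactAt.smul (h.formSmoothAt_scaledForm hα hχ ha0 ha hχa hx) (hα.smooth_form.formSmoothAt x)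
    (Filter.Eventually.of_forall fun z => cov_scaledForm χ z) (scale_pos hχ0 hχ1 x).ne'
    (hα.contact x)

end IsCollar

end Collar

/-! ### Gluing in the mapping torus -/

theorem isLocalDiffeomorphAt_congr {M N : Type*} [TopologicalSpace M] [ChartedSpace E5 M]
    [TopologicalSpace N] [ChartedSpace E5 N] {F G : M → N} {x : M}
    (h : IsLocalDiffeomorphAt (𝓡 5) (𝓡 5) ∞ F x) (e : G =ᶠ[nhds x] F) :
    IsLocalDiffeomorphAt (𝓡 5) (𝓡 5) ∞ G x := by
  obtain ⟨Φ, hx, heq⟩ := h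
  obtain ⟨U, hU1, hU, hxU⟩ := eventually_nhds_iff.1 e
  refine isLocalDiffeomorphAt_of_openPartialHomeomorph (Φ.toOpenPartialHomeomorph.restrOpen U hU)
    ?_ ?_ ⟨hx, hxU⟩ ?_
  · exact Φ.contMDiffOn_toFun.mono fun z hz => hz.1
  · exact Φ.contMDiffOn_invFun.mono fun z hz => hz.1
  · exact fun z hz => (hU1 z hz.2).trans (heq hz.1)

/-- A map is a local diffeomorphism if its composition with a local diffeomorphism is one. -/
theorem isLocalDiffeomorphAt_of_comp {M N P : Type*} [TopologicalSpace M] [ChartedSpace E5 M]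
    [TopologicalSpace N] [ChartedSpace E5 N] [TopologicalSpace P] [ChartedSpace E5 P]
    {F : M → N} {D : N → P} {x : M} (hF : IsLocalDiffeomorphAt (𝓡 5) (𝓡 5) ∞ F x)
    (h : IsLocalDiffeomorphAt (𝓡 5) (𝓡 5) ∞ (fun z => D (F z)) x) :
    IsLocalDiffeomorphAt (𝓡 5) (𝓡 5) ∞ D (F x) := by
  have h1 := hF.localInverse_isLocalDiffeomorphAt
  have h2 : hF.localInverse (F x) = x := hF.localInverse_eventuallyEq_left.self_of_nhds
  refine isLocalDiffeomorphAt_congr (h1.comp (𝓡 5) _ (h2.symm ▸ h)) ?_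
  filter_upwards [hF.localInverse_eventuallyEq_right] with z hz
  exact congrArg D hz.symm

theorem norm_stdPoint_p {r : ℝ} (hr : 0 ≤ r) : ‖(stdPoint r).p‖ = r := by
  have : (stdPoint r).p = !₂[0, r, 0] := rfl
  rw [this]
  simp [EuclideanSpace.norm_eq, Fin.sum_univ_three, Real.sqrt_sq hr]

section TorusNorm

variable {k : ℤ} {ε : ℝ} {hε : 0 < ε}

/-- The function `|p|` on the mapping torus. -/
def torusNorm (k : ℤ) (ε : ℝ) (hε : 0 < ε) : MappingTorus (dehnTwist k ε hε) → ℝ :=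
  MappingTorus.lift _ (fun y => ‖y.2.p‖) fun y => by
    rw [MappingTorus.shift_one]
    exact (geod_mem y.2.2 (twist_h0 k hε y.2.1)).2

theorem torusNorm_mk (y : Cyl) : torusNorm k ε hε (MappingTorus.mk _ y) = ‖y.2.p‖ := rfl

theorem continuous_torusNorm : Continuous (torusNorm k ε hε) :=
  MappingTorus.continuous_lift _ continuous_norm_p

theorem torusNorm_smul (g : SO3) (x : MappingTorus (dehnTwist k ε hε)) :
    torusNorm k ε hε (g • x) = torusNorm k ε hε x := by
  obtain ⟨y, rfl⟩ := MappingTorus.mk_surjective _ x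
  rw [MappingTorus.smul_mk, torusNorm_mk, torusNorm_mk, Cyl.norm_smul_p]

/-- The image of a region defined by `|p|` in the mapping torus. -/
theorem image_mk_eq {P : ℝ → Prop} :
    MappingTorus.mk (dehnTwist k ε hε) '' {y : Cyl | P ‖y.2.p‖} = {x | P (torusNorm k ε hε x)} := by
  ext x
  constructor
  · rintro ⟨y, hy, rfl⟩
    exact hy
  · intro hx
    obtain ⟨y, rfl⟩ := MappingTorus.mk_surjective _ x
    exact ⟨y, hx, rfl⟩

end TorusNorm

section Gluing

variable {M : Type*} [TopologicalSpace M] [ChartedSpace E5 M] [MulAction SO3 M]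
  {α : OneForm M} {K : Set M} {δ : ℝ} {ψ : Cyl → M} {ε : ℝ}

/-- The map induced by the collar on the part `ε < |p| < δ` of the mapping torus. -/
def collarMap (k : ℤ) {ε : ℝ} (hε : 0 < ε) (ψ : Cyl → M)
    (x : MappingTorus (dehnTwist k ε hε)) : M :=
  ψ (MappingTorus.mk_surjective _ x).choose

namespace IsCollar

/-- The collar map does not depend on the chosen representatives: where the Dehn twist is the
identity, they differ by integers in the direction `t`. -/
theorem collarMap_mk {k : ℤ} {hε : 0 < ε} (h : IsCollar α K δ ψ) {y : Cyl} (h1 : ε < ‖y.2.p‖)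
    (h2 : ‖y.2.p‖ < δ) :
    collarMap k hε ψ (MappingTorus.mk _ y) = ψ y := by
  obtain ⟨n, hn⟩ := (MappingTorus.mk_eq_iff _).1
    (MappingTorus.mk_surjective _ (MappingTorus.mk (dehnTwist k ε hε) y)).choose_spec.symm
  rw [shift_eq_of_lt k hε h1] at hn
  unfold collarMap
  rw [hn]
  exact ((h.fibers y (y.1 + n, y.2) (hε.trans h1) h2 (hε.trans h1) h2).2 ⟨n, rfl⟩).symm

theorem isLocalDiffeomorphAt_collarMap {k : ℤ} {hε : 0 < ε} (h : IsCollar α K δ ψ) {y : Cyl}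
    (h1 : ε < ‖y.2.p‖) (h2 : ‖y.2.p‖ < δ) :
    IsLocalDiffeomorphAt (𝓡 5) (𝓡 5) ∞ (collarMap k hε ψ) (MappingTorus.mk _ y) := by
  refine isLocalDiffeomorphAt_of_comp (MappingTorus.isLocalDiffeomorph_mk _ y) ?_
  refine isLocalDiffeomorphAt_congr (h.localDiffeo ⟨y, hε.trans h1, h2⟩) ?_
  filter_upwards [(isOpen_lt continuous_const continuous_norm_p).mem_nhds h1,
    (isOpen_lt continuous_norm_p continuous_const).mem_nhds h2] with z hz1 hz2
  exact h.collarMap_mk hz1 hz2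

/-- The data for gluing in the mapping torus. -/
def gluingData [T2Space M] (h : IsCollar α K δ ψ) (hM : IsSmoothAction M) (k : ℤ) (hε : 0 < ε)
    (hδ : ε < δ) : GluingData M (MappingTorus (dehnTwist k ε hε)) where
  U₁ := (core K ψ ε)ᶜ
  U₂ := {x | torusNorm k ε hε x < δ}
  V := {x | ε < torusNorm k ε hε x ∧ torusNorm k ε hε x < δ}
  θ := collarMap k hε ψ
  isOpen₁ := (h.isClosed ε hε hδ).isOpen_compl
  isOpen₂ := isOpen_lt continuous_torusNorm continuous_const
  isOpenV := (isOpen_lt continuous_const continuous_torusNorm).inter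
    (isOpen_lt continuous_torusNorm continuous_const)
  subset _ hx := hx.2
  nonempty := by
    refine ⟨MappingTorus.mk _ (0, stdPoint ((ε + δ) / 2)), ?_⟩
    rw [Set.mem_ofPred_eq, torusNorm_mk, norm_stdPoint_p (by linarith)]
    constructor <;> linarith
  mapsTo x hx := by
    obtain ⟨y, rfl⟩ := MappingTorus.mk_surjective _ x
    rw [h.collarMap_mk hx.1 hx.2]
    intro hc
    exact absurd ((h.mem_core_iff ⟨hε.trans hx.1, hx.2⟩ hδ).1 hc) (not_le.2 hx.1)
  injOn x hx x' hx' e := by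
    obtain ⟨y, rfl⟩ := MappingTorus.mk_surjective _ x
    obtain ⟨y', rfl⟩ := MappingTorus.mk_surjective _ x'
    rw [h.collarMap_mk hx.1 hx.2, h.collarMap_mk hx'.1 hx'.2] at e
    obtain ⟨n, rfl⟩ := (h.fibers _ _ (hε.trans hx.1) hx.2 (hε.trans hx'.1) hx'.2).1 e
    rw [← shift_eq_of_lt k hε hx.1, MappingTorus.mk_shift]
  localDiffeo := by
    rintro ⟨x, hx⟩
    obtain ⟨y, rfl⟩ := MappingTorus.mk_surjective _ x
    exact h.isLocalDiffeomorphAt_collarMap hx.1 hx.2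
  separated x hx z hz hxz := by
    obtain ⟨y, rfl⟩ := MappingTorus.mk_surjective _ z
    rcases lt_or_ge ε ‖y.2.p‖ with h1 | h1
    · have hV : MappingTorus.mk (dehnTwist k ε hε) y ∈
          {x | ε < torusNorm k ε hε x ∧ torusNorm k ε hε x < δ} := ⟨h1, hz⟩
      obtain ⟨A, B, hA, hB, hxA, hyB, hd⟩ := t2_separation (hxz hV)
      obtain ⟨B', hB', hoB', hyB'⟩ := mem_nhds_iff.1
        ((h.isLocalDiffeomorphAt_collarMap (k := k) (hε := hε) h1 hz).contMDiffAt.continuousAt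
          |>.preimage_mem_nhds (hB.mem_nhds hyB))
      exact ⟨A, B', hA, hoB', hxA, hyB', fun w hw _ hwA => Set.disjoint_left.1 hd hwA (hB' hw)⟩
    -- a point of the closed core `|p| ≤ ε` is separated from `x` by the level of some `a > ε` below
    -- the level of `x`
    · obtain ⟨a, ha1, ha2, hxa⟩ : ∃ a, ε < a ∧ a < δ ∧ x ∉ core K ψ a := by
        by_cases hc : x ∈ core K ψ ((ε + δ) / 2)
        · rcases hc with hc | ⟨w, ⟨hw1, hw2⟩, rfl⟩
          · exact absurd (Or.inl hc) hx
          · have hw : w ∈ annulus δ := ⟨hw1, by linarith⟩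
            have hw3 : ε < ‖w.2.p‖ := by
              by_contra! hle
              exact hx ((h.mem_core_iff hw hδ).2 hle)
            refine ⟨(ε + ‖w.2.p‖) / 2, by linarith, by linarith, fun hc => ?_⟩
            have := (h.mem_core_iff hw (by linarith)).1 hc
            linarith
        · exact ⟨_, by linarith, by linarith, hc⟩
      refine ⟨(core K ψ a)ᶜ, {x | torusNorm k ε hε x < a},
        (h.isClosed a (hε.trans ha1) ha2).isOpen_compl,
        isOpen_lt continuous_torusNorm continuous_const, hxa, h1.trans_lt ha1, ?_⟩
      intro w hw hwV hc
      obtain ⟨u, rfl⟩ := MappingTorus.mk_surjective _ w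
      rw [h.collarMap_mk hwV.1 hwV.2] at hc
      exact hc ((h.mem_core_iff ⟨hε.trans hwV.1, hwV.2⟩ ha2).2 (le_of_lt hw))
  smul₁ g x hx := h.smul_mem_compl_core hM hε hδ g hx
  smul₂ g x hx := by rw [Set.mem_ofPred_eq, torusNorm_smul]; exact hx
  smulV g x hx := by rw [Set.mem_ofPred_eq, torusNorm_smul]; exact hx
  equivariant g x hx := by
    obtain ⟨y, rfl⟩ := MappingTorus.mk_surjective _ x
    have hn := Cyl.norm_smul_p g y
    rw [h.collarMap_mk hx.1 hx.2, ← h.equivariant g y (hε.trans hx.1) hx.2, MappingTorus.smul_mk,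
      h.collarMap_mk] <;> rw [hn]
    exacts [hx.1, hx.2]

/-- The glued manifold is covered by two compact sets: the complement of an open collar in `M`, and
the image of the region `t ∈ [0, 1]`, `|p| ≤ a` of `ℝ × T^*S²`. -/
theorem compactSpace_gluing [T2Space M] [CompactSpace M] (h : IsCollar α K δ ψ)
    (hM : IsSmoothAction M) (k : ℤ) (hε : 0 < ε) (hδ : ε < δ) :
    CompactSpace (h.gluingData hM k hε hδ).Space := by
  set D := h.gluingData hM k hε hδ with hD
  set a := (ε + δ) / 2 with ha
  have ha1 : ε < a := by linarith
  have ha2 : a < δ := by linarith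
  -- `a` lies between `ε` and `δ`, so that both compact sets reach into the overlap
  set C₁ : Set M := (K ∪ ψ '' {y : Cyl | 0 < ‖y.2.p‖ ∧ ‖y.2.p‖ < a})ᶜ with hC₁
  set C₂ : Set Cyl := {y : Cyl | y.1 ∈ Set.Icc (0 : ℝ) 1 ∧ ‖y.2.p‖ ≤ a} with hC₂
  have k1 : IsCompact C₁ := (h.isOpen a (hε.trans ha1) ha2).isClosed_compl.isCompact
  have s1 : C₁ ⊆ D.U₁ := by
    refine Set.compl_subset_compl.2 (Set.union_subset_union_right _ (Set.image_mono ?_))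
    exact fun y hy => ⟨hy.1, hy.2.trans_lt ha1⟩
  have k2 : IsCompact C₂ := by
    have hcl : Topology.IsClosedEmbedding Cyl.emb := by
      refine ⟨⟨Cyl.isInducing_emb, Cyl.emb_injective⟩, ?_⟩
      have : Set.range Cyl.emb = {w : Amb | ‖w.2.1‖ = 1 ∧ ⟪w.2.1, w.2.2⟫_ℝ = 0} := by
        ext w
        constructor
        · rintro ⟨y, rfl⟩
          exact y.2.2
        · intro hw
          exact ⟨(w.1, ⟨w.2, hw⟩), rfl⟩
      rw [this]
      exact (isClosed_eq (by fun_prop) (by fun_prop)).inter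
        (isClosed_eq (by fun_prop) (by fun_prop))
    have : C₂ ⊆ Cyl.emb ⁻¹' (Set.Icc (0 : ℝ) 1 ×ˢ (Metric.closedBall (0 : E3) 1 ×ˢ
        Metric.closedBall (0 : E3) a)) := by
      intro y hy
      exact ⟨hy.1, mem_closedBall_zero_iff.2 y.2.norm_q.le, mem_closedBall_zero_iff.2 hy.2⟩
    refine (hcl.isCompact_preimage (isCompact_Icc.prod ((isCompact_closedBall _ _).prod
      (isCompact_closedBall _ _)))).of_isClosed_subset ?_ this
    exact (isClosed_Icc.preimage continuous_fst).inter
      (isClosed_le continuous_norm_p continuous_const)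
  have s2 : MappingTorus.mk (dehnTwist k ε hε) '' C₂ ⊆ D.U₂ := by
    rintro _ ⟨y, hy, rfl⟩
    exact hy.2.trans_lt ha2
  have e : D.E₁ '' C₁ ∪ D.E₂ '' (MappingTorus.mk (dehnTwist k ε hε) '' C₂) = Set.univ := by
    refine Set.eq_univ_of_forall fun z => ?_
    have hmk : ∀ y : Cyl, ‖y.2.p‖ ≤ a → D.E₂ (MappingTorus.mk _ y) ∈
        D.E₂ '' (MappingTorus.mk (dehnTwist k ε hε) '' C₂) := by
      intro y hy
      refine ⟨_, ⟨(dehnTwist k ε hε).shift (-⌊y.1⌋) y, ⟨?_, ?_⟩, rfl⟩, ?_⟩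
      · change y.1 + ((-⌊y.1⌋ : ℤ) : ℝ) ∈ _
        push_cast
        exact ⟨by linarith [Int.floor_le y.1], by linarith [Int.lt_floor_add_one y.1]⟩
      · rw [← torusNorm_mk (k := k) (hε := hε), MappingTorus.mk_shift]
        exact hy
      · rw [MappingTorus.mk_shift]
    rcases D.exists_eq z with ⟨x, hx, rfl⟩ | ⟨w, hw, hwV, rfl⟩
    · by_cases hxC : x ∈ C₁
      · exact Or.inl ⟨x, hxC, rfl⟩
      · right
        rcases Set.notMem_compl_iff.1 hxC with hK | ⟨y, ⟨hy1, hy2⟩, rfl⟩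
        · exact absurd (Or.inl hK) hx
        · have hy3 : ε < ‖y.2.p‖ := by
            by_contra! hle
            exact hx (Or.inr ⟨y, ⟨hy1, hle⟩, rfl⟩)
          have hyV : MappingTorus.mk (dehnTwist k ε hε) y ∈ D.V := ⟨hy3, hy2.trans ha2⟩
          have := (D.E₁_eq_E₂ hx (D.subset hyV)).2
            ⟨hyV, (h.collarMap_mk hy3 (hy2.trans ha2)).symm⟩
          rw [this]
          exact hmk y hy2.le
    · obtain ⟨y, rfl⟩ := MappingTorus.mk_surjective _ w
      right
      refine hmk y ?_
      by_contra! hlt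
      exact hwV ⟨ha1.trans hlt, hw⟩
  rw [← isCompact_univ_iff, ← e]
  refine (k1.image_of_continuousOn ?_).union
    ((k2.image (MappingTorus.continuous_mk _)).image_of_continuousOn ?_)
  · exact D.E₁.continuousOn.mono (by rw [D.E₁_source]; exact s1)
  · exact D.E₂.continuousOn.mono (by rw [D.E₂_source]; exact s2)

variable [IsManifold (𝓡 5) ∞ M]

/-- A contact form on the glued manifold: `α` is rescaled to equal `dt + λ_can` in the part of the
collar next to the mapping torus. -/
theorem exists_isGluing_gluingData {k : ℤ} {hε : 0 < ε} [T2Space M] (h : IsCollar α K δ ψ)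
    (hα : IsContactSO3 α) (hε' : ε < epsBound k) (hδ : ε < δ) :
    ∃ α' : OneForm (h.gluingData hα.smooth_action k hε hδ).Space,
      IsGluing α K δ ψ k ε hε α' (h.gluingData hα.smooth_action k hε hδ).E₁
        (h.gluingData hα.smooth_action k hε hδ).E₂ := by
  set D := h.gluingData hα.smooth_action k hε hδ with hD
  -- the cut-off function `χ` is `1` for `r ≤ a₀` and `0` for `r ≥ a₁`, where `ε < a₀ < a₁ < δ`
  set a₀ := (2 * ε + δ) / 3 with ha₀
  set a₁ := (ε + 2 * δ) / 3 with ha₁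
  set χ : ℝ → ℝ := fun r => Real.smoothTransition ((a₁ - r) / (a₁ - a₀)) with hχ
  have hχs : ContDiff ℝ ∞ χ := Real.smoothTransition.contDiff.comp (by fun_prop)
  have hχ0 : ∀ r, 0 ≤ χ r := fun r => Real.smoothTransition.nonneg _
  have hχ1 : ∀ r, χ r ≤ 1 := fun r => Real.smoothTransition.le_one _
  have h01 : 0 < a₁ - a₀ := by simp only [ha₀, ha₁]; linarith
  have hχa : ∀ r, a₁ < r → χ r = 0 := fun r hr =>
    Real.smoothTransition.zero_of_nonpos (div_nonpos_of_nonpos_of_nonneg (by linarith) h01.le)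
  have hχb : ∀ r, r ≤ a₀ → χ r = 1 := fun r hr =>
    Real.smoothTransition.one_of_one_le ((one_le_div h01).2 (by linarith))
  have hεa₀ : ε < a₀ := by simp only [ha₀]; linarith
  have ha₁δ : a₁ < δ := by simp only [ha₁]; linarith
  have ha₁0 : 0 < a₁ := by simp only [ha₁]; linarith
  set α₁ := scaledForm α δ ψ χ with hα₁
  have hU1K : ∀ x ∈ D.U₁, x ∉ K := fun x hx hK => hx (Or.inl hK)
  -- relations between the forms on the overlap can be checked on `ℝ × T^*S²`
  have hov : ∀ y : Cyl, ε < ‖y.2.p‖ → ‖y.2.p‖ < δ → ∀ c : ℝ,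
      cov (pullback ψ α₁) y = c • cov (dehnForm k ε) y →
      cov (pullback D.θ α₁) (MappingTorus.mk _ y) =
        c • cov (torusForm k hε) (MappingTorus.mk _ y) := by
    intro y h1 h2 c hc
    have hmk := MappingTorus.isLocalDiffeomorph_mk (dehnTwist k ε hε) y
    have hθ : IsLocalDiffeomorphAt (𝓡 5) (𝓡 5) ∞ (collarMap k hε ψ) (MappingTorus.mk _ y) :=
      h.isLocalDiffeomorphAt_collarMap h1 h2
    have e1 : cov (pullback (MappingTorus.mk (dehnTwist k ε hε)) (pullback D.θ α₁)) y =
        c • cov (pullback (MappingTorus.mk (dehnTwist k ε hε)) (torusForm k hε)) y := by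
      rw [cov_pullback_torusForm, ← hc, ← pullback_comp (G := D.θ) (F := MappingTorus.mk _) α₁
        (hθ.contMDiffAt.mdifferentiableAt (by simp)) (hmk.contMDiffAt.mdifferentiableAt (by simp)),
        pullback_congr (G := ψ)]
      filter_upwards [(isOpen_lt continuous_const continuous_norm_p).mem_nhds h1,
        (isOpen_lt continuous_norm_p continuous_const).mem_nhds h2] with z hz1 hz2
      exact h.collarMap_mk hz1 hz2
    ext v
    obtain ⟨u, rfl⟩ := (mder_bijective hmk).2 v
    exact DFunLike.congr_fun e1 u
  -- for `|p| < a₀` the rescaled form is `dt + λ_can`, which is the form of the mapping torus there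
  have hW : ∀ x ∈ D.V, x ∈ {x | torusNorm k ε hε x < a₀} →
      cov (pullback D.θ α₁) x = cov (torusForm k hε) x := by
    intro x hx hxW
    obtain ⟨y, rfl⟩ := MappingTorus.mk_surjective _ x
    have hyW : ‖y.2.p‖ < a₀ := hxW
    rw [hov y hx.1 hx.2 1, one_smul]
    rw [h.cov_pullback_scaledForm χ ⟨hε.trans hx.1, hx.2⟩, hχb _ hyW.le,
      dehnForm_eq_canForm hε hx.1]
    simp
  refine ⟨D.form α₁ (torusForm k hε), ?_⟩
  have hmk2 : MappingTorus.mk (dehnTwist k ε hε) '' {y : Cyl | ‖y.2.p‖ < δ} = D.U₂ :=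
    image_mk_eq (P := fun r => r < δ)
  exact
  { contact := by
      refine D.isContactSO3_form hα.smooth_action MappingTorus.isSmoothAction
        (W := {x | torusNorm k ε hε x < a₀}) (isOpen_lt continuous_torusNorm continuous_const)
        ?_ ?_ ?_ ?_ ?_ (formSmoothAt_torusForm k hε) (contactAt_torusForm k hε hε')
        (cov_pullback_smul_torusForm k hε) hW
      · intro x hx hxV
        by_contra! hlt
        exact hxV ⟨hεa₀.trans_le (not_lt.1 hlt), hx⟩
      · intro g x hx
        rw [Set.mem_ofPred_eq, torusNorm_smul]; exact hx
      · exact fun x hx => h.formSmoothAt_scaledForm hα hχs ha₁0 ha₁δ hχa (hU1K x hx)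
      · exact fun x hx => h.contactAt_scaledForm hα hχs hχ0 hχ1 ha₁0 ha₁δ hχa (hU1K x hx)
      · exact fun g x _ => h.cov_pullback_smul_scaledForm hα χ g x
    localDiffeo₁ := fun x => D.isLocalDiffeomorphAt_E₁ x.2
    injOn₁ := by
      have := D.E₁.injOn
      rwa [D.E₁_source] at this
    equivariant₁ := fun g x hx => D.E₁_smul g hx
    form₁ := fun x hx => ⟨scale α δ ψ χ x, scale_pos hχ0 hχ1 x,
      D.cov_pullback_E₁_form α₁ (torusForm k hε) hx⟩
    localDiffeo₂ := fun x => D.isLocalDiffeomorphAt_E₂ (hmk2 ▸ x.2)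
    injOn₂ := by
      have := D.E₂.injOn
      rwa [D.E₂_source, ← hmk2] at this
    equivariant₂ := fun g y hy => D.E₂_smul (y := MappingTorus.mk _ y) g hy
    form₂ := by
      intro y hy
      have hmk := MappingTorus.isLocalDiffeomorph_mk (dehnTwist k ε hε) y
      have hy2 : MappingTorus.mk (dehnTwist k ε hε) y ∈ D.U₂ := hy
      have e0 : ∀ β : OneForm D.Space, cov (pullback (fun z => D.E₂ (MappingTorus.mk
          (dehnTwist k ε hε) z)) β) y = cov (pullback (MappingTorus.mk (dehnTwist k ε hε))
            (pullback D.E₂ β)) y := fun β =>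
        pullback_comp β ((D.isLocalDiffeomorphAt_E₂ hy2).contMDiffAt.mdifferentiableAt (by simp))
          (hmk.contMDiffAt.mdifferentiableAt (by simp))
      rcases lt_or_ge ε ‖y.2.p‖ with h1 | h1
      · have hV : MappingTorus.mk (dehnTwist k ε hε) y ∈ D.V := ⟨h1, hy⟩
        obtain ⟨c, hc, hcf⟩ := h.form y (hε.trans h1) hy
        have hcf' : cov (pullback ψ α) y = c • cov canForm y := hcf
        have hs := scale_pos (α := α) (δ := δ) (ψ := ψ) hχ0 hχ1 (ψ y)
        refine ⟨scale α δ ψ χ (ψ y) * c, mul_pos hs hc, ?_⟩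
        have e1 : cov (pullback ψ α₁) y = (scale α δ ψ χ (ψ y) * c) • cov (dehnForm k ε) y := by
          rw [cov_pullback, cov_scaledForm, ContinuousLinearMap.smul_comp, ← cov_pullback, hcf',
            dehnForm_eq_canForm hε h1, smul_smul]
        have e2 : cov (pullback (fun z => D.E₂ (MappingTorus.mk (dehnTwist k ε hε) z))
            (D.form α₁ (torusForm k hε))) y = cov (pullback ψ α₁) y := by
          have hθ := h.isLocalDiffeomorphAt_collarMap (k := k) (hε := hε) h1 hy
          have hψU : ψ y ∈ D.U₁ := by
            rw [← h.collarMap_mk (k := k) (hε := hε) h1 hy]; exact D.mapsTo _ hV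
          rw [pullback_congr (G := fun z => D.E₁ (ψ z)), pullback_comp, cov_pullback,
            D.cov_pullback_E₁_form _ _ hψU, ← cov_pullback]
          · exact (D.isLocalDiffeomorphAt_E₁ hψU).contMDiffAt.mdifferentiableAt (by simp)
          · exact h.mdifferentiableAt ⟨hε.trans h1, hy⟩
          · filter_upwards [(isOpen_lt continuous_const continuous_norm_p).mem_nhds h1,
              (isOpen_lt continuous_norm_p continuous_const).mem_nhds hy] with z hz1 hz2
            have hzV : MappingTorus.mk (dehnTwist k ε hε) z ∈ D.V := ⟨hz1, hz2⟩
            have hm := D.mapsTo _ hzV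
            have e3 : D.θ (MappingTorus.mk _ z) = ψ z := h.collarMap_mk hz1 hz2
            exact ((D.E₁_eq_E₂ (e3 ▸ hm) (D.subset hzV)).2 ⟨hzV, e3.symm⟩).symm
        exact e2.trans e1
      · refine ⟨1, one_pos, ?_⟩
        rw [one_smul]
        have h2 := D.cov_pullback_E₂_form (α₁ := α₁) (α₂ := torusForm k hε) hy2
          fun hV => absurd hV.1 (not_lt.2 h1)
        refine (e0 _).trans ?_
        rw [cov_pullback, h2, ← cov_pullback]
        exact cov_pullback_torusForm k hε y
    glue := by
      intro x hx y hy
      rw [D.E₁_eq_E₂ hx (y := MappingTorus.mk _ y) hy]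
      constructor
      · rintro ⟨⟨h1, h2⟩, h3⟩
        exact ⟨h1, h3.trans (h.collarMap_mk h1 h2)⟩
      · rintro ⟨h1, h3⟩
        exact ⟨⟨h1, hy⟩, h3.trans (h.collarMap_mk h1 hy).symm⟩
    cover := by
      refine Set.eq_univ_of_forall fun z => ?_
      rcases D.exists_eq z with ⟨x, hx, rfl⟩ | ⟨w, hw, -, rfl⟩
      · exact Or.inl ⟨x, hx, rfl⟩
      · obtain ⟨y, rfl⟩ := MappingTorus.mk_surjective _ w
        exact Or.inr ⟨y, hw, rfl⟩ }

end IsCollar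

/-- Existence of a closed contact manifold obtained by gluing. -/
theorem exists_isGluing.{w} {M : Type w} [TopologicalSpace M] [ChartedSpace E5 M]
    [IsManifold (𝓡 5) ∞ M] [T2Space M] [CompactSpace M] [MulAction SO3 M] {α : OneForm M}
    {K : Set M} {δ : ℝ} {ψ : Cyl → M} {k : ℤ} {ε : ℝ} {hε : 0 < ε} (h : IsCollar α K δ ψ)
    (hα : IsContactSO3 α) (hε' : ε < epsBound k) (hδ : ε < δ) :
    ∃ (M' : Type w) (_ : TopologicalSpace M') (_ : ChartedSpace E5 M')
      (_ : IsManifold (𝓡 5) ∞ M') (_ : T2Space M') (_ : CompactSpace M')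
      (_ : MulAction SO3 M') (α' : OneForm M') (j₁ : M → M')
      (j₂ : MappingTorus (dehnTwist k ε hε) → M'), IsGluing α K δ ψ k ε hε α' j₁ j₂ := by
  obtain ⟨α', hα'⟩ := h.exists_isGluing_gluingData (hε := hε) hα hε' hδ
  exact ⟨_, _, _, inferInstance, inferInstance, h.compactSpace_gluing hα.smooth_action k hε hδ, _,
    α', _, _, hα'⟩

end Gluing

/-! ### Transport along equivariant contact embeddings -/

section Transport

variable {M : Type*} [TopologicalSpace M] [ChartedSpace E5 M] [MulAction SO3 M]
variable {N : Type*} [TopologicalSpace N] [ChartedSpace E5 N] [MulAction SO3 N]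

/-- Local diffeomorphisms are locally homeomorphisms. -/
theorem map_nhds_eq_of_isLocalDiffeomorphAt {F : M → N} {x : M}
    (h : IsLocalDiffeomorphAt (𝓡 5) (𝓡 5) ∞ F x) : Filter.map F (nhds x) = nhds (F x) := by
  refine le_antisymm h.contMDiffAt.continuousAt fun s hs => ?_
  obtain ⟨G, h1, h2, h3, -⟩ := exists_local_inverse h
  have h4 : F ⁻¹' s ∈ nhds (G (F x)) := by rw [h1]; exact hs
  filter_upwards [h2.continuousAt.preimage_mem_nhds h4, h3] with y hy hy'
  rw [← hy']
  exact hy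

theorem mem_closure_map {F : M → N} {x : M} (h : IsLocalDiffeomorphAt (𝓡 5) (𝓡 5) ∞ F x)
    {A : Set M} {B : Set N} (hAB : ∀ᶠ z in nhds x, (F z ∈ B ↔ z ∈ A)) :
    F x ∈ closure B ↔ x ∈ closure A := by
  rw [mem_closure_iff_frequently, mem_closure_iff_frequently,
    ← map_nhds_eq_of_isLocalDiffeomorphAt h, Filter.frequently_map]
  exact Filter.frequently_congr hAB

/-- The connected component of a point does not leave the open set of a separation. -/
theorem connectedComponentIn_eq_of_separated {X : Type*} [TopologicalSpace X] {S V W : Set X}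
    (hV : IsOpen V) (hW : IsOpen W) (hS : S ⊆ V ∪ W) (hd : Disjoint V W) {x : X}
    (hx : x ∈ S ∩ V) : connectedComponentIn S x = connectedComponentIn (S ∩ V) x := by
  refine Set.Subset.antisymm ?_ (connectedComponentIn_mono x Set.inter_subset_left)
  have hp : IsPreconnected (connectedComponentIn S x) := isPreconnected_connectedComponentIn
  have hsub := connectedComponentIn_subset S x
  exact hp.subset_connectedComponentIn (mem_connectedComponentIn hx.1)
    (Set.subset_inter hsub (hp.subset_left_of_subset_union hV hW hd (hsub.trans hS)
      ⟨x, mem_connectedComponentIn hx.1, hx.2⟩))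

/-- Homeomorphisms between subsets respect connected components. -/
theorem image_connectedComponentIn_of_continuousOn {X Y : Type*} [TopologicalSpace X]
    [TopologicalSpace Y] {f : X → Y} {g : Y → X} {S : Set X} (hf : ContinuousOn f S)
    (hg : ContinuousOn g (f '' S)) (hgf : ∀ x ∈ S, g (f x) = x) {x : X} (hx : x ∈ S) :
    f '' connectedComponentIn S x = connectedComponentIn (f '' S) (f x) := by
  have hsub := connectedComponentIn_subset S x
  have hsub' := connectedComponentIn_subset (f '' S) (f x)
  refine Set.Subset.antisymm ?_ fun y hy => ?_
  · exact ((isPreconnected_connectedComponentIn (x := x) (F := S)).image f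
      (hf.mono hsub)).subset_connectedComponentIn
      ⟨x, mem_connectedComponentIn hx, rfl⟩ (Set.image_mono hsub)
  · have h1 : g '' connectedComponentIn (f '' S) (f x) ⊆ connectedComponentIn S x := by
      refine ((isPreconnected_connectedComponentIn (x := f x) (F := f '' S)).image g
        (hg.mono hsub')).subset_connectedComponentIn
        ⟨f x, mem_connectedComponentIn ⟨x, hx, rfl⟩, hgf x hx⟩ ?_
      rintro _ ⟨z, hz, rfl⟩
      obtain ⟨w, hw, rfl⟩ := hsub' hz
      rwa [hgf w hw]
    refine ⟨g y, h1 ⟨y, hy, rfl⟩, ?_⟩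
    obtain ⟨w, hw, rfl⟩ := hsub' hy
    rw [hgf w hw]

/-- On the invariant open set `U` the map `j` is an equivariant open contact embedding. -/
structure ContactEmb (α : OneForm M) (β : OneForm N) (j : M → N) (U : Set M) : Prop where
  isOpen : IsOpen U
  smul_mem : ∀ (g : SO3), ∀ x ∈ U, g • x ∈ U
  localDiffeo : IsLocalDiffeomorphOn (𝓡 5) (𝓡 5) ∞ j U
  injOn : Set.InjOn j U
  equivariant : ∀ (g : SO3), ∀ x ∈ U, j (g • x) = g • j x
  form : ∀ x ∈ U, ∃ c : ℝ, 0 < c ∧ cov (pullback j β) x = c • cov α x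

namespace ContactEmb

variable {α : OneForm M} {β : OneForm N} {j : M → N} {U : Set M}

theorem contMDiffAt (h : ContactEmb α β j U) {x : M} (hx : x ∈ U) :
    ContMDiffAt (𝓡 5) (𝓡 5) ∞ j x := (h.localDiffeo ⟨x, hx⟩).contMDiffAt

theorem mdifferentiableAt (h : ContactEmb α β j U) {x : M} (hx : x ∈ U) :
    MDifferentiableAt (𝓡 5) (𝓡 5) j x := (h.contMDiffAt hx).mdifferentiableAt (by simp)

theorem continuousOn (h : ContactEmb α β j U) : ContinuousOn j U := fun _ hx =>
  (h.contMDiffAt hx).continuousAt.continuousWithinAt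

theorem isOpen_image (h : ContactEmb α β j U) : IsOpen (j '' U) :=
  isOpen_image_of_isLocalDiffeomorphOn h.localDiffeo h.isOpen le_rfl

theorem mem_of_smul_mem (h : ContactEmb α β j U) {g : SO3} {x : M} (hx : g • x ∈ U) : x ∈ U := by
  have := h.smul_mem g⁻¹ _ hx
  rwa [inv_smul_smul] at this

/-- The inverse of a contact embedding is a contact embedding. -/
theorem inverse [Nonempty M] (h : ContactEmb α β j U) :
    ContactEmb β α (Function.invFunOn j U) (j '' U) := by
  have hl : ∀ x ∈ U, Function.invFunOn j U (j x) = x := h.injOn.leftInvOn_invFunOn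
  have hld : ∀ x ∈ U, IsLocalDiffeomorphAt (𝓡 5) (𝓡 5) ∞ (Function.invFunOn j U) (j x) := by
    intro x hx
    refine isLocalDiffeomorphAt_of_comp (D := Function.invFunOn j U) (h.localDiffeo ⟨x, hx⟩)
      (isLocalDiffeomorphAt_congr ((Diffeomorph.refl (𝓡 5) M ∞).isLocalDiffeomorph x) ?_)
    filter_upwards [h.isOpen.mem_nhds hx] with z hz using hl z hz
  refine ⟨h.isOpen_image, ?_, ?_, ?_, ?_, ?_⟩
  · rintro g _ ⟨x, hx, rfl⟩
    exact ⟨g • x, h.smul_mem g x hx, h.equivariant g x hx⟩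
  · rintro ⟨_, x, hx, rfl⟩
    exact hld x hx
  · rintro _ ⟨x, hx, rfl⟩ _ ⟨y, hy, rfl⟩ e
    rw [hl x hx, hl y hy] at e
    rw [e]
  · rintro g _ ⟨x, hx, rfl⟩
    rw [hl x hx, ← h.equivariant g x hx, hl _ (h.smul_mem g x hx)]
  · rintro _ ⟨x, hx, rfl⟩
    obtain ⟨c, hc, e⟩ := h.form x hx
    refine ⟨c⁻¹, inv_pos.2 hc, ?_⟩
    have hd : MDifferentiableAt (𝓡 5) (𝓡 5) (Function.invFunOn j U) (j x) :=
      (hld x hx).contMDiffAt.mdifferentiableAt (by simp)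
    have e1 : cov (pullback j (pullback (Function.invFunOn j U) α)) x =
        c⁻¹ • cov (pullback j β) x := by
      rw [e, smul_smul, inv_mul_cancel₀ hc.ne', one_smul, ← pullback_comp α hd
        (h.mdifferentiableAt hx), pullback_congr (G := fun z => z), pullback_id]
      filter_upwards [h.isOpen.mem_nhds hx] with z hz using hl z hz
    ext v
    obtain ⟨u, rfl⟩ := (mder_bijective (h.localDiffeo ⟨x, hx⟩)).2 v
    exact DFunLike.congr_fun e1 u

theorem mem_crossSection (h : ContactEmb α β j U) (hM : IsSmoothAction M) {x : M} (hx : x ∈ U) :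
    j x ∈ crossSection β ↔ x ∈ crossSection α := by
  obtain ⟨c, hc, e⟩ := h.form x hx
  exact crossSection_map hM (h.mdifferentiableAt hx) (fun g => h.equivariant g x hx) hc e

theorem mem_closure_crossSection (h : ContactEmb α β j U) (hM : IsSmoothAction M) {x : M}
    (hx : x ∈ U) : j x ∈ closure (crossSection β) ↔ x ∈ closure (crossSection α) := by
  refine mem_closure_map (h.localDiffeo ⟨x, hx⟩) ?_
  filter_upwards [h.isOpen.mem_nhds hx] with z hz using h.mem_crossSection hM hz

theorem mem_singularSet (h : ContactEmb α β j U) (hM : IsSmoothAction M) {x : M} (hx : x ∈ U) :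
    j x ∈ singularSet N ↔ x ∈ singularSet M :=
  singularSet_map hM (h.mdifferentiableAt hx) (fun g => h.equivariant g x hx)
    (mder_bijective (h.localDiffeo ⟨x, hx⟩)).1

theorem smul_eq_iff (h : ContactEmb α β j U) {x : M} (hx : x ∈ U) (g : SO3) :
    g • j x = j x ↔ g • x = x := by
  rw [← h.equivariant g x hx, h.injOn.eq_iff (h.smul_mem g x hx) hx]

theorem mem_freePart (h : ContactEmb α β j U) (hM : IsSmoothAction M) {x : M} (hx : x ∈ U) :
    j x ∈ freePart β ↔ x ∈ freePart α := by
  simp only [freePart, Set.mem_ofPred_eq, h.mem_closure_crossSection hM hx, h.smul_eq_iff hx]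

theorem stabilizer_eq (h : ContactEmb α β j U) {x : M} (hx : x ∈ U) :
    MulAction.stabilizer SO3 (j x) = MulAction.stabilizer SO3 x := by
  ext g
  rw [MulAction.mem_stabilizer_iff, MulAction.mem_stabilizer_iff, h.smul_eq_iff hx]

theorem image_zOrbit (h : ContactEmb α β j U) {x : M} (hx : x ∈ U) :
    zOrbit (j x) = j '' zOrbit x := by
  ext z
  constructor
  · rintro ⟨s, rfl⟩
    exact ⟨rot 2 s • x, ⟨s, rfl⟩, h.equivariant _ x hx⟩
  · rintro ⟨_, ⟨s, rfl⟩, rfl⟩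
    exact ⟨s, h.equivariant _ x hx⟩

theorem zOrbit_subset (h : ContactEmb α β j U) {x : M} (hx : x ∈ U) : zOrbit x ⊆ U := by
  rintro _ ⟨s, rfl⟩
  exact h.smul_mem _ x hx

theorem image_connectedComponentIn (h : ContactEmb α β j U) {S : Set M} (hS : S ⊆ U) {x : M}
    (hx : x ∈ S) : j '' connectedComponentIn S x = connectedComponentIn (j '' S) (j x) := by
  have : Nonempty M := ⟨x⟩
  exact image_connectedComponentIn_of_continuousOn (h.continuousOn.mono hS)
    (h.inverse.continuousOn.mono (Set.image_mono hS))
    (fun z hz => h.injOn.leftInvOn_invFunOn (hS hz)) hx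

/-- Marked curves are transported by contact embeddings. -/
theorem image_markedCurve (h : ContactEmb α β j U) {T : Set M} (hT : T ⊆ U) {x₀ : M}
    (hx₀ : x₀ ∈ T) : markedCurve (j '' T) (j x₀) = j '' markedCurve T x₀ := by
  unfold markedCurve
  rw [h.image_connectedComponentIn
    (S := {x | x ∈ T ∧ MulAction.stabilizer SO3 x = MulAction.stabilizer SO3 x₀})
    (fun x hx => hT hx.1) ⟨hx₀, rfl⟩]
  congr 1
  ext z
  constructor
  · rintro ⟨⟨x, hx, rfl⟩, hs⟩
    rw [h.stabilizer_eq (hT hx), h.stabilizer_eq (hT hx₀)] at hs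
    exact ⟨x, ⟨hx, hs⟩, rfl⟩
  · rintro ⟨x, ⟨hx, hs⟩, rfl⟩
    exact ⟨⟨x, hx, rfl⟩, by rw [h.stabilizer_eq (hT hx), h.stabilizer_eq (hT hx₀), hs]⟩

end ContactEmb

theorem rot_two_pi_mul_int (i : Fin 3) (n : ℤ) : rot i (2 * Real.pi * n) = 1 := by
  have h1 : Real.cos (2 * Real.pi * n) = 1 := by
    rw [mul_comm]; exact Real.cos_int_mul_two_pi n
  have h2 : Real.sin (2 * Real.pi * n) = 0 := by
    rw [show 2 * Real.pi * (n : ℝ) = ((2 * n : ℤ) : ℝ) * Real.pi by push_cast; ring]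
    exact Real.sin_int_mul_pi _
  apply Subtype.ext
  ext j l
  fin_cases i <;> fin_cases j <;> fin_cases l <;> simp [rot, h1, h2]

/-- The circle acts freely on the boundary tori. -/
theorem IsTorusCover.subset_freePart {α : OneForm M} {T : Set M} {Φ : ℝ × ℝ → M}
    (h : IsTorusCover α T Φ) (hT : T ⊆ closure (crossSection α)) : T ⊆ freePart α := by
  intro x hx
  refine ⟨hT hx, fun s hs => ?_⟩
  rw [← h.range_eq] at hx
  obtain ⟨⟨a, b⟩, rfl⟩ := hx
  have hpi : 2 * Real.pi ≠ 0 := by positivity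
  have e : 2 * Real.pi * (s / (2 * Real.pi)) = s := by field_simp
  rw [← e, ← h.equivariant, eq_comm, h.fibers] at hs
  obtain ⟨m, n, hmn⟩ := hs
  have h2 : b + s / (2 * Real.pi) = b + n := congrArg Prod.snd hmn
  have h3 : s / (2 * Real.pi) = n := by linarith
  rw [← e, h3, rot_two_pi_mul_int]

/-- Contributions are invariant under contact embeddings: all data entering the definition are
transported by `j`, and positive factors do not change orientations. -/
theorem ContactEmb.hasContribution {α : OneForm M} {β : OneForm N} {j : M → N} {U : Set M}
    (h : ContactEmb α β j U) (hM : IsSmoothAction M) {L : Set M} (hL : L ⊆ U) {σ : M → M}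
    {σ' : N → N}
    (hσ' : ∀ x ∈ freePart α, x ∈ U → σ' (j x) = j (σ x)) {n : ℤ}
    (hc : HasContribution α σ L n) : HasContribution β σ' (j '' L) n := by
  obtain ⟨T, Φ, x₀, γ, b', a, b, hT, hΦ, hx₀, hγ, ha, hb', hb, hn⟩ := hc
  have hTU : T ⊆ U := hT ▸ fun x hx => hL hx.2
  have hTf : T ⊆ freePart α := hΦ.subset_freePart (hT ▸ Set.inter_subset_left)
  have hΦT : ∀ z, Φ z ∈ T := fun z => hΦ.range_eq ▸ Set.mem_range_self z
  have hΦU : ∀ z, Φ z ∈ U := fun z => hTU (hΦT z)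
  have hloop : ∀ (S : Set M) (c : ℝ → ℝ × ℝ) (a : ℤ × ℤ), IsSimpleLoop Φ S c a →
      IsSimpleLoop (fun z => j (Φ z)) (j '' S) c a := fun S c a hc =>
    ⟨hc.continuous, hc.periodic, fun u v e => hc.simple u v (h.injOn (hΦU _) (hΦU _) e), by
      rw [← hc.range_eq, ← Set.range_comp]; rfl⟩
  have himg : σ' '' (j '' T) = j '' (σ '' T) := by
    rw [Set.image_image, Set.image_image]
    exact Set.image_congr fun x hx => hσ' x (hTf hx) (hTU hx)
  have hmk := h.image_markedCurve hTU hx₀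
  have hcard : ∀ x ∈ T, (markedCurve (j '' T) (j x₀) ∩ zOrbit (j x)).ncard =
      (markedCurve T x₀ ∩ zOrbit x).ncard := by
    intro x hx
    have h1 : markedCurve T x₀ ⊆ U := (connectedComponentIn_subset _ _).trans fun y hy => hTU hy.1
    rw [hmk, h.image_zOrbit (hTU hx), ← h.injOn.image_inter h1 (h.zOrbit_subset (hTU hx)),
      (h.injOn.mono (Set.inter_subset_left.trans h1)).ncard_image]
  refine ⟨j '' T, fun z => j (Φ z), j x₀, γ, b', a, b, ?_, ?_, ⟨x₀, hx₀, rfl⟩, ?_, ha, ?_, hb, ?_⟩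
  · rw [hT]
    ext z
    constructor
    · rintro ⟨x, ⟨hx, hxL⟩, rfl⟩
      exact ⟨(h.mem_closure_crossSection hM (hL hxL)).2 hx, x, hxL, rfl⟩
    · rintro ⟨hz, x, hxL, rfl⟩
      exact ⟨x, ⟨(h.mem_closure_crossSection hM (hL hxL)).1 hz, hxL⟩, rfl⟩
  · refine ⟨fun z => (h.contMDiffAt (hΦU z)).comp z (hΦ.smooth z), ?_, ?_, ?_, ?_⟩
    · intro x y s
      rw [hΦ.equivariant, h.equivariant _ _ (hΦU _)]
    · intro z w
      rw [h.injOn.eq_iff (hΦU _) (hΦU _), hΦ.fibers]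
    · rw [← hΦ.range_eq, ← Set.range_comp]; rfl
    · intro z
      obtain ⟨c, hc, e⟩ := h.form (Φ z) (hΦU z)
      have h1 := mder_comp (F := Φ) (G := j) (x := z) (h.mdifferentiableAt (hΦU z))
        ((hΦ.smooth z).mdifferentiableAt (by simp))
      have h2 : cov β (j (Φ z)) (mder 𝓘(ℝ, ℝ × ℝ) (𝓡 5) (fun z => j (Φ z)) z ((1, 0) : ℝ × ℝ)) =
          c * cov α (Φ z) (mder 𝓘(ℝ, ℝ × ℝ) (𝓡 5) Φ z ((1, 0) : ℝ × ℝ)) := by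
        rw [h1]
        exact DFunLike.congr_fun e _
      change 0 < cov β (j (Φ z)) (mder 𝓘(ℝ, ℝ × ℝ) (𝓡 5) (fun z => j (Φ z)) z ((1, 0) : ℝ × ℝ))
      rw [h2]
      exact mul_pos hc (hΦ.oriented z)
  · rw [hmk]; exact hloop _ _ _ hγ
  · rw [himg]; exact hloop _ _ _ hb'
  · simp only [Set.forall_mem_image]
    refine hn.imp (fun hn => ⟨fun x hx => ?_, hn.2⟩) (fun hn => ⟨fun x hx => ?_, hn.2⟩)
    · rw [hcard x hx, hn.1 x hx]
    · rw [hcard x hx, hn.1 x hx]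

end Transport

/-! ### The singular orbits of the glued manifold -/

/-- The zero-section `ℝ × S²` is connected. -/
theorem isPreconnected_zeroSection : IsPreconnected {y : Cyl | y.2.p = 0} := by
  have hs : IsPreconnected ((Set.univ : Set ℝ) ×ˢ Metric.sphere (0 : E3) 1) := by
    refine isPreconnected_univ.prod (isPreconnected_sphere ?_ 0 1)
    rw [← Module.finrank_eq_rank]
    simp
  have hs' : IsPreconnected (Cyl.emb '' {y : Cyl | y.2.p = 0}) := by
    have : Cyl.emb '' {y : Cyl | y.2.p = 0} =
        (fun z : ℝ × E3 => ((z.1, z.2, 0) : Amb)) ''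
          ((Set.univ : Set ℝ) ×ˢ Metric.sphere (0 : E3) 1) := by
      ext w
      constructor
      · rintro ⟨y, hy, rfl⟩
        refine ⟨(y.1, y.2.q), ⟨trivial, by simpa using y.2.norm_q⟩, ?_⟩
        exact Prod.ext rfl (Prod.ext rfl (Eq.symm hy))
      · rintro ⟨⟨t, q⟩, ⟨-, hq⟩, rfl⟩
        exact ⟨(t, ⟨(q, 0), by simpa using hq, by simp⟩), rfl, rfl⟩
    rw [this]
    exact hs.image _ (by fun_prop)
  exact Cyl.isInducing_emb.isPreconnected_image.1 hs'

/-- The singular orbits of the mapping torus form its zero-section. -/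
theorem mk_mem_singularSet {k : ℤ} {ε : ℝ} {hε : 0 < ε} (y : Cyl) :
    MappingTorus.mk (dehnTwist k ε hε) y ∈ singularSet (MappingTorus (dehnTwist k ε hε)) ↔
      y.2.p = 0 := by
  have h := (MappingTorus.isLocalDiffeomorph_mk (dehnTwist k ε hε)) y
  rw [singularSet_map isSmoothAction_cyl (h.contMDiffAt.mdifferentiableAt (by simp))
    (fun g => rfl) (mder_bijective h).1, Cyl.mem_singularSet_iff]

section Gluing

variable {M : Type*} [TopologicalSpace M] [ChartedSpace E5 M] [MulAction SO3 M]
variable {M' : Type*} [TopologicalSpace M'] [ChartedSpace E5 M'] [MulAction SO3 M']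
variable {α : OneForm M} {K : Set M} {δ : ℝ} {ψ : Cyl → M} {k : ℤ} {ε : ℝ} {hε : 0 < ε}
variable {α' : OneForm M'} {j₁ : M → M'} {j₂ : MappingTorus (dehnTwist k ε hε) → M'}

theorem IsCollar.notMem_singularSet (hc : IsCollar α K δ ψ) {y : Cyl} (hy : y ∈ annulus δ) :
    ψ y ∉ singularSet M := by
  have h : IsLocalDiffeomorphAt (𝓡 5) (𝓡 5) ∞ ψ y := hc.localDiffeo ⟨y, hy⟩
  rw [singularSet_map isSmoothAction_cyl (h.contMDiffAt.mdifferentiableAt (by simp))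
    (fun g => hc.equivariant g y hy.1 hy.2) (mder_bijective h).1, Cyl.mem_singularSet_iff]
  exact norm_pos_iff.1 hy.1

theorem IsCollar.mem_K_of_mem_core (hc : IsCollar α K δ ψ) (hδ : ε < δ) {x : M}
    (hx : x ∈ singularSet M) (hxc : x ∈ core K ψ ε) : x ∈ K := by
  rcases hxc with h | ⟨y, hy, rfl⟩
  · exact h
  · exact absurd hx (hc.notMem_singularSet ⟨hy.1, hy.2.trans_lt hδ⟩)

/-- A component of the singular orbits that meets the complement of the core lies in it. -/
theorem IsCollar.component_eq (hc : IsCollar α K δ ψ) (hε : 0 < ε) (hδ : ε < δ) {x : M}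
    (hx : x ∈ singularSet M) (hxc : x ∈ (core K ψ ε)ᶜ) :
    connectedComponentIn (singularSet M) x =
      connectedComponentIn (singularSet M ∩ (core K ψ ε)ᶜ) x := by
  refine connectedComponentIn_eq_of_separated (hc.isClosed ε hε hδ).isOpen_compl
    (hc.isOpen ε hε hδ) ?_ ?_ ⟨hx, hxc⟩
  · intro z hz
    by_cases h : z ∈ core K ψ ε
    · exact Or.inr (Or.inl (hc.mem_K_of_mem_core hδ hz h))
    · exact Or.inl h
  · refine Set.disjoint_left.2 fun z hz hz' => hz ?_
    exact hz'.imp_right fun ⟨y, hy, e⟩ => ⟨y, ⟨hy.1, hy.2.le⟩, e⟩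

/-- The components of the singular orbits other than `K` are the components of the part of the
singular set outside of the core. -/
theorem IsCollar.singularComponents_diff (hc : IsCollar α K δ ψ) (hε : 0 < ε) (hδ : ε < δ)
    (hK : K ∈ singularComponents M) {L : Set M} :
    L ∈ singularComponents M \ {K} ↔ ∃ x ∈ singularSet M ∩ (core K ψ ε)ᶜ,
      L = connectedComponentIn (singularSet M ∩ (core K ψ ε)ᶜ) x := by
  constructor
  · rintro ⟨⟨x, hx, rfl⟩, hne⟩
    have hxc : x ∈ (core K ψ ε)ᶜ := by
      intro h
      obtain ⟨z, hz, rfl⟩ := hK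
      exact hne (connectedComponentIn_eq (hc.mem_K_of_mem_core hδ hx h)).symm
    exact ⟨x, ⟨hx, hxc⟩, hc.component_eq hε hδ hx hxc⟩
  · rintro ⟨x, hx, rfl⟩
    refine ⟨⟨x, hx.1, (hc.component_eq hε hδ hx.1 hx.2).symm⟩, ?_⟩
    intro h
    have h' : connectedComponentIn (singularSet M ∩ (core K ψ ε)ᶜ) x = K := h
    exact hx.2 (Or.inl (h'.subset (mem_connectedComponentIn hx)))

theorem IsCollar.subset_compl_core (hc : IsCollar α K δ ψ) (hε : 0 < ε) (hδ : ε < δ)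
    (hK : K ∈ singularComponents M) {L : Set M} (hL : L ∈ singularComponents M \ {K}) :
    L ⊆ (core K ψ ε)ᶜ := by
  obtain ⟨x, -, rfl⟩ := (hc.singularComponents_diff hε hδ hK).1 hL
  exact (connectedComponentIn_subset _ _).trans Set.inter_subset_right

namespace IsGluing

/-- The part coming from `M` is contact embedded in the glued manifold. -/
theorem contactEmb₁ (hg : IsGluing α K δ ψ k ε hε α' j₁ j₂) (hc : IsCollar α K δ ψ)
    (hM : IsSmoothAction M) (hδ : ε < δ) : ContactEmb α α' j₁ (core K ψ ε)ᶜ :=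
  ⟨(hc.isClosed ε hε hδ).isOpen_compl, fun g _ hx => hc.smul_mem_compl_core hM hε hδ g hx,
    hg.localDiffeo₁, hg.injOn₁, hg.equivariant₁, hg.form₁⟩

/-- The part coming from the mapping torus is contact embedded in the glued manifold. -/
theorem contactEmb₂ (hg : IsGluing α K δ ψ k ε hε α' j₁ j₂) : ContactEmb (torusForm k hε) α' j₂
    (MappingTorus.mk (dehnTwist k ε hε) '' {y : Cyl | ‖y.2.p‖ < δ}) := by
  have ho : IsOpen {y : Cyl | ‖y.2.p‖ < δ} := isOpen_lt continuous_norm_p continuous_const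
  refine ⟨MappingTorus.isOpenMap_mk _ _ ho, ?_, hg.localDiffeo₂, hg.injOn₂, ?_, ?_⟩
  · rintro g _ ⟨y, hy, rfl⟩
    exact ⟨g • y, by simpa only [Set.mem_ofPred_eq, Cyl.norm_smul_p] using hy, rfl⟩
  · rintro g _ ⟨y, hy, rfl⟩
    exact hg.equivariant₂ g y hy
  · rintro _ ⟨y, hy, rfl⟩
    obtain ⟨c, hc, e⟩ := hg.form₂ y hy
    refine ⟨c, hc, ?_⟩
    have hm := (MappingTorus.isLocalDiffeomorph_mk (dehnTwist k ε hε)) y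
    have hj : IsLocalDiffeomorphAt (𝓡 5) (𝓡 5) ∞ j₂ (MappingTorus.mk _ y) :=
      hg.localDiffeo₂ ⟨_, y, hy, rfl⟩
    have e1 := pullback_comp α' (F := MappingTorus.mk (dehnTwist k ε hε)) (G := j₂) (x := y)
      (hj.contMDiffAt.mdifferentiableAt (by simp)) (hm.contMDiffAt.mdifferentiableAt (by simp))
    have e2 : cov (pullback (fun z => j₂ (MappingTorus.mk (dehnTwist k ε hε) z)) α') y =
        c • cov (dehnForm k ε) y := e
    rw [e2, ← cov_pullback_torusForm k hε y] at e1
    ext v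
    obtain ⟨u, rfl⟩ := (mder_bijective hm).2 v
    exact (DFunLike.congr_fun e1 u).symm

theorem isLocalDiffeomorphAt_mk (hg : IsGluing α K δ ψ k ε hε α' j₁ j₂) {y : Cyl}
    (hy : ‖y.2.p‖ < δ) : IsLocalDiffeomorphAt (𝓡 5) (𝓡 5) ∞
      (fun z => j₂ (MappingTorus.mk (dehnTwist k ε hε) z)) y := by
  have hj : IsLocalDiffeomorphAt (𝓡 5) (𝓡 5) ∞ j₂ (MappingTorus.mk _ y) :=
    hg.localDiffeo₂ ⟨_, y, hy, rfl⟩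
  exact ((MappingTorus.isLocalDiffeomorph_mk (dehnTwist k ε hε)) y).comp (𝓡 5) _ hj

theorem contMDiffAt_mk (hg : IsGluing α K δ ψ k ε hε α' j₁ j₂) {y : Cyl} (hy : ‖y.2.p‖ < δ) :
    ContMDiffAt (𝓡 5) (𝓡 5) ∞ (fun z => j₂ (MappingTorus.mk (dehnTwist k ε hε) z)) y :=
  (hg.isLocalDiffeomorphAt_mk hy).contMDiffAt

theorem mk_mem_singularSet (hg : IsGluing α K δ ψ k ε hε α' j₁ j₂) {y : Cyl} (hy : ‖y.2.p‖ < δ) :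
    j₂ (MappingTorus.mk _ y) ∈ singularSet M' ↔ y.2.p = 0 := by
  rw [hg.contactEmb₂.mem_singularSet MappingTorus.isSmoothAction ⟨y, hy, rfl⟩,
    DehnTwist.mk_mem_singularSet]

/-- The singular orbits of the glued manifold. -/
theorem singularSet_eq (hg : IsGluing α K δ ψ k ε hε α' j₁ j₂) (hc : IsCollar α K δ ψ)
    (hM : IsSmoothAction M) (hδ : ε < δ) :
    singularSet M' = gluedComponent j₂ ∪ j₁ '' (singularSet M ∩ (core K ψ ε)ᶜ) := by
  have h1 := hg.contactEmb₁ hc hM hδ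
  ext z
  constructor
  · intro hz
    have hcov : z ∈ j₁ '' (core K ψ ε)ᶜ ∪ _ := hg.cover ▸ Set.mem_univ z
    rcases hcov with ⟨x, hx, rfl⟩ | ⟨y, hy, rfl⟩
    · exact Or.inr ⟨x, ⟨(h1.mem_singularSet hM hx).1 hz, hx⟩, rfl⟩
    · exact Or.inl ⟨y, (hg.mk_mem_singularSet hy).1 hz, rfl⟩
  · rintro (⟨y, hy, rfl⟩ | ⟨x, hx, rfl⟩)
    · have hy0 : y.2.p = 0 := hy
      refine (hg.mk_mem_singularSet ?_).2 hy0
      rw [hy0, norm_zero]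
      exact hε.trans hδ
    · exact (h1.mem_singularSet hM hx.2).2 hx.1

theorem norm_lt_of_p_eq_zero (hε : 0 < ε) (hδ : ε < δ) {y : Cyl} (hy : y.2.p = 0) :
    ‖y.2.p‖ < δ := by
  rw [hy, norm_zero]
  exact hε.trans hδ

theorem gluedComponent_nonempty : (gluedComponent j₂).Nonempty :=
  ⟨_, (0, stdPoint 0), by
    apply norm_eq_zero.1
    rw [norm_stdPoint_p le_rfl], rfl⟩

/-- The two charts of the covering of `M'` that separate the glued component from the others. -/
theorem disjoint_images (hg : IsGluing α K δ ψ k ε hε α' j₁ j₂) (hδ : ε < δ) :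
    Disjoint (j₂ '' (MappingTorus.mk (dehnTwist k ε hε) '' {y : Cyl | ‖y.2.p‖ < ε}))
      (j₁ '' (core K ψ ε)ᶜ) := by
  refine Set.disjoint_left.2 ?_
  rintro _ ⟨_, ⟨y, hy, rfl⟩, rfl⟩ ⟨x, hx, e⟩
  have hy' : ‖y.2.p‖ < ε := hy
  exact ((hg.glue x hx y (hy'.trans hδ)).1 e).1.not_gt hy'

theorem gluedComponent_subset : gluedComponent j₂ ⊆
    j₂ '' (MappingTorus.mk (dehnTwist k ε hε) '' {y : Cyl | ‖y.2.p‖ < ε}) := by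
  rintro _ ⟨y, hy, rfl⟩
  have hy0 : y.2.p = 0 := hy
  exact ⟨_, ⟨y, by rw [Set.mem_ofPred_eq, hy0, norm_zero]; exact hε, rfl⟩, rfl⟩

theorem disjoint_gluedComponent (hg : IsGluing α K δ ψ k ε hε α' j₁ j₂) (hδ : ε < δ) :
    Disjoint (gluedComponent j₂) (j₁ '' (core K ψ ε)ᶜ) :=
  (hg.disjoint_images hδ).mono_left gluedComponent_subset

/-- The zero-section of the mapping torus is a whole component of the singular orbits: it is
connected, and the images of the cores separate it from the rest. -/
theorem component_of_mem_glued (hg : IsGluing α K δ ψ k ε hε α' j₁ j₂) (hc : IsCollar α K δ ψ)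
    (hM : IsSmoothAction M) (hδ : ε < δ) {z : M'} (hz : z ∈ gluedComponent j₂) :
    connectedComponentIn (singularSet M') z = gluedComponent j₂ := by
  have hV : IsOpen (j₂ '' (MappingTorus.mk (dehnTwist k ε hε) '' {y : Cyl | ‖y.2.p‖ < ε})) :=
    isOpen_image_of_isLocalDiffeomorphOn hg.localDiffeo₂
      (MappingTorus.isOpenMap_mk _ _ (isOpen_lt continuous_norm_p continuous_const))
      (Set.image_mono fun y (hy : ‖y.2.p‖ < ε) => hy.trans hδ)
  have h1 := hg.contactEmb₁ hc hM hδ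
  have hS := hg.singularSet_eq hc hM hδ
  have hd := hg.disjoint_images hδ
  have hSV : singularSet M' ∩
      (j₂ '' (MappingTorus.mk (dehnTwist k ε hε) '' {y : Cyl | ‖y.2.p‖ < ε})) =
        gluedComponent j₂ := by
    rw [hS, Set.union_inter_distrib_right, Set.inter_eq_left.2 gluedComponent_subset,
      Set.union_eq_left.2]
    rintro _ ⟨⟨x, hx, rfl⟩, h⟩
    exact (Set.disjoint_left.1 hd h ⟨x, hx.2, rfl⟩).elim
  have hpre : IsPreconnected (gluedComponent j₂) := by
    refine isPreconnected_zeroSection.image _ fun y hy => ?_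
    exact (hg.contMDiffAt_mk (norm_lt_of_p_eq_zero hε hδ hy)).continuousAt.continuousWithinAt
  rw [connectedComponentIn_eq_of_separated hV h1.isOpen_image ?_ hd
    ⟨hS ▸ Or.inl hz, gluedComponent_subset hz⟩, hSV]
  · exact hpre.connectedComponentIn hz
  · rw [hS]
    exact Set.union_subset_union gluedComponent_subset (Set.image_mono Set.inter_subset_right)

/-- Components of singular orbits in the part coming from `M` are images of components. -/
theorem component_of_mem_image (hg : IsGluing α K δ ψ k ε hε α' j₁ j₂) (hc : IsCollar α K δ ψ)
    (hM : IsSmoothAction M) (hδ : ε < δ) {x : M} (hx : x ∈ singularSet M ∩ (core K ψ ε)ᶜ) :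
    connectedComponentIn (singularSet M') (j₁ x) =
      j₁ '' connectedComponentIn (singularSet M ∩ (core K ψ ε)ᶜ) x := by
  have hV : IsOpen (j₂ '' (MappingTorus.mk (dehnTwist k ε hε) '' {y : Cyl | ‖y.2.p‖ < ε})) :=
    isOpen_image_of_isLocalDiffeomorphOn hg.localDiffeo₂
      (MappingTorus.isOpenMap_mk _ _ (isOpen_lt continuous_norm_p continuous_const))
      (Set.image_mono fun y (hy : ‖y.2.p‖ < ε) => hy.trans hδ)
  have h1 := hg.contactEmb₁ hc hM hδ
  have hS := hg.singularSet_eq hc hM hδ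
  have hd := hg.disjoint_images hδ
  have hSV : singularSet M' ∩ j₁ '' (core K ψ ε)ᶜ = j₁ '' (singularSet M ∩ (core K ψ ε)ᶜ) := by
    rw [hS, Set.union_inter_distrib_right, (hg.disjoint_gluedComponent hδ).inter_eq,
      Set.empty_union, Set.inter_eq_left]
    exact Set.image_mono Set.inter_subset_right
  rw [connectedComponentIn_eq_of_separated h1.isOpen_image hV ?_ hd.symm
    ⟨hS ▸ Or.inr ⟨x, hx, rfl⟩, x, hx.2, rfl⟩, hSV,
    h1.image_connectedComponentIn Set.inter_subset_right hx]
  · rw [hS, Set.union_comm]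
    exact Set.union_subset_union (Set.image_mono Set.inter_subset_right) gluedComponent_subset

/-- The components of the singular orbits of the glued manifold. -/
theorem singularComponents_eq (hg : IsGluing α K δ ψ k ε hε α' j₁ j₂) (hc : IsCollar α K δ ψ)
    (hM : IsSmoothAction M) (hδ : ε < δ) (hK : K ∈ singularComponents M) :
    singularComponents M' = insert (gluedComponent j₂)
      ((fun L => j₁ '' L) '' (singularComponents M \ {K})) := by
  have hS := hg.singularSet_eq hc hM hδ
  ext L
  constructor
  · rintro ⟨z, hz, rfl⟩
    rw [hS] at hz
    rcases hz with hz | ⟨x, hx, rfl⟩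
    · exact Or.inl (hg.component_of_mem_glued hc hM hδ hz)
    · exact Or.inr ⟨_, (hc.singularComponents_diff hε hδ hK).2 ⟨x, hx, rfl⟩,
        (hg.component_of_mem_image hc hM hδ hx).symm⟩
  · rintro (rfl | ⟨L, hL, rfl⟩)
    · obtain ⟨z, hz⟩ := gluedComponent_nonempty (j₂ := j₂)
      exact ⟨z, hS ▸ Or.inl hz, (hg.component_of_mem_glued hc hM hδ hz).symm⟩
    · obtain ⟨x, hx, rfl⟩ := (hc.singularComponents_diff hε hδ hK).1 hL
      exact ⟨j₁ x, hS ▸ Or.inr ⟨x, hx, rfl⟩, (hg.component_of_mem_image hc hM hδ hx).symm⟩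

theorem gluedComponent_notMem (hg : IsGluing α K δ ψ k ε hε α' j₁ j₂) (hc : IsCollar α K δ ψ)
    (hδ : ε < δ) (hK : K ∈ singularComponents M) :
    gluedComponent j₂ ∉ (fun L => j₁ '' L) '' (singularComponents M \ {K}) := by
  rintro ⟨L, hL, e⟩
  have e' : j₁ '' L = gluedComponent j₂ := e
  obtain ⟨z, hz⟩ := gluedComponent_nonempty (j₂ := j₂)
  refine Set.disjoint_left.1 (hg.disjoint_gluedComponent hδ) hz ?_
  exact Set.image_mono (hc.subset_compl_core hε hδ hK hL) (e' ▸ hz)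

/-- The other components keep their contributions, by transport along the embedding of the part
coming from `M` and along its inverse. -/
theorem hasContribution_image_iff (hg : IsGluing α K δ ψ k ε hε α' j₁ j₂)
    (hc : IsCollar α K δ ψ) (hM : IsSmoothAction M) (hδ : ε < δ)
    (hK : K ∈ singularComponents M) {σ : M → M} (hσ : IsStandardSection α σ) {σ' : M' → M'}
    (hσ' : ∀ x ∈ freePart α, x ∉ core K ψ ε → σ' (j₁ x) = j₁ (σ x)) {L : Set M}
    (hL : L ∈ singularComponents M \ {K}) (c : ℤ) :
    HasContribution α' σ' (j₁ '' L) c ↔ HasContribution α σ L c := by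
  have h1 := hg.contactEmb₁ hc hM hδ
  have hLU := hc.subset_compl_core hε hδ hK hL
  refine ⟨fun h => ?_, h1.hasContribution hM hLU hσ'⟩
  have : Nonempty M := by
    obtain ⟨⟨x, -⟩, -⟩ := hL
    exact ⟨x⟩
  have hl : ∀ x ∈ (core K ψ ε)ᶜ, Function.invFunOn j₁ (core K ψ ε)ᶜ (j₁ x) = x :=
    h1.injOn.leftInvOn_invFunOn
  have h2 := h1.inverse.hasContribution hg.contact.smooth_action (L := j₁ '' L)
    (Set.image_mono hLU) (σ := σ') (σ' := σ) ?_ h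
  · rwa [Set.image_image, Set.image_congr fun x hx => hl x (hLU hx), Set.image_id'] at h2
  · rintro _ hx ⟨x, hxU, rfl⟩
    have hxf : x ∈ freePart α := (h1.mem_freePart hM hxU).1 hx
    rw [hσ' x hxf hxU, hl x hxU, hl _ (h1.zOrbit_subset hxU (hσ.mem_orbit x hxf))]

end IsGluing

end Gluing

/-! ### The moment map at singular points -/

section Moment

variable {M : Type*} [TopologicalSpace M] [ChartedSpace E5 M] [IsManifold (𝓡 5) ∞ M]

/-- A curve with vanishing velocity is constant. -/
theorem eq_of_mder_eq_zero [T2Space M] {c : ℝ → M} (hc : ContMDiff 𝓘(ℝ, ℝ) (𝓡 5) ∞ c)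
    (h : ∀ s, mder 𝓘(ℝ, ℝ) (𝓡 5) c s = 0) (s t : ℝ) : c s = c t := by
  have hcl : IsClosed {u | c u = c t} := isClosed_eq hc.continuous continuous_const
  have hop : IsOpen {u | c u = c t} := by
    rw [Metric.isOpen_iff]
    intro u hu
    have hs : c ⁻¹' (chartAt E5 (c u)).source ∈ nhds u :=
      hc.continuous.continuousAt.preimage_mem_nhds
        ((chartAt E5 (c u)).open_source.mem_nhds (mem_chart_source E5 (c u)))
    obtain ⟨r, hr, hr'⟩ := Metric.mem_nhds_iff.1 hs
    refine ⟨r, hr, fun v hv => ?_⟩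
    have hd : ∀ w ∈ Metric.ball u r, HasFDerivAt (fun w => chartAt E5 (c u) (c w))
        (0 : ℝ →L[ℝ] E5) w := by
      intro w hw
      have h1 : MDifferentiableAt (𝓡 5) (𝓡 5) (chartAt E5 (c u)) (c w) :=
        (contMDiffAt_chart (hr' hw)).mdifferentiableAt (by simp)
      have h2 : MDifferentiableAt 𝓘(ℝ, ℝ) (𝓡 5) c w := (hc w).mdifferentiableAt (by simp)
      have h3 := mder_comp h1 h2
      have h4 := h1.comp w h2
      rw [h w, ContinuousLinearMap.comp_zero, mder_eq_fderiv] at h3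
      rw [← h3]
      exact h4.differentiableAt.hasFDerivAt
    have e : chartAt E5 (c u) (c v) = chartAt E5 (c u) (c u) :=
      (convex_ball u r).is_const_of_fderivWithin_eq_zero (𝕜 := ℝ)
        (f := fun w => chartAt E5 (c u) (c w))
        (fun w hw => (hd w hw).differentiableAt.differentiableWithinAt)
        (fun w hw => by
          rw [fderivWithin_of_isOpen Metric.isOpen_ball hw, (hd w hw).fderiv])
        hv (Metric.mem_ball_self hr)
    have e' := (chartAt E5 (c u)).injOn (hr' hv) (hr' (Metric.mem_ball_self hr)) e
    change c v = c t
    rw [e']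
    exact hu
  have huniv := IsClopen.eq_univ ⟨hcl, hop⟩ ⟨t, rfl⟩
  have : s ∈ {u | c u = c t} := huniv ▸ Set.mem_univ s
  exact this

variable [MulAction SO3 M]

/-- A point at which the generator of a one-parameter group vanishes is fixed by the group, because
the velocity of its orbit is transported from time `0` to any other time. -/
theorem IsSmoothAction.fixed_of_mder_eq_zero [T2Space M] (hM : IsSmoothAction M) {g : ℝ → SO3}
    (hg : ∀ i j, ContDiff ℝ ∞ fun a => (g a).1 i j) (h0 : g 0 = 1)
    (ha : ∀ s t, g (s + t) = g s * g t) {x : M}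
    (hx : mder 𝓘(ℝ, ℝ) (𝓡 5) (fun s => g s • x) 0 = 0) (s : ℝ) : g s • x = x := by
  have hc := hM.contMDiff_curve hg x
  have h1 : ∀ u, mder 𝓘(ℝ, ℝ) (𝓡 5) (fun s => g s • x) u = 0 := by
    intro u
    have e : (fun s => g s • x) = fun s => g u • (g (s - u) • x) := by
      ext1 s
      rw [smul_smul, ← ha, add_sub_cancel]
    have hsub : MDifferentiableAt 𝓘(ℝ, ℝ) 𝓘(ℝ, ℝ) (fun s : ℝ => s - u) u :=
      (differentiableAt_id.sub_const u).mdifferentiableAt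
    have h2 : MDifferentiableAt 𝓘(ℝ, ℝ) (𝓡 5) (fun s => g s • x) (u - u) :=
      (hc _).mdifferentiableAt (by simp)
    have h3 : MDifferentiableAt 𝓘(ℝ, ℝ) (𝓡 5) (fun s => g (s - u) • x) u :=
      MDifferentiableAt.comp (f := fun s : ℝ => s - u) (g := fun s => g s • x) u h2 hsub
    rw [e, mder_comp (F := fun s => g (s - u) • x) (G := fun z : M => g u • z)
      ((hM.contMDiff_smul (g u) _).mdifferentiableAt (by simp)) h3,
      mder_comp (F := fun s : ℝ => s - u) (G := fun s => g s • x) h2 hsub,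
      mder_congr_point (sub_self u), hx, ContinuousLinearMap.zero_comp,
      ContinuousLinearMap.comp_zero]
  have := eq_of_mder_eq_zero hc h1 s 0
  simpa only [h0, one_smul] using this

theorem IsSmoothAction.rot_smul_of_gen_eq_zero [T2Space M] (hM : IsSmoothAction M) {i : Fin 3}
    {x : M} (hx : genv i x = 0) (s : ℝ) : rot i s • x = x := by
  refine hM.fixed_of_mder_eq_zero (contDiff_rot_entry i) (rot_zero i) (rot_add i) ?_ s
  ext1
  exact hx

/-- The rotations around the `i`-th axis in a chart, as a function of time and coordinates. -/
theorem contMDiffAt_rot_smul_chart_symm (hM : IsSmoothAction M) (i : Fin 3) {x₀ : M} {z : E5}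
    (hz : z ∈ (chartAt E5 x₀).target) : ContMDiffAt 𝓘(ℝ, ℝ × E5) (𝓡 5) ∞
      (fun w : ℝ × E5 => rot i w.1 • (chartAt E5 x₀).symm w.2) (0, z) := by
  have h0 : ContMDiffAt 𝓘(ℝ, ℝ × E5) (𝓡 5) ∞ (fun w : ℝ × E5 => w.2) (0, z) := by
    exact contDiff_snd.contMDiff.contMDiffAt
  have h1 : ContMDiffAt 𝓘(ℝ, ℝ × E5) (𝓡 5) ∞
      (fun w : ℝ × E5 => (chartAt E5 x₀).symm w.2) (0, z) := by
    exact ContMDiffAt.comp (I' := 𝓡 5) (0, z) (f := fun w : ℝ × E5 => w.2)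
      (g := (chartAt E5 x₀).symm) (contMDiffAt_chart_symm hz) h0
  have h2 : ContMDiffAt 𝓘(ℝ, ℝ × E5) 𝓘(ℝ, ℝ) ∞ (fun w : ℝ × E5 => w.1) (0, z) := by
    exact contDiff_fst.contMDiff.contMDiffAt
  have h3 := (hM.contMDiff_curve₂ (contDiff_rot_entry i)) ((0 : ℝ), (chartAt E5 x₀).symm z)
  exact ContMDiffAt.comp (I' := 𝓘(ℝ, ℝ).prod (𝓡 5)) (0, z)
    (f := fun w : ℝ × E5 => (w.1, (chartAt E5 x₀).symm w.2))
    (g := fun w : ℝ × M => rot i w.1 • w.2) h3 (h2.prodMk h1)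

/-- The moment map is continuous. -/
theorem continuous_momentMap {α : OneForm M} (hα : IsContactSO3 α) (i : Fin 3) :
    Continuous fun x => momentMap α x i := by
  have hM := hα.smooth_action
  rw [continuous_iff_continuousAt]
  intro x₀
  set φ := chartAt E5 x₀ with hφ
  have hx₀ : x₀ ∈ φ.source := mem_chart_source E5 x₀
  set G : ℝ × E5 → E5 := fun w => φ (rot i w.1 • φ.symm w.2) with hG
  have hz₀ : φ x₀ ∈ φ.target := φ.map_source hx₀
  have hcurve := contMDiffAt_rot_smul_chart_symm hM i hz₀
  have hval : rot i 0 • φ.symm (φ x₀) = x₀ := by rw [rot_zero, one_smul, φ.left_inv hx₀]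
  have hGs : ContDiffAt ℝ ∞ G (0, φ x₀) := by
    have h1 : ContMDiffAt (𝓡 5) (𝓡 5) ∞ φ (rot i 0 • φ.symm (φ x₀)) :=
      contMDiffAt_chart (by rw [hval]; exact hx₀)
    exact (ContMDiffAt.comp (0, φ x₀) (g := φ) (f := fun w : ℝ × E5 => rot i w.1 • φ.symm w.2)
      h1 hcurve).contDiffAt
  have hA : ContinuousAt (inChart α x₀) (φ x₀) :=
    (hα.smooth_form.formSmoothAt x₀ : ContDiffAt ℝ ∞ (inChart α x₀) (φ x₀)).continuousAt
  have hB : ContinuousAt (fun z : E5 => fderiv ℝ G (0, z) (1, 0)) (φ x₀) := by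
    have h1 : ContinuousAt (fderiv ℝ G) (0, φ x₀) :=
      (hGs.fderiv_right (m := 0) (by simp)).continuousAt
    have h2 : ContinuousAt (fun z : E5 => fderiv ℝ G (0, z)) (φ x₀) :=
      ContinuousAt.comp (f := fun z : E5 => ((0, z) : ℝ × E5)) h1 (by fun_prop)
    exact h2.clm_apply continuousAt_const
  have hφc : ContinuousAt φ x₀ := φ.continuousAt hx₀
  -- the generator at `x` is the derivative at time `0` of the flow `G` in the fixed chart at `x₀`
  have hev : (fun x => momentMap α x i) =ᶠ[nhds x₀]
      fun x => inChart α x₀ (φ x) (fderiv ℝ G (0, φ x) (1, 0)) := by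
    have hGd : ∀ᶠ w in nhds ((0 : ℝ), φ x₀), DifferentiableAt ℝ G w :=
      ((hGs.of_le (m := 1) (by simp)).eventually (by simp)).mono fun w hw =>
        hw.differentiableAt (by simp)
    have hpair : ContinuousAt (fun x => ((0 : ℝ), φ x)) x₀ := continuousAt_const.prodMk hφc
    filter_upwards [hpair.eventually hGd, φ.open_source.mem_nhds hx₀] with x hx hxs
    have e1 : rot i 0 • x = x := by rw [rot_zero, one_smul]
    have hd : MDifferentiableAt (𝓡 5) (𝓡 5) φ x :=
      (contMDiffAt_chart hxs).mdifferentiableAt (by simp)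
    have hd' : MDifferentiableAt (𝓡 5) (𝓡 5) φ (rot i 0 • x) := by rwa [e1]
    have h1 : fderiv ℝ G (0, φ x) (1, 0) = mder (𝓡 5) (𝓡 5) φ x (genv i x) := by
      have h2 : HasFDerivAt (fun s : ℝ => G (s, φ x))
          ((fderiv ℝ G (0, φ x)).comp (ContinuousLinearMap.inl ℝ ℝ E5)) 0 :=
        HasFDerivAt.comp 0 (f := fun s : ℝ => (s, φ x)) hx.hasFDerivAt
          (hasFDerivAt_prodMk_left (𝕜 := ℝ) (0 : ℝ) (φ x))
      have h3 : (fun s : ℝ => G (s, φ x)) = fun s => φ (rot i s • x) := by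
        ext1 s
        rw [hG]
        simp only [φ.left_inv hxs]
      have h4 := mder_comp (F := fun s : ℝ => rot i s • x) hd' (hM.mdifferentiableAt_rot i x)
      rw [h3] at h2
      rw [mder_eq_fderiv, h2.fderiv, mder_congr_point e1] at h4
      exact DFunLike.congr_fun h4 1
    have hcs : MDifferentiableAt (𝓡 5) (𝓡 5) φ.symm (φ x) :=
      (contMDiffAt_chart_symm (φ.map_source hxs)).mdifferentiableAt (by simp)
    have h5 := pullback_comp (F := φ) (G := φ.symm) (x := x) α hcs hd
    rw [pullback_congr (G := fun z => z), pullback_id] at h5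
    · rw [h1]
      exact DFunLike.congr_fun h5 (genv i x)
    · filter_upwards [φ.open_source.mem_nhds hxs] with z hz using φ.left_inv hz
  refine ContinuousAt.congr ?_ hev.symm
  exact (ContinuousAt.comp (f := φ) hA hφc).clm_apply
    (ContinuousAt.comp (f := φ) (g := fun z : E5 => fderiv ℝ G (0, z) (1, 0)) hB hφc)

/-- The first two components of the moment map vanish on the closure of the cross-section. -/
theorem momentMap_of_mem_closure {α : OneForm M} (hα : IsContactSO3 α) {x : M}
    (hx : x ∈ closure (crossSection α)) : momentMap α x 0 = 0 ∧ momentMap α x 1 = 0 := by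
  have hcl : IsClosed {x : M | momentMap α x 0 = 0 ∧ momentMap α x 1 = 0} :=
    (isClosed_eq (continuous_momentMap hα 0) continuous_const).inter
      (isClosed_eq (continuous_momentMap hα 1) continuous_const)
  have hsub : crossSection α ⊆ {x : M | momentMap α x 0 = 0 ∧ momentMap α x 1 = 0} :=
    fun z hz => ⟨hz.1, hz.2.1⟩
  exact closure_minimal hsub hcl hx

/-- The Cayley parametrization of the rotations around the axes in the plane `z = 0`: the unit
quaternion `(1, a, b, 0)` up to normalization. -/
def cayley (a b : ℝ) : SO3 :=
  ⟨(1 + a ^ 2 + b ^ 2)⁻¹ • !![1 + a ^ 2 - b ^ 2, 2 * a * b, 2 * b;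
      2 * a * b, 1 - a ^ 2 + b ^ 2, -2 * a; -2 * b, 2 * a, 1 - a ^ 2 - b ^ 2], by
    have h : 1 + a ^ 2 + b ^ 2 ≠ 0 := by positivity
    rw [Matrix.mem_specialOrthogonalGroup_iff, Matrix.mem_orthogonalGroup_iff]
    refine ⟨?_, ?_⟩
    · ext i j
      fin_cases i <;> fin_cases j <;> simp [Matrix.mul_apply, Fin.sum_univ_three] <;>
        field_simp <;> ring
    · simp [Matrix.det_fin_three]
      field_simp
      ring⟩

theorem contDiff_cayley_entry (i j : Fin 3) :
    ContDiff ℝ ∞ fun z : EuclideanSpace ℝ (Fin 2) => (cayley (z 0) (z 1)).1 i j := by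
  have h : ContDiff ℝ ∞ fun z : EuclideanSpace ℝ (Fin 2) => (1 + z 0 ^ 2 + z 1 ^ 2)⁻¹ := by
    refine ContDiff.inv (by fun_prop) fun z => ?_
    positivity
  fin_cases i <;> fin_cases j <;> simp [cayley] <;>
    first | exact h.mul (by fun_prop) | exact (h.mul (by fun_prop)).neg

/-- `cayley (s cos θ) (s sin θ)` is the rotation by `2 arctan s` around `(cos θ, sin θ, 0)`. -/
theorem cayley_polar (θ s : ℝ) : cayley (s * Real.cos θ) (s * Real.sin θ) =
    rot 2 θ * rot 0 (2 * Real.arctan s) * rot 2 (-θ) := by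
  have h : 1 + s ^ 2 ≠ 0 := by positivity
  have hc : Real.cos (2 * Real.arctan s) = (1 - s ^ 2) / (1 + s ^ 2) := by
    rw [Real.cos_two_mul, Real.cos_sq_arctan]
    field_simp
    ring
  have hs : Real.sin (2 * Real.arctan s) = 2 * s / (1 + s ^ 2) := by
    rw [Real.sin_two_mul, Real.sin_arctan, Real.cos_arctan]
    have h1 : √(1 + s ^ 2) ≠ 0 := (Real.sqrt_pos.2 (by positivity)).ne'
    have h2 : √(1 + s ^ 2) * √(1 + s ^ 2) = 1 + s ^ 2 := Real.mul_self_sqrt (by positivity)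
    field_simp
    rw [pow_two (√(1 + s ^ 2)), h2]
  have hcs := Real.sin_sq_add_cos_sq θ
  have hn : 1 + (s * Real.cos θ) ^ 2 + (s * Real.sin θ) ^ 2 = 1 + s ^ 2 := by
    linear_combination s ^ 2 * hcs
  have hs2 : Real.sin θ ^ 2 = 1 - Real.cos θ ^ 2 := by linarith
  apply Subtype.ext
  change _ = (rot 2 θ).1 * (rot 0 (2 * Real.arctan s)).1 * (rot 2 (-θ)).1
  ext j l
  fin_cases j <;> fin_cases l <;>
    simp [cayley, rot, Matrix.mul_apply, Fin.sum_univ_three, hn, hc, hs] <;> field_simp <;>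
    ring_nf <;> try (rw [hs2]; ring)

/-- The rotation by `s` around `(cos θ, sin θ, 0)`. -/
def tilt (θ s : ℝ) : SO3 := rot 2 θ * rot 0 s * rot 2 (-θ)

theorem contDiff_tilt_entry (θ : ℝ) (i j : Fin 3) : ContDiff ℝ ∞ fun s => (tilt θ s).1 i j := by
  have e : ∀ s, (tilt θ s).1 i j =
      ∑ l, (∑ m, (rot 2 θ).1 i m * (rot 0 s).1 m l) * (rot 2 (-θ)).1 l j := fun s => rfl
  simp only [e]
  exact ContDiff.sum fun l _ => (ContDiff.sum fun m _ =>
    contDiff_const.mul (contDiff_rot_entry 0 m l)).mul contDiff_const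

theorem rot_mul_rot_neg (i : Fin 3) (s : ℝ) : rot i s * rot i (-s) = 1 := by
  rw [← rot_add, add_neg_cancel, rot_zero]

theorem rot_neg_mul_rot (i : Fin 3) (s : ℝ) : rot i (-s) * rot i s = 1 := by
  rw [← rot_add, neg_add_cancel, rot_zero]

theorem tilt_zero (θ : ℝ) : tilt θ 0 = 1 := by
  rw [tilt, rot_zero, mul_one, rot_mul_rot_neg]

theorem tilt_add (θ s t : ℝ) : tilt θ (s + t) = tilt θ s * tilt θ t := by
  have h : rot 2 (-θ) * (rot 2 θ * rot 0 t) = rot 0 t := by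
    rw [← mul_assoc, rot_neg_mul_rot, one_mul]
  rw [tilt, tilt, tilt, rot_add, mul_assoc (rot 2 θ * rot 0 s), ← mul_assoc (rot 2 (-θ)), h]
  simp only [mul_assoc]

/-- The half turn around a horizontal axis conjugates the rotations around the `z`-axis to their
inverses. -/
theorem tilt_pi_mul_rot (θ s : ℝ) : tilt θ Real.pi * rot 2 s = rot 2 (-s) * tilt θ Real.pi := by
  have h : rot 0 Real.pi * rot 2 s = rot 2 (-s) * rot 0 Real.pi := by
    apply Subtype.ext
    change (rot 0 Real.pi).1 * (rot 2 s).1 = (rot 2 (-s)).1 * (rot 0 Real.pi).1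
    ext j l
    fin_cases j <;> fin_cases l <;> simp [rot, Matrix.mul_apply, Fin.sum_univ_three]
  rw [tilt, mul_assoc, ← rot_add, add_comm, rot_add, ← mul_assoc, mul_assoc (rot 2 θ), h,
    ← mul_assoc, ← mul_assoc, ← mul_assoc, ← rot_add, ← rot_add, add_comm]

theorem tilt_pi_div_two (s : ℝ) : tilt (Real.pi / 2) s = rot 1 s := by
  apply Subtype.ext
  change (rot 2 (Real.pi / 2)).1 * (rot 0 s).1 * (rot 2 (-(Real.pi / 2))).1 = _
  ext j l
  fin_cases j <;> fin_cases l <;> simp [rot, Matrix.mul_apply, Fin.sum_univ_three]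

theorem tilt_zero_left (s : ℝ) : tilt 0 s = rot 0 s := by
  rw [tilt, neg_zero, rot_zero, one_mul, mul_one]

/-- The velocity of the rotations around `(cos θ, sin θ, 0)` depends linearly on the axis; this is
read off from the Cayley parametrization, which contains all of them. -/
theorem IsSmoothAction.mder_tilt (hM : IsSmoothAction M) (θ : ℝ) (x : M) :
    mder 𝓘(ℝ, ℝ) (𝓡 5) (fun s : ℝ => tilt θ s • x) 0 1 =
      Real.cos θ • genv 0 x + Real.sin θ • genv 1 x := by
  set F : EuclideanSpace ℝ (Fin 2) → M := fun z => cayley (z 0) (z 1) • x with hF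
  have hFs : ContMDiff (𝓡 2) (𝓡 5) ∞ F := hM.contMDiff_family contDiff_cayley_entry x
  -- `cayley` maps the line in the direction `(cos θ, sin θ)` to the rotations around this axis,
  -- with speed `2` at the origin
  have key : ∀ θ : ℝ, mder (𝓡 2) (𝓡 5) F 0 !₂[Real.cos θ, Real.sin θ] =
      (2 : ℝ) • mder 𝓘(ℝ, ℝ) (𝓡 5) (fun s : ℝ => tilt θ s • x) 0 1 := by
    intro θ
    set v : EuclideanSpace ℝ (Fin 2) := !₂[Real.cos θ, Real.sin θ] with hv
    have e : (fun s : ℝ => F (s • v)) = fun s => tilt θ (2 * Real.arctan s) • x := by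
      ext1 s
      have e1 : cayley ((s • v) 0) ((s • v) 1) = tilt θ (2 * Real.arctan s) := by
        rw [tilt, ← cayley_polar]
        simp [hv]
      rw [hF]
      simp only [e1]
    have hl : HasFDerivAt (fun s : ℝ => s • v)
        ((ContinuousLinearMap.id ℝ ℝ).smulRight v) (0 : ℝ) :=
      ((ContinuousLinearMap.id ℝ ℝ).smulRight v).hasFDerivAt
    have hA : HasDerivAt (fun s : ℝ => 2 * Real.arctan s) 2 0 := by
      simpa using (Real.hasDerivAt_arctan 0).const_mul 2
    have h0 : 2 * Real.arctan 0 = 0 := by simp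
    have h1 := mder_comp (I := 𝓘(ℝ, ℝ)) (I' := 𝓡 2) (F := fun s : ℝ => s • v) (G := F) (x := 0)
      ((hFs _).mdifferentiableAt (by simp)) hl.differentiableAt.mdifferentiableAt
    have h2 := mder_comp (I := 𝓘(ℝ, ℝ)) (I' := 𝓘(ℝ, ℝ)) (F := fun s : ℝ => 2 * Real.arctan s)
      (G := fun s => tilt θ s • x) (x := 0)
      ((hM.contMDiff_curve (contDiff_tilt_entry θ) x _).mdifferentiableAt (by simp))
      hA.differentiableAt.mdifferentiableAt
    rw [e, h2, mder_eq_fderiv, mder_eq_fderiv, hl.fderiv, hA.hasFDerivAt.fderiv,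
      mder_congr_point h0, mder_congr_point (zero_smul ℝ v)] at h1
    have h3 := DFunLike.congr_fun h1 1
    simp only [ContinuousLinearMap.comp_apply] at h3
    have h4 : (ContinuousLinearMap.id ℝ ℝ).smulRight v (1 : ℝ) = v := by simp
    have h5 : (ContinuousLinearMap.toSpanSingleton ℝ (2 : ℝ)) 1 = (2 : ℝ) • (1 : ℝ) := by simp
    rw [h4, h5, map_smul] at h3
    exact h3.symm
  have k0 := key 0
  have k1 := key (Real.pi / 2)
  simp only [tilt_zero_left, tilt_pi_div_two, Real.cos_zero, Real.sin_zero, Real.cos_pi_div_two,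
    Real.sin_pi_div_two] at k0 k1
  have k := key θ
  have hv : (!₂[Real.cos θ, Real.sin θ] : EuclideanSpace ℝ (Fin 2)) =
      Real.cos θ • !₂[1, 0] + Real.sin θ • !₂[0, 1] := by
    ext i
    fin_cases i <;> simp
  rw [hv, map_add, map_smul, map_smul, k0, k1, smul_comm, smul_comm (Real.sin θ), ← smul_add] at k
  exact (smul_right_injective E5 (two_ne_zero' ℝ) k).symm

/-- On the singular points of the closure of the cross-section the moment map vanishes: a vanishing
combination of the generators that involves `Z_M` gives this at once, and otherwise the point is
fixed by a half turn that reverses `Z_M`. -/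
theorem momentMap_two_eq_zero [T2Space M] {α : OneForm M} (hα : IsContactSO3 α) {x : M}
    (hx : x ∈ closure (crossSection α)) (hs : x ∈ singularSet M) : momentMap α x 2 = 0 := by
  have hM := hα.smooth_action
  obtain ⟨h0, h1⟩ := momentMap_of_mem_closure hα hx
  have h0' : cov α x (genv 0 x) = 0 := h0
  have h1' : cov α x (genv 1 x) = 0 := h1
  change cov α x (genv 2 x) = 0
  rw [mem_singularSet, Fintype.not_linearIndependent_iff] at hs
  obtain ⟨c, hc, hne⟩ := hs
  rw [Fin.sum_univ_three] at hc
  by_cases h2 : c 2 = 0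
  -- the relation says that the rotations around the horizontal axis at angle `θ` fix the point
  · obtain ⟨θ, hθ0, hθ1⟩ := exists_polar (c 0) (c 1)
    generalize √(c 0 ^ 2 + c 1 ^ 2) = r at hθ0 hθ1
    have hr : r ≠ 0 := by
      intro h
      rw [h, zero_mul] at hθ0 hθ1
      obtain ⟨i, hi⟩ := hne
      fin_cases i
      · exact hi hθ0
      · exact hi hθ1
      · exact hi h2
    have hz : Real.cos θ • genv 0 x + Real.sin θ • genv 1 x = 0 := by
      rw [h2, zero_smul, add_zero] at hc
      rw [hθ0, hθ1, mul_smul, mul_smul, ← smul_add] at hc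
      exact (smul_eq_zero.1 hc).resolve_left hr
    have hfix : tilt θ Real.pi • x = x := by
      refine hM.fixed_of_mder_eq_zero (contDiff_tilt_entry θ) (tilt_zero θ) (tilt_add θ) ?_ _
      ext1
      rw [hM.mder_tilt, hz]
      rfl
    set g := tilt θ Real.pi with hg
    have e1 : (fun s : ℝ => g • (rot 2 s • x)) = fun s => rot 2 (-s) • x := by
      ext1 s
      rw [smul_smul, hg, tilt_pi_mul_rot, mul_smul, hfix]
    have hgx : rot 2 0 • x = x := by rw [rot_zero, one_smul]
    have m1 := mder_comp (F := fun s : ℝ => rot 2 s • x) (G := fun z : M => g • z) (x := 0)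
      ((hM.contMDiff_smul g _).mdifferentiableAt (by simp)) (hM.mdifferentiableAt_rot 2 x)
    have hn : HasDerivAt (fun s : ℝ => -s) (-1) 0 := hasDerivAt_neg 0
    have m2 := mder_comp (I := 𝓘(ℝ, ℝ)) (I' := 𝓘(ℝ, ℝ)) (F := fun s : ℝ => -s)
      (G := fun s : ℝ => rot 2 s • x) (x := 0)
      ((hM.contMDiff_rot 2 x _).mdifferentiableAt (by simp)) hn.differentiableAt.mdifferentiableAt
    rw [e1, m2, mder_eq_fderiv, hn.hasFDerivAt.fderiv, mder_congr_point (neg_zero (G := ℝ)),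
      mder_congr_point hgx] at m1
    have m3 := DFunLike.congr_fun m1 1
    simp only [ContinuousLinearMap.comp_apply] at m3
    have h5 : (ContinuousLinearMap.toSpanSingleton ℝ (-1 : ℝ)) 1 = (-1 : ℝ) • (1 : ℝ) := by simp
    rw [h5, map_smul] at m3
    -- the half turn `g` fixes `x`, preserves `α` and reverses `Z_M`, so `α(Z_M) = -α(Z_M)` at `x`
    have m4 : mder (𝓡 5) (𝓡 5) (fun z : M => g • z) x (genv 2 x) = (-1 : ℝ) • genv 2 x := m3.symm
    have hinv : cov (pullback (fun z : M => g • z) α) x (genv 2 x) = cov α x (genv 2 x) := by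
      rw [hα.invariant g]
    have hinv' : cov α (g • x) (mder (𝓡 5) (𝓡 5) (fun z : M => g • z) x (genv 2 x)) =
        cov α x (genv 2 x) := hinv
    rw [m4, hfix, map_smul, smul_eq_mul] at hinv'
    linarith
  · have h3 := congrArg (cov α x) hc
    simp only [map_add, map_smul, h0', h1', mul_zero, zero_add, map_zero, smul_eq_mul] at h3
    exact (mul_eq_zero.1 h3).resolve_left h2

end Moment

/-! ### Lifting to the universal covering of a boundary torus -/

section Lifting

/-- If `Φ` has the same fibers as the quotient map `Q` to a compact space, a continuous map into the
image of `Φ` factors through a continuous map into the quotient: the injection of the quotient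
induced by `Φ` is a closed embedding. -/
theorem exists_factor {E B X M : Type*} [TopologicalSpace E] [TopologicalSpace B]
    [TopologicalSpace X] [TopologicalSpace M] [CompactSpace B] [T2Space M] {Q : E → B}
    (hQ : Topology.IsQuotientMap Q) {Φ : E → M} (hΦ : Continuous Φ)
    (h : ∀ a b, Φ a = Φ b ↔ Q a = Q b) {f : X → M} (hf : Continuous f)
    (hr : ∀ x, f x ∈ Set.range Φ) :
    ∃ f' : X → B, Continuous f' ∧ ∀ x a, Q a = f' x ↔ Φ a = f x := by
  choose s hs using hQ.surjective
  have he : ∀ a, Φ (s (Q a)) = Φ a := fun a => (h _ _).2 (hs _)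
  have hec : Continuous fun b => Φ (s b) := by
    rw [hQ.continuous_iff]
    exact hΦ.congr fun a => (he a).symm
  have hei : Function.Injective fun b => Φ (s b) := by
    intro b b' e
    have := (h _ _).1 e
    rwa [hs, hs] at this
  choose l hl using hr
  refine ⟨fun x => Q (l x), ?_, fun x a => ?_⟩
  · rw [(hec.isClosedEmbedding hei).isEmbedding.continuous_iff]
    exact hf.congr fun x => by rw [Function.comp, he, hl]
  · rw [← h, hl]

variable {X : Type*} [TopologicalSpace X]

theorem coe_addCircle_eq_iff {a b : ℝ} :
    (a : AddCircle (1 : ℝ)) = b ↔ ∃ n : ℤ, b = a + n := by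
  rw [eq_comm, QuotientAddGroup.eq_iff_sub_mem, AddSubgroup.mem_zmultiples_iff]
  refine exists_congr fun n => ?_
  rw [zsmul_eq_mul, mul_one, eq_sub_iff_add_eq', eq_comm]

/-- Lifting through the universal covering of the circle. -/
theorem exists_lift_addCircle [SimplyConnectedSpace X] [LocallyPathConnectedSpace X]
    {f : X → AddCircle (1 : ℝ)} (hf : Continuous f) {x₀ : X} {t₀ : ℝ}
    (h : (t₀ : AddCircle (1 : ℝ)) = f x₀) :
    ∃ g : X → ℝ, Continuous g ∧ g x₀ = t₀ ∧ ∀ x, (g x : AddCircle (1 : ℝ)) = f x := by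
  obtain ⟨F, ⟨h1, h2⟩, -⟩ :=
    (AddCircle.isCoveringMap_coe (1 : ℝ)).existsUnique_continuousMap_lifts ⟨f, hf⟩ x₀ t₀ h
  exact ⟨F, F.continuous, h1, fun x => congrFun h2 x⟩

/-- A continuous function with integer values on a connected space is constant. -/
theorem eq_of_forall_int [PreconnectedSpace X] {g : X → ℝ} (hg : Continuous g)
    (h : ∀ x, ∃ n : ℤ, g x = n) (x y : X) : g x = g y := by
  choose l hl using h
  have hc : Continuous l := by
    rw [Int.isClosedEmbedding_coe_real.isEmbedding.continuous_iff]
    exact hg.congr hl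
  rw [hl, hl, PreconnectedSpace.constant ‹_› hc]

theorem isQuotientMap_coe_addCircle :
    Topology.IsQuotientMap fun a : ℝ => (a : AddCircle (1 : ℝ)) :=
  isQuotientMap_quotient_mk'

theorem add_int_of_add_one {g : ℝ → ℝ × ℝ} {v : ℝ × ℝ} (h : ∀ x, g (x + 1) = g x + v) (n : ℤ)
    (x : ℝ) : g (x + n) = g x + (n : ℝ) • v := by
  induction n using Int.induction_on generalizing x with
  | zero => simp
  | succ i ih =>
    rw [Int.cast_add, Int.cast_one, ← add_assoc, h, ih, add_smul, one_smul, add_assoc]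
  | pred i ih =>
    have h1 := ih (x - 1)
    have h2 := h (x - 1)
    rw [sub_add_cancel] at h2
    have e : x + ((-(i : ℤ) - 1 : ℤ) : ℝ) = x - 1 + ((-(i : ℤ) : ℤ) : ℝ) := by push_cast; ring
    rw [e, h1, Int.cast_sub, Int.cast_one, sub_smul, one_smul, h2]
    abel

end Lifting

section Torus

variable {M : Type*} [TopologicalSpace M] [ChartedSpace E5 M] [MulAction SO3 M] [T2Space M]
variable {α : OneForm M} {T : Set M} {Φ Φ' : ℝ × ℝ → M}
variable {X : Type*} [TopologicalSpace X]

theorem IsTorusCover.continuous (h : IsTorusCover α T Φ) : Continuous Φ := h.smooth.continuous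

theorem IsTorusCover.mem (h : IsTorusCover α T Φ) (z : ℝ × ℝ) : Φ z ∈ T :=
  h.range_eq ▸ Set.mem_range_self z

/-- Lifting through the universal covering of a boundary torus, which is identified with the product
of two circles. -/
theorem IsTorusCover.exists_lift (h : IsTorusCover α T Φ) [SimplyConnectedSpace X]
    [LocallyPathConnectedSpace X] {f : X → M} (hf : Continuous f) (hT : ∀ x, f x ∈ T) {x₀ : X}
    {p₀ : ℝ × ℝ} (h0 : Φ p₀ = f x₀) :
    ∃ g : X → ℝ × ℝ, Continuous g ∧ g x₀ = p₀ ∧ ∀ x, Φ (g x) = f x := by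
  have hQ : Topology.IsQuotientMap (Prod.map (fun a : ℝ => (a : AddCircle (1 : ℝ)))
      fun a : ℝ => (a : AddCircle (1 : ℝ))) :=
    ((QuotientAddGroup.isOpenQuotientMap_mk).prodMap
      QuotientAddGroup.isOpenQuotientMap_mk).isQuotientMap
  obtain ⟨f', hf', hff⟩ := exists_factor hQ h.continuous (fun a b => by
    rw [h.fibers, Prod.map, Prod.map, Prod.mk.injEq, coe_addCircle_eq_iff, coe_addCircle_eq_iff]
    constructor
    · rintro ⟨m, n, rfl⟩
      exact ⟨⟨m, rfl⟩, n, rfl⟩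
    · rintro ⟨⟨m, hm⟩, n, hn⟩
      exact ⟨m, n, Prod.ext hm hn⟩) hf (fun x => h.range_eq ▸ hT x)
  have e0 := (hff x₀ p₀).2 h0
  obtain ⟨g1, c1, i1, l1⟩ := exists_lift_addCircle (continuous_fst.comp hf') (x₀ := x₀)
    (congrArg Prod.fst e0)
  obtain ⟨g2, c2, i2, l2⟩ := exists_lift_addCircle (continuous_snd.comp hf') (x₀ := x₀)
    (congrArg Prod.snd e0)
  exact ⟨fun x => (g1 x, g2 x), c1.prodMk c2, Prod.ext i1 i2, fun x =>
    (hff x _).1 (Prod.ext (l1 x) (l2 x))⟩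

/-- Two lifts of the same map differ by a deck transformation. -/
theorem IsTorusCover.sub_eq (h : IsTorusCover α T Φ) [PreconnectedSpace X] {g g' : X → ℝ × ℝ}
    (hg : Continuous g) (hg' : Continuous g') (e : ∀ x, Φ (g x) = Φ (g' x)) :
    ∃ m n : ℤ, ∀ x, g' x = g x + ((m : ℝ), (n : ℝ)) := by
  rcases isEmpty_or_nonempty X with hX | ⟨⟨x₀⟩⟩
  · exact ⟨0, 0, fun x => hX.elim x⟩
  · have hi : ∀ x, ∃ m n : ℤ, g' x = g x + ((m : ℝ), (n : ℝ)) := fun x => (h.fibers _ _).1 (e x)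
    have k1 := eq_of_forall_int ((continuous_fst.comp hg').sub (continuous_fst.comp hg)) fun x => by
      obtain ⟨m, n, hm⟩ := hi x
      exact ⟨m, by simp [hm]⟩
    have k2 := eq_of_forall_int ((continuous_snd.comp hg').sub (continuous_snd.comp hg)) fun x => by
      obtain ⟨m, n, hm⟩ := hi x
      exact ⟨n, by simp [hm]⟩
    obtain ⟨m, n, hm⟩ := hi x₀
    refine ⟨m, n, fun x => ?_⟩
    have e1 := k1 x x₀
    have e2 := k2 x x₀
    simp only [Pi.sub_apply, Function.comp_apply] at e1 e2
    rw [hm] at e1 e2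
    simp only [Prod.fst_add, Prod.snd_add] at e1 e2
    exact Prod.ext (by simp only [Prod.fst_add]; linarith) (by simp only [Prod.snd_add]; linarith)

/-! ### Homology classes of simple loops -/

theorem IsSimpleLoop.apply_eq_iff {S : Set M} {c : ℝ → ℝ × ℝ} {a : ℤ × ℤ}
    (hc : IsSimpleLoop Φ S c a) (h : IsTorusCover α T Φ) (u v : ℝ) :
    Φ (c u) = Φ (c v) ↔ ∃ n : ℤ, v = u + n := by
  refine ⟨hc.simple u v, ?_⟩
  rintro ⟨n, rfl⟩
  rw [h.fibers, add_int_of_add_one hc.periodic]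
  exact ⟨n * a.1, n * a.2, by simp⟩

/-- Two simple loops with the same image have proportional homology classes. -/
theorem IsSimpleLoop.exists_smul {S : Set M} {c c' : ℝ → ℝ × ℝ} {a a' : ℤ × ℤ}
    (hc : IsSimpleLoop Φ S c a) (hc' : IsSimpleLoop Φ S c' a') (h : IsTorusCover α T Φ) :
    ∃ n : ℤ, a'.1 = n * a.1 ∧ a'.2 = n * a.2 := by
  have hcc : Continuous fun u => Φ (c u) := h.continuous.comp hc.continuous
  have hcc' : Continuous fun u => Φ (c' u) := h.continuous.comp hc'.continuous
  obtain ⟨f', hf', hff⟩ := exists_factor isQuotientMap_coe_addCircle hcc (fun u v => by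
    rw [hc.apply_eq_iff h, coe_addCircle_eq_iff]) hcc' (fun x => by
      rw [hc.range_eq, ← hc'.range_eq]
      exact ⟨x, rfl⟩)
  obtain ⟨t₀, ht₀⟩ := isQuotientMap_coe_addCircle.surjective (f' 0)
  obtain ⟨l, hl, -, hll⟩ := exists_lift_addCircle hf' ht₀
  have e : ∀ u, Φ (c (l u)) = Φ (c' u) := fun u => (hff u (l u)).1 (hll u)
  obtain ⟨n, hn⟩ := (hc.apply_eq_iff h (l 0) (l 1)).1 (by
    rw [e, e, hc'.apply_eq_iff h]
    exact ⟨1, by simp⟩)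
  obtain ⟨p, q, hpq⟩ := h.sub_eq (hc.continuous.comp hl) hc'.continuous e
  have h0 := hpq 0
  have h1 := hpq 1
  have h2 := hc'.periodic 0
  rw [zero_add, h1, h0] at h2
  simp only [Function.comp_apply] at h2
  rw [hn, add_int_of_add_one hc.periodic] at h2
  have e1 := congrArg Prod.fst h2
  have e2 := congrArg Prod.snd h2
  simp only [Prod.fst_add, Prod.snd_add, Prod.smul_fst, Prod.smul_snd, smul_eq_mul] at e1 e2
  refine ⟨n, ?_, ?_⟩
  · have : (a'.1 : ℝ) = n * a.1 := by linarith
    exact_mod_cast this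
  · have : (a'.2 : ℝ) = n * a.2 := by linarith
    exact_mod_cast this

/-- The homology class of a simple loop is determined by its image and by the sign of its first
component. -/
theorem IsSimpleLoop.class_eq {S : Set M} {c c' : ℝ → ℝ × ℝ} {a a' : ℤ × ℤ}
    (hc : IsSimpleLoop Φ S c a) (hc' : IsSimpleLoop Φ S c' a') (h : IsTorusCover α T Φ)
    (hs : 0 < a.1 * a'.1) : a = a' := by
  obtain ⟨n, h1, h2⟩ := hc.exists_smul hc' h
  obtain ⟨m, h3, -⟩ := hc'.exists_smul hc h
  have ha : a.1 ≠ 0 := by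
    intro h0
    rw [h0, zero_mul] at hs
    exact hs.false
  -- the factors of proportionality in both directions are inverse to each other, hence `±1`
  have hmn : m * n = 1 := by
    rw [h1, ← mul_assoc] at h3
    exact mul_right_cancel₀ ha (by rw [one_mul]; exact h3.symm)
  have hn : n = 1 := by
    rcases Int.isUnit_iff.1 (IsUnit.of_mul_eq_one_right m hmn) with hn | hn
    · exact hn
    · rw [h1, hn] at hs
      nlinarith [mul_self_nonneg a.1]
  rw [hn, one_mul] at h1 h2
  exact (Prod.ext h1 h2).symm

end Torus

/-! ### Coordinate changes of the boundary tori -/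

section Torus

variable {M : Type*} [TopologicalSpace M] [ChartedSpace E5 M] [IsManifold (𝓡 5) ∞ M]
variable [MulAction SO3 M] [T2Space M]
variable {α : OneForm M} {T : Set M} {Φ Φ' : ℝ × ℝ → M}

/-- Tangent vectors are read in the preferred chart at the base point. -/
theorem mder_chart_self (x : M) :
    mder (𝓡 5) (𝓡 5) (chartAt E5 x) x = ContinuousLinearMap.id ℝ E5 := by
  set φ := chartAt E5 x with hφ
  have hx : x ∈ φ.source := mem_chart_source E5 x
  have h := mder_comp (F := φ) (G := φ.symm) (x := x)
    ((contMDiffAt_chart_symm (φ.map_source hx)).mdifferentiableAt (by simp))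
    ((contMDiffAt_chart hx).mdifferentiableAt (by simp))
  have e : (fun y => φ.symm (φ y)) =ᶠ[nhds x] fun y => y := by
    filter_upwards [φ.open_source.mem_nhds hx] with z hz using φ.left_inv hz
  rw [mder_congr e, mder_id, mder_chart_symm_self, ContinuousLinearMap.id_comp] at h
  exact h.symm

/-- The manifold derivative of a parametrization is its derivative in the preferred chart. -/
theorem hasStrictFDerivAt_chart_comp {F : Type*} [NormedAddCommGroup F] [NormedSpace ℝ F]
    {f : F → M} {z : F} (hf : ContMDiffAt 𝓘(ℝ, F) (𝓡 5) ∞ f z) :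
    HasStrictFDerivAt (fun w => chartAt E5 (f z) (f w)) (mder 𝓘(ℝ, F) (𝓡 5) f z) z := by
  have h1 : ContMDiffAt (𝓡 5) (𝓡 5) ∞ (chartAt E5 (f z)) (f z) :=
    contMDiffAt_chart (mem_chart_source E5 (f z))
  have h2 : ContDiffAt ℝ ∞ (fun w => chartAt E5 (f z) (f w)) z := (h1.comp z hf).contDiffAt
  have h3 := mder_comp (F := f) (G := chartAt E5 (f z)) (x := z)
    (h1.mdifferentiableAt (by simp)) (hf.mdifferentiableAt (by simp))
  rw [mder_chart_self, ContinuousLinearMap.id_comp, mder_eq_fderiv] at h3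
  rw [← h3]
  exact h2.hasStrictFDerivAt (by simp)

/-- The second coordinate of the cover runs along the circle orbits with speed `2π`. -/
theorem IsTorusCover.mder_snd (h : IsTorusCover α T Φ) (hM : IsSmoothAction M) (p : ℝ × ℝ) :
    mder 𝓘(ℝ, ℝ × ℝ) (𝓡 5) Φ p (0, 1) = (2 * Real.pi) • genv 2 (Φ p) := by
  have hl : HasFDerivAt (fun s : ℝ => p + (0, s)) (ContinuousLinearMap.inr ℝ ℝ ℝ) 0 :=
    (ContinuousLinearMap.inr ℝ ℝ ℝ).hasFDerivAt.const_add p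
  have hA : HasDerivAt (fun s : ℝ => 2 * Real.pi * s) (2 * Real.pi) 0 := by
    simpa using (hasDerivAt_id (0 : ℝ)).const_mul (2 * Real.pi)
  have e : (fun s : ℝ => Φ (p + (0, s))) = fun s => rot 2 (2 * Real.pi * s) • Φ p := by
    ext1 s
    rw [← h.equivariant]
    congr 1
    exact Prod.ext (add_zero _) rfl
  have h0 : p + (0, (0 : ℝ)) = p := add_zero p
  have h1 := mder_comp (I := 𝓘(ℝ, ℝ)) (I' := 𝓘(ℝ, ℝ × ℝ)) (F := fun s : ℝ => p + (0, s)) (G := Φ)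
    (x := 0) ((h.smooth _).mdifferentiableAt (by simp)) hl.differentiableAt.mdifferentiableAt
  have h2 := mder_comp (I := 𝓘(ℝ, ℝ)) (I' := 𝓘(ℝ, ℝ)) (F := fun s : ℝ => 2 * Real.pi * s)
    (G := fun s => rot 2 s • Φ p) (x := 0)
    ((hM.contMDiff_rot 2 (Φ p) _).mdifferentiableAt (by simp))
    hA.differentiableAt.mdifferentiableAt
  rw [e, h2, mder_eq_fderiv, mder_eq_fderiv, hl.fderiv, hA.hasFDerivAt.fderiv,
    mder_congr_point (mul_zero (2 * Real.pi)), mder_congr_point h0] at h1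
  have h3 := DFunLike.congr_fun h1 1
  simp only [ContinuousLinearMap.comp_apply] at h3
  have h5 : (ContinuousLinearMap.toSpanSingleton ℝ (2 * Real.pi)) 1 =
      (2 * Real.pi) • (1 : ℝ) := by simp
  rw [h5, map_smul] at h3
  exact h3.symm

/-- Points of the torus are not fixed by the half turn around the `z`-axis. -/
theorem IsTorusCover.genv_ne_zero (h : IsTorusCover α T Φ) (hM : IsSmoothAction M) (p : ℝ × ℝ) :
    genv 2 (Φ p) ≠ 0 := by
  intro h0
  have h1 := hM.rot_smul_of_gen_eq_zero h0 (2 * Real.pi * (1 / 2))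
  rw [← h.equivariant p.1 p.2, eq_comm, h.fibers] at h1
  obtain ⟨m, n, hn⟩ := h1
  have h2 : p.2 + 1 / 2 = p.2 + n := congrArg Prod.snd hn
  have h3 : (1 : ℝ) = ((2 * n : ℤ) : ℝ) := by push_cast; linarith
  have h4 : (1 : ℤ) = 2 * n := by exact_mod_cast h3
  omega

/-- As `α(Z_M) = 0`, the form `α` only sees the first coordinate. -/
theorem IsTorusCover.cov_mder (h : IsTorusCover α T Φ) (hM : IsSmoothAction M) {p : ℝ × ℝ}
    (hZ : cov α (Φ p) (genv 2 (Φ p)) = 0) (u : ℝ × ℝ) :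
    cov α (Φ p) (mder 𝓘(ℝ, ℝ × ℝ) (𝓡 5) Φ p u) =
      u.1 * cov α (Φ p) (mder 𝓘(ℝ, ℝ × ℝ) (𝓡 5) Φ p (1, 0)) := by
  have e : u = u.1 • ((1, 0) : ℝ × ℝ) + u.2 • ((0, 1) : ℝ × ℝ) := by
    ext <;> simp
  conv_lhs => rw [e]
  rw [map_add, map_smul, map_smul, h.mder_snd hM, map_add, map_smul, map_smul, map_smul, hZ,
    smul_zero, smul_zero, add_zero, smul_eq_mul]

/-- The cover is an immersion: the orientation condition excludes a kernel transverse to the circle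
orbits, and the generator of the circle action does not vanish. -/
theorem IsTorusCover.mder_injective (h : IsTorusCover α T Φ) (hM : IsSmoothAction M) {p : ℝ × ℝ}
    (hZ : cov α (Φ p) (genv 2 (Φ p)) = 0) :
    Function.Injective (mder 𝓘(ℝ, ℝ × ℝ) (𝓡 5) Φ p) := by
  rw [injective_iff_map_eq_zero]
  intro u hu
  have h1 := h.cov_mder hM hZ u
  rw [hu, map_zero] at h1
  have h2 : 0 < cov α (Φ p) (mder 𝓘(ℝ, ℝ × ℝ) (𝓡 5) Φ p (1, 0)) := h.oriented p
  have h3 : u.1 = 0 := by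
    rcases mul_eq_zero.1 h1.symm with h3 | h3
    · exact h3
    · exact absurd h3 h2.ne'
  have e : u = u.2 • ((0, 1) : ℝ × ℝ) := by ext <;> simp [h3]
  rw [e, map_smul, h.mder_snd hM, smul_smul] at hu
  have h4 : u.2 * (2 * Real.pi) = 0 :=
    (smul_eq_zero.1 hu).resolve_right (h.genv_ne_zero hM p)
  have h5 : u.2 = 0 := (mul_eq_zero.1 h4).resolve_right (by positivity)
  exact Prod.ext h3 h5

/-- A continuous lift of a differentiable curve through an immersion is differentiable. -/
theorem differentiableAt_of_comp_immersion {V W : Type*} [NormedAddCommGroup V] [NormedSpace ℝ V]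
    [FiniteDimensional ℝ V] [NormedAddCommGroup W] [NormedSpace ℝ W] [FiniteDimensional ℝ W]
    {A : V → W} {L : V →L[ℝ] W} {g : ℝ → V} {x₀ : ℝ} (hA : HasStrictFDerivAt A L (g x₀))
    (hL : Function.Injective L) (hg : ContinuousAt g x₀)
    (hd : DifferentiableAt ℝ (fun x => A (g x)) x₀) : DifferentiableAt ℝ g x₀ := by
  have : CompleteSpace V := FiniteDimensional.complete ℝ V
  obtain ⟨P, hP⟩ := LinearMap.exists_leftInverse_of_injective L.toLinearMap
    (LinearMap.ker_eq_bot.2 hL)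
  have hPs : HasStrictFDerivAt (fun w => P.toContinuousLinearMap (A w))
      ((ContinuousLinearEquiv.refl ℝ V : V →L[ℝ] V)) (g x₀) := by
    refine (P.toContinuousLinearMap.hasStrictFDerivAt.comp (g x₀) hA).congr_fderiv ?_
    exact ContinuousLinearMap.ext fun u => DFunLike.congr_fun hP u
  have h1 : g =ᶠ[nhds x₀] fun x => hPs.localInverse _ _ _ (P.toContinuousLinearMap (A (g x))) := by
    filter_upwards [hg.eventually hPs.eventually_left_inverse] with x hx using hx.symm
  refine DifferentiableAt.congr_of_eventuallyEq ?_ h1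
  exact (hPs.to_localInverse.hasFDerivAt.differentiableAt).comp x₀
    (P.toContinuousLinearMap.differentiableAt.comp x₀ hd)

/-- A lift through `Φ` of the first coordinate lines of another cover moves to the right, because
both covers are oriented by `α` and `α(Z_M) = 0`. -/
theorem IsTorusCover.deriv_lift_pos (h : IsTorusCover α T Φ) (h' : IsTorusCover α T Φ')
    (hM : IsSmoothAction M) (hZ : ∀ x ∈ T, cov α x (genv 2 x) = 0) {g : ℝ → ℝ × ℝ}
    (hg : Continuous g) (hgΦ : ∀ x, Φ (g x) = Φ' (x, 0)) (x₀ : ℝ) :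
    0 < deriv (fun x => (g x).1) x₀ := by
  set L := mder 𝓘(ℝ, ℝ × ℝ) (𝓡 5) Φ (g x₀) with hL
  have hZ' := hZ _ (h.mem (g x₀))
  have hs := hasStrictFDerivAt_chart_comp (h.smooth (g x₀))
  have hcurve : ContMDiffAt 𝓘(ℝ, ℝ) (𝓡 5) ∞ (fun x : ℝ => Φ' (x, 0)) x₀ :=
    ContMDiffAt.comp (I' := 𝓘(ℝ, ℝ × ℝ)) x₀ (f := fun x : ℝ => ((x, 0) : ℝ × ℝ)) (h'.smooth _)
      (contDiff_id.prodMk contDiff_const).contMDiff.contMDiffAt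
  have hm := (hasStrictFDerivAt_chart_comp hcurve).hasFDerivAt
  set m := mder 𝓘(ℝ, ℝ) (𝓡 5) (fun x : ℝ => Φ' (x, 0)) x₀ with hm_def
  have hA : ∀ x, chartAt E5 (Φ (g x₀)) (Φ (g x)) = chartAt E5 (Φ' (x₀, 0)) (Φ' (x, 0)) :=
    fun x => by rw [hgΦ, hgΦ]
  have hgd : DifferentiableAt ℝ g x₀ :=
    differentiableAt_of_comp_immersion hs (h.mder_injective hM hZ') hg.continuousAt
      (hm.differentiableAt.congr_of_eventuallyEq (Filter.Eventually.of_forall hA))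
  have hLm : L (deriv g x₀) = m 1 := by
    have h1 : HasFDerivAt (fun x => chartAt E5 (Φ (g x₀)) (Φ (g x)))
        (L.comp (fderiv ℝ g x₀)) x₀ := hs.hasFDerivAt.comp x₀ hgd.hasFDerivAt
    simp only [hA] at h1
    have h2 := h1.unique hm
    exact DFunLike.congr_fun h2 1
  have hm1 : m 1 = mder 𝓘(ℝ, ℝ × ℝ) (𝓡 5) Φ' (x₀, 0) (1, 0) := by
    have hl : HasFDerivAt (fun x : ℝ => ((x, 0) : ℝ × ℝ)) (ContinuousLinearMap.inl ℝ ℝ ℝ) x₀ :=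
      hasFDerivAt_prodMk_left x₀ 0
    have h1 := mder_comp (I := 𝓘(ℝ, ℝ)) (I' := 𝓘(ℝ, ℝ × ℝ)) (F := fun x : ℝ => ((x, 0) : ℝ × ℝ))
      (G := Φ') (x := x₀) ((h'.smooth _).mdifferentiableAt (by simp))
      hl.differentiableAt.mdifferentiableAt
    rw [mder_eq_fderiv, hl.fderiv] at h1
    exact DFunLike.congr_fun h1 1
  have hpos : 0 < cov α (Φ' (x₀, 0)) (m 1) := hm1 ▸ h'.oriented (x₀, 0)
  rw [← hLm, ← hgΦ, h.cov_mder hM hZ'] at hpos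
  have h2 : 0 < cov α (Φ (g x₀)) (mder 𝓘(ℝ, ℝ × ℝ) (𝓡 5) Φ (g x₀) (1, 0)) := h.oriented (g x₀)
  have h3 : deriv (fun x => (g x).1) x₀ = (deriv g x₀).1 := by
    have := (ContinuousLinearMap.fst ℝ ℝ ℝ).hasFDerivAt.comp_hasDerivAt x₀ hgd.hasDerivAt
    exact this.deriv
  rw [h3]
  exact (mul_pos_iff_of_pos_right h2).1 hpos

/-- Two covers of a boundary torus differ by a shear. -/
theorem IsTorusCover.exists_transition (h : IsTorusCover α T Φ) (h' : IsTorusCover α T Φ')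
    (hM : IsSmoothAction M) (hZ : ∀ x ∈ T, cov α x (genv 2 x) = 0) :
    ∃ (G : ℝ × ℝ → ℝ × ℝ) (e : ℤ), Continuous G ∧ (∀ z, Φ (G z) = Φ' z) ∧
      ∀ (z : ℝ × ℝ) (m n : ℤ), G (z + ((m : ℝ), (n : ℝ))) = G z + ((m : ℝ), (n + m * e : ℝ)) := by
  have hc : Continuous fun x : ℝ => Φ' (x, 0) := h'.continuous.comp (by fun_prop)
  obtain ⟨p₀, hp₀⟩ : ∃ p₀, Φ p₀ = Φ' (0, 0) := by
    have := h'.mem (0, 0)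
    rwa [← h.range_eq] at this
  obtain ⟨g, hg, -, hgΦ⟩ := h.exists_lift hc (fun x => h'.mem _) (x₀ := (0 : ℝ)) hp₀
  -- the lift `g` of one coordinate line of `Φ'` determines the transition by equivariance
  have hG : ∀ z : ℝ × ℝ, Φ (g z.1 + (0, z.2)) = Φ' z := by
    intro z
    have e1 : g z.1 + (0, z.2) = ((g z.1).1, (g z.1).2 + z.2) := Prod.ext (add_zero _) rfl
    have e2 : z = (z.1, 0 + z.2) := Prod.ext rfl (zero_add _).symm
    rw [e1, h.equivariant, Prod.mk.eta, hgΦ, ← h'.equivariant, ← e2]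
  obtain ⟨d, e, hde⟩ := h.sub_eq hg (hg.comp (continuous_id.add continuous_const)) (fun x => by
    change Φ (g x) = Φ (g (x + 1))
    rw [hgΦ, hgΦ, h'.fibers]
    exact ⟨1, 0, by simp⟩)
  have hper : ∀ x, g (x + 1) = g x + ((d : ℝ), (e : ℝ)) := hde
  have hd0 : (0 : ℝ) < d := by
    have hmono := strictMono_of_deriv_pos (h.deriv_lift_pos h' hM hZ hg hgΦ)
    have h1 := hmono (zero_lt_one (α := ℝ))
    have h2 := congrArg Prod.fst (hper 0)
    simp only [zero_add, Prod.fst_add] at h2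
    simp only at h1
    linarith
  -- if `d ≥ 2`, the lift passes through `(g 0).1 + 1` before time `1`, which contradicts the
  -- injectivity of `Φ'` modulo integers
  have hd1 : d = 1 := by
    have hd0' : 0 < d := by exact_mod_cast hd0
    by_contra hne
    have hd2 : (2 : ℝ) ≤ d := by exact_mod_cast (show 2 ≤ d by omega)
    have h2 := congrArg Prod.fst (hper 0)
    simp only [zero_add, Prod.fst_add] at h2
    obtain ⟨x, ⟨hx0, hx1⟩, hx⟩ := intermediate_value_Icc (zero_le_one (α := ℝ))
      (continuous_fst.comp hg).continuousOn
      (show (g 0).1 + 1 ∈ Set.Icc ((Prod.fst ∘ g) 0) ((Prod.fst ∘ g) 1) by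
        simp only [Function.comp_apply, Set.mem_Icc]
        constructor <;> linarith)
    simp only [Function.comp_apply] at hx
    have h3 : Φ (g (0, (0 : ℝ)).1 + (0, ((0 : ℝ), (0 : ℝ)).2)) =
        Φ (g (x, (g 0).2 - (g x).2).1 + (0, (x, (g 0).2 - (g x).2).2)) := by
      rw [h.fibers]
      refine ⟨1, 0, Prod.ext ?_ ?_⟩
      · simp only [Prod.fst_add, hx]; simp
      · simp only [Prod.snd_add]; simp
    rw [hG (x, (g 0).2 - (g x).2), hG (0, 0), h'.fibers] at h3
    obtain ⟨m, n, hmn⟩ := h3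
    have h4 : x = 0 + m := congrArg Prod.fst hmn
    rw [zero_add] at h4
    have h5 : (0 : ℝ) ≤ m := h4 ▸ hx0
    have h6 : (m : ℝ) ≤ 1 := h4 ▸ hx1
    have h5' : 0 ≤ m := by exact_mod_cast h5
    have h6' : m ≤ 1 := by exact_mod_cast h6
    have hm : m = 0 ∨ m = 1 := by omega
    rcases hm with rfl | rfl
    · rw [h4, Int.cast_zero] at hx
      linarith
    · rw [h4, Int.cast_one, h2] at hx
      linarith
  subst hd1
  refine ⟨fun z => g z.1 + (0, z.2), e, by fun_prop, hG, fun z m n => ?_⟩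
  simp only [Prod.fst_add, Prod.snd_add]
  rw [add_int_of_add_one hper]
  ext
  · simp
  · simp only [Prod.snd_add, Prod.smul_snd, smul_eq_mul]
    ring

/-! ### Uniqueness of the contributions -/

/-- The action of an element preserving `T` maps marked curves to marked curves, because stabilizers
along an orbit are conjugate. -/
theorem image_smul_markedCurve (hM : IsSmoothAction M) {g : SO3} (hT : ∀ x ∈ T, g • x ∈ T)
    (hT' : ∀ x ∈ T, g⁻¹ • x ∈ T) {x₀ : M} (hx₀ : x₀ ∈ T) :
    (fun x => g • x) '' markedCurve T x₀ = markedCurve T (g • x₀) := by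
  have hc : ∀ g : SO3, Continuous fun x : M => g • x := fun g => (hM.contMDiff_smul g).continuous
  have hst : ∀ x : M, MulAction.stabilizer SO3 x = MulAction.stabilizer SO3 x₀ ↔
      MulAction.stabilizer SO3 (g • x) = MulAction.stabilizer SO3 (g • x₀) := by
    intro x
    rw [MulAction.stabilizer_smul_eq_stabilizer_map_conj,
      MulAction.stabilizer_smul_eq_stabilizer_map_conj]
    exact (Subgroup.map_injective (MulAut.conj g).injective).eq_iff.symm
  unfold markedCurve
  rw [image_connectedComponentIn_of_continuousOn (g := fun x => g⁻¹ • x)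
    (S := {x | x ∈ T ∧ MulAction.stabilizer SO3 x = MulAction.stabilizer SO3 x₀})
    (hc g).continuousOn (hc g⁻¹).continuousOn (fun x _ => inv_smul_smul g x) ⟨hx₀, rfl⟩]
  congr 1
  ext z
  constructor
  · rintro ⟨x, ⟨hx, hs⟩, rfl⟩
    exact ⟨hT x hx, (hst x).1 hs⟩
  · rintro ⟨hz, hs⟩
    refine ⟨g⁻¹ • z, ⟨hT' z hz, ?_⟩, smul_inv_smul g z⟩
    rw [hst, smul_inv_smul, hs]

theorem IsTorusCover.rot_smul_mem (h : IsTorusCover α T Φ) (s : ℝ) {x : M} (hx : x ∈ T) :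
    rot 2 s • x ∈ T := by
  rw [← h.range_eq] at hx ⊢
  obtain ⟨z, rfl⟩ := hx
  refine ⟨(z.1, z.2 + s / (2 * Real.pi)), ?_⟩
  rw [h.equivariant, mul_div_cancel₀ _ (by positivity)]

/-- All curves of marked points that meet every circle orbit are rotated into each other. -/
theorem IsTorusCover.exists_markedCurve_eq (h : IsTorusCover α T Φ) (hM : IsSmoothAction M)
    {x₀ x₁ : M} (hx₁ : x₁ ∈ T) (hne : (markedCurve T x₀ ∩ zOrbit x₁).Nonempty) :
    ∃ s : ℝ, markedCurve T x₀ = (fun x => rot 2 s • x) '' markedCurve T x₁ := by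
  obtain ⟨_, hy, s, rfl⟩ := hne
  have hs : (rot 2 s)⁻¹ = rot 2 (-s) := inv_eq_of_mul_eq_one_right (rot_mul_rot_neg 2 s)
  refine ⟨s, ?_⟩
  rw [image_smul_markedCurve hM (fun x hx => h.rot_smul_mem s hx)
    (fun x hx => hs ▸ h.rot_smul_mem (-s) hx) hx₁]
  have hst := (connectedComponentIn_subset _ _ hy).2
  unfold markedCurve
  rw [hst]
  exact connectedComponentIn_eq hy

/-- Rotated loops have the same homology class. -/
theorem IsSimpleLoop.rotate (h : IsTorusCover α T Φ) {S : Set M} {c : ℝ → ℝ × ℝ} {a : ℤ × ℤ}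
    (hc : IsSimpleLoop Φ S c a) (s : ℝ) :
    IsSimpleLoop Φ ((fun x => rot 2 s • x) '' S) (fun u => c u + (0, s / (2 * Real.pi))) a := by
  have e : ∀ u, Φ (c u + (0, s / (2 * Real.pi))) = rot 2 s • Φ (c u) := by
    intro u
    have e1 : c u + (0, s / (2 * Real.pi)) = ((c u).1, (c u).2 + s / (2 * Real.pi)) :=
      Prod.ext (add_zero _) rfl
    rw [e1, h.equivariant, mul_div_cancel₀ _ (by positivity)]
  refine ⟨hc.continuous.add continuous_const, fun u => ?_, fun u v huv => ?_, ?_⟩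
  · rw [hc.periodic]
    abel
  · rw [e, e] at huv
    exact hc.simple u v (smul_left_cancel _ huv)
  · simp only [e]
    rw [← hc.range_eq, ← Set.range_comp]
    rfl

/-- A shear `G` relating two covers turns a loop of class `a` into a loop of class `(a.1, a.2 + a.1
e)`. -/
theorem IsSimpleLoop.transition {S : Set M} {c : ℝ → ℝ × ℝ} {a : ℤ × ℤ}
    (hc : IsSimpleLoop Φ' S c a) {G : ℝ × ℝ → ℝ × ℝ} {e : ℤ} (hG : Continuous G)
    (hΦ : ∀ z, Φ (G z) = Φ' z)
    (hper : ∀ (z : ℝ × ℝ) (m n : ℤ),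
      G (z + ((m : ℝ), (n : ℝ))) = G z + ((m : ℝ), (n + m * e : ℝ))) :
    IsSimpleLoop Φ S (fun u => G (c u)) (a.1, a.2 + a.1 * e) := by
  refine ⟨hG.comp hc.continuous, fun u => ?_, fun u v huv => ?_, ?_⟩
  · rw [hc.periodic, hper]
    push_cast
    rfl
  · rw [hΦ, hΦ] at huv
    exact hc.simple u v huv
  · simp only [hΦ]
    exact hc.range_eq

theorem ncard_image_smul_inter_zOrbit (g : ℝ) (S : Set M) (x : M) :
    ((fun z => rot 2 g • z) '' S ∩ zOrbit x).ncard = (S ∩ zOrbit x).ncard := by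
  have e : zOrbit x = (fun z => rot 2 g • z) '' zOrbit x := by
    ext z
    constructor
    · rintro ⟨s, rfl⟩
      refine ⟨rot 2 (s - g) • x, ⟨_, rfl⟩, ?_⟩
      simp only
      rw [smul_smul, ← rot_add, add_sub_cancel]
    · rintro ⟨_, ⟨s, rfl⟩, rfl⟩
      exact ⟨g + s, by simp only; rw [smul_smul, ← rot_add]⟩
  have hi : Function.Injective fun z : M => rot 2 g • z := fun _ _ => smul_left_cancel _
  conv_lhs => rw [e]
  rw [← Set.image_inter hi, Set.ncard_image_of_injective _ hi]

/-- The contribution of a component of the singular orbits is well defined. -/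
theorem HasContribution.unique (hα : IsContactSO3 α) {L : Set M} (hL : L ⊆ singularSet M)
    {σ : M → M} {n n' : ℤ} (h : HasContribution α σ L n) (h' : HasContribution α σ L n') :
    n = n' := by
  obtain ⟨T, Φ, x₀, γ, β, a, b, rfl, hΦ, hx₀, hγ, ha, hβ, hb, hn⟩ := h
  obtain ⟨T', Φ', x₁, γ', β', a', b', rfl, hΦ', hx₁, hγ', ha', hβ', hb', hn'⟩ := h'
  set T := closure (crossSection α) ∩ L with hT
  have hM := hα.smooth_action
  have hZ : ∀ x ∈ T, cov α x (genv 2 x) = 0 := fun x hx =>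
    momentMap_two_eq_zero hα hx.1 (hL hx.2)
  have hne : (markedCurve T x₀ ∩ zOrbit x₁).Nonempty := by
    apply Set.nonempty_of_ncard_ne_zero
    rcases hn with hn | hn <;> rw [hn.1 x₁ hx₁] <;> norm_num
  obtain ⟨s, hs⟩ := hΦ.exists_markedCurve_eq hM hx₁ hne
  obtain ⟨G, e, hG, hGΦ, hper⟩ := hΦ.exists_transition hΦ' hM hZ
  have hγ2 := (hγ'.transition hG hGΦ hper).rotate hΦ s
  rw [← hs] at hγ2
  -- both loops describe the same curve in the same cover, and the orientations are fixed by the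
  -- signs of the first components
  have e1 := hγ.class_eq hγ2 hΦ (mul_pos ha ha')
  have e2 := hβ.class_eq (hβ'.transition hG hGΦ hper) hΦ (mul_pos_of_neg_of_neg hb hb')
  -- intersection numbers are invariant under shears
  have hint : torusIntersection a b = torusIntersection a' b' := by
    rw [e1, e2]
    simp only [torusIntersection]
    ring
  have hcard : ∀ x, (markedCurve T x₀ ∩ zOrbit x).ncard =
      (markedCurve T x₁ ∩ zOrbit x).ncard := fun x => by
    rw [hs, ncard_image_smul_inter_zOrbit]
  rcases hn with ⟨h1, h2⟩ | ⟨h1, h2⟩ <;> rcases hn' with ⟨h3, h4⟩ | ⟨h3, h4⟩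
  · rw [h2, h4, hint]
  · have := hcard x₀
    rw [h1 x₀ hx₀, h3 x₀ hx₀] at this
    omega
  · have := hcard x₀
    rw [h1 x₀ hx₀, h3 x₀ hx₀] at this
    omega
  · rw [h2, h4, hint]

end Torus

/-! ### The cross-section of the mapping torus -/

/-- The point of the closure of the cross-section of `ℝ × T^*S²` over `t`, at distance `r` from the
zero-section and at the angle `θ` from the standard section. -/
def crossPoint (t θ r : ℝ) : Cyl := (t, rot 2 θ • stdPoint r)

theorem crossPoint_q (t θ r : ℝ) : (crossPoint t θ r).2.q = !₂[Real.cos θ, Real.sin θ, 0] := by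
  change rotVec (rot 2 θ) !₂[1, 0, 0] = _
  ext i
  rw [rotVec_apply]
  fin_cases i <;> simp [rot, Fin.sum_univ_three]

theorem crossPoint_p (t θ r : ℝ) :
    (crossPoint t θ r).2.p = !₂[-(r * Real.sin θ), r * Real.cos θ, 0] := by
  change rotVec (rot 2 θ) !₂[0, r, 0] = _
  ext i
  rw [rotVec_apply]
  fin_cases i <;> simp [rot, Fin.sum_univ_three] <;> ring

theorem norm_crossPoint_p (t θ : ℝ) {r : ℝ} (hr : 0 ≤ r) : ‖(crossPoint t θ r).2.p‖ = r := by
  exact (norm_rotVec (rot 2 θ) (stdPoint r).p).trans (norm_stdPoint_p hr)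

theorem rot_smul_crossPoint (s t θ r : ℝ) :
    rot 2 s • crossPoint t θ r = crossPoint t (s + θ) r := by
  refine Prod.ext rfl ?_
  change rot 2 s • (rot 2 θ • stdPoint r) = rot 2 (s + θ) • stdPoint r
  rw [smul_smul, rot_add]

/-- Stated in the ambient vector space, where `r` may be negative. -/
theorem contDiff_emb_crossPoint :
    ContDiff ℝ ∞ fun z : ℝ × ℝ × ℝ => Cyl.emb (crossPoint z.1 z.2.1 z.2.2) := by
  simp only [Cyl.emb, crossPoint_q, crossPoint_p]
  refine ContDiff.prodMk (by fun_prop) (ContDiff.prodMk ?_ ?_)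
  · rw [contDiff_euclidean]
    intro i
    fin_cases i <;> simp <;> fun_prop
  · rw [contDiff_euclidean]
    intro i
    fin_cases i <;> simp <;> fun_prop

theorem continuous_crossPoint : Continuous fun z : ℝ × ℝ × ℝ => crossPoint z.1 z.2.1 z.2.2 :=
  Cyl.continuous_iff_emb.2 contDiff_emb_crossPoint.continuous

theorem rot_two_eq_one_of_smul_eq {s : ℝ} {t θ r : ℝ}
    (h : (rot 2 s • crossPoint t θ r).2.q = (crossPoint t θ r).2.q) : rot 2 s = 1 := by
  rw [rot_smul_crossPoint, crossPoint_q, crossPoint_q] at h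
  have h0 : Real.cos (s + θ) = Real.cos θ := congrArg (fun v : E3 => v 0) h
  have h1 : Real.sin (s + θ) = Real.sin θ := congrArg (fun v : E3 => v 1) h
  have e : s = (s + θ) + -θ := by ring
  have e2 : rot 2 (s + θ) = rot 2 θ := by
    apply Subtype.ext
    simp only [rot, h0, h1]
  rw [e, rot_add, e2, rot_mul_rot_neg]

section CrossSection

variable {k : ℤ} {ε : ℝ}

/-- The moment map is the angular momentum `q × p`: the function `f(|p|)` contributes nothing, since
`p` is orthogonal to `X × p`. -/
theorem momentMap_dehnForm (hε : 0 < ε) (y : Cyl) :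
    momentMap (dehnForm k ε) y 0 = y.2.q 1 * y.2.p 2 - y.2.q 2 * y.2.p 1 ∧
    momentMap (dehnForm k ε) y 1 = y.2.q 2 * y.2.p 0 - y.2.q 0 * y.2.p 2 ∧
    momentMap (dehnForm k ε) y 2 = y.2.q 0 * y.2.p 1 - y.2.q 1 * y.2.p 0 := by
  have h : ∀ i, momentMap (dehnForm k ε) y i =
      ⟪y.2.p, crs i y.2.q⟫_ℝ - y.1 * deriv (twistAngle k ε) ‖y.2.p‖ * ⟪y.2.p, crs i y.2.p⟫_ℝ := by
    intro i
    have h1 : momentMap (dehnForm k ε) y i = cov (dehnForm k ε) y (genv i y) := rfl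
    have h2 : Cyl.demb y (genv i y) = _ := Cyl.demb_gen i y
    rw [h1, cov_dehnForm_apply k hε, h2]
    simp
  refine ⟨?_, ?_, ?_⟩ <;> rw [h] <;> simp [crs, Cyl.inner_E3] <;> ring

/-- On the cross-section `q × p` is a positive multiple of `e₃`, so that `q` and `p` are orthogonal
vectors of the plane `z = 0` and form a positive basis of it. -/
theorem mem_crossSection_dehnForm (hε : 0 < ε) (y : Cyl) :
    y ∈ crossSection (dehnForm k ε) ↔ ∃ θ r, 0 < r ∧ y = crossPoint y.1 θ r := by
  obtain ⟨m0, m1, m2⟩ := momentMap_dehnForm (k := k) hε y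
  simp only [crossSection, Set.mem_ofPred_eq, m0, m1, m2]
  have hq : y.2.q 0 ^ 2 + y.2.q 1 ^ 2 + y.2.q 2 ^ 2 = 1 := by
    rw [← Cyl.norm_sq_E3, y.2.norm_q, one_pow]
  have hqp : y.2.q 0 * y.2.p 0 + y.2.q 1 * y.2.p 1 + y.2.q 2 * y.2.p 2 = 0 := by
    rw [← Cyl.inner_E3, y.2.inner_q_p]
  constructor
  · rintro ⟨h0, h1, h2⟩
    -- The vectors `q` and `p` are orthogonal to `q × p = (0, 0, r)`.
    set r := y.2.q 0 * y.2.p 1 - y.2.q 1 * y.2.p 0 with hr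
    have q2 : y.2.q 2 = 0 := by
      have : r * y.2.q 2 = 0 := by
        rw [hr]; linear_combination (-y.2.q 0) * h0 + (-y.2.q 1) * h1
      exact (mul_eq_zero.1 this).resolve_left h2.ne'
    have p2 : y.2.p 2 = 0 := by
      have : r * y.2.p 2 = 0 := by
        rw [hr]; linear_combination (-y.2.p 0) * h0 + (-y.2.p 1) * h1
      exact (mul_eq_zero.1 this).resolve_left h2.ne'
    rw [q2] at hq hqp
    obtain ⟨θ, hc, hs⟩ := exists_polar (y.2.q 0) (y.2.q 1)
    have hn : √(y.2.q 0 ^ 2 + y.2.q 1 ^ 2) = 1 := by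
      rw [Real.sqrt_eq_one]
      linarith
    rw [hn, one_mul] at hc hs
    refine ⟨θ, r, h2, Prod.ext rfl (CotS2.ext ?_ ?_)⟩
    · rw [crossPoint_q, ← hc, ← hs]
      ext i
      fin_cases i
      · rfl
      · rfl
      · exact q2
    · rw [crossPoint_p, ← hc, ← hs]
      ext i
      fin_cases i
      · change y.2.p 0 = -(r * y.2.q 1)
        rw [hr]
        linear_combination (-y.2.p 0) * hq + y.2.q 0 * hqp
      · change y.2.p 1 = r * y.2.q 0
        rw [hr]
        linear_combination (-y.2.p 1) * hq + y.2.q 1 * hqp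
      · exact p2
  · rintro ⟨θ, r, hr, hy⟩
    have hcs := Real.sin_sq_add_cos_sq θ
    rw [hy, crossPoint_q, crossPoint_p]
    refine ⟨by simp, by simp, ?_⟩
    simp
    nlinarith

/-- The closure of the cross-section adds the unit circle of the plane `z = 0` in the zero-section.
-/
theorem mem_closure_crossSection_dehnForm (hε : 0 < ε) (y : Cyl) :
    y ∈ closure (crossSection (dehnForm k ε)) ↔ ∃ θ r, 0 ≤ r ∧ y = crossPoint y.1 θ r := by
  constructor
  · intro hy
    have hq : ∀ i, Continuous fun z : Cyl => z.2.q i := fun i =>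
      (EuclideanSpace.proj i).continuous.comp (Cyl.continuous_q.comp continuous_snd)
    have hp : ∀ i, Continuous fun z : Cyl => z.2.p i := fun i =>
      (EuclideanSpace.proj i).continuous.comp (Cyl.continuous_p.comp continuous_snd)
    have hcl : IsClosed {z : Cyl | z.2.q 2 = 0 ∧ z.2.p 0 = -(‖z.2.p‖ * z.2.q 1) ∧
        z.2.p 1 = ‖z.2.p‖ * z.2.q 0 ∧ z.2.p 2 = 0} :=
      (isClosed_eq (hq 2) continuous_const).inter
        ((isClosed_eq (hp 0) (continuous_norm_p.mul (hq 1)).neg).inter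
          ((isClosed_eq (hp 1) (continuous_norm_p.mul (hq 0))).inter
            (isClosed_eq (hp 2) continuous_const)))
    have hsub : crossSection (dehnForm k ε) ⊆ {z : Cyl | z.2.q 2 = 0 ∧
        z.2.p 0 = -(‖z.2.p‖ * z.2.q 1) ∧ z.2.p 1 = ‖z.2.p‖ * z.2.q 0 ∧ z.2.p 2 = 0} := by
      intro z hz
      obtain ⟨θ, r, hr, e⟩ := (mem_crossSection_dehnForm hε z).1 hz
      rw [e, Set.mem_ofPred_eq, norm_crossPoint_p _ _ hr.le, crossPoint_q, crossPoint_p]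
      simp
    obtain ⟨q2, p0, p1, p2⟩ := closure_minimal hsub hcl hy
    obtain ⟨θ, hc, hs⟩ := exists_polar (y.2.q 0) (y.2.q 1)
    have hn : √(y.2.q 0 ^ 2 + y.2.q 1 ^ 2) = 1 := by
      have hq : y.2.q 0 ^ 2 + y.2.q 1 ^ 2 + y.2.q 2 ^ 2 = 1 := by
        rw [← Cyl.norm_sq_E3, y.2.norm_q, one_pow]
      rw [q2] at hq
      rw [Real.sqrt_eq_one]
      linarith
    rw [hn, one_mul] at hc hs
    refine ⟨θ, ‖y.2.p‖, norm_nonneg _, Prod.ext rfl (CotS2.ext ?_ ?_)⟩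
    · rw [crossPoint_q, ← hc, ← hs]
      ext i
      fin_cases i
      · rfl
      · rfl
      · exact q2
    · rw [crossPoint_p, ← hc, ← hs]
      ext i
      fin_cases i
      · exact p0
      · exact p1
      · exact p2
  · rintro ⟨θ, r, hr, hy⟩
    rw [hy]
    have hc : Continuous fun s : ℝ => crossPoint y.1 θ s :=
      continuous_crossPoint.comp (by fun_prop : Continuous fun s : ℝ => (y.1, θ, s))
    have hmem : r ∈ closure (Set.Ioi (0 : ℝ)) := by rw [closure_Ioi]; exact hr
    refine closure_mono ?_ (image_closure_subset_closure_image hc ⟨r, hmem, rfl⟩)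
    rintro _ ⟨s, hs, rfl⟩
    exact (mem_crossSection_dehnForm hε _).2 ⟨θ, s, hs, rfl⟩

/-- The closure of the cross-section of the mapping torus is the image of that of `ℝ × T^*S²`,
because the projection is a local diffeomorphism that pulls the contact form back to the given one.
-/
theorem mk_mem_closure_crossSection (hε : 0 < ε) (y : Cyl) :
    MappingTorus.mk (dehnTwist k ε hε) y ∈ closure (crossSection (torusForm k hε)) ↔
      ∃ θ r, 0 ≤ r ∧ y = crossPoint y.1 θ r := by
  rw [← mem_closure_crossSection_dehnForm (k := k) hε]
  have hl := MappingTorus.isLocalDiffeomorph_mk (dehnTwist k ε hε)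
  refine mem_closure_map (hl y) (Filter.Eventually.of_forall fun z => ?_)
  refine crossSection_map isSmoothAction_cyl ((hl z).contMDiffAt.mdifferentiableAt (by simp))
    (fun g => rfl) one_pos ?_
  rw [one_smul, cov_pullback_torusForm]

/-- The circle acts freely on the closure of the cross-section of the mapping torus. -/
theorem mk_mem_freePart (hε : 0 < ε) (y : Cyl) :
    MappingTorus.mk (dehnTwist k ε hε) y ∈ freePart (torusForm k hε) ↔
      ∃ θ r, 0 ≤ r ∧ y = crossPoint y.1 θ r := by
  refine ⟨fun h => (mk_mem_closure_crossSection hε y).1 h.1, fun h =>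
    ⟨(mk_mem_closure_crossSection hε y).2 h, fun s hs => ?_⟩⟩
  obtain ⟨n, hn⟩ := (MappingTorus.mk_eq_iff _).1 hs
  have h1 : y.1 = y.1 + n := congrArg Prod.fst hn
  have h2 : (n : ℝ) = 0 := by linarith
  have h3 : n = 0 := by exact_mod_cast h2
  rw [h3, EquivDiffeo.shift_zero] at hn
  obtain ⟨θ, r, -, e⟩ := h
  rw [e] at hn
  exact rot_two_eq_one_of_smul_eq (congrArg (fun z : Cyl => z.2.q) hn.symm)

/-- On the closure of the cross-section the Dehn twist is the rotation by `f(|p|)`. -/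
theorem dehnTwist_crossPoint (hε : 0 < ε) (t θ : ℝ) {r : ℝ} (hr : 0 ≤ r) :
    (dehnTwist k ε hε).shift 1 (crossPoint t θ r) =
      crossPoint (t + 1) (θ + twistAngle k ε r) r := by
  rw [MappingTorus.shift_one]
  refine Prod.ext rfl ?_
  have hn : ‖(crossPoint t θ r).2.1.2‖ = r := norm_crossPoint_p t θ hr
  have hq : (crossPoint t θ r).2.1.1 = _ := crossPoint_q t θ r
  have hp : (crossPoint t θ r).2.1.2 = _ := crossPoint_p t θ r
  have h0 : r = 0 → Real.sin (twistAngle k ε r) = 0 := by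
    rintro rfl
    exact sin_twistAngle_of_le (by positivity)
  set f := twistAngle k ε r with hf
  have hgeod : twistFun k ε (crossPoint t θ r).2.1 = geod f (crossPoint t θ r).2.1 := by
    rw [twistFun, hn]
  have hfr : Real.sin f / r * r = Real.sin f := by
    rcases eq_or_ne r 0 with h | h
    · rw [h0 h, zero_div, zero_mul]
    · exact div_mul_cancel₀ _ h
  refine CotS2.ext ?_ ?_
  · change (twistFun k ε (crossPoint t θ r).2.1).1 = _
    rw [hgeod, crossPoint_q, geod, hn, hq, hp, Real.cos_add, Real.sin_add]
    ext i
    fin_cases i <;> simp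
    · linear_combination (-Real.sin θ) * hfr
    · linear_combination Real.cos θ * hfr
  · change (twistFun k ε (crossPoint t θ r).2.1).2 = _
    rw [hgeod, crossPoint_p, geod, hn, hq, hp, Real.cos_add, Real.sin_add]
    ext i
    fin_cases i <;> simp <;> ring

/-- The section of the circle action over the closure of the cross-section of the mapping torus that
continues the standard section over `ε < |p|`, lifted to `ℝ × T^*S²`. -/
def sectionFun (k : ℤ) (ε : ℝ) (y : Cyl) : Cyl :=
  crossPoint y.1 (-(y.1 * (Real.pi * k * (1 - rho ε ‖y.2.p‖)))) ‖y.2.p‖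

theorem continuous_sectionFun (hε : 0 < ε) : Continuous (sectionFun k ε) := by
  have h : Continuous fun y : Cyl => rho ε ‖y.2.p‖ :=
    (contDiff_rho hε).continuous.comp continuous_norm_p
  exact continuous_crossPoint.comp (continuous_fst.prodMk
    ((continuous_fst.mul (continuous_const.mul (continuous_const.sub h))).neg.prodMk
      continuous_norm_p))

/-- The section descends to the mapping torus: the angles over the two representatives differ by `2
π k`. -/
theorem mk_sectionFun_shift (hε : 0 < ε) (y : Cyl) :
    MappingTorus.mk (dehnTwist k ε hε) (sectionFun k ε ((dehnTwist k ε hε).shift 1 y)) =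
      MappingTorus.mk (dehnTwist k ε hε) (sectionFun k ε y) := by
  rw [← MappingTorus.mk_shift _ 1 (sectionFun k ε y), sectionFun, sectionFun,
    dehnTwist_crossPoint hε _ _ (norm_nonneg _)]
  have hn : ‖((dehnTwist k ε hε).shift 1 y).2.p‖ = ‖y.2.p‖ := by
    rw [MappingTorus.shift_one]
    exact (geod_mem y.2.2 (twist_h0 k hε y.2.1)).2
  have ht : ((dehnTwist k ε hε).shift 1 y).1 = y.1 + 1 := by
    rw [MappingTorus.shift_one]
  rw [hn, ht]
  congr 1
  have e : -(y.1 * (Real.pi * k * (1 - rho ε ‖y.2.p‖))) + twistAngle k ε ‖y.2.p‖ =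
      -((y.1 + 1) * (Real.pi * k * (1 - rho ε ‖y.2.p‖))) + 2 * Real.pi * k := by
    rw [twistAngle]
    ring
  rw [e]
  refine Prod.ext rfl ?_
  change rot 2 _ • stdPoint _ = rot 2 _ • stdPoint _
  rw [rot_add, rot_two_pi_mul_int, mul_one]

/-- The section of the circle action over the closure of the cross-section of the mapping torus. -/
def torusSection (k : ℤ) {ε : ℝ} (hε : 0 < ε) :
    MappingTorus (dehnTwist k ε hε) → MappingTorus (dehnTwist k ε hε) :=
  MappingTorus.lift _ (fun y => MappingTorus.mk _ (sectionFun k ε y)) (mk_sectionFun_shift hε)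

theorem torusSection_mk (hε : 0 < ε) (y : Cyl) : torusSection k hε (MappingTorus.mk _ y) =
    MappingTorus.mk (dehnTwist k ε hε) (sectionFun k ε y) := rfl

theorem continuous_torusSection (hε : 0 < ε) : Continuous (torusSection k hε) :=
  MappingTorus.continuous_lift _ ((MappingTorus.continuous_mk _).comp (continuous_sectionFun hε))

theorem sectionFun_crossPoint (t θ : ℝ) {r : ℝ} (hr : 0 ≤ r) : sectionFun k ε (crossPoint t θ r) =
    crossPoint t (-(t * (Real.pi * k * (1 - rho ε r)))) r := by
  rw [sectionFun, norm_crossPoint_p _ _ hr]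
  rfl

/-- For `|p| > ε` the section is the standard one. -/
theorem sectionFun_of_lt (hε : 0 < ε) {y : Cyl} (h : ε < ‖y.2.p‖) :
    sectionFun k ε y = (y.1, stdPoint ‖y.2.p‖) := by
  have h1 : rho ε ‖y.2.p‖ = 1 := by
    rw [rho, if_neg (by linarith), if_neg (by linarith)]
  rw [sectionFun, h1, sub_self, mul_zero, mul_zero, neg_zero, crossPoint, rot_zero, one_smul]

end CrossSection

/-! ### The extension of the section over the glued manifold -/

section Extension

variable {M : Type*} [TopologicalSpace M] [ChartedSpace E5 M] [MulAction SO3 M]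
variable {N : Type*} [TopologicalSpace N] [ChartedSpace E5 N] [MulAction SO3 N]

/-- A slice disc inside an open set on which `j` is a contact embedding is mapped to a slice disc
after shrinking its parametrization. -/
theorem ContactEmb.isOrbitSlice [IsManifold (𝓡 5) ∞ M] [IsManifold (𝓡 5) ∞ N]
    {α : OneForm M} {β : OneForm N} {j : M → N} {U : Set M}
    (h : ContactEmb α β j U) (hα : IsContactSO3 α) (hβ : IsSmoothForm β) {m : ℕ} {x : M}
    {d : ℂ → M} (hd : IsOrbitSlice α m x d) {ρ : ℝ} (hρ : 0 < ρ) (hρ1 : ρ ≤ 1)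
    (hU : ∀ w ∈ Metric.ball (0 : ℂ) 1, d (ρ * w) ∈ U) :
    IsOrbitSlice β m (j x) (fun w => j (d (ρ * w))) := by
  have hb : ∀ w ∈ Metric.ball (0 : ℂ) 1, (ρ : ℂ) * w ∈ Metric.ball (0 : ℂ) 1 := by
    intro w hw
    rw [mem_ball_zero_iff] at hw ⊢
    rw [norm_mul, Complex.norm_real, Real.norm_of_nonneg hρ.le]
    nlinarith [norm_nonneg w]
  have hρ' : (ρ : ℂ) ≠ 0 := by exact_mod_cast hρ.ne'
  have hdat : ∀ w ∈ Metric.ball (0 : ℂ) 1,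
      ContMDiffAt 𝓘(ℝ, ℂ) (𝓡 5) ∞ (fun w => d (ρ * w)) w := by
    intro w hw
    have h1 : ContMDiffAt 𝓘(ℝ, ℂ) (𝓡 5) ∞ d (ρ * w) :=
      hd.smooth.contMDiffAt (Metric.isOpen_ball.mem_nhds (hb w hw))
    have h2 : ContMDiffAt 𝓘(ℝ, ℂ) 𝓘(ℝ, ℂ) ∞ (fun w : ℂ => (ρ : ℂ) * w) w :=
      (contDiff_const.mul contDiff_id).contMDiff.contMDiffAt
    exact ContMDiffAt.comp (I' := 𝓘(ℝ, ℂ)) (g := d) (f := fun w : ℂ => (ρ : ℂ) * w) w h1 h2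
  have h0 : (0 : ℂ) ∈ Metric.ball (0 : ℂ) 1 := by simp
  have hxU : d 0 ∈ U := by simpa using hU 0 h0
  refine ⟨by simp [hd.center], ?_, ?_, ?_, ?_, ?_, ?_⟩
  · intro w hw
    exact (ContMDiffAt.comp (I' := 𝓡 5) (g := j) (f := fun w : ℂ => d (ρ * w)) w
      (h.contMDiffAt (hU w hw)) (hdat w hw)).contMDiffWithinAt
  · intro w hw w' hw' e
    exact mul_left_cancel₀ hρ' (hd.injOn (hb w hw) (hb w' hw') (h.injOn (hU w hw) (hU w' hw') e))
  · intro w hw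
    exact (h.mem_crossSection hα.smooth_action (hU w hw)).2 (hd.mem _ (hb w hw))
  · obtain ⟨ν, hν⟩ := hd.equivariant
    refine ⟨ν, fun w hw => ?_⟩
    rw [← h.equivariant _ _ (hU w hw), hν _ (hb w hw), mul_left_comm]
  · intro w hw w' hw' s e
    rw [← h.equivariant _ _ (hU w hw)] at e
    exact hd.slice _ (hb w hw) _ (hb w' hw') s
      (h.injOn (h.smul_mem _ _ (hU w hw)) (hU w' hw') e)
  · have hd0 : MDifferentiableAt 𝓘(ℝ, ℂ) (𝓡 5) d ((fun w : ℂ => (ρ : ℂ) * w) 0) := by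
      have : ContMDiffAt 𝓘(ℝ, ℂ) (𝓡 5) ∞ d (ρ * 0) :=
        hd.smooth.contMDiffAt (Metric.isOpen_ball.mem_nhds (hb 0 h0))
      exact this.mdifferentiableAt (by simp)
    have hl : HasFDerivAt (fun w : ℂ => (ρ : ℂ) * w) (ρ • ContinuousLinearMap.id ℝ ℂ) 0 := by
      have := (hasFDerivAt_id (𝕜 := ℝ) (0 : ℂ)).const_smul ρ
      refine this.congr_of_eventuallyEq (Filter.Eventually.of_forall fun w => ?_)
      simp
    have e1 : ∀ v : ℂ, mder 𝓘(ℝ, ℂ) (𝓡 5) (fun w => j (d (ρ * w))) 0 v =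
        mder (𝓡 5) (𝓡 5) j (d 0) (ρ • mder 𝓘(ℝ, ℂ) (𝓡 5) d 0 v) := by
      intro v
      have e2 := mder_comp (I := 𝓘(ℝ, ℂ)) (F := fun w : ℂ => (ρ : ℂ) * w) (G := d) (x := 0) hd0
        hl.differentiableAt.mdifferentiableAt
      have e3 := mder_comp (I := 𝓘(ℝ, ℂ)) (F := fun w : ℂ => d (ρ * w)) (G := j) (x := 0)
        (by
          rw [mul_zero]
          exact h.mdifferentiableAt hxU) ((hdat 0 h0).mdifferentiableAt (by simp))
      have e4 : mder 𝓘(ℝ, ℂ) 𝓘(ℝ, ℂ) (fun w : ℂ => (ρ : ℂ) * w) 0 =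
          ρ • ContinuousLinearMap.id ℝ ℂ := hl.hasMFDerivAt.mfderiv
      rw [e3, e2, e4]
      simp
    choose! c hc0 hc using h.form
    have hβx : FormSmoothAt β (j (d 0)) := hβ.formSmoothAt _
    have hjx := h.contMDiffAt hxU
    have hws := fun u v w : E5 => wedgeD_smul (hβx.pullback hjx)
      (hα.smooth_form.formSmoothAt (d 0)) (c := c)
      (by filter_upwards [h.isOpen.mem_nhds hxU] with y hy using hc y hy)
      (hα.contact (d 0)).1 u v w
    have hgen : gen 2 (j (d 0)) = mder (𝓡 5) (𝓡 5) j (d 0) (gen 2 (d 0)) :=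
      gen_map hα.smooth_action (h.mdifferentiableAt hxU) (fun g => h.equivariant g _ hxU) 2
    have hbase : j (d (ρ * 0)) = j (d 0) := by rw [mul_zero]
    -- The map `j` multiplies `α ∧ dα` by `c²` and the contraction of the disc multiplies it by
    -- `ρ²`, so the orientation of the disc is preserved.
    have key : wedgeD β (j (d 0)) (mder 𝓘(ℝ, ℂ) (𝓡 5) (fun w => j (d (ρ * w))) 0 1)
        (mder 𝓘(ℝ, ℂ) (𝓡 5) (fun w => j (d (ρ * w))) 0 Complex.I) (gen 2 (j (d 0))) =
        (c (d 0)) ^ 2 * (ρ ^ 2 * wedgeD α (d 0) (mder 𝓘(ℝ, ℂ) (𝓡 5) d 0 1)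
          (mder 𝓘(ℝ, ℂ) (𝓡 5) d 0 Complex.I) (gen 2 (d 0))) := by
      rw [e1, e1, hgen]
      refine (wedgeD_pullback hβx hjx _ _ _).symm.trans ((hws _ _ _).trans ?_)
      congr 1
      have hA : ∀ u : E5, cov α (d 0) (ρ • u) = ρ * cov α (d 0) u := fun u => by
        rw [map_smul, smul_eq_mul]
      have hE : ∀ u v : E5, extD α (d 0) (ρ • u : E5) v = ρ * extD α (d 0) u v := fun u v => by
        rw [extD_eq, extD_eq, flatD, flatD, map_smul, map_smul]
        simp
        ring
      have hE' : ∀ u v : E5, extD α (d 0) u (ρ • v : E5) = ρ * extD α (d 0) u v := fun u v => by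
        rw [extD_eq, extD_eq, flatD, flatD, map_smul, map_smul]
        simp
        ring
      change cov α (d 0) _ * _ + cov α (d 0) _ * _ + cov α (d 0) _ * _ =
        ρ ^ 2 * (cov α (d 0) _ * _ + cov α (d 0) _ * _ + cov α (d 0) _ * _)
      erw [hA, hA, hE, hE', hE, hE']
      ring
    have hpos := hd.oriented
    change 0 < wedgeD β (j (d (ρ * 0))) (mder 𝓘(ℝ, ℂ) (𝓡 5) (fun w => j (d (ρ * w))) 0 1 : E5)
      (mder 𝓘(ℝ, ℂ) (𝓡 5) (fun w => j (d (ρ * w))) 0 Complex.I : E5) (genv 2 (j (d (ρ * 0))))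
    rw [hbase]
    refine lt_of_lt_of_eq ?_ key.symm
    have := hc0 _ hxU
    exact mul_pos (by positivity) (mul_pos (by positivity) hpos)

/-- A section of the circle action over the free part of `M` induces one over the image of a contact
embedding. -/
theorem ContactEmb.section_image [Nonempty M] {α : OneForm M} {β : OneForm N} {j : M → N}
    {U : Set M} (h : ContactEmb α β j U) (hM : IsSmoothAction M) {σ : M → M} {σ' : N → N}
    (hcont : ContinuousOn σ (freePart α)) (horb : ∀ x ∈ freePart α, σ x ∈ zOrbit x)
    (hinv : ∀ x ∈ freePart α, ∀ s : ℝ, σ (rot 2 s • x) = σ x)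
    (hσ' : ∀ x ∈ freePart α, x ∈ U → ∀ s : ℝ, σ' (j (rot 2 s • x)) = j (σ (rot 2 s • x)))
    {z : N} (hz : z ∈ freePart β) (hzU : z ∈ j '' U) :
    ContinuousWithinAt σ' (freePart β) z ∧ σ' z ∈ zOrbit z ∧
      ∀ s : ℝ, σ' (rot 2 s • z) = σ' z := by
  have hσ0 : ∀ x ∈ freePart α, x ∈ U → σ' (j x) = j (σ x) := by
    intro x hx hxU
    have := hσ' x hx hxU 0
    rwa [rot_zero, one_smul] at this
  have hl : ∀ x ∈ U, Function.invFunOn j U (j x) = x := h.injOn.leftInvOn_invFunOn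
  have hi := h.inverse
  refine ⟨?_, ?_⟩
  · have hc : ContinuousOn (fun w => j (σ (Function.invFunOn j U w))) (freePart β ∩ j '' U) := by
      have h1 : Set.MapsTo (Function.invFunOn j U) (freePart β ∩ j '' U) (freePart α ∩ U) := by
        rintro _ ⟨hx, x, hxU, rfl⟩
        rw [hl x hxU]
        exact ⟨(h.mem_freePart hM hxU).1 hx, hxU⟩
      have h2 : Set.MapsTo σ (freePart α ∩ U) U := fun x hx =>
        h.zOrbit_subset hx.2 (horb x hx.1)
      exact h.continuousOn.comp ((hcont.mono Set.inter_subset_left).comp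
        (hi.continuousOn.mono Set.inter_subset_right) h1) (h2.comp h1)
    have hc' : ContinuousOn σ' (freePart β ∩ j '' U) := by
      refine hc.congr ?_
      rintro _ ⟨hx, x, hxU, rfl⟩
      simp only [hl x hxU]
      exact hσ0 x ((h.mem_freePart hM hxU).1 hx) hxU
    exact (continuousWithinAt_inter (h.isOpen_image.mem_nhds hzU)).1 (hc' z ⟨hz, hzU⟩)
  · obtain ⟨x, hxU, rfl⟩ := hzU
    have hx := (h.mem_freePart hM hxU).1 hz
    rw [hσ0 x hx hxU, h.image_zOrbit hxU]
    refine ⟨⟨σ x, horb x hx, rfl⟩, fun s => ?_⟩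
    rw [← h.equivariant _ x hxU, hσ' x hx hxU, hinv x hx]

variable {M' : Type*} [TopologicalSpace M'] [ChartedSpace E5 M'] [MulAction SO3 M']
variable {α : OneForm M} {K : Set M} {δ : ℝ} {ψ : Cyl → M} {k : ℤ} {ε : ℝ} {hε : 0 < ε}
variable {α' : OneForm M'} {j₁ : M → M'} {j₂ : MappingTorus (dehnTwist k ε hε) → M'}

theorem rot_smul_mk_mem_freePart {x : MappingTorus (dehnTwist k ε hε)}
    (hx : x ∈ freePart (torusForm k hε)) (s : ℝ) : rot 2 s • x ∈ freePart (torusForm k hε) := by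
  obtain ⟨y, rfl⟩ := MappingTorus.mk_surjective _ x
  obtain ⟨θ, r, hr, e⟩ := (mk_mem_freePart hε y).1 hx
  refine (mk_mem_freePart hε (rot 2 s • y)).2 ⟨s + θ, r, hr, ?_⟩
  have h1 : (rot 2 s • y).1 = y.1 := rfl
  rw [h1, ← rot_smul_crossPoint, ← e]

theorem torusSection_mem_zOrbit {x : MappingTorus (dehnTwist k ε hε)}
    (hx : x ∈ freePart (torusForm k hε)) : torusSection k hε x ∈ zOrbit x := by
  obtain ⟨y, rfl⟩ := MappingTorus.mk_surjective _ x
  obtain ⟨θ, r, hr, e⟩ := (mk_mem_freePart hε y).1 hx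
  obtain ⟨t, rfl⟩ : ∃ t, y = crossPoint t θ r := ⟨_, e⟩
  refine ⟨-(t * (Real.pi * k * (1 - rho ε r))) - θ, ?_⟩
  rw [torusSection_mk, MappingTorus.smul_mk, rot_smul_crossPoint, sub_add_cancel,
    sectionFun_crossPoint _ _ hr]

theorem torusSection_rot_smul (x : MappingTorus (dehnTwist k ε hε)) (s : ℝ) :
    torusSection k hε (rot 2 s • x) = torusSection k hε x := by
  obtain ⟨y, rfl⟩ := MappingTorus.mk_surjective _ x
  rw [MappingTorus.smul_mk, torusSection_mk, torusSection_mk]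
  congr 1
  rw [sectionFun, sectionFun, Cyl.norm_smul_p]
  rfl

namespace IsGluing

/-- On the overlap of the two parts the given section agrees with the section of the mapping
torus. -/
theorem section_compat (hg : IsGluing α K δ ψ k ε hε α' j₁ j₂) (hc : IsCollar α K δ ψ)
    (hM : IsSmoothAction M) (hδ : ε < δ) {σ : M → M} (hσ : IsStandardSection α σ)
    (hst : ∀ t r : ℝ, 0 < r → r < δ → σ (ψ (t, stdPoint r)) = ψ (t, stdPoint r))
    {x : M} (hx : x ∈ (core K ψ ε)ᶜ) {y : Cyl} (hy : ‖y.2.p‖ < δ)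
    (hyf : MappingTorus.mk _ y ∈ freePart (torusForm k hε))
    (e : j₁ x = j₂ (MappingTorus.mk _ y)) :
    j₁ (σ x) = j₂ (torusSection k hε (MappingTorus.mk _ y)) := by
  have h1 := hg.contactEmb₁ hc hM hδ
  have hxf : x ∈ freePart α := by
    rw [← h1.mem_freePart hM hx, e, hg.contactEmb₂.mem_freePart MappingTorus.isSmoothAction
      ⟨y, hy, rfl⟩]
    exact hyf
  obtain ⟨hp, rfl⟩ := (hg.glue x hx y hy).1 e
  obtain ⟨θ, r, hr, ey⟩ := (mk_mem_freePart hε y).1 hyf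
  have hnr : ‖y.2.p‖ = r := by
    conv_lhs => rw [ey]
    exact norm_crossPoint_p _ _ hr
  have hr0 : 0 < r := hε.trans (hnr ▸ hp)
  have hrδ : r < δ := hnr ▸ hy
  have hrot : rot 2 (-θ) • y = (y.1, stdPoint r) := by
    rw [ey, rot_smul_crossPoint, neg_add_cancel, crossPoint, rot_zero, one_smul]
    rfl
  have h2 : σ (ψ y) = ψ (y.1, stdPoint r) := by
    rw [← hσ.invariant _ hxf (-θ), ← hc.equivariant _ y (hε.trans hp) hy, hrot, hst _ _ hr0 hrδ]
  have h3 : ψ (y.1, stdPoint r) ∈ (core K ψ ε)ᶜ :=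
    h2 ▸ h1.zOrbit_subset hx (hσ.mem_orbit _ hxf)
  rw [h2, torusSection_mk, sectionFun_of_lt hε hp, hnr]
  have hn : ‖((y.1, stdPoint r) : Cyl).2.p‖ = r := norm_stdPoint_p hr
  exact (hg.glue _ h3 (y.1, stdPoint r) (hn.trans_lt hrδ)).2 ⟨(hnr ▸ hp).trans_eq hn.symm, rfl⟩

open Classical in
/-- The sections of the two parts agree on the overlap and define a function on the glued manifold.
-/
theorem exists_extension_fun (hg : IsGluing α K δ ψ k ε hε α' j₁ j₂) (hc : IsCollar α K δ ψ)
    (hM : IsSmoothAction M) (hδ : ε < δ) {σ : M → M} (hσ : IsStandardSection α σ)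
    (hst : ∀ t r : ℝ, 0 < r → r < δ → σ (ψ (t, stdPoint r)) = ψ (t, stdPoint r)) :
    ∃ σ' : M' → M', (∀ x ∈ (core K ψ ε)ᶜ, σ' (j₁ x) = j₁ (σ x)) ∧
      ∀ y : Cyl, ‖y.2.p‖ < δ → MappingTorus.mk _ y ∈ freePart (torusForm k hε) →
        σ' (j₂ (MappingTorus.mk _ y)) = j₂ (torusSection k hε (MappingTorus.mk _ y)) := by
  have h2 := hg.contactEmb₂
  refine ⟨fun z => if h : ∃ x ∈ (core K ψ ε)ᶜ, j₁ x = z then j₁ (σ h.choose) else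
    if h : ∃ x ∈ MappingTorus.mk (dehnTwist k ε hε) '' {y : Cyl | ‖y.2.p‖ < δ}, j₂ x = z then
      j₂ (torusSection k hε h.choose) else z, fun x hx => ?_, fun y hy hyf => ?_⟩
  · have h : ∃ x' ∈ (core K ψ ε)ᶜ, j₁ x' = j₁ x := ⟨x, hx, rfl⟩
    simp only [dif_pos h]
    rw [hg.injOn₁ h.choose_spec.1 hx h.choose_spec.2]
  · by_cases h : ∃ x ∈ (core K ψ ε)ᶜ, j₁ x = j₂ (MappingTorus.mk _ y)
    · simp only [dif_pos h]
      exact hg.section_compat hc hM hδ hσ hst h.choose_spec.1 hy hyf h.choose_spec.2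
    · have h' : ∃ x ∈ MappingTorus.mk (dehnTwist k ε hε) '' {y : Cyl | ‖y.2.p‖ < δ},
          j₂ x = j₂ (MappingTorus.mk _ y) := ⟨_, ⟨y, hy, rfl⟩, rfl⟩
      simp only [dif_neg h, dif_pos h']
      rw [hg.injOn₂ h'.choose_spec.1 ⟨y, hy, rfl⟩ h'.choose_spec.2]

/-- The section of `M` extends over the part glued in, where the action of the circle on the closure
of the cross-section is free, so that no exceptional orbits are added. -/
theorem exists_section [IsManifold (𝓡 5) ∞ M] [IsManifold (𝓡 5) ∞ M']
    (hg : IsGluing α K δ ψ k ε hε α' j₁ j₂) (hc : IsCollar α K δ ψ)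
    (hα : IsContactSO3 α) (hδ : ε < δ) {σ : M → M} (hσ : IsStandardSection α σ)
    (hst : ∀ t r : ℝ, 0 < r → r < δ → σ (ψ (t, stdPoint r)) = ψ (t, stdPoint r)) :
    ∃ σ' : M' → M', IsStandardSection α' σ' ∧
      ∀ x ∈ freePart α, x ∉ core K ψ ε → σ' (j₁ x) = j₁ (σ x) := by
  have hM := hα.smooth_action
  have h1 := hg.contactEmb₁ hc hM hδ
  have h2 := hg.contactEmb₂
  have hcov : ∀ z, z ∈ j₁ '' (core K ψ ε)ᶜ ∨
      z ∈ j₂ '' (MappingTorus.mk (dehnTwist k ε hε) '' {y : Cyl | ‖y.2.p‖ < δ}) := by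
    intro z
    have hz : z ∈ j₁ '' (core K ψ ε)ᶜ ∪ _ := hg.cover ▸ Set.mem_univ z
    rw [Set.image_image]
    exact hz
  obtain ⟨σ', hσ1, hσ2⟩ := hg.exists_extension_fun hc hM hδ hσ hst
  have main : ∀ z ∈ freePart α', ContinuousWithinAt σ' (freePart α') z ∧ σ' z ∈ zOrbit z ∧
      ∀ s : ℝ, σ' (rot 2 s • z) = σ' z := by
    intro z hz
    rcases hcov z with hzU | hzU
    · have : Nonempty M := ⟨hzU.choose⟩
      exact h1.section_image hM hσ.continuousOn hσ.mem_orbit hσ.invariant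
        (fun x _ hxU s => hσ1 _ (h1.smul_mem _ x hxU)) hz hzU
    · have : Nonempty (MappingTorus (dehnTwist k ε hε)) := ⟨hzU.choose⟩
      refine h2.section_image MappingTorus.isSmoothAction
        (continuous_torusSection hε).continuousOn (fun x hx => torusSection_mem_zOrbit hx)
        (fun x _ s => torusSection_rot_smul x s) ?_ hz hzU
      intro x hx hxU s
      obtain ⟨y, hy, e⟩ := h2.smul_mem (rot 2 s) x hxU
      have hf := rot_smul_mk_mem_freePart hx s
      rw [← e] at hf ⊢
      exact hσ2 y hy hf
  refine ⟨σ', ⟨fun z hz => (main z hz).1, fun z hz => (main z hz).2.1,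
    fun z hz => (main z hz).2.2, ?_⟩, fun x _ hx => hσ1 x hx⟩
  rintro z hz ⟨s, hs, hs1⟩
  rcases hcov z with ⟨x, hxU, rfl⟩ | ⟨_, ⟨y, hy, rfl⟩, rfl⟩
  · obtain ⟨m, d, β, hm, hd, hβ0, hβm, hβ⟩ := hσ.standard x
      ((h1.mem_crossSection hM hxU).1 hz) ⟨s, (h1.smul_eq_iff hxU _).1 hs, hs1⟩
    have hd0 : d 0 ∈ (core K ψ ε)ᶜ := by rw [hd.center]; exact hxU
    have hdc : ContinuousAt d 0 :=
      (hd.smooth.contMDiffAt (Metric.isOpen_ball.mem_nhds (by simp))).continuousAt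
    -- The slice disc at an exceptional orbit is contracted until it lies in the part from `M`.
    obtain ⟨η, hη, hball⟩ := Metric.mem_nhds_iff.1
      (hdc.preimage_mem_nhds (h1.isOpen.mem_nhds hd0))
    have hρ : 0 < min η 1 := lt_min hη one_pos
    have hU : ∀ w ∈ Metric.ball (0 : ℂ) 1, d ((min η 1 : ℝ) * w) ∈ (core K ψ ε)ᶜ := by
      intro w hw
      apply hball
      rw [mem_ball_zero_iff] at hw ⊢
      rw [norm_mul, Complex.norm_real, Real.norm_of_nonneg hρ.le]
      calc min η 1 * ‖w‖ < min η 1 * 1 := by gcongr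
        _ ≤ η := by rw [mul_one]; exact min_le_left _ _
    refine ⟨m, _, β, hm, h1.isOrbitSlice hα hg.contact.smooth_form hd hρ (min_le_right _ _) hU,
      hβ0, hβm, fun r hr0 hr1 => ?_⟩
    obtain ⟨h, hhc, hhp, hh⟩ := hβ (min η 1 * r) (by positivity)
      (by nlinarith [min_le_right η 1])
    refine ⟨h, hhc, hhp, fun u => ?_⟩
    have e : (((min η 1 : ℝ) : ℂ) * (r * Complex.exp (2 * Real.pi * Complex.I * u))) =
        ((min η 1 * r : ℝ) : ℂ) * Complex.exp (2 * Real.pi * Complex.I * u) := by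
      push_cast
      ring
    have hwU : d ((min η 1 : ℝ) * (r * Complex.exp (2 * Real.pi * Complex.I * u))) ∈
        (core K ψ ε)ᶜ := by
      apply hU
      rw [mem_ball_zero_iff, norm_mul, Complex.norm_real, Real.norm_of_nonneg hr0.le,
        show 2 * Real.pi * Complex.I * u = ((2 * Real.pi * u : ℝ) : ℂ) * Complex.I by
          push_cast; ring, Complex.norm_exp_ofReal_mul_I, mul_one]
      exact hr1
    rw [hσ1 _ hwU]
    rw [e] at hwU ⊢
    have hσU : σ (d (((min η 1 * r : ℝ) : ℂ) * Complex.exp (2 * Real.pi * Complex.I * u))) ∈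
        (core K ψ ε)ᶜ := by
      apply h1.mem_of_smul_mem (g := rot 2 (2 * Real.pi * h u))
      rw [← hh u]
      exact hwU
    rw [← h1.equivariant _ _ hσU, ← hh u]
  · -- The circle acts freely on the part coming from the mapping torus.
    exfalso
    have hyU : MappingTorus.mk (dehnTwist k ε hε) y ∈
        MappingTorus.mk (dehnTwist k ε hε) '' {y : Cyl | ‖y.2.p‖ < δ} := ⟨y, hy, rfl⟩
    have h3 := (h2.mem_closure_crossSection MappingTorus.isSmoothAction hyU).1 (subset_closure hz)
    have h4 := (mk_mem_freePart (k := k) hε y).2 ((mk_mem_closure_crossSection hε y).1 h3)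
    exact hs1 (h4.2 s ((h2.smul_eq_iff hyU _).1 hs))

end IsGluing

end Extension

/-! ### The tori of constant `|p|` in the cross-section of the mapping torus -/

/-- Coordinates `(x, y)` on the torus `|p| = r` in the closure of the cross-section, in which the
mapping torus identification becomes the translation by `(1, 0)` and the circle orbits are the lines
`x = const`. -/
def torusPoint (k : ℤ) (ε x y r : ℝ) : Cyl :=
  crossPoint x (x * twistAngle k ε r + 2 * Real.pi * y) r

section TorusPoint

variable {k : ℤ} {ε : ℝ}

theorem norm_torusPoint_p (x y : ℝ) {r : ℝ} (hr : 0 ≤ r) : ‖(torusPoint k ε x y r).2.p‖ = r :=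
  norm_crossPoint_p _ _ hr

theorem rot_smul_torusPoint (s x y r : ℝ) : rot 2 (2 * Real.pi * s) • torusPoint k ε x y r =
    torusPoint k ε x (y + s) r := by
  rw [torusPoint, rot_smul_crossPoint, torusPoint]
  congr 1
  ring

theorem torusPoint_add_int (x y r : ℝ) (n : ℤ) :
    torusPoint k ε x (y + n) r = torusPoint k ε x y r := by
  rw [← rot_smul_torusPoint, rot_two_pi_mul_int, one_smul]

theorem exists_torusPoint (t θ r : ℝ) : ∃ y, crossPoint t θ r = torusPoint k ε t y r := by
  refine ⟨(θ - t * twistAngle k ε r) / (2 * Real.pi), ?_⟩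
  rw [torusPoint, mul_div_cancel₀ _ (by positivity)]
  congr 1
  ring

theorem continuous_torusPoint (hε : 0 < ε) :
    Continuous fun z : ℝ × ℝ × ℝ => torusPoint k ε z.1 z.2.1 z.2.2 := by
  have hf : Continuous (twistAngle k ε) :=
    continuous_const.mul (continuous_const.add (contDiff_rho hε).continuous)
  exact continuous_crossPoint.comp (continuous_fst.prodMk
    (((continuous_fst.mul (hf.comp continuous_snd.snd)).add
      (continuous_const.mul continuous_snd.fst)).prodMk continuous_snd.snd))

/-- The term `x f(r)` in the definition of `torusPoint` compensates the rotation by `f(r)` that the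
Dehn twist performs on the torus `|p| = r`. -/
theorem mk_torusPoint_add (hε : 0 < ε) (x y : ℝ) {r : ℝ} (hr : 0 ≤ r) (m n : ℤ) :
    MappingTorus.mk (dehnTwist k ε hε) (torusPoint k ε (x + m) (y + n) r) =
      MappingTorus.mk (dehnTwist k ε hε) (torusPoint k ε x y r) := by
  rw [torusPoint_add_int]
  have h1 : Function.Periodic
      (fun x => MappingTorus.mk (dehnTwist k ε hε) (torusPoint k ε x y r)) 1 := by
    intro x
    simp only
    rw [← MappingTorus.mk_shift _ 1 (torusPoint k ε x y r), torusPoint, torusPoint,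
      dehnTwist_crossPoint hε _ _ hr]
    congr 2
    ring
  have := h1.int_mul m x
  simpa using this

theorem eq_of_mk_eq {τ : EquivDiffeo} {y z : Cyl} (h : MappingTorus.mk τ y = MappingTorus.mk τ z)
    (ht : y.1 = z.1) : y = z := by
  obtain ⟨n, hn⟩ := (MappingTorus.mk_eq_iff _).1 h
  have h1 : z.1 = y.1 + n := congrArg Prod.fst hn
  have h2 : (n : ℝ) = 0 := by linarith
  have h3 : n = 0 := by exact_mod_cast h2
  rw [h3, EquivDiffeo.shift_zero] at hn
  exact hn.symm

theorem mk_torusPoint_eq_iff (hε : 0 < ε) {x y x' y' r r' : ℝ} (hr : 0 ≤ r) (hr' : 0 ≤ r') :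
    MappingTorus.mk (dehnTwist k ε hε) (torusPoint k ε x y r) =
      MappingTorus.mk (dehnTwist k ε hε) (torusPoint k ε x' y' r') ↔
      r = r' ∧ ∃ m n : ℤ, x' = x + m ∧ y' = y + n := by
  constructor
  · intro h
    obtain ⟨m, hm⟩ := (MappingTorus.mk_eq_iff _).1 h
    have hx : x' = x + m := congrArg Prod.fst hm
    subst hx
    have h1 := mk_torusPoint_add (k := k) hε x y hr m 0
    rw [Int.cast_zero, add_zero] at h1
    have h2 := eq_of_mk_eq (h1.trans h) rfl
    have hrr : r = r' := by
      rw [← norm_torusPoint_p (k := k) (ε := ε) (x + m) y hr, h2, norm_torusPoint_p _ _ hr']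
    subst hrr
    have hq := congrArg (fun z : Cyl => z.2.q) h2
    simp only [torusPoint, crossPoint_q] at hq
    have hc := congrArg (fun v : E3 => v 0) hq
    have hs := congrArg (fun v : E3 => v 1) hq
    obtain ⟨n, hn⟩ := Real.Angle.angle_eq_iff_two_pi_dvd_sub.1
      (Real.Angle.cos_sin_inj hc hs)
    refine ⟨rfl, m, -n, rfl, ?_⟩
    have h3 : 2 * Real.pi * (y - y' - n) = 0 := by linear_combination hn
    have h4 := (mul_eq_zero.1 h3).resolve_left (by positivity)
    push_cast
    linarith
  · rintro ⟨rfl, m, n, rfl, rfl⟩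
    exact (mk_torusPoint_add hε x y hr m n).symm

theorem mk_torusPoint_mem_freePart (hε : 0 < ε) (x y : ℝ) {r : ℝ} (hr : 0 ≤ r) :
    MappingTorus.mk (dehnTwist k ε hε) (torusPoint k ε x y r) ∈ freePart (torusForm k hε) :=
  (mk_mem_freePart hε _).2 ⟨_, r, hr, rfl⟩

end TorusPoint

section Winding

variable {M : Type*} [TopologicalSpace M] [ChartedSpace E5 M] [MulAction SO3 M]
variable {M' : Type*} [TopologicalSpace M'] [ChartedSpace E5 M'] [MulAction SO3 M']
variable {α : OneForm M} {K : Set M} {δ : ℝ} {ψ : Cyl → M} {k : ℤ} {ε : ℝ} {hε : 0 < ε}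
variable {α' : OneForm M'} {j₁ : M → M'} {j₂ : MappingTorus (dehnTwist k ε hε) → M'}

/-- The point of the glued manifold with the torus coordinates `(x, y)` at distance `r` from the
zero-section. -/
def gluedPoint (j₂ : MappingTorus (dehnTwist k ε hε) → M') (x y r : ℝ) : M' :=
  j₂ (MappingTorus.mk _ (torusPoint k ε x y r))

namespace IsGluing

theorem gluedPoint_eq_iff (hg : IsGluing α K δ ψ k ε hε α' j₁ j₂) {x y x' y' r r' : ℝ}
    (hr : 0 ≤ r) (hrδ : r < δ) (hr' : 0 ≤ r') (hrδ' : r' < δ) :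
    gluedPoint j₂ x y r = gluedPoint j₂ x' y' r' ↔
      r = r' ∧ ∃ m n : ℤ, x' = x + m ∧ y' = y + n := by
  rw [gluedPoint, gluedPoint, hg.injOn₂.eq_iff, mk_torusPoint_eq_iff hε hr hr']
  · exact ⟨_, (norm_torusPoint_p _ _ hr).trans_lt hrδ, rfl⟩
  · exact ⟨_, (norm_torusPoint_p _ _ hr').trans_lt hrδ', rfl⟩

theorem rot_smul_gluedPoint (hg : IsGluing α K δ ψ k ε hε α' j₁ j₂) (s x y : ℝ) {r : ℝ}
    (hr : 0 ≤ r) (hrδ : r < δ) :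
    rot 2 (2 * Real.pi * s) • gluedPoint j₂ x y r = gluedPoint j₂ x (y + s) r := by
  rw [gluedPoint, gluedPoint, ← rot_smul_torusPoint, ← MappingTorus.smul_mk,
    hg.equivariant₂ _ _ ((norm_torusPoint_p _ _ hr).trans_lt hrδ)]

theorem gluedPoint_mem_freePart (hg : IsGluing α K δ ψ k ε hε α' j₁ j₂) (x y : ℝ) {r : ℝ}
    (hr : 0 ≤ r) (hrδ : r < δ) : gluedPoint j₂ x y r ∈ freePart α' :=
  (hg.contactEmb₂.mem_freePart MappingTorus.isSmoothAction
    ⟨_, (norm_torusPoint_p _ _ hr).trans_lt hrδ, rfl⟩).2 (mk_torusPoint_mem_freePart hε x y hr)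

theorem continuous_gluedPoint (hg : IsGluing α K δ ψ k ε hε α' j₁ j₂) {X : Type*}
    [TopologicalSpace X] {x y r : X → ℝ} (hx : Continuous x) (hy : Continuous y)
    (hr : Continuous r) (h0 : ∀ a, 0 ≤ r a) (hδ : ∀ a, r a < δ) :
    Continuous fun a => gluedPoint j₂ (x a) (y a) (r a) := by
  have hc : Continuous fun a => torusPoint k ε (x a) (y a) (r a) :=
    (continuous_torusPoint (k := k) hε).comp (hx.prodMk (hy.prodMk hr))
  rw [continuous_iff_continuousAt]
  intro a
  have h1 := (hg.contMDiffAt_mk (y := torusPoint k ε (x a) (y a) (r a))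
    ((norm_torusPoint_p _ _ (h0 a)).trans_lt (hδ a))).continuousAt
  exact ContinuousAt.comp (f := fun a => torusPoint k ε (x a) (y a) (r a)) h1 hc.continuousAt

theorem exists_eq_gluedPoint (hg : IsGluing α K δ ψ k ε hε α' j₁ j₂) {x y r : ℝ} (hr : 0 ≤ r)
    (hrδ : r < δ) {z : M'} (hz : z ∈ zOrbit (gluedPoint j₂ x y r)) :
    ∃ y', z = gluedPoint j₂ x y' r := by
  obtain ⟨s, rfl⟩ := hz
  refine ⟨y + s / (2 * Real.pi), ?_⟩
  rw [← hg.rot_smul_gluedPoint _ _ _ hr hrδ, mul_div_cancel₀ _ (by positivity)]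

/-- A section of the circle action is given over all the tori `|p| = r` with `r ≤ r₁` by a
continuous function of the coordinate `x` and of `r`. -/
theorem exists_section_height [T2Space M'] (hg : IsGluing α K δ ψ k ε hε α' j₁ j₂) {σ' : M' → M'}
    (hσ' : IsStandardSection α' σ') {r₁ : ℝ} (hr₁ : 0 ≤ r₁) (hrδ : r₁ < δ) :
    ∃ g : ℝ × ℝ → ℝ, Continuous g ∧ ∀ x r, r ∈ Set.Icc 0 r₁ → ∀ y,
      σ' (gluedPoint j₂ x y r) = gluedPoint j₂ x (g (x, r)) r := by
  have hI : ∀ v : Set.Icc (0 : ℝ) r₁, (v : ℝ) < δ := fun v => v.2.2.trans_lt hrδ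
  -- With the retraction `R` of the line onto `[0, r₁]` the maps to be lifted are defined on all of
  -- `ℝ × ℝ`.
  set R : ℝ → Set.Icc (0 : ℝ) r₁ := Set.projIcc 0 r₁ hr₁
  have hR : Continuous R := continuous_projIcc
  set F : ℝ × ℝ → M' := fun z => σ' (gluedPoint j₂ z.1 0 (R z.2)) with hF
  have hFc : Continuous F := by
    have h1 : Continuous fun z : ℝ × ℝ => gluedPoint j₂ z.1 0 (R z.2) :=
      hg.continuous_gluedPoint continuous_fst continuous_const
        (continuous_subtype_val.comp (hR.comp continuous_snd)) (fun z => (R z.2).2.1)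
        (fun z => hI _)
    exact hσ'.continuousOn.comp_continuous h1 fun z =>
      hg.gluedPoint_mem_freePart _ _ (R z.2).2.1 (hI _)
  have horb : ∀ z : ℝ × ℝ, ∃ y', F z = gluedPoint j₂ z.1 y' (R z.2) := fun z =>
    hg.exists_eq_gluedPoint (R z.2).2.1 (hI _)
      (hσ'.mem_orbit _ (hg.gluedPoint_mem_freePart _ _ (R z.2).2.1 (hI _)))
  -- The union of the tori is the product of two circles and an interval. The section is a map to
  -- it, whose component in the circle of the orbits is lifted to the real line.
  have hQ : Topology.IsQuotientMap (Prod.map (fun a : ℝ => (a : AddCircle (1 : ℝ)))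
      (Prod.map (fun a : ℝ => (a : AddCircle (1 : ℝ))) (id : Set.Icc (0 : ℝ) r₁ → _))) :=
    ((QuotientAddGroup.isOpenQuotientMap_mk).prodMap
      ((QuotientAddGroup.isOpenQuotientMap_mk).prodMap IsOpenQuotientMap.id)).isQuotientMap
  obtain ⟨f', hf', hff⟩ := exists_factor hQ
    (Φ := fun a : ℝ × ℝ × Set.Icc (0 : ℝ) r₁ => gluedPoint j₂ a.1 a.2.1 a.2.2)
    (hg.continuous_gluedPoint continuous_fst continuous_snd.fst
      (continuous_subtype_val.comp continuous_snd.snd) (fun a => a.2.2.2.1) (fun a => hI _))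
    (fun a b => by
      rw [hg.gluedPoint_eq_iff a.2.2.2.1 (hI _) b.2.2.2.1 (hI _)]
      simp only [Prod.map, Prod.mk.injEq, coe_addCircle_eq_iff, id, ← Subtype.ext_iff]
      constructor
      · rintro ⟨h, m, n, h1, h2⟩
        exact ⟨⟨m, h1⟩, ⟨n, h2⟩, h⟩
      · rintro ⟨⟨m, h1⟩, ⟨n, h2⟩, h⟩
        exact ⟨h, m, n, h1, h2⟩) hFc (fun z => by
      obtain ⟨y', hy'⟩ := horb z
      exact ⟨(z.1, y', R z.2), hy'.symm⟩)
  have hf2 : Continuous fun z => (f' z).2.1 := hf'.snd.fst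
  obtain ⟨t₀, ht₀⟩ := isQuotientMap_coe_addCircle.surjective (f' (0, 0)).2.1
  obtain ⟨g, hgc, -, hgl⟩ := exists_lift_addCircle hf2 (x₀ := ((0, 0) : ℝ × ℝ)) ht₀
  refine ⟨g, hgc, fun x r hr y => ?_⟩
  have hRr : (R r : ℝ) = r := by rw [show R r = ⟨r, hr⟩ from Set.projIcc_of_mem hr₁ hr]
  have hrδ' : r < δ := hr.2.trans_lt hrδ
  have e1 : σ' (gluedPoint j₂ x y r) = F (x, r) := by
    rw [hF]
    simp only [hRr]
    rw [← hσ'.invariant _ (hg.gluedPoint_mem_freePart x y hr.1 hrδ') (2 * Real.pi * -y),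
      hg.rot_smul_gluedPoint _ _ _ hr.1 hrδ', add_neg_cancel]
  obtain ⟨y', hy'⟩ := horb (x, r)
  have e2 := (hff (x, r) (x, y', R r)).2 hy'.symm
  have e3 : (y' : AddCircle (1 : ℝ)) = g (x, r) := by
    rw [hgl, ← e2]
    rfl
  obtain ⟨n, hn⟩ := coe_addCircle_eq_iff.1 e3
  rw [e1, hy', hn, gluedPoint, gluedPoint, torusPoint_add_int]
  simp only [hRr]

/-- For `ε < r < δ` every extension of the section fixes the points of the standard section. -/
theorem section_apply_stdPoint (hg : IsGluing α K δ ψ k ε hε α' j₁ j₂) (hc : IsCollar α K δ ψ)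
    (hM : IsSmoothAction M) (hδ : ε < δ) {σ : M → M} {σ' : M' → M'}
    (hst : ∀ t r : ℝ, 0 < r → r < δ → σ (ψ (t, stdPoint r)) = ψ (t, stdPoint r))
    (hσσ' : ∀ x ∈ freePart α, x ∉ core K ψ ε → σ' (j₁ x) = j₁ (σ x)) (t : ℝ) {r : ℝ}
    (hr : ε < r) (hrδ : r < δ) :
    σ' (j₂ (MappingTorus.mk _ (t, stdPoint r))) = j₂ (MappingTorus.mk _ (t, stdPoint r)) := by
  have hr0 : 0 < r := hε.trans hr
  have hn : ‖((t, stdPoint r) : Cyl).2.p‖ = r := norm_stdPoint_p hr0.le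
  have hx : ψ (t, stdPoint r) ∉ core K ψ ε := by
    rintro (h | ⟨z, hz, e⟩)
    · exact hc.disjoint _ (hr0.trans_eq hn.symm) (hn.trans_lt hrδ) h
    · obtain ⟨n, hz'⟩ := (hc.fibers _ _ hz.1 (hz.2.trans_lt hδ) (hr0.trans_eq hn.symm)
        (hn.trans_lt hrδ)).1 e
      have h2 : stdPoint r = z.2 := congrArg Prod.snd hz'
      have h3 : ‖z.2.p‖ = r := by rw [← h2]; exact hn
      exact (h3 ▸ hz.2).not_gt hr
  have e : j₁ (ψ (t, stdPoint r)) = j₂ (MappingTorus.mk _ (t, stdPoint r)) :=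
    (hg.glue _ hx (t, stdPoint r) (hn.trans_lt hrδ)).2 ⟨hr.trans_eq hn.symm, rfl⟩
  have hf : ψ (t, stdPoint r) ∈ freePart α := by
    rw [← (hg.contactEmb₁ hc hM hδ).mem_freePart hM hx, e,
      hg.contactEmb₂.mem_freePart MappingTorus.isSmoothAction ⟨_, hn.trans_lt hrδ, rfl⟩,
      mk_mem_freePart]
    refine ⟨0, r, hr0.le, ?_⟩
    rw [crossPoint, rot_zero, one_smul]
  rw [← e, hσσ' _ hf hx, hst t r hr0 hrδ]

/-- Over the torus around the glued component the section winds `-k` times around the circle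
direction: the winding number does not depend on `r`, and for `r > ε` the section is the curve
`y = -k x`, because there `f = 2 π k`. -/
theorem exists_boundary_section [T2Space M'] (hg : IsGluing α K δ ψ k ε hε α' j₁ j₂)
    (hc : IsCollar α K δ ψ) (hM : IsSmoothAction M) (hδ : ε < δ) {σ : M → M} {σ' : M' → M'}
    (hst : ∀ t r : ℝ, 0 < r → r < δ → σ (ψ (t, stdPoint r)) = ψ (t, stdPoint r))
    (hσ' : IsStandardSection α' σ')
    (hσσ' : ∀ x ∈ freePart α, x ∉ core K ψ ε → σ' (j₁ x) = j₁ (σ x)) :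
    ∃ g : ℝ → ℝ, Continuous g ∧ (∀ x, g (x + 1) = g x - k) ∧
      ∀ x y, σ' (gluedPoint j₂ x y 0) = gluedPoint j₂ x (g x) 0 := by
  obtain ⟨r₁, h1, h2⟩ := exists_between hδ
  have hr₁ : 0 < r₁ := hε.trans h1
  obtain ⟨g, hgc, hgs⟩ := hg.exists_section_height hσ' hr₁.le h2
  -- The winding is an integer for every `r`, hence independent of `r`.
  have hint : ∀ x r, r ∈ Set.Icc 0 r₁ → ∃ n : ℤ, g (x + 1, r) - g (x, r) = n := by
    intro x r hr
    have hrδ : r < δ := hr.2.trans_lt h2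
    have e1 : gluedPoint j₂ x 0 r = gluedPoint j₂ (x + 1) 0 r :=
      (hg.gluedPoint_eq_iff hr.1 hrδ hr.1 hrδ).2 ⟨rfl, 1, 0, by simp, by simp⟩
    have e2 := congrArg σ' e1
    rw [hgs _ _ hr, hgs _ _ hr] at e2
    obtain ⟨-, m, n, -, hn⟩ := (hg.gluedPoint_eq_iff hr.1 hrδ hr.1 hrδ).1 e2
    exact ⟨n, by rw [hn]; ring⟩
  have hI : PreconnectedSpace (Set.Icc (0 : ℝ) r₁) :=
    Subtype.preconnectedSpace isPreconnected_Icc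
  have hconst := eq_of_forall_int (X := ℝ × Set.Icc (0 : ℝ) r₁)
    (g := fun z => g (z.1 + 1, z.2) - g (z.1, z.2)) (by fun_prop) fun z => hint z.1 _ z.2.2
  -- Over `r = r₁`, where `ε < r₁ < δ`, the section is the curve `y = -k x` up to an integer.
  have hw := eq_of_forall_int (X := ℝ) (g := fun x => g (x, r₁) + x * k) (by fun_prop) fun x => by
    have hr : r₁ ∈ Set.Icc 0 r₁ := ⟨hr₁.le, le_rfl⟩
    have e1 : gluedPoint j₂ x (-(x * k)) r₁ = j₂ (MappingTorus.mk _ (x, stdPoint r₁)) := by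
      have hf : twistAngle k ε r₁ = 2 * Real.pi * k := by
        rw [twistAngle, rho, if_neg (by linarith), if_neg (by linarith)]
        ring
      rw [gluedPoint, torusPoint, hf, show x * (2 * Real.pi * k) + 2 * Real.pi * -(x * k) = 0 by
        ring, crossPoint, rot_zero, one_smul]
    have e2 := hgs x r₁ hr (-(x * k))
    rw [e1, hg.section_apply_stdPoint hc hM hδ hst hσσ' x h1 h2, ← e1] at e2
    obtain ⟨-, m, n, -, hn⟩ := (hg.gluedPoint_eq_iff hr.1 h2 hr.1 h2).1 e2
    exact ⟨n, by rw [hn]; ring⟩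
  have hk : g (1, r₁) - g (0, r₁) = -k := by
    have := hw 1 0
    linarith
  refine ⟨fun x => g (x, 0), by fun_prop, fun x => ?_, fun x y => hgs x 0 ⟨le_rfl, hr₁.le⟩ y⟩
  have := hconst (x, ⟨0, le_rfl, hr₁.le⟩) (0, ⟨r₁, hr₁.le, le_rfl⟩)
  simp only [zero_add] at this
  simp only
  linarith

end IsGluing

end Winding

/-! ### The contribution of the glued component -/

section Contribution

variable {M : Type*} [TopologicalSpace M] [ChartedSpace E5 M] [MulAction SO3 M]
variable {M' : Type*} [TopologicalSpace M'] [ChartedSpace E5 M'] [MulAction SO3 M']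
variable {α : OneForm M} {K : Set M} {δ : ℝ} {ψ : Cyl → M} {k : ℤ} {ε : ℝ} {hε : 0 < ε}
variable {α' : OneForm M'} {j₁ : M → M'} {j₂ : MappingTorus (dehnTwist k ε hε) → M'}

theorem contMDiff_torusPoint (r : ℝ) :
    ContMDiff 𝓘(ℝ, ℝ × ℝ) (𝓡 5) ∞ fun z : ℝ × ℝ => torusPoint k ε z.1 z.2 r := by
  intro z
  apply Cyl.contMDiffAt_of_emb
  have h : ContDiff ℝ ∞ fun z : ℝ × ℝ =>
      ((z.1, z.1 * twistAngle k ε r + 2 * Real.pi * z.2, r) : ℝ × ℝ × ℝ) := by fun_prop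
  exact (contDiff_emb_crossPoint.comp h).contMDiff z

theorem torusPoint_p_zero (x y : ℝ) : (torusPoint k ε x y 0).2.p = 0 :=
  norm_eq_zero.1 (norm_torusPoint_p x y le_rfl)

/-- On the zero-section the contact form is `dt`, so it takes the value `1` on the derivative in the
direction of `x`. -/
theorem cov_dehnForm_mder_torusPoint (hε : 0 < ε) (z : ℝ × ℝ) :
    cov (dehnForm k ε) (torusPoint k ε z.1 z.2 0)
      (mder 𝓘(ℝ, ℝ × ℝ) (𝓡 5) (fun z : ℝ × ℝ => torusPoint k ε z.1 z.2 0) z (1, 0)) = 1 := by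
  have h1 := mder_comp (I := 𝓘(ℝ, ℝ × ℝ)) (I'' := 𝓘(ℝ, Amb))
    (F := fun z : ℝ × ℝ => torusPoint k ε z.1 z.2 0) (G := Cyl.emb) (x := z)
    (Cyl.mdifferentiableAt_emb _)
    (((contMDiff_torusPoint (k := k) (ε := ε) 0) z).mdifferentiableAt (by simp))
  have h2 : HasFDerivAt (fun z : ℝ × ℝ => Cyl.emb (torusPoint k ε z.1 z.2 0))
      (fderiv ℝ (fun z : ℝ × ℝ => Cyl.emb (torusPoint k ε z.1 z.2 0)) z) z := by
    have h : ContDiff ℝ ∞ fun z : ℝ × ℝ =>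
        ((z.1, z.1 * twistAngle k ε 0 + 2 * Real.pi * z.2, (0 : ℝ)) : ℝ × ℝ × ℝ) := by fun_prop
    exact ((contDiff_emb_crossPoint.comp h).differentiable (by simp) z).hasFDerivAt
  have h3 : (fderiv ℝ (fun z : ℝ × ℝ => Cyl.emb (torusPoint k ε z.1 z.2 0)) z (1, 0)).1 = 1 := by
    have := h2.fst.unique (hasFDerivAt_fst (𝕜 := ℝ) (p := z))
    exact DFunLike.congr_fun this ((1, 0) : ℝ × ℝ)
  rw [mder_eq_fderiv] at h1
  rw [h1] at h3
  -- The other terms of the form contain the factor `p = 0`.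
  rw [cov_dehnForm_apply k hε, torusPoint_p_zero, inner_zero_left, inner_zero_left, mul_zero,
    add_zero, sub_zero]
  exact h3

namespace IsGluing

theorem mem_closure_crossSection_mk (hg : IsGluing α K δ ψ k ε hε α' j₁ j₂) {y : Cyl}
    (hy : ‖y.2.p‖ < δ) : j₂ (MappingTorus.mk _ y) ∈ closure (crossSection α') ↔
      ∃ θ r, 0 ≤ r ∧ y = crossPoint y.1 θ r := by
  rw [hg.contactEmb₂.mem_closure_crossSection MappingTorus.isSmoothAction ⟨y, hy, rfl⟩,
    mk_mem_closure_crossSection]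

/-- The torus coordinates at `r = 0` cover the boundary torus at the glued component. -/
theorem isTorusCover (hg : IsGluing α K δ ψ k ε hε α' j₁ j₂) (hδ : 0 < δ) :
    IsTorusCover α' (closure (crossSection α') ∩ gluedComponent j₂)
      (fun z => gluedPoint j₂ z.1 z.2 0) := by
  have hn : ∀ x y, ‖(torusPoint k ε x y 0).2.p‖ < δ := fun x y =>
    (norm_torusPoint_p x y le_rfl).trans_lt hδ
  refine ⟨fun z => ?_, fun x y s => (hg.rot_smul_gluedPoint s x y le_rfl hδ).symm, fun a b => ?_,
    ?_, fun z => ?_⟩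
  · exact ContMDiffAt.comp (I' := 𝓡 5) (f := fun z : ℝ × ℝ => torusPoint k ε z.1 z.2 0)
      (g := fun y => j₂ (MappingTorus.mk (dehnTwist k ε hε) y)) z (hg.contMDiffAt_mk (hn _ _))
      (contMDiff_torusPoint 0 z)
  · rw [hg.gluedPoint_eq_iff le_rfl hδ le_rfl hδ]
    constructor
    · rintro ⟨-, m, n, h1, h2⟩
      exact ⟨m, n, Prod.ext h1 h2⟩
    · rintro ⟨m, n, rfl⟩
      exact ⟨rfl, m, n, rfl, rfl⟩
  · ext w
    constructor
    · rintro ⟨z, rfl⟩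
      exact ⟨(hg.mem_closure_crossSection_mk (hn _ _)).2 ⟨_, 0, le_rfl, rfl⟩,
        torusPoint k ε z.1 z.2 0, torusPoint_p_zero _ _, rfl⟩
    · rintro ⟨hw, y, hy, rfl⟩
      have hy0 : ‖y.2.p‖ = 0 := norm_eq_zero.2 hy
      obtain ⟨θ, r, hr, e⟩ := (hg.mem_closure_crossSection_mk (hy0.trans_lt hδ)).1 hw
      have hr0 : r = 0 := by
        rw [e, norm_crossPoint_p _ _ hr] at hy0
        exact hy0
      obtain ⟨v, hv⟩ := exists_torusPoint (k := k) (ε := ε) y.1 θ r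
      refine ⟨(y.1, v), ?_⟩
      change j₂ (MappingTorus.mk _ (torusPoint k ε y.1 v 0)) = j₂ (MappingTorus.mk _ y)
      rw [hr0] at e hv
      rw [← hv, ← e]
  · obtain ⟨c, hc, e⟩ := hg.form₂ _ (hn z.1 z.2)
    have h1 := mder_comp (I := 𝓘(ℝ, ℝ × ℝ)) (F := fun z : ℝ × ℝ => torusPoint k ε z.1 z.2 0)
      (G := fun y => j₂ (MappingTorus.mk (dehnTwist k ε hε) y)) (x := z)
      ((hg.contMDiffAt_mk (hn _ _)).mdifferentiableAt (by simp))
      (((contMDiff_torusPoint (k := k) (ε := ε) 0) z).mdifferentiableAt (by simp))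
    have h2 : cov α' (gluedPoint j₂ z.1 z.2 0)
        (mder 𝓘(ℝ, ℝ × ℝ) (𝓡 5) (fun z : ℝ × ℝ => gluedPoint j₂ z.1 z.2 0) z (1, 0)) =
        c * cov (dehnForm k ε) (torusPoint k ε z.1 z.2 0)
          (mder 𝓘(ℝ, ℝ × ℝ) (𝓡 5) (fun z : ℝ × ℝ => torusPoint k ε z.1 z.2 0) z (1, 0)) :=
      (congrArg (fun L : ℝ × ℝ →L[ℝ] E5 => cov α' (gluedPoint j₂ z.1 z.2 0) (L (1, 0))) h1).trans
        (DFunLike.congr_fun (F := E5 →L[ℝ] ℝ) e _)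
    rw [cov_dehnForm_mder_torusPoint hε, mul_one] at h2
    exact hc.trans_eq h2.symm

/-- Over the zero-section a point of the mapping torus has the stabilizer of its base point `q`,
since the action preserves `t`. -/
theorem smul_gluedPoint_eq_iff (hg : IsGluing α K δ ψ k ε hε α' j₁ j₂) (hδ : 0 < δ) (g : SO3)
    (x y : ℝ) : g • gluedPoint j₂ x y 0 = gluedPoint j₂ x y 0 ↔
      rotVec g (torusPoint k ε x y 0).2.q = (torusPoint k ε x y 0).2.q := by
  rw [gluedPoint, hg.contactEmb₂.smul_eq_iff
    ⟨_, (norm_torusPoint_p x y le_rfl).trans_lt hδ, rfl⟩, MappingTorus.smul_mk]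
  constructor
  · intro h
    exact congrArg (fun z : Cyl => z.2.q) (eq_of_mk_eq h rfl)
  · intro h
    congr 1
    refine Prod.ext rfl (CotS2.ext h ?_)
    change rotVec g (torusPoint k ε x y 0).2.p = (torusPoint k ε x y 0).2.p
    rw [torusPoint_p_zero]
    simp [rotVec]

/-- The points with the same stabilizer as `q = (1, 0, 0)` are those with `q = ±(1, 0, 0)`. -/
theorem stabilizer_gluedPoint_eq_iff (hg : IsGluing α K δ ψ k ε hε α' j₁ j₂) (hδ : 0 < δ)
    (x y : ℝ) : MulAction.stabilizer SO3 (gluedPoint j₂ x y 0) =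
      MulAction.stabilizer SO3 (gluedPoint j₂ 0 0 0) ↔ ∃ m : ℤ, y = (m - x * k) / 2 := by
  have hq : ∀ x y, (torusPoint k ε x y 0).2.q =
      !₂[Real.cos (x * (Real.pi * k) + 2 * Real.pi * y),
        Real.sin (x * (Real.pi * k) + 2 * Real.pi * y), 0] := by
    intro x y
    rw [torusPoint, crossPoint_q, twistAngle_of_le (by positivity)]
  have hq0 : (torusPoint k ε 0 0 0).2.q = !₂[1, 0, 0] := by
    rw [hq]
    simp
  constructor
  · intro h
    -- The rotation by `π` around the first axis fixes, among the unit vectors with `z = 0`, only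
    -- `±(1, 0, 0)`.
    have h1 : rot 0 Real.pi ∈ MulAction.stabilizer SO3 (gluedPoint j₂ 0 0 0) := by
      rw [MulAction.mem_stabilizer_iff, hg.smul_gluedPoint_eq_iff hδ, hq0]
      ext i
      rw [rotVec_apply]
      fin_cases i <;> simp [rot, Fin.sum_univ_three]
    rw [← h, MulAction.mem_stabilizer_iff, hg.smul_gluedPoint_eq_iff hδ, hq] at h1
    have h2 := congrArg (fun v : E3 => v 1) h1
    simp only [rotVec_apply] at h2
    simp [rot, Fin.sum_univ_three] at h2
    have h3 : Real.sin (x * (Real.pi * k) + 2 * Real.pi * y) = 0 := by linarith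
    obtain ⟨m, hm⟩ := Real.sin_eq_zero_iff.1 h3
    refine ⟨m, ?_⟩
    have h4 : Real.pi * (m - x * k - 2 * y) = 0 := by linear_combination hm
    have h5 := (mul_eq_zero.1 h4).resolve_left Real.pi_ne_zero
    linarith
  · rintro ⟨m, rfl⟩
    have hθ : x * (Real.pi * k) + 2 * Real.pi * ((m - x * k) / 2) = m * Real.pi := by ring
    have hs : Real.sin (m * Real.pi) = 0 := Real.sin_int_mul_pi m
    have hc : Real.cos (m * Real.pi) ≠ 0 := by
      intro h
      have := Real.sin_sq_add_cos_sq (m * Real.pi)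
      rw [hs, h] at this
      norm_num at this
    have hqq : (torusPoint k ε x ((m - x * k) / 2) 0).2.q =
        Real.cos (m * Real.pi) • (!₂[1, 0, 0] : E3) := by
      rw [hq, hθ, hs]
      ext i
      fin_cases i <;> simp
    ext g
    rw [MulAction.mem_stabilizer_iff, MulAction.mem_stabilizer_iff, hg.smul_gluedPoint_eq_iff hδ,
      hg.smul_gluedPoint_eq_iff hδ, hqq, hq0, rotVec_smul]
    exact (smul_right_injective E3 hc).eq_iff

/-- The marked points are those on the lines `y = (m - x k) / 2` of the universal cover of the
torus. -/
theorem mem_marked_iff (hg : IsGluing α K δ ψ k ε hε α' j₁ j₂) (hδ : 0 < δ) (z : M') :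
    z ∈ {z | z ∈ closure (crossSection α') ∩ gluedComponent j₂ ∧
      MulAction.stabilizer SO3 z = MulAction.stabilizer SO3 (gluedPoint j₂ 0 0 0)} ↔
      ∃ (x : ℝ) (m : ℤ), z = gluedPoint j₂ x ((m - x * k) / 2) 0 := by
  rw [Set.mem_ofPred_eq, ← (hg.isTorusCover hδ).range_eq]
  constructor
  · rintro ⟨⟨⟨x, y⟩, rfl⟩, h⟩
    obtain ⟨m, rfl⟩ := (hg.stabilizer_gluedPoint_eq_iff hδ x y).1 h
    exact ⟨x, m, rfl⟩
  · rintro ⟨x, m, rfl⟩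
    exact ⟨⟨(x, _), rfl⟩, (hg.stabilizer_gluedPoint_eq_iff hδ x _).2 ⟨m, rfl⟩⟩

/-- For even `k` the marked points form two curves, which are sections of the circle action. -/
theorem markedCurve_of_even [T2Space M'] (hg : IsGluing α K δ ψ k ε hε α' j₁ j₂) (hδ : 0 < δ)
    {l : ℤ} (hk : k = 2 * l) :
    markedCurve (closure (crossSection α') ∩ gluedComponent j₂) (gluedPoint j₂ 0 0 0) =
      Set.range fun x : ℝ => gluedPoint j₂ x (-(x * l)) 0 := by
  have hkl : (k : ℝ) = 2 * l := by exact_mod_cast hk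
  set c : ℤ → ℝ → M' := fun m x => gluedPoint j₂ x ((m - x * k) / 2) 0 with hc
  have hcont : ∀ m, Continuous (c m) := fun m =>
    hg.continuous_gluedPoint continuous_id (by fun_prop) continuous_const (fun _ => le_rfl)
      (fun _ => hδ)
  have hclosed : ∀ m, IsClosed (Set.range (c m)) := by
    intro m
    have hp : Function.Periodic (c m) 1 := by
      intro x
      refine ((hg.gluedPoint_eq_iff le_rfl hδ le_rfl hδ).2 ⟨rfl, 1, -l, by simp, ?_⟩).symm
      rw [hkl]
      push_cast
      ring
    exact (hp.compact_of_continuous one_ne_zero (hcont m)).isClosed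
  have hdisj : ∀ z, z ∈ Set.range (c 0) → z ∉ Set.range (c 1) := by
    rintro _ ⟨x, rfl⟩ ⟨x', e⟩
    obtain ⟨-, i, n, hx, hn⟩ := (hg.gluedPoint_eq_iff le_rfl hδ le_rfl hδ).1 e
    rw [hkl, hx] at hn
    have h1 : (2 * n : ℝ) = -1 - 2 * i * l := by push_cast at hn; linear_combination (-2) * hn
    have h2 : 2 * n = -1 - 2 * i * l := by exact_mod_cast h1
    have h3 : 2 * (n + i * l) = -1 := by linear_combination h2
    omega
  have e0 : (Set.range fun x : ℝ => gluedPoint j₂ x (-(x * l)) 0) = Set.range (c 0) := by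
    congr 1
    ext1 x
    rw [hc]
    simp only
    congr 1
    rw [hkl]
    push_cast
    ring
  rw [e0]
  have hx₀ : gluedPoint j₂ 0 0 0 ∈ Set.range (c 0) := ⟨0, by rw [hc]; simp⟩
  have hsub : Set.range (c 0) ⊆ {z | z ∈ closure (crossSection α') ∩ gluedComponent j₂ ∧
      MulAction.stabilizer SO3 z = MulAction.stabilizer SO3 (gluedPoint j₂ 0 0 0)} := by
    rintro _ ⟨x, rfl⟩
    exact (hg.mem_marked_iff hδ _).2 ⟨x, 0, rfl⟩
  refine Set.Subset.antisymm ?_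
    ((isPreconnected_range (hcont 0)).subset_connectedComponentIn hx₀ hsub)
  intro z hz
  -- The two curves are closed and disjoint, hence a connected set of marked points lies in one.
  by_contra hz0
  have hcov : ∀ w ∈ markedCurve (closure (crossSection α') ∩ gluedComponent j₂)
      (gluedPoint j₂ 0 0 0), w ∈ Set.range (c 0) ∪ Set.range (c 1) := by
    intro w hw
    obtain ⟨x, m, rfl⟩ := (hg.mem_marked_iff hδ _).1 (connectedComponentIn_subset _ _ hw)
    obtain ⟨n, hn | hn⟩ := Int.even_or_odd' m
    · refine Or.inl ⟨x, (hg.gluedPoint_eq_iff le_rfl hδ le_rfl hδ).2 ⟨rfl, 0, n, by simp, ?_⟩⟩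
      rw [hn]
      push_cast
      ring
    · refine Or.inr ⟨x, (hg.gluedPoint_eq_iff le_rfl hδ le_rfl hδ).2 ⟨rfl, 0, n, by simp, ?_⟩⟩
      rw [hn]
      push_cast
      ring
  have hpre : IsPreconnected (markedCurve (closure (crossSection α') ∩ gluedComponent j₂)
    (gluedPoint j₂ 0 0 0)) := isPreconnected_connectedComponentIn
  obtain ⟨w, -, h0, h1⟩ := isPreconnected_closed_iff.1 hpre _ _ (hclosed 0) (hclosed 1) hcov
    ⟨_, mem_connectedComponentIn (hsub hx₀), hx₀⟩ ⟨z, hz, (hcov z hz).resolve_left hz0⟩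
  exact hdisj w h0 h1

/-- For odd `k` the marked points form a single curve. -/
theorem markedCurve_of_odd (hg : IsGluing α K δ ψ k ε hε α' j₁ j₂) (hδ : 0 < δ) (hk : Odd k) :
    markedCurve (closure (crossSection α') ∩ gluedComponent j₂) (gluedPoint j₂ 0 0 0) =
      Set.range fun u : ℝ => gluedPoint j₂ (2 * u) (-(u * k)) 0 := by
  have hcont : Continuous fun u : ℝ => gluedPoint j₂ (2 * u) (-(u * k)) 0 :=
    hg.continuous_gluedPoint (by fun_prop) (by fun_prop) continuous_const (fun _ => le_rfl)
      (fun _ => hδ)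
  have heq_u : ∀ u : ℝ, gluedPoint j₂ (2 * u) (-(u * k)) 0 =
      gluedPoint j₂ (2 * u) (((0 : ℤ) - 2 * u * k) / 2) 0 := by
    intro u
    congr 1
    push_cast
    ring
  have hS : {z | z ∈ closure (crossSection α') ∩ gluedComponent j₂ ∧
      MulAction.stabilizer SO3 z = MulAction.stabilizer SO3 (gluedPoint j₂ 0 0 0)} =
      Set.range fun u : ℝ => gluedPoint j₂ (2 * u) (-(u * k)) 0 := by
    ext z
    rw [hg.mem_marked_iff hδ]
    constructor
    · rintro ⟨x, m, rfl⟩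
      obtain ⟨l, hl⟩ := hk
      have hkl : (k : ℝ) = 2 * l + 1 := by exact_mod_cast hl
      -- The curve passes over `x` twice, at `u = x / 2` and at `u = (x + 1) / 2`.
      obtain ⟨n, hn | hn⟩ := Int.even_or_odd' m
      · refine ⟨x / 2, (hg.gluedPoint_eq_iff le_rfl hδ le_rfl hδ).2
          ⟨rfl, 0, n, by push_cast; ring, ?_⟩⟩
        rw [hn]
        push_cast
        ring
      · refine ⟨(x + 1) / 2, (hg.gluedPoint_eq_iff le_rfl hδ le_rfl hδ).2
          ⟨rfl, -1, n + l + 1, by push_cast; ring, ?_⟩⟩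
        rw [hn, hkl]
        push_cast
        ring
    · rintro ⟨u, rfl⟩
      exact ⟨2 * u, 0, heq_u u⟩
  unfold markedCurve
  rw [hS]
  refine (isPreconnected_range hcont).connectedComponentIn ⟨0, by simp⟩

/-- The contribution of the glued component is `k`. The boundary of the section has the class `(-1,
k)`. If `k = 2 l`, the marked curve has the class `(1, -l)` and meets each orbit once, which gives
`2 (k - l) = k`. If `k` is odd, it has the class `(2, -k)` and meets each orbit twice, which gives
`2 k - k = k`. -/
theorem hasContribution_gluedComponent [T2Space M'] (hg : IsGluing α K δ ψ k ε hε α' j₁ j₂)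
    (hc : IsCollar α K δ ψ) (hM : IsSmoothAction M) (hδ : ε < δ) {σ : M → M} {σ' : M' → M'}
    (hst : ∀ t r : ℝ, 0 < r → r < δ → σ (ψ (t, stdPoint r)) = ψ (t, stdPoint r))
    (hσ' : IsStandardSection α' σ')
    (hσσ' : ∀ x ∈ freePart α, x ∉ core K ψ ε → σ' (j₁ x) = j₁ (σ x)) :
    HasContribution α' σ' (gluedComponent j₂) k := by
  have hδ0 : 0 < δ := hε.trans hδ
  obtain ⟨g, hgc, hgp, hgs⟩ := hg.exists_boundary_section hc hM hδ hst hσ' hσσ'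
  have hT := hg.isTorusCover hδ0
  have heq : ∀ {x y x' y' : ℝ}, gluedPoint j₂ x y 0 = gluedPoint j₂ x' y' 0 ↔
      ∃ m n : ℤ, x' = x + m ∧ y' = y + n := fun {x y x' y'} =>
    (hg.gluedPoint_eq_iff le_rfl hδ0 le_rfl hδ0).trans (and_iff_right rfl)
  have horb : ∀ x y y', gluedPoint j₂ x y' 0 ∈ zOrbit (gluedPoint j₂ x y 0) := fun x y y' =>
    ⟨2 * Real.pi * (y' - y), by rw [hg.rot_smul_gluedPoint _ _ _ le_rfl hδ0]; congr 1; ring⟩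
  have hx₀ : gluedPoint j₂ 0 0 0 ∈ closure (crossSection α') ∩ gluedComponent j₂ := by
    rw [← hT.range_eq]
    exact ⟨(0, 0), rfl⟩
  -- The boundary of the section is run through backwards, so that the outward normal comes last.
  have hβ : IsSimpleLoop (fun z : ℝ × ℝ => gluedPoint j₂ z.1 z.2 0)
      (σ' '' (closure (crossSection α') ∩ gluedComponent j₂)) (fun u => (-u, g (-u))) (-1, k) := by
    refine ⟨by fun_prop, fun u => ?_, fun u v e => ?_, ?_⟩
    · have h1 := hgp (-(u + 1))
      rw [neg_add, neg_add_cancel_right] at h1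
      refine Prod.ext ?_ ?_
      · simp only [Prod.fst_add]
        push_cast
        ring
      · simp only [Prod.snd_add]
        rw [neg_add]
        linarith
    · obtain ⟨m, n, hm, -⟩ := heq.1 e
      refine ⟨-m, ?_⟩
      push_cast
      linarith
    · rw [← hT.range_eq, ← Set.range_comp]
      ext z
      constructor
      · rintro ⟨u, rfl⟩
        exact ⟨(-u, 0), hgs _ _⟩
      · rintro ⟨⟨x, y⟩, rfl⟩
        refine ⟨-x, ?_⟩
        simp only [neg_neg]
        exact (hgs x y).symm
  rcases Int.even_or_odd' k with ⟨l, hk | hk⟩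
  · have hkl : (k : ℝ) = 2 * l := by exact_mod_cast hk
    have hm := hg.markedCurve_of_even hδ0 hk
    refine ⟨_, _, gluedPoint j₂ 0 0 0, fun u => (u, -(u * l)), _, (1, -l), (-1, k), rfl, hT, hx₀,
      ⟨by fun_prop, fun u => ?_, fun u v e => ?_, by rw [hm]⟩, one_pos, hβ, by norm_num,
      Or.inl ⟨?_, ?_⟩⟩
    · refine Prod.ext (by simp) ?_
      simp only [Prod.snd_add]
      push_cast
      ring
    · obtain ⟨m, n, h, -⟩ := heq.1 e
      exact ⟨m, h⟩
    · rw [hm, ← hT.range_eq]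
      rintro _ ⟨⟨x, y⟩, rfl⟩
      rw [Set.ncard_eq_one]
      refine ⟨gluedPoint j₂ x (-(x * l)) 0, Set.Subset.antisymm ?_ ?_⟩
      · rintro _ ⟨⟨x', rfl⟩, hz⟩
        obtain ⟨y', e⟩ := hg.exists_eq_gluedPoint le_rfl hδ0 hz
        obtain ⟨m, n, h1, -⟩ := heq.1 e
        refine heq.2 ⟨m, -(m * l), h1, ?_⟩
        simp only at h1
        rw [h1]
        push_cast
        ring
      · rintro _ rfl
        exact ⟨⟨x, rfl⟩, horb _ _ _⟩
    · rw [torusIntersection, hk]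
      ring
  · have hkl : (k : ℝ) = 2 * l + 1 := by exact_mod_cast hk
    have hm := hg.markedCurve_of_odd hδ0 ⟨l, hk⟩
    refine ⟨_, _, gluedPoint j₂ 0 0 0, fun u => (2 * u, -(u * k)), _, (2, -k), (-1, k), rfl, hT,
      hx₀, ⟨by fun_prop, fun u => ?_, fun u v e => ?_, by rw [hm]⟩, two_pos, hβ, by norm_num,
      Or.inr ⟨?_, ?_⟩⟩
    · refine Prod.ext ?_ ?_
      · simp only [Prod.fst_add]
        push_cast
        ring
      · simp only [Prod.snd_add]
        push_cast
        ring
    · obtain ⟨m, n, h1, h2⟩ := heq.1 e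
      have h3 : (m * k : ℝ) = -2 * n := by linear_combination (-k) * h1 + (-2) * h2
      have h4 : m * k = -2 * n := by exact_mod_cast h3
      have h5 : Even m := by
        have h6 : Even (m * k) := ⟨-n, by rw [h4]; ring⟩
        rcases Int.even_mul.1 h6 with h | h
        · exact h
        · exact absurd h (Int.not_even_iff_odd.2 ⟨l, hk⟩)
      obtain ⟨i, hi⟩ := h5
      refine ⟨i, ?_⟩
      rw [hi] at h1
      push_cast at h1
      linarith
    · rw [hm, ← hT.range_eq]
      rintro _ ⟨⟨x, y⟩, rfl⟩
      rw [Set.ncard_eq_two]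
      refine ⟨gluedPoint j₂ x (-(x / 2 * k)) 0, gluedPoint j₂ x (-((x + 1) / 2 * k)) 0, ?_,
        Set.Subset.antisymm ?_ ?_⟩
      · intro e
        obtain ⟨m, n, h1, h2⟩ := heq.1 e
        have h3 : ((2 * l + 1 : ℤ) : ℝ) = ((-2 * n : ℤ) : ℝ) := by
          push_cast
          rw [← hkl]
          linear_combination (-2) * h2
        have h4 : 2 * l + 1 = -2 * n := by exact_mod_cast h3
        omega
      · rintro _ ⟨⟨u, rfl⟩, hz⟩
        obtain ⟨y', e⟩ := hg.exists_eq_gluedPoint le_rfl hδ0 hz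
        obtain ⟨m, n, h1, -⟩ := heq.1 e
        simp only at h1
        obtain ⟨i, hi | hi⟩ := Int.even_or_odd' m
        · refine Or.inl (heq.2 ⟨m, -(i * k), h1, ?_⟩)
          rw [h1, hi]
          push_cast
          ring
        · refine Or.inr (heq.2 ⟨m, -((i + 1) * k), h1, ?_⟩)
          rw [h1, hi]
          push_cast
          ring
      · rintro _ (rfl | rfl)
        · refine ⟨⟨x / 2, ?_⟩, horb _ _ _⟩
          simp only
          congr 1
          ring
        · refine ⟨⟨(x + 1) / 2, ?_⟩, horb _ _ _⟩
          refine heq.2 ⟨-1, 0, ?_, ?_⟩ <;> push_cast <;> ring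
    · rw [torusIntersection]
      ring

theorem hasContribution_gluedComponent_iff [IsManifold (𝓡 5) ∞ M'] [T2Space M']
    (hg : IsGluing α K δ ψ k ε hε α' j₁ j₂)
    (hc : IsCollar α K δ ψ) (hM : IsSmoothAction M) (hδ : ε < δ) {σ : M → M} {σ' : M' → M'}
    (hst : ∀ t r : ℝ, 0 < r → r < δ → σ (ψ (t, stdPoint r)) = ψ (t, stdPoint r))
    (hσ' : IsStandardSection α' σ')
    (hσσ' : ∀ x ∈ freePart α, x ∉ core K ψ ε → σ' (j₁ x) = j₁ (σ x)) (c : ℤ) :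
    HasContribution α' σ' (gluedComponent j₂) c ↔ c = k := by
  have h := hg.hasContribution_gluedComponent hc hM hδ hst hσ' hσσ'
  refine ⟨fun h' => HasContribution.unique hg.contact ?_ h' h, fun e => e ▸ h⟩
  rintro _ ⟨y, hy, rfl⟩
  exact (hg.mk_mem_singularSet (norm_lt_of_p_eq_zero hε hδ hy)).2 hy

end IsGluing

end Contribution

/-! ### The Dehn–Euler number of the glued manifold -/

section DehnEuler

variable {M : Type*} [TopologicalSpace M] [ChartedSpace E5 M] [IsManifold (𝓡 5) ∞ M] [T2Space M]
  [MulAction SO3 M]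
variable {M' : Type*} [TopologicalSpace M'] [ChartedSpace E5 M'] [IsManifold (𝓡 5) ∞ M']
  [T2Space M'] [MulAction SO3 M']
variable {α : OneForm M} {K : Set M} {δ : ℝ} {ψ : Cyl → M} {k : ℤ} {ε : ℝ} {hε : 0 < ε}
variable {α' : OneForm M'} {j₁ : M → M'} {j₂ : MappingTorus (dehnTwist k ε hε) → M'}

theorem subset_singularSet_of_mem {L : Set M} (hL : L ∈ singularComponents M) :
    L ⊆ singularSet M := by
  obtain ⟨x, -, rfl⟩ := hL
  exact connectedComponentIn_subset _ _

namespace IsGluing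

open Classical in
/-- The components of the singular orbits of the glued manifold are the new one, which contributes
`k`, and those of `M` other than `K`, whose contributions are unchanged. As contributions are
unique, the two sums differ by `k - c`. -/
theorem isDehnEulerNumber_iff (hg : IsGluing α K δ ψ k ε hε α' j₁ j₂) (hc : IsCollar α K δ ψ)
    (hα : IsContactSO3 α) (hδ : ε < δ) (hK : K ∈ singularComponents M) {σ : M → M} {σ' : M' → M'}
    (hst : ∀ t r : ℝ, 0 < r → r < δ → σ (ψ (t, stdPoint r)) = ψ (t, stdPoint r))
    (hσ : IsStandardSection α σ) (hσ' : IsStandardSection α' σ')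
    (hσσ' : ∀ x ∈ freePart α, x ∉ core K ψ ε → σ' (j₁ x) = j₁ (σ x)) {n c : ℤ}
    (hn : IsDehnEulerNumber α σ n) (hcK : HasContribution α σ K c) (n' : ℤ) :
    IsDehnEulerNumber α' σ' n' ↔ n' = n - c + k := by
  have hM := hα.smooth_action
  obtain ⟨F, c₀, hF, hc₀, hsum⟩ := hn
  have hmem : ∀ L, L ∈ F ↔ L ∈ singularComponents M := fun L => by rw [← hF, Finset.mem_coe]
  have hmem' : ∀ L ∈ F.erase K, L ∈ singularComponents M \ {K} := fun L hL =>
    ⟨(hmem L).1 (Finset.mem_of_mem_erase hL), Finset.ne_of_mem_erase hL⟩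
  have hcK' : c₀ K = c := HasContribution.unique hα (subset_singularSet_of_mem hK)
    (hc₀ K ((hmem K).2 hK)) hcK
  set F' : Finset (Set M') := insert (gluedComponent j₂) ((F.erase K).image fun L => j₁ '' L)
    with hF'_def
  have hF' : (F' : Set (Set M')) = singularComponents M' := by
    rw [hg.singularComponents_eq hc hM hδ hK, ← hF]
    simp [hF'_def]
  have hnot : gluedComponent j₂ ∉ (F.erase K).image fun L => j₁ '' L := by
    intro h
    obtain ⟨L, hL, e⟩ := Finset.mem_image.1 h
    exact hg.gluedComponent_notMem hc hδ hK ⟨L, hmem' L hL, e⟩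
  have hglued := hg.hasContribution_gluedComponent_iff hc hM hδ hst hσ' hσσ'
  have himage := fun L hL => hg.hasContribution_image_iff hc hM hδ hK hσ hσσ' (L := L) hL
  -- Every assignment of contributions to the components has the same sum.
  have hval : ∀ c' : Set M' → ℤ, (∀ S ∈ F', HasContribution α' σ' S (c' S)) →
      ∑ S ∈ F', c' S = n - c + k := by
    intro c' hc'
    have hinj : Set.InjOn (fun L => j₁ '' L) (F.erase K : Set (Set M)) := by
      intro L hL L' hL' e
      exact (hg.injOn₁.image_eq_image_iff (hc.subset_compl_core hε hδ hK (hmem' L hL))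
        (hc.subset_compl_core hε hδ hK (hmem' L' hL'))).1 e
    rw [hF'_def, Finset.sum_insert hnot, Finset.sum_image hinj,
      (hglued _).1 (hc' _ (Finset.mem_insert_self _ _)), hsum,
      ← Finset.add_sum_erase F c₀ ((hmem K).2 hK), hcK']
    have : ∑ L ∈ F.erase K, c' (j₁ '' L) = ∑ L ∈ F.erase K, c₀ L := by
      refine Finset.sum_congr rfl fun L hL => ?_
      have h1 := (himage L (hmem' L hL) _).1
        (hc' _ (Finset.mem_insert_of_mem (Finset.mem_image_of_mem _ hL)))
      exact HasContribution.unique hα (subset_singularSet_of_mem (hmem' L hL).1) h1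
        (hc₀ L (Finset.mem_of_mem_erase hL))
    rw [this]
    ring
  constructor
  · rintro ⟨F'', c', hF'', hc', rfl⟩
    have e : F'' = F' := Finset.coe_injective (hF''.trans hF'.symm)
    subst e
    exact hval c' hc'
  · rintro rfl
    have hex : ∀ S ∈ F', ∃ m, HasContribution α' σ' S m := by
      intro S hS
      rcases Finset.mem_insert.1 hS with rfl | hS
      · exact ⟨k, (hglued k).2 rfl⟩
      · obtain ⟨L, hL, rfl⟩ := Finset.mem_image.1 hS
        exact ⟨c₀ L, (himage L (hmem' L hL) _).2 (hc₀ L (Finset.mem_of_mem_erase hL))⟩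
    choose! c' hc' using hex
    exact ⟨F', c', hF', hc', (hval c' hc').symm⟩

end IsGluing

end DehnEuler

end DehnTwist

end

theorem mainTheorem6 (k : ℤ) :
    ∃ ε₀ : ℝ, 0 < ε₀ ∧
    (∀ (ε : ℝ) (hε : 0 < ε),
      (Even k → ∃ D : MappingTorus (dehnTwist k ε hε) ≃ₘ^∞⟮𝓡 5, 𝓡 5⟯ VdualTriv,
        ∀ (g : SO3) (x : MappingTorus (dehnTwist k ε hε)), D (g • x) = g • D x) ∧
      (Odd k → ∃ D : MappingTorus (dehnTwist k ε hε) ≃ₘ^∞⟮𝓡 5, 𝓡 5⟯ VdualTwist,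
        ∀ (g : SO3) (x : MappingTorus (dehnTwist k ε hε)), D (g • x) = g • D x)) ∧
    ∀ (ε : ℝ) (hε : 0 < ε), ε < ε₀ →
      (T2Space (MappingTorus (dehnTwist k ε hε)) ∧
        SecondCountableTopology (MappingTorus (dehnTwist k ε hε)) ∧
        ∃ α : OneForm (MappingTorus (dehnTwist k ε hε)),
          pullback (MappingTorus.mk (dehnTwist k ε hε)) α = dehnForm k ε ∧ IsContactSO3 α) ∧
      ∀ (M : Type u) [TopologicalSpace M] [ChartedSpace E5 M] [IsManifold (𝓡 5) ∞ M]
        [T2Space M] [CompactSpace M] [MulAction SO3 M] (α : OneForm M), IsContactSO3 α →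
        Dense {x : M | MulAction.stabilizer SO3 x = ⊥} →
        ∀ K ∈ singularComponents M, ∀ σ : M → M, IsStandardSection α σ →
        ∀ (δ : ℝ) (ψ : Cyl → M), ε < δ → IsCollar α K δ ψ →
        (∀ t r : ℝ, 0 < r → r < δ → σ (ψ (t, stdPoint r)) = ψ (t, stdPoint r)) →
        (∃ (M' : Type u) (_ : TopologicalSpace M') (_ : ChartedSpace E5 M')
          (_ : IsManifold (𝓡 5) ∞ M') (_ : T2Space M') (_ : CompactSpace M')
          (_ : MulAction SO3 M') (α' : OneForm M') (j₁ : M → M')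
          (j₂ : MappingTorus (dehnTwist k ε hε) → M'), IsGluing α K δ ψ k ε hε α' j₁ j₂) ∧
        ∀ (M' : Type u) [TopologicalSpace M'] [ChartedSpace E5 M'] [IsManifold (𝓡 5) ∞ M']
          [T2Space M'] [MulAction SO3 M'] (α' : OneForm M') (j₁ : M → M')
          (j₂ : MappingTorus (dehnTwist k ε hε) → M'), IsGluing α K δ ψ k ε hε α' j₁ j₂ →
          singularComponents M' = insert (gluedComponent j₂)
            ((fun L => j₁ '' L) '' (singularComponents M \ {K})) ∧
          gluedComponent j₂ ∉ (fun L => j₁ '' L) '' (singularComponents M \ {K}) ∧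
          (∃ σ' : M' → M', IsStandardSection α' σ' ∧
            ∀ x ∈ freePart α, x ∉ core K ψ ε → σ' (j₁ x) = j₁ (σ x)) ∧
          ∀ σ' : M' → M', IsStandardSection α' σ' →
            (∀ x ∈ freePart α, x ∉ core K ψ ε → σ' (j₁ x) = j₁ (σ x)) →
            (∀ c : ℤ, HasContribution α' σ' (gluedComponent j₂) c ↔ c = k) ∧
            (∀ L ∈ singularComponents M, L ≠ K →
              ∀ c : ℤ, HasContribution α' σ' (j₁ '' L) c ↔ HasContribution α σ L c) ∧
            ∀ n c : ℤ, IsDehnEulerNumber α σ n → HasContribution α σ K c →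
              ∀ n' : ℤ, IsDehnEulerNumber α' σ' n' ↔ n' = n - c + k := by
  refine ⟨epsBound k, epsBound_pos k, fun ε hε => ⟨fun hk => exists_diffeomorph_triv hε hk,
    fun hk => exists_diffeomorph_twist hε hk⟩, fun ε hε hεk => ⟨⟨inferInstance, inferInstance,
    torusForm k hε, pullback_torusForm k hε, isContactSO3_torusForm k hε hεk⟩, ?_⟩⟩
  intro M _ _ _ _ _ _ α hα _ K hK σ hσ δ ψ hδ hc hst
  refine ⟨exists_isGluing hc hα hεk hδ, ?_⟩
  intro M' _ _ _ _ _ α' j₁ j₂ hg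
  have hM := hα.smooth_action
  refine ⟨hg.singularComponents_eq hc hM hδ hK, hg.gluedComponent_notMem hc hδ hK,
    hg.exists_section hc hα hδ hσ hst, fun σ' hσ' hσσ' => ⟨?_, ?_, ?_⟩⟩
  · exact hg.hasContribution_gluedComponent_iff hc hM hδ hst hσ' hσσ'
  · exact fun L hL hLK => hg.hasContribution_image_iff hc hM hδ hK hσ hσσ' ⟨hL, hLK⟩
  · exact fun n c hn hcK => hg.isDehnEulerNumber_iff hc hα hδ hK hst hσ hσ' hσσ' hn hcK
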